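/- **Setting.** All functions and function spaces are real, $\langle\cdot,\cdot\rangle$ is the $L^2(\mathbb R)$ pairing. Let $f\in C^k(\mathbb R)$ for some $k\ge 3$ with $f^{(k)}$ bounded and $f(0)=f'(0)=0$, and let $F(s)=\int_0^s f$. Put $P(u)=\frac12\int u^2$, $H_b(u)=\int \frac12(\partial_xu)^2-F(u)+\frac12 b u^2$ and $\Lambda_{ca}(u)=H_{b=0}(u)+cP(u)$. Let $I_0\subset(0,\infty)$ be an open interval such that for every $c\in I_0$ the number $x^*=\inf\{x>0: \int_0^x (f(y)-cy)\,dy=0\}$ exists, $x^*>0$ and $f(x^*)-cx^*>0$. For $c\in I_0$ let $Q_c$ be the positive, even $C^2$ solution of $-Q_c''+cQ_c-f(Q_c)=0$ that decays at infinity. Assume that $c\mapsto Q_c(x)$ is $C^3$ on $I_0$ for every $x$ and that $x^m\partial_c^nQ_c\in L^1(\mathbb R)$ for $n=1,2,3$, $m=0,1,2$. Let $Q_{ca}(x)=Q_c(x-a)$, $\zeta^{tr}_{ca}=-\partial_xQ_{ca}$, $\zeta^n_{ca}=\partial_cQ_{ca}$ and $\delta(c)=P(Q_c)$. For $\alpha>0$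 let $\mathcal K_{Q\alpha}=\mathcal K P_Q+(\partial_x+\alpha)^{-1}(1-P_Q)$, where $\mathcal Kg(x)=\int_{-\infty}^xg$, $(\partial_x+\alpha)^{-1}g(x)=\int_{-\infty}^xg(y)e^{\alpha(y-x)}dy$, and $P_Q$ is the $L^2$-orthogonal projection onto the span of $\zeta^{tr}_{ca}$. Write $v\perp\mathcal K_{Q\alpha}T_{ca}$ if $v$ is $L^2$-orthogonal to $\mathcal K_{Q\alpha}\zeta^{tr}_{ca}$ and $\mathcal K_{Q\alpha}\zeta^n_{ca}$. **Statement.** Let $I\subset I_0$ be compact with $\delta'(c)>0$ and $\int\partial_cQ_c\ne0$ for all $c\in I$. There are constants $\alpha_0\in(0,1]$, $\kappa>0$ and $C>0$, depending only on $f$, on the family $(Q_c)$ and on $I$, such that the following holds. Let $0<\epsilon_a\le1$, $0<\epsilon_x\le1$, $\epsilon_t>0$ and $0<\alpha\le\alpha_0$. Let $b(t,x)$ be twice differentiable with $|\partial_t^n\partial_x^mb|\le\epsilon_a\epsilon_t^n\epsilon_x^m$ for $n\in\{0,1\}$, $m\in\{0,1,2\}$, $n+m\le2$; write $b'=\partial_xb$.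 Let $u\in C(J,H^1(\mathbb R))\cap C^1(J,H^{-2}(\mathbb R))$, with $J\subset\mathbb R$ open, solve $$\partial_tu=-\partial_x\left(\partial_x^2u+f(u)-b(t,x)u\right)$$ and satisfy on $J$ the balance laws $$\tfrac{d}{dt}H_b(u)=\tfrac12\int(\partial_tb)u^2,\qquad \tfrac{d}{dt}P(u)=\tfrac12\int b'u^2,$$ $$\tfrac{d}{dt}\tfrac12\int bu^2=\int\tfrac12u^2\partial_tb+b'\left(uf(u)-\tfrac32(\partial_xu)^2-F(u)\right)-b''u\,\partial_xu .$$ Let $a:J\to\mathbb R$ and $c:J\to I_0$ be differentiable such that $\xi(t):=u(t)-Q_{c(t)a(t)}\perp\mathcal K_{Q\alpha}T_{c(t)a(t)}$ for all $t\in J$. Fix $t\in J$ with $c(t)\in I$, let $\eta$ be a minimizer of $\langle(-\partial_x^2+c-f'(Q_{ca}))v,v\rangle$ over all $v\in H^1$ with $v\perp\mathcal K_{Q\alpha}T_{ca}$ and $\|v\|_{L^2}=1$, where $c=c(t)$, $a=a(t)$, and let $\xi_g=\xi-\langle\xi,\eta\rangle\eta$. If $\|\xi\|_{H^1}\le1$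 and $\alpha^{-1/2}\|\xi_g\|_{H^1}+\|\xi\|_{H^1}\le\kappa$ at time $t$, then the corrected Lyapunov functional $$M_c(t)=\Lambda_{ca}(Q_{ca}+\xi)-\Lambda_{ca}(Q_{ca})+b'(t,a)\langle(x-a)Q_{ca},\xi\rangle$$ is differentiable at $t$ and $$\frac{d}{dt}M_c(t)\le C\left(\epsilon_a\epsilon_x+\|\xi\|_{H^1}^2\right)\Xi,$$ $$\Xi:=\epsilon_a\epsilon_x+\left(\alpha^{1/2}+\alpha^{-1/2}\epsilon_a\epsilon_x\right)\|\xi_g\|_{H^1}+(\alpha+\epsilon_x+\epsilon_t)\|\xi\|_{H^1}+\|\xi\|_{H^1}^2 .$$ -/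

import Mathlib

open MeasureTheory Set Filter Topology
open scoped ContDiff

noncomputable section

namespace BKdV

/-! ### Real Sobolev spaces on the line -/

/-- `w` is the weak derivative of `v` on the real line. -/
def IsWeakDeriv (v w : ℝ → ℝ) : Prop :=
  ∀ φ : ℝ → ℝ, ContDiff ℝ ∞ φ → HasCompactSupport φ →
    ∫ x, v x * deriv φ x = -∫ x, w x * φ x

/-- The Sobolev space `H¹(ℝ)`: square integrable with a square integrable weak derivative. -/
def MemH1 (v : ℝ → ℝ) : Prop :=
  MemLp v 2 volume ∧ ∃ w, MemLp w 2 volume ∧ IsWeakDeriv v w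

open Classical in
/-- The square integrable weak derivative (unique up to null sets), when there is one. -/
def weakDeriv (v : ℝ → ℝ) : ℝ → ℝ :=
  if h : ∃ w, MemLp w 2 volume ∧ IsWeakDeriv v w then h.choose else 0

/-- The Sobolev space `H²(ℝ)`. -/
def MemH2 (v : ℝ → ℝ) : Prop :=
  MemH1 v ∧ MemH1 (weakDeriv v)

/-- The real `L²` pairing. -/
def ip (g h : ℝ → ℝ) : ℝ := ∫ x, g x * h x

/-- The `H¹` norm (for elements of `H¹`). -/
def h1Norm (v : ℝ → ℝ) : ℝ :=
  √((∫ x, v x ^ 2) + ∫ x, weakDeriv v x ^ 2)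

/-! ### Nonlinearity, potential, functionals -/

/-- `f` is `C^k` with bounded `k`-th derivative for some `k ≥ 3`, and `f(0) = f'(0) = 0`. -/
structure IsNonlinearity (f : ℝ → ℝ) : Prop where
  smooth : ∃ k : ℕ, 3 ≤ k ∧ ContDiff ℝ k f ∧ ∃ B : ℝ, ∀ x, |iteratedDeriv k f x| ≤ B
  zero : f 0 = 0
  deriv_zero : deriv f 0 = 0

/-- The antiderivative `F` of `f` with `F(0) = 0`. -/
def antideriv (f : ℝ → ℝ) (s : ℝ) : ℝ := ∫ r in (0 : ℝ)..s, f r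

/-- The potential `b(t,x)` is twice differentiable on the plane and
`|∂ₜⁿ ∂ₓᵐ b| ≤ εa εtⁿ εxᵐ` for `n ≤ 1`, `m ≤ 2`, `n + m ≤ 2`. -/
structure IsPotential (b : ℝ → ℝ → ℝ) (εa εt εx : ℝ) : Prop where
  diff : Differentiable ℝ (Function.uncurry b)
  diff_two : Differentiable ℝ (fderiv ℝ (Function.uncurry b))
  bound : ∀ n m : ℕ, n ≤ 1 → m ≤ 2 → n + m ≤ 2 → ∀ t x : ℝ,
    |iteratedDeriv n (fun s => iteratedDeriv m (fun y => b s y) x) t| ≤ εa * εt ^ n * εx ^ m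

/-- The space derivative `b' = ∂ₓ b`. -/
def dx (b : ℝ → ℝ → ℝ) (t x : ℝ) : ℝ := deriv (fun y => b t y) x

/-- The time derivative `∂ₜ b`. -/
def dt (b : ℝ → ℝ → ℝ) (t x : ℝ) : ℝ := deriv (fun s => b s x) t

/-- The momentum `P(u)`. -/
def momentum (u : ℝ → ℝ) : ℝ := (1 / 2) * ∫ x, u x ^ 2

/-- The Hamiltonian `H_b(u)`, for the potential `b = b(t, ·)` at a fixed time. -/
def hamiltonian (f : ℝ → ℝ) (b : ℝ → ℝ) (u : ℝ → ℝ) : ℝ :=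
  ∫ x, ((1 / 2) * weakDeriv u x ^ 2 - antideriv f (u x) + (1 / 2) * b x * u x ^ 2)

/-- The functional `Λ_{ca}(u) = H_{b=0}(u) + c P(u)`; it does not depend on `a`. -/
def lam (f : ℝ → ℝ) (c : ℝ) (u : ℝ → ℝ) : ℝ :=
  hamiltonian f (fun _ => 0) u + c * momentum u

/-! ### Solutions of the equation -/

/-- `u ∈ C(J, H¹) ∩ C¹(J, H⁻²)` solves `∂ₜ u = -∂ₓ(∂ₓ² u + f(u) - b u)` in `H⁻²`, that is, after
pairing with `H²` test functions. (Continuity in `H⁻²` of `∂ₜ u` follows from the equation.) -/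
structure IsSolution (f : ℝ → ℝ) (b : ℝ → ℝ → ℝ) (J : Set ℝ) (u : ℝ → ℝ → ℝ) : Prop where
  mem : ∀ t ∈ J, MemH1 (u t)
  cont : ∀ t ∈ J, Tendsto (fun s => h1Norm (fun x => u s x - u t x)) (𝓝[J] t) (𝓝 0)
  eqn : ∀ t ∈ J, ∀ φ : ℝ → ℝ, MemH2 φ →
    HasDerivAt (fun s => ∫ x, u s x * φ x)
      (∫ x, (-(weakDeriv (u t) x * weakDeriv (weakDeriv φ) x)
        + (f (u t x) - b t x * u t x) * weakDeriv φ x)) t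

/-- The balance laws for Hamiltonian, momentum and potential energy, which the flow on `H¹` is
assumed to enjoy (for smoother solutions they are obtained through integration by parts). -/
structure HasBalanceLaws (f : ℝ → ℝ) (b : ℝ → ℝ → ℝ) (J : Set ℝ) (u : ℝ → ℝ → ℝ) : Prop where
  hamiltonian_law : ∀ t ∈ J, HasDerivAt (fun s => hamiltonian f (b s) (u s))
    ((1 / 2) * ∫ x, dt b t x * u t x ^ 2) t
  momentum_law : ∀ t ∈ J, HasDerivAt (fun s => momentum (u s))
    ((1 / 2) * ∫ x, dx b t x * u t x ^ 2) t
  potential_law : ∀ t ∈ J, HasDerivAt (fun s => (1 / 2) * ∫ x, b s x * u s x ^ 2)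
    (∫ x, ((1 / 2) * u t x ^ 2 * dt b t x
      + dx b t x * (u t x * f (u t x) - (3 / 2) * weakDeriv (u t) x ^ 2
          - antideriv f (u t x))
      - dx (dx b) t x * u t x * weakDeriv (u t) x)) t

/-! ### Solitary waves -/

/-- `Q c`, for `c` in an open interval `I₀` of positive numbers, is the family of solitary wave
profiles: the positive even `C²` solutions, decaying at infinity, of `-Q'' + c Q - f(Q) = 0`.
`existence` is the Berestycki-Lions condition on the first positive zero of the antiderivative of
`g(u) = f(u) - c u` (their other conditions, `g` locally Lipschitz, `g(0) = 0` and
`lim g(s)/s = -c < 0` at `0`, hold by the assumptions on `f`). -/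
structure IsSolitaryWaveFamily (f : ℝ → ℝ) (I₀ : Set ℝ) (Q : ℝ → ℝ → ℝ) : Prop where
  isOpen : IsOpen I₀
  interval : I₀.OrdConnected
  pos_speed : ∀ c ∈ I₀, 0 < c
  existence : ∀ c ∈ I₀,
    {x : ℝ | 0 < x ∧ ∫ y in (0 : ℝ)..x, (f y - c * y) = 0}.Nonempty ∧
    0 < sInf {x : ℝ | 0 < x ∧ ∫ y in (0 : ℝ)..x, (f y - c * y) = 0} ∧
    0 < f (sInf {x : ℝ | 0 < x ∧ ∫ y in (0 : ℝ)..x, (f y - c * y) = 0})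
      - c * sInf {x : ℝ | 0 < x ∧ ∫ y in (0 : ℝ)..x, (f y - c * y) = 0}
  contDiff : ∀ c ∈ I₀, ContDiff ℝ 2 (Q c)
  pos : ∀ c ∈ I₀, ∀ x, 0 < Q c x
  even : ∀ c ∈ I₀, ∀ x, Q c (-x) = Q c x
  decay : ∀ c ∈ I₀, Tendsto (Q c) atTop (𝓝 0)
  eqn : ∀ c ∈ I₀, ∀ x, -iteratedDeriv 2 (Q c) x + c * Q c x - f (Q c x) = 0
  smooth_speed : ∀ x, ContDiffOn ℝ 3 (fun c => Q c x) I₀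
  integrable : ∀ c ∈ I₀, ∀ n m : ℕ, 1 ≤ n → n ≤ 3 → m ≤ 2 →
    Integrable (fun x => x ^ m * iteratedDeriv n (fun c' => Q c' x) c)

/-- The translated wave `Q_{ca}(x) = Q_c(x - a)`. -/
def wave (Q : ℝ → ℝ → ℝ) (c a x : ℝ) : ℝ := Q c (x - a)

/-- The translation vector `ζ^{tr} = ∂ₐ Q_{ca} = -∂ₓ Q_{ca}`. -/
def zetaTr (Q : ℝ → ℝ → ℝ) (c a x : ℝ) : ℝ := -deriv (wave Q c a) x

/-- The normalization vector `ζⁿ = ∂_c Q_{ca}`. -/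
def zetaN (Q : ℝ → ℝ → ℝ) (c a x : ℝ) : ℝ := deriv (fun c' => wave Q c' a x) c

/-- `δ(c) = P(Q_c)`. -/
def delta (Q : ℝ → ℝ → ℝ) (c : ℝ) : ℝ := momentum (Q c)

/-! ### Regularized symplectic operator and modulation -/

/-- `𝒦 g (x) = ∫_{-∞}^x g`. -/
def symp (g : ℝ → ℝ) (x : ℝ) : ℝ := ∫ y in Iic x, g y

/-- `(∂ₓ + α)⁻¹ g (x) = ∫_{-∞}^x g(y) e^{α(y-x)} dy`. -/
def regSymp (α : ℝ) (g : ℝ → ℝ) (x : ℝ) : ℝ := ∫ y in Iic x, g y * Real.exp (α * (y - x))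

/-- The orthogonal projection onto the span of `ζ^{tr}`. -/
def projTr (Q : ℝ → ℝ → ℝ) (c a : ℝ) (g : ℝ → ℝ) (x : ℝ) : ℝ :=
  ip g (zetaTr Q c a) / ip (zetaTr Q c a) (zetaTr Q c a) * zetaTr Q c a x

/-- The anisotropic regularization `𝒦 P + (∂ₓ + α)⁻¹ (1 - P)`. -/
def anisoSymp (Q : ℝ → ℝ → ℝ) (α c a : ℝ) (g : ℝ → ℝ) (x : ℝ) : ℝ :=
  symp (projTr Q c a g) x + regSymp α (fun y => g y - projTr Q c a g y) x

/-- `v` is `L²`-orthogonal to the image of the tangent space under the regularized operator. -/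
def IsSympOrth (Q : ℝ → ℝ → ℝ) (α c a : ℝ) (v : ℝ → ℝ) : Prop :=
  ip v (anisoSymp Q α c a (zetaTr Q c a)) = 0 ∧ ip v (anisoSymp Q α c a (zetaN Q c a)) = 0

/-- The quadratic form `⟨L v, v⟩` on `H¹` of the Hessian `L = -∂ₓ² + c - f'(Q_{ca})`. -/
def hessForm (f : ℝ → ℝ) (Q : ℝ → ℝ → ℝ) (c a : ℝ) (v : ℝ → ℝ) : ℝ :=
  ∫ x, (weakDeriv v x ^ 2 + c * v x ^ 2 - deriv f (wave Q c a x) * v x ^ 2)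

/-- Admissible functions for the constrained minimization of the Hessian. -/
def IsAdmissible (Q : ℝ → ℝ → ℝ) (α c a : ℝ) (v : ℝ → ℝ) : Prop :=
  MemH1 v ∧ IsSympOrth Q α c a v ∧ ∫ x, v x ^ 2 = 1

/-- `η` attains the infimum of `⟨L v, v⟩` over symplectically orthogonal `v` of unit `L²` norm. -/
def IsHessMinimizer (f : ℝ → ℝ) (Q : ℝ → ℝ → ℝ) (α c a : ℝ) (η : ℝ → ℝ) : Prop :=
  IsAdmissible Q α c a η ∧
    ∀ v, IsAdmissible Q α c a v → hessForm f Q c a η ≤ hessForm f Q c a v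

/-- The good part `ξ_g = ξ - ⟨ξ, η⟩ η` of the fluctuation. -/
def goodPart (η ξ : ℝ → ℝ) (x : ℝ) : ℝ := ξ x - ip ξ η * η x

/-- The fluctuation `ξ(t) = u(t) - Q_{c(t)a(t)}`. -/
def fluct (Q u : ℝ → ℝ → ℝ) (a c : ℝ → ℝ) (t x : ℝ) : ℝ := u t x - wave Q (c t) (a t) x

/-- On the time set `J`, `u = Q_{ca} + ξ` with differentiable parameters `a(t)`, `c(t) ∈ I₀` and
`ξ` symplectically orthogonal to the tangent space of the solitary waves. -/
structure IsModulated (Q : ℝ → ℝ → ℝ) (I₀ : Set ℝ) (α : ℝ) (J : Set ℝ) (u : ℝ → ℝ → ℝ)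
    (a c : ℝ → ℝ) : Prop where
  diff_a : ∀ t ∈ J, DifferentiableAt ℝ a t
  diff_c : ∀ t ∈ J, DifferentiableAt ℝ c t
  mem : ∀ t ∈ J, c t ∈ I₀
  orth : ∀ t ∈ J, IsSympOrth Q α (c t) (a t) (fluct Q u a c t)

/-- The corrected Lyapunov functional
`M_c(t) = Λ_{ca}(Q_{ca} + ξ) - Λ_{ca}(Q_{ca}) + b'(t,a) ⟨(x-a) Q_{ca}, ξ⟩`. -/
def lyapunov (f : ℝ → ℝ) (b Q u : ℝ → ℝ → ℝ) (a c : ℝ → ℝ) (t : ℝ) : ℝ :=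
  lam f (c t) (fun x => wave Q (c t) (a t) x + fluct Q u a c t x)
    - lam f (c t) (wave Q (c t) (a t))
    + dx b t (a t) * ip (fun x => (x - a t) * wave Q (c t) (a t) x) (fluct Q u a c t)

/-- The small quantity `Ξ`, as a function of `g = ‖ξ_g‖_{H¹}` and `r = ‖ξ‖_{H¹}`. -/
def bigXi (εa εt εx α g r : ℝ) : ℝ :=
  εa * εx + (√α + (√α)⁻¹ * (εa * εx)) * g + (α + εx + εt) * r + r ^ 2

end BKdV

end

/-!
Write `L = -∂ₓ² + c - f'(Q_c)` for the Hessian in the frame centred at `a`, `l = c - ȧ - b(t, a)` for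
the slip rate, and `w = (∂ₓ + α)⁻¹ ∂_c Q_c`. By parity `P_Q ζⁿ = 0`, hence orthogonality of `ξ` to
`𝒦_{Qα} T` means `⟨ξ, Q⟩ = 0` and `⟨ξ, w⟩ = 0` (`IsWaveData.isSympOrth_iff`).

**The rate of the functional.** By the balance laws, `d/dt Λ_c(u)` is the flux of a quadratic density
through the slope `b'` plus `ċ P(u)`. Since `⟨ξ, Q⟩ = 0`, subtracting `Λ_c(Q)` leaves only
`ċ ‖ξ‖² / 2` of the last term (`IsWaveData.hasDerivAt_lyapunov`). Expand the flux in `ξ`. At order zero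
it is the integral of `(b' Q Q')'`, which vanishes. At order one, with `b'` frozen at `a`, it pairs `ξ`
with `-(3 Q'' - (c - f'(Q)) Q)`, up to `O(ε_a ε_x²) ‖ξ‖`. The rest is quadratic with the factor
`ε_a ε_x` (`IsWaveData.exists_abs_flux_le`). The first order term is what the correction
`b'(t, a) ⟨(x - a) Q, ξ⟩` removes: by the equation for `ξ`, the time derivative of `⟨(x - a) Q, ξ⟩` is
the Hessian pairing of `ξ` with `∂ₓ(x Q)`, which produces the same function, up to `l`, `ċ`, `ε_a ε_x`
and `‖ξ‖²` (`IsWaveData.exists_abs_dilation_rate_le`). Everything is thus reduced to bounds for `l` and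
`ċ`.

**Modulation equations.** The two constraints hold for all times, so the derivatives of `⟨ξ, Q⟩` and
`⟨ξ, w⟩` vanish. The derivative of the first bounds `ċ`, the one of the second bounds `l`, both with
leading coefficient close to `δ'(c)`. Because `w' = ∂_c Q - α w` and `L ∂_c Q = -Q ⊥ ξ`, the term
linear in `ξ` carries a factor `α`. The remaining danger is that `w` only decays like `e^{-αx}` and has
norm of size `α^{-1/2}`, so that Cauchy-Schwarz against `ξ` loses too much. Here the splitting
`ξ = ξ_g + ⟨ξ, η⟩ η` helps: the loss is harmless for `ξ_g`, and `η` is nearly a multiple of `Q'`, a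
localized function. The outcome is
`|l| + |ċ| ≲ ε_a ε_x + α^{1/2} ‖ξ_g‖ + α ‖ξ‖ + ‖ξ‖²` (`IsStableData.exists_modulation_rates`).

**The minimizer.** `Q'` itself is in the kernel of `L` and misses the constraint against `w` by `O(1)`.
Since `α ‖w‖²` tends to `(∫ ∂_c Q)² / 2 ≠ 0`, adding multiples of `w` and `Q` with coefficients of size
`α` restores the constraints at the cost of an energy `O(α)`. So the minimal energy is `O(α)`, and
coercivity of `L` up to the directions `Q` and `Q'` puts `η` within `O(α^{1/2})` of a multiple of `Q'`
(`IsStableData.exists_minimizer_close`).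

**Coercivity.** No spectral theory is used. `-Q'` is positive on the half-line and solves
`L Q' = 0`; completing the square with its logarithmic derivative shows that the quadratic form is
nonnegative, with a gap off `Q'`, for functions on a half-line that vanish at the origin
(`IsGroundState.jacobi`). Any `v` vanishes at the origin after a multiple `t` of `∂_c Q` is added
(`∂_c Q(0) ≠ 0` by a Wronskian), and by `L ∂_c Q = -Q` this changes the form by
`-2 t ⟨v, Q⟩ - t² δ'(c)`. When `δ'(c) > 0`, the form of `v` therefore controls both the corrected function and `t`, up
to the pairings of `v` with `Q` and `Q'` (`IsWaveData.exists_coercive`).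

**Uniformity.** All constants come from exponential bounds for `Q_c`, `∂_c Q_c`, `∂_c² Q_c` and their
increments, with a rate that is locally uniform in `c`. Differences of these functions at two speeds
solve linearized profile equations; they are estimated by a Gronwall argument on a bounded interval, and
by the maximum principle beyond it, where the equation is elliptic (`IsWaveNhd.exists_waveData`).
Compactness of `I` makes the constants uniform (`IsSolitaryWaveFamily.exists_lyapunovBound`).
-/

noncomputable section

namespace BKdV

/-! ### Square integrable functions -/

lemma integrable_mul_of_memLp {g h : ℝ → ℝ} (hg : MemLp g 2 volume) (hh : MemLp h 2 volume) :
    Integrable (fun x => g x * h x) volume := hg.integrable_mul hh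

/-- The `L²` norm of a real function on the line. -/
def l2 (g : ℝ → ℝ) : ℝ := √(∫ x, g x ^ 2)

lemma l2_nonneg (g : ℝ → ℝ) : 0 ≤ l2 g := Real.sqrt_nonneg _

lemma l2_sq (g : ℝ → ℝ) : l2 g ^ 2 = ∫ x, g x ^ 2 :=
  Real.sq_sqrt (integral_nonneg fun _ => sq_nonneg _)

lemma l2_congr {g h : ℝ → ℝ} (e : g =ᵐ[volume] h) : l2 g = l2 h := by
  unfold l2
  congr 1
  exact integral_congr_ae (e.mono fun x hx => by simp only [hx])

/-- The Cauchy–Schwarz inequality. -/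
lemma abs_integral_mul_le {g h : ℝ → ℝ} (hg : MemLp g 2 volume) (hh : MemLp h 2 volume) :
    |∫ x, g x * h x| ≤ l2 g * l2 h := by
  have hq : ∀ s : ℝ, 0 ≤ (l2 h ^ 2) * (s * s) + (2 * ∫ x, g x * h x) * s + l2 g ^ 2 := by
    intro s
    have : ∫ x, (g x + s * h x) ^ 2
        = (l2 h ^ 2) * (s * s) + (2 * ∫ x, g x * h x) * s + l2 g ^ 2 := by
      rw [l2_sq, l2_sq]
      have e : (fun x => (g x + s * h x) ^ 2)
          = fun x => (s * s) * h x ^ 2 + (2 * s) * (g x * h x) + g x ^ 2 := by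
        funext x; ring
      rw [e, integral_add, integral_add, integral_const_mul, integral_const_mul]
      · ring
      · exact hh.integrable_sq.const_mul _
      · exact (integrable_mul_of_memLp hg hh).const_mul _
      · exact (hh.integrable_sq.const_mul _).add ((integrable_mul_of_memLp hg hh).const_mul _)
      · exact hg.integrable_sq
    rw [← this]
    exact integral_nonneg fun _ => sq_nonneg _
  have hd := discrim_le_zero hq
  rw [discrim] at hd
  apply abs_le_of_sq_le_sq _ (mul_nonneg (l2_nonneg _) (l2_nonneg _))
  nlinarith

lemma l2_add_le {g h : ℝ → ℝ} (hg : MemLp g 2 volume) (hh : MemLp h 2 volume) :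
    l2 (fun x => g x + h x) ≤ l2 g + l2 h := by
  have hcs := (abs_le.1 (abs_integral_mul_le hg hh)).2
  have e : l2 (fun x => g x + h x) ^ 2 = l2 g ^ 2 + 2 * (∫ x, g x * h x) + l2 h ^ 2 := by
    rw [l2_sq, l2_sq, l2_sq]
    have e : (fun x => (g x + h x) ^ 2)
        = fun x => g x ^ 2 + 2 * (g x * h x) + h x ^ 2 := by
      funext x; ring
    rw [e, integral_add, integral_add, integral_const_mul]
    · exact hg.integrable_sq
    · exact (integrable_mul_of_memLp hg hh).const_mul _
    · exact hg.integrable_sq.add ((integrable_mul_of_memLp hg hh).const_mul _)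
    · exact hh.integrable_sq
  apply le_of_sq_le_sq _ (add_nonneg (l2_nonneg _) (l2_nonneg _))
  nlinarith

lemma l2_const_mul (s : ℝ) (g : ℝ → ℝ) : l2 (fun x => s * g x) = |s| * l2 g := by
  unfold l2
  have : (fun x => (s * g x) ^ 2) = fun x => s ^ 2 * g x ^ 2 := by funext x; ring
  rw [this, integral_const_mul, Real.sqrt_mul (sq_nonneg _), Real.sqrt_sq_eq_abs]

lemma l2_mono {g h : ℝ → ℝ} (hh : MemLp h 2 volume) (hgh : ∀ x, |g x| ≤ |h x|) :
    l2 g ≤ l2 h := by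
  apply Real.sqrt_le_sqrt
  by_cases hi : Integrable (fun x => g x ^ 2)
  · exact integral_mono hi hh.integrable_sq fun x => sq_le_sq.2 (hgh x)
  · rw [integral_undef hi]
    exact integral_nonneg fun _ => sq_nonneg _

/-! ### Primitives of locally integrable functions -/

/-- `v` is a primitive of the locally integrable function `w`: the form in which the absolutely
continuous representative of a Sobolev function is used. -/
structure IsPrimitive (v w : ℝ → ℝ) : Prop where
  locInt : LocallyIntegrable w volume
  sub_eq : ∀ x y, v y - v x = ∫ t in x..y, w t

lemma ac_const (s a b : ℝ) : AbsolutelyContinuousOnInterval (fun _ : ℝ => s) a b :=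
  (contDiffOn_const (n := 1)).absolutelyContinuousOnInterval

lemma intervalIntegrable_of_locallyIntegrable {w : ℝ → ℝ} (h : LocallyIntegrable w volume)
    (a b : ℝ) : IntervalIntegrable w volume a b :=
  intervalIntegrable_iff.mpr ((h.integrableOn_isCompact isCompact_uIcc).mono_set uIoc_subset_uIcc)

namespace IsPrimitive

variable {v w v₂ w₂ : ℝ → ℝ}

lemma ac (h : IsPrimitive v w) (a b : ℝ) : AbsolutelyContinuousOnInterval v a b := by
  have e : v = fun x => v a + ∫ t in a..x, w t := by
    funext x; rw [← h.sub_eq]; ring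
  rw [e]
  exact (ac_const _ _ _).add ((intervalIntegrable_of_locallyIntegrable h.locInt a b
    ).absolutelyContinuousOnInterval_intervalIntegral (by simp))

lemma ae_hasDerivAt (h : IsPrimitive v w) : ∀ᵐ x, HasDerivAt v (w x) x := by
  filter_upwards [LocallyIntegrable.ae_hasDerivAt_integral h.locInt] with x hx
  have e : v = fun x => v 0 + ∫ t in (0 : ℝ)..x, w t := by
    funext x; rw [← h.sub_eq]; ring
  rw [e]
  exact (hx 0).const_add _

lemma continuous (h : IsPrimitive v w) : Continuous v := by
  have e : v = fun x => v 0 + ∫ t in (0 : ℝ)..x, w t := by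
    funext x; rw [← h.sub_eq]; ring
  rw [e]
  exact continuous_const.add (intervalIntegral.continuous_primitive
    (intervalIntegrable_of_locallyIntegrable h.locInt) 0)

lemma of_hasDerivAt (h : ∀ x, HasDerivAt v (w x) x) (hw : Continuous w) : IsPrimitive v w where
  locInt := hw.locallyIntegrable
  sub_eq _ _ := (intervalIntegral.integral_eq_sub_of_hasDerivAt (fun t _ => h t)
    (hw.intervalIntegrable _ _)).symm

lemma add (h : IsPrimitive v w) (h₂ : IsPrimitive v₂ w₂) :
    IsPrimitive (fun x => v x + v₂ x) (fun x => w x + w₂ x) where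
  locInt := h.locInt.add h₂.locInt
  sub_eq x y := by
    rw [intervalIntegral.integral_add (intervalIntegrable_of_locallyIntegrable h.locInt _ _)
      (intervalIntegrable_of_locallyIntegrable h₂.locInt _ _), ← h.sub_eq, ← h₂.sub_eq]
    ring

lemma const_mul (h : IsPrimitive v w) (s : ℝ) :
    IsPrimitive (fun x => s * v x) (fun x => s * w x) where
  locInt := h.locInt.smul s
  sub_eq x y := by
    rw [intervalIntegral.integral_const_mul, ← h.sub_eq]
    ring

end IsPrimitive

/-- The fundamental theorem of calculus for an absolutely continuous function whose derivative is
known almost everywhere. -/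
lemma ac_integral_eq {g g' : ℝ → ℝ} {a b : ℝ} (hg : AbsolutelyContinuousOnInterval g a b)
    (h : ∀ᵐ x, x ∈ uIcc a b → HasDerivAt g (g' x) x) :
    IntervalIntegrable g' volume a b ∧ ∫ x in a..b, g' x = g b - g a := by
  have e : ∀ᵐ x, x ∈ uIoc a b → deriv g x = g' x := by
    filter_upwards [h] with x hx hx'
    exact (hx (uIoc_subset_uIcc hx')).deriv
  constructor
  · refine hg.intervalIntegrable_deriv.congr_ae ?_
    exact (ae_restrict_iff' measurableSet_uIoc).2 e
  · rw [← hg.integral_deriv_eq_sub]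
    exact (intervalIntegral.integral_congr_ae e).symm

lemma IsPrimitive.integral_mul {v w v₂ w₂ : ℝ → ℝ} (h : IsPrimitive v w)
    (h₂ : IsPrimitive v₂ w₂) (a b : ℝ) :
    IntervalIntegrable (fun x => w x * v₂ x + v x * w₂ x) volume a b ∧
    ∫ x in a..b, (w x * v₂ x + v x * w₂ x) = v b * v₂ b - v a * v₂ a := by
  refine ac_integral_eq (g := fun x => v x * v₂ x) ((h.ac a b).fun_mul (h₂.ac a b)) ?_
  filter_upwards [h.ae_hasDerivAt, h₂.ae_hasDerivAt] with x hx hx₂ _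
  exact hx.mul hx₂

/-! ### The Sobolev space `H¹` -/

/-- Integration by parts against a test function, which vanishes at the ends of a large interval. -/
lemma IsPrimitive.isWeakDeriv {v w : ℝ → ℝ} (h : IsPrimitive v w) : IsWeakDeriv v w := by
  intro φ hφ hc
  have hφ1 : Differentiable ℝ φ := hφ.differentiable (by simp)
  have hφ' : Continuous (deriv φ) := hφ.continuous_deriv (by simp)
  have hpφ : IsPrimitive φ (deriv φ) := .of_hasDerivAt (fun x => (hφ1 x).hasDerivAt) hφ'
  obtain ⟨R, hR⟩ := hc.isCompact.isBounded.subset_closedBall 0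
  have hR' : ∀ x, φ x ≠ 0 → |x| ≤ R := fun x hx => by
    simpa using hR (subset_tsupport _ hx)
  have hR'' : ∀ x, deriv φ x ≠ 0 → |x| ≤ R := fun x hx => by
    simpa using hR (support_deriv_subset hx)
  set S := max R 0 + 1
  have hS : 0 < S := by positivity
  have hRS : R < S := by have := le_max_left R 0; simp only [S]; linarith
  have key := (h.integral_mul hpφ (-S) S).2
  have z1 : φ S = 0 := by
    by_contra hne; have := hR' _ hne; rw [abs_of_pos hS] at this; linarith
  have z2 : φ (-S) = 0 := by
    by_contra hne; have := hR' _ hne; rw [abs_neg, abs_of_pos hS] at this; linarith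
  rw [z1, z2] at key
  have i1 : Integrable (fun x => v x * deriv φ x) :=
    (h.continuous.mul hφ').integrable_of_hasCompactSupport (hc.deriv.mul_left)
  have i2 : Integrable (fun x => w x * φ x) := by
    have := h.locInt.integrable_smul_left_of_hasCompactSupport hφ.continuous hc
    simpa [smul_eq_mul, mul_comm] using this
  have : ∫ x in (-S)..S, (w x * φ x + v x * deriv φ x)
      = ∫ x, (w x * φ x + v x * deriv φ x) := by
    apply intervalIntegral.integral_eq_integral_of_support_subset
    intro x hx
    have : |x| ≤ R := by
      by_contra hne
      apply hx
      have a1 : φ x = 0 := by by_contra h1; exact hne (hR' _ h1)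
      have a2 : deriv φ x = 0 := by by_contra h1; exact hne (hR'' _ h1)
      simp [a1, a2]
    have := abs_le.1 this
    constructor <;> linarith
  rw [this, integral_add i2 i1] at key
  linarith

/-- The lemma of du Bois-Reymond. The constant is the mean of `d` against a fixed bump: a test function
minus its mass times the bump has vanishing mean and is the derivative of a test function. -/
lemma ae_const_of_weakDeriv_zero {d : ℝ → ℝ} (hd : LocallyIntegrable d volume)
    (h : ∀ φ : ℝ → ℝ, ContDiff ℝ ∞ φ → HasCompactSupport φ → ∫ x, d x * deriv φ x = 0) :
    ∃ κ : ℝ, ∀ᵐ x, d x = κ := by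
  let B : ContDiffBump (0 : ℝ) := ⟨1, 2, by norm_num, by norm_num⟩
  set ψ : ℝ → ℝ := B.normed volume
  have hψ : ContDiff ℝ ∞ ψ := B.contDiff_normed
  have hψc : HasCompactSupport ψ := B.hasCompactSupport_normed
  have hψ1 : ∫ x, ψ x = 1 := B.integral_normed
  have int : ∀ g : ℝ → ℝ, Continuous g → HasCompactSupport g →
      Integrable (fun x => d x * g x) := fun g hg hc => by
    have := hd.integrable_smul_left_of_hasCompactSupport hg hc
    simpa [smul_eq_mul, mul_comm] using this
  refine ⟨∫ x, d x * ψ x, ?_⟩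
  refine ae_eq_of_integral_contDiff_smul_eq hd (locallyIntegrable_const _) ?_
  intro g hg hgc
  simp only [smul_eq_mul]
  rw [integral_mul_const]
  -- `g - (∫ g) ψ` has integral zero, so its primitive is a test function.
  set m := ∫ x, g x
  set k : ℝ → ℝ := fun x => g x - m * ψ x
  have hk : ContDiff ℝ ∞ k := hg.sub (contDiff_const.mul hψ)
  have hkc : HasCompactSupport k := hgc.sub hψc.mul_left
  have hki : Integrable k := hk.continuous.integrable_of_hasCompactSupport hkc
  have hgi : Integrable g := hg.continuous.integrable_of_hasCompactSupport hgc
  have hψi : Integrable ψ := hψ.continuous.integrable_of_hasCompactSupport hψc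
  have hk0 : ∫ x, k x = 0 := by
    simp only [k]
    rw [integral_sub hgi (hψi.const_mul _), integral_const_mul, hψ1]
    simp [m]
  obtain ⟨R, hR⟩ := hkc.isCompact.isBounded.subset_closedBall 0
  have hR' : ∀ x, R < |x| → k x = 0 := fun x hx => by
    by_contra hne
    have : |x| ≤ R := by simpa using hR (subset_tsupport _ hne)
    linarith
  set φ : ℝ → ℝ := fun x => ∫ t in (-(max R 0 + 1))..x, k t
  have hφd : ∀ x, HasDerivAt φ (k x) x := fun x =>
    intervalIntegral.integral_hasDerivAt_right (hk.continuous.intervalIntegrable _ _)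
      (hk.continuous.stronglyMeasurableAtFilter _ _) hk.continuous.continuousAt
  have hφd' : deriv φ = k := funext fun x => (hφd x).deriv
  have hφ : ContDiff ℝ ∞ φ := by
    rw [contDiff_infty_iff_deriv]
    exact ⟨fun x => (hφd x).differentiableAt, hφd' ▸ hk⟩
  have hφc : HasCompactSupport φ := by
    refine HasCompactSupport.of_support_subset_isCompact
      (isCompact_Icc (a := -(max R 0 + 1)) (b := max R 0 + 1)) ?_
    intro x hx
    have hmR := le_max_left R 0
    have hm0 := le_max_right R 0
    rw [mem_Icc]
    by_contra hne
    apply hx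
    rcases lt_or_ge x (-(max R 0 + 1)) with h1 | h1
    · simp only [φ]
      rw [intervalIntegral.integral_symm, neg_eq_zero]
      rw [intervalIntegral.integral_congr (g := fun _ => (0 : ℝ))]
      · simp
      · intro t ht
        rw [uIcc_of_le h1.le] at ht
        apply hR'
        rw [abs_of_neg (by linarith [ht.2])]
        linarith [ht.2]
    · have h2 : max R 0 + 1 < x := by
        by_contra h3; exact hne ⟨h1, not_lt.1 h3⟩
      simp only [φ]
      refine Eq.trans ?_ hk0
      apply intervalIntegral.integral_eq_integral_of_support_subset
      intro t ht
      have : |t| ≤ R := by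
        by_contra h3
        exact ht (hR' t (not_le.1 h3))
      have := abs_le.1 this
      constructor <;> linarith
  have := h φ hφ hφc
  rw [hφd'] at this
  simp only [k] at this
  have e : (fun x => d x * (g x - m * ψ x)) = fun x => d x * g x - m * (d x * ψ x) := by
    funext x; ring
  rw [e, integral_sub (int g hg.continuous hgc) ((int ψ hψ.continuous hψc).const_mul _),
    integral_const_mul] at this
  simp only [mul_comm (g _)]
  linarith

lemma locallyIntegrable_of_memLp {g : ℝ → ℝ} (hg : MemLp g 2 volume) :
    LocallyIntegrable g volume := hg.locallyIntegrable (by norm_num)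

lemma IsWeakDeriv.ae_unique {v w₁ w₂ : ℝ → ℝ} (h₁ : IsWeakDeriv v w₁) (h₂ : IsWeakDeriv v w₂)
    (l₁ : LocallyIntegrable w₁ volume) (l₂ : LocallyIntegrable w₂ volume) :
    w₁ =ᵐ[volume] w₂ := by
  refine ae_eq_of_integral_contDiff_smul_eq l₁ l₂ fun φ hφ hc => ?_
  have a := h₁ φ hφ hc
  have b := h₂ φ hφ hc
  simp only [smul_eq_mul, mul_comm (φ _)]
  linarith

lemma IsWeakDeriv.congr {v v₂ w w₂ : ℝ → ℝ} (h : IsWeakDeriv v w) (hv : v =ᵐ[volume] v₂)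
    (hw : w =ᵐ[volume] w₂) : IsWeakDeriv v₂ w₂ := by
  intro φ hφ hc
  have e₁ : ∫ x, v₂ x * deriv φ x = ∫ x, v x * deriv φ x :=
    integral_congr_ae (hv.mono fun x hx => by simp only [hx])
  have e₂ : ∫ x, w₂ x * φ x = ∫ x, w x * φ x :=
    integral_congr_ae (hw.mono fun x hx => by simp only [hx])
  rw [e₁, e₂]
  exact h φ hφ hc

namespace MemH1

variable {v v₂ : ℝ → ℝ}

lemma memLp (h : MemH1 v) : MemLp v 2 volume := h.1

lemma weakDeriv_spec (h : MemH1 v) :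
    MemLp (weakDeriv v) 2 volume ∧ IsWeakDeriv v (weakDeriv v) := by
  have := h.2.choose_spec
  rw [weakDeriv, dif_pos h.2]
  exact this

lemma memLp_weakDeriv (h : MemH1 v) : MemLp (weakDeriv v) 2 volume := h.weakDeriv_spec.1

lemma weakDeriv_ae_eq {w : ℝ → ℝ} (hv : MemLp v 2 volume) (hw : MemLp w 2 volume)
    (h : IsWeakDeriv v w) : MemH1 v ∧ weakDeriv v =ᵐ[volume] w := by
  have hm : MemH1 v := ⟨hv, w, hw, h⟩
  exact ⟨hm, hm.weakDeriv_spec.2.ae_unique h (locallyIntegrable_of_memLp hm.memLp_weakDeriv)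
    (locallyIntegrable_of_memLp hw)⟩

/-- Every function in `H¹` has an absolutely continuous representative. -/
lemma exists_primitive (h : MemH1 v) :
    ∃ r, IsPrimitive r (weakDeriv v) ∧ v =ᵐ[volume] r := by
  have hl := locallyIntegrable_of_memLp h.memLp_weakDeriv
  set V : ℝ → ℝ := fun x => ∫ t in (0 : ℝ)..x, weakDeriv v t
  have hV : IsPrimitive V (weakDeriv v) := ⟨hl, fun x y => by
    simp only [V]
    rw [intervalIntegral.integral_interval_sub_left] <;>
    exact intervalIntegrable_of_locallyIntegrable hl _ _⟩
  obtain ⟨κ, hκ⟩ := ae_const_of_weakDeriv_zero (d := fun x => v x - V x)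
    ((locallyIntegrable_of_memLp h.memLp).sub hV.continuous.locallyIntegrable) (by
      intro φ hφ hc
      have a := h.weakDeriv_spec.2 φ hφ hc
      have b := hV.isWeakDeriv φ hφ hc
      have hφ' : Continuous (deriv φ) := hφ.continuous_deriv (by simp)
      simp only [sub_mul]
      rw [integral_sub, a, b, sub_self]
      · have := (locallyIntegrable_of_memLp h.memLp).integrable_smul_left_of_hasCompactSupport hφ'
          hc.deriv
        simpa [smul_eq_mul, mul_comm] using this
      · exact (hV.continuous.mul hφ').integrable_of_hasCompactSupport (hc.deriv.mul_left))
  refine ⟨fun x => κ + V x, ⟨hl, fun x y => ?_⟩, ?_⟩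
  · rw [← hV.sub_eq]; ring
  · filter_upwards [hκ] with x hx
    linarith

lemma of_primitive {w : ℝ → ℝ} (h : IsPrimitive v w) (hv : MemLp v 2 volume)
    (hw : MemLp w 2 volume) : MemH1 v ∧ weakDeriv v =ᵐ[volume] w :=
  weakDeriv_ae_eq hv hw h.isWeakDeriv

lemma congr (h : MemH1 v) (e : v =ᵐ[volume] v₂) :
    MemH1 v₂ ∧ weakDeriv v₂ =ᵐ[volume] weakDeriv v :=
  weakDeriv_ae_eq (h.memLp.ae_eq e) h.memLp_weakDeriv (h.weakDeriv_spec.2.congr e .rfl)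

lemma add (h : MemH1 v) (h₂ : MemH1 v₂) : MemH1 (fun x => v x + v₂ x) ∧
    weakDeriv (fun x => v x + v₂ x) =ᵐ[volume] fun x => weakDeriv v x + weakDeriv v₂ x := by
  obtain ⟨r, hr, er⟩ := h.exists_primitive
  obtain ⟨r₂, hr₂, er₂⟩ := h₂.exists_primitive
  have e : (fun x => v x + v₂ x) =ᵐ[volume] fun x => r x + r₂ x := er.add er₂
  exact weakDeriv_ae_eq (h.memLp.add h₂.memLp) (h.memLp_weakDeriv.add h₂.memLp_weakDeriv)
    ((hr.add hr₂).isWeakDeriv.congr e.symm .rfl)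

lemma const_mul (h : MemH1 v) (s : ℝ) : MemH1 (fun x => s * v x) ∧
    weakDeriv (fun x => s * v x) =ᵐ[volume] fun x => s * weakDeriv v x := by
  obtain ⟨r, hr, er⟩ := h.exists_primitive
  have e : (fun x => s * v x) =ᵐ[volume] fun x => s * r x :=
    er.mono fun x hx => by simp only [hx]
  exact weakDeriv_ae_eq (h.memLp.const_mul s) (h.memLp_weakDeriv.const_mul s)
    ((hr.const_mul s).isWeakDeriv.congr e.symm .rfl)

lemma sub (h : MemH1 v) (h₂ : MemH1 v₂) : MemH1 (fun x => v x - v₂ x) ∧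
    weakDeriv (fun x => v x - v₂ x) =ᵐ[volume] fun x => weakDeriv v x - weakDeriv v₂ x := by
  have a := h₂.const_mul (-1)
  have b := h.add a.1
  have e : (fun x => v x - v₂ x) = fun x => v x + -1 * v₂ x := by funext x; ring
  rw [e]
  refine ⟨b.1, b.2.trans ?_⟩
  filter_upwards [a.2] with x hx
  rw [hx]; ring

end MemH1

lemma exists_ge_small_of_integrable {g : ℝ → ℝ} (hg : Integrable g) (x : ℝ)
    {ε : ℝ} (hε : 0 < ε) : ∃ y, x ≤ y ∧ g y ≤ ε := by
  by_contra hne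
  push Not at hne
  have : IntegrableOn (fun _ : ℝ => ε) (Ici x) := by
    refine Integrable.mono' (hg.integrableOn (s := Ici x)) aestronglyMeasurable_const ?_
    refine (ae_restrict_iff' measurableSet_Ici).2 (.of_forall fun y hy => ?_)
    rw [Real.norm_of_nonneg hε.le]
    exact (hne y hy).le
  rw [integrableOn_const_iff (by simp)] at this
  simp [hε.ne'] at this

namespace IsPrimitive

variable {v w v₂ w₂ : ℝ → ℝ}

/-- Square integrability of a function and of its derivative controls the pointwise values by
the tail of the `H¹` norm. -/
lemma sq_le_tail (h : IsPrimitive v w) (hv : MemLp v 2 volume) (hw : MemLp w 2 volume) (x : ℝ) :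
    v x ^ 2 ≤ ∫ t in Ioi x, (v t ^ 2 + w t ^ 2) := by
  have hi : Integrable (fun t => v t ^ 2 + w t ^ 2) := hv.integrable_sq.add hw.integrable_sq
  apply le_of_forall_pos_le_add
  intro ε hε
  obtain ⟨y, hxy, hy⟩ := exists_ge_small_of_integrable hv.integrable_sq x hε
  obtain ⟨i1, e1⟩ := h.integral_mul h x y
  have i2 : IntervalIntegrable (fun t => v t ^ 2 + w t ^ 2) volume x y := hi.intervalIntegrable
  have : -(∫ t in x..y, (v t ^ 2 + w t ^ 2)) ≤ ∫ t in x..y, (w t * v t + v t * w t) := by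
    rw [← intervalIntegral.integral_neg]
    refine intervalIntegral.integral_mono_on hxy i2.neg i1 fun t _ => ?_
    nlinarith [sq_nonneg (v t + w t)]
  have h3 : ∫ t in x..y, (v t ^ 2 + w t ^ 2) ≤ ∫ t in Ioi x, (v t ^ 2 + w t ^ 2) := by
    rw [intervalIntegral.integral_of_le hxy]
    exact setIntegral_mono_set hi.integrableOn (.of_forall fun t => by positivity)
      (LE.le.eventuallyLE Ioc_subset_Ioi_self)
  nlinarith

lemma sq_le (h : IsPrimitive v w) (hv : MemLp v 2 volume) (hw : MemLp w 2 volume) (x : ℝ) :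
    v x ^ 2 ≤ ∫ t, (v t ^ 2 + w t ^ 2) :=
  (h.sq_le_tail hv hw x).trans (setIntegral_le_integral (hv.integrable_sq.add hw.integrable_sq)
    (.of_forall fun t => by positivity))

lemma tendsto_atTop (h : IsPrimitive v w) (hv : MemLp v 2 volume) (hw : MemLp w 2 volume) :
    Tendsto v atTop (𝓝 0) := by
  have hi : Integrable (fun t => v t ^ 2 + w t ^ 2) := hv.integrable_sq.add hw.integrable_sq
  have h1 : Tendsto (fun x => ∫ t in Ioi x, (v t ^ 2 + w t ^ 2)) atTop (𝓝 0) := by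
    have h2 := intervalIntegral_tendsto_integral_Ioi 0 hi.integrableOn tendsto_id
    have h3 := h2.const_sub (∫ t in Ioi (0 : ℝ), (v t ^ 2 + w t ^ 2))
    rw [sub_self] at h3
    refine h3.congr' ?_
    filter_upwards [eventually_ge_atTop 0] with x hx
    have := intervalIntegral.integral_Ioi_sub_Ioi (hi.integrableOn (s := Ioi 0)) hx
    simp only [id]
    linarith
  have h2 : Tendsto (fun x => v x ^ 2) atTop (𝓝 0) :=
    squeeze_zero (fun _ => sq_nonneg _) (fun x => h.sq_le_tail hv hw x) h1
  have h3 := (Real.continuous_sqrt.tendsto 0).comp h2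
  rw [Real.sqrt_zero] at h3
  refine (tendsto_zero_iff_abs_tendsto_zero v).2 (h3.congr fun x => ?_)
  simp [Real.sqrt_sq_eq_abs]

lemma comp_neg (h : IsPrimitive v w) : IsPrimitive (fun x => v (-x)) (fun x => -w (-x)) where
  locInt := by
    have : LocallyIntegrable (fun x => w (-x)) volume := by
      rw [locallyIntegrable_iff]
      intro k hk
      have := (h.locInt.integrableOn_isCompact hk.neg)
      rw [← (Measure.measurePreserving_neg (volume : Measure ℝ)).integrableOn_comp_preimage
        (Homeomorph.neg ℝ).measurableEmbedding] at this
      simpa [Function.comp_def] using this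
    exact this.neg
  sub_eq x y := by
    rw [intervalIntegral.integral_neg, intervalIntegral.integral_comp_neg,
      ← h.sub_eq]
    ring

lemma comp_add (h : IsPrimitive v w) (a : ℝ) :
    IsPrimitive (fun x => v (x + a)) (fun x => w (x + a)) where
  locInt := by
    rw [locallyIntegrable_iff]
    intro k hk
    have := (h.locInt.integrableOn_isCompact (hk.image (continuous_add_const a)))
    rw [← (measurePreserving_add_right (volume : Measure ℝ) a).integrableOn_comp_preimage
      (Homeomorph.addRight a).measurableEmbedding] at this
    refine this.mono_set ?_
    exact subset_preimage_image _ _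
  sub_eq x y := by
    rw [intervalIntegral.integral_comp_add_right, ← h.sub_eq]

end IsPrimitive

lemma memLp_comp_neg {g : ℝ → ℝ} (hg : MemLp g 2 volume) : MemLp (fun x => g (-x)) 2 volume :=
  hg.comp_measurePreserving (Measure.measurePreserving_neg volume)

lemma memLp_comp_add {g : ℝ → ℝ} (hg : MemLp g 2 volume) (a : ℝ) :
    MemLp (fun x => g (x + a)) 2 volume :=
  hg.comp_measurePreserving (measurePreserving_add_right volume a)

lemma IsPrimitive.tendsto_atBot {v w : ℝ → ℝ} (h : IsPrimitive v w) (hv : MemLp v 2 volume)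
    (hw : MemLp w 2 volume) : Tendsto v atBot (𝓝 0) := by
  have := (h.comp_neg.tendsto_atTop (memLp_comp_neg hv) (memLp_comp_neg hw).neg).comp
    tendsto_neg_atBot_atTop
  refine this.congr fun x => ?_
  simp

lemma IsPrimitive.integral_by_parts {v w v₂ w₂ : ℝ → ℝ} (h : IsPrimitive v w)
    (h₂ : IsPrimitive v₂ w₂) (hv : MemLp v 2 volume) (hw : MemLp w 2 volume)
    (hv₂ : MemLp v₂ 2 volume) (hw₂ : MemLp w₂ 2 volume) :
    ∫ x, w x * v₂ x = -∫ x, v x * w₂ x := by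
  have i1 := integrable_mul_of_memLp hw hv₂
  have i2 := integrable_mul_of_memLp hv hw₂
  have lim := intervalIntegral_tendsto_integral (i1.add i2)
    (tendsto_neg_atTop_atBot (G := ℝ)) (tendsto_id (α := ℝ) (x := atTop))
  have lim2 : Tendsto (fun n : ℝ => ∫ x in (-n)..n, (w x * v₂ x + v x * w₂ x)) atTop (𝓝 0) := by
    simp only [(h.integral_mul h₂ _ _).2]
    have a := (h.tendsto_atTop hv hw).mul (h₂.tendsto_atTop hv₂ hw₂)
    have b := ((h.tendsto_atBot hv hw).mul (h₂.tendsto_atBot hv₂ hw₂)).comp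
      (tendsto_neg_atTop_atBot (G := ℝ))
    simpa using a.sub b
  have := tendsto_nhds_unique lim lim2
  have e : ∫ x, ((fun x => w x * v₂ x) + fun x => v x * w₂ x) x
      = (∫ x, w x * v₂ x) + ∫ x, v x * w₂ x := integral_add i1 i2
  linarith

/-! ### The `H¹` norm -/

lemma h1Norm_nonneg (v : ℝ → ℝ) : 0 ≤ h1Norm v := Real.sqrt_nonneg _

lemma h1Norm_sq (v : ℝ → ℝ) : h1Norm v ^ 2 = l2 v ^ 2 + l2 (weakDeriv v) ^ 2 := by
  rw [h1Norm, Real.sq_sqrt, l2_sq, l2_sq]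
  exact add_nonneg (integral_nonneg fun _ => sq_nonneg _) (integral_nonneg fun _ => sq_nonneg _)

lemma l2_le_h1Norm (v : ℝ → ℝ) : l2 v ≤ h1Norm v := by
  apply le_of_sq_le_sq _ (h1Norm_nonneg v)
  rw [h1Norm_sq]; nlinarith [sq_nonneg (l2 (weakDeriv v))]

lemma l2_weakDeriv_le_h1Norm (v : ℝ → ℝ) : l2 (weakDeriv v) ≤ h1Norm v := by
  apply le_of_sq_le_sq _ (h1Norm_nonneg v)
  rw [h1Norm_sq]; nlinarith [sq_nonneg (l2 v)]

/-- The Sobolev embedding `H¹ ⊂ L^∞`, with constant one. -/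
lemma MemH1.ae_abs_le {v : ℝ → ℝ} (h : MemH1 v) : ∀ᵐ x, |v x| ≤ h1Norm v := by
  obtain ⟨r, hr, er⟩ := h.exists_primitive
  filter_upwards [er] with x hx
  rw [hx]
  apply abs_le_of_sq_le_sq _ (h1Norm_nonneg v)
  refine (hr.sq_le (h.memLp.ae_eq er) h.memLp_weakDeriv x).trans ?_
  rw [h1Norm_sq, l2_congr er, l2_sq, l2_sq,
    integral_add (h.memLp.ae_eq er).integrable_sq h.memLp_weakDeriv.integrable_sq]

/-! ### Exponential weights -/

/-- The exponential weight `e^{-ν|x|}`. -/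
def expW (ν x : ℝ) : ℝ := Real.exp (-(ν * |x|))

lemma expW_pos (ν x : ℝ) : 0 < expW ν x := Real.exp_pos _

lemma expW_neg (ν x : ℝ) : expW ν (-x) = expW ν x := by simp [expW]

lemma expW_of_nonneg (ν : ℝ) {x : ℝ} (hx : 0 ≤ x) : expW ν x = Real.exp (-(ν * x)) := by
  rw [expW, abs_of_nonneg hx]

lemma expW_le_one {ν : ℝ} (hν : 0 ≤ ν) (x : ℝ) : expW ν x ≤ 1 := by
  rw [expW, Real.exp_le_one_iff]
  have := mul_nonneg hν (abs_nonneg x)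
  linarith

lemma expW_anti {ν ν' : ℝ} (h : ν' ≤ ν) (x : ℝ) : expW ν x ≤ expW ν' x := by
  rw [expW, expW, Real.exp_le_exp]
  have := mul_le_mul_of_nonneg_right h (abs_nonneg x)
  linarith

lemma continuous_expW (ν : ℝ) : Continuous (expW ν) := by unfold expW; fun_prop

lemma integral_expW {ν : ℝ} (hν : 0 < ν) : ∫ x, expW ν x = 2 / ν := by
  have h := integral_comp_abs (f := fun x => Real.exp (-(ν * x)))
  have h2 : ∫ x in Ioi (0 : ℝ), Real.exp (-(ν * x)) = 1 / ν := by
    have := integral_exp_mul_Ioi (a := -ν) (by linarith) 0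
    simp only [neg_mul] at this
    rw [this]; field_simp; simp
  unfold expW
  rw [h, h2]; ring

lemma integrable_expW {ν : ℝ} (hν : 0 < ν) : Integrable (expW ν) :=
  .of_integral_ne_zero (by rw [integral_expW hν]; positivity)

lemma expW_sq (ν x : ℝ) : expW ν x ^ 2 = expW (2 * ν) x := by
  rw [expW, expW, ← Real.exp_nat_mul]; congr 1; push_cast; ring

lemma expW_shift {ν : ℝ} (hν : 0 ≤ ν) (x y : ℝ) :
    expW ν x ≤ Real.exp (ν * |x - y|) * expW ν y := by
  rw [expW, expW, ← Real.exp_add, Real.exp_le_exp]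
  have h1 : |y| ≤ |x| + |x - y| := by
    have := abs_sub_abs_le_abs_sub y x
    rw [abs_sub_comm] at this; linarith
  have := mul_le_mul_of_nonneg_left h1 hν
  linarith

lemma abs_mul_expW_le {ν : ℝ} (hν : 0 < ν) (x : ℝ) :
    |x| * expW ν x ≤ 2 / ν * expW (ν / 2) x := by
  have e : expW ν x = expW (ν / 2) x * expW (ν / 2) x := by
    rw [← sq, expW_sq]; congr 1; ring
  have h1 : |x| * expW (ν / 2) x ≤ 2 / ν := by
    rw [expW, Real.exp_neg, ← div_eq_mul_inv, div_le_iff₀ (Real.exp_pos _)]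
    have := Real.add_one_le_exp (ν / 2 * |x|)
    calc |x| = 2 / ν * (ν / 2 * |x|) := by field_simp
      _ ≤ 2 / ν * Real.exp (ν / 2 * |x|) := by
        apply mul_le_mul_of_nonneg_left _ (by positivity)
        linarith
  rw [e, ← mul_assoc]
  exact mul_le_mul_of_nonneg_right h1 (expW_pos _ _).le

/-- `g` is bounded by `K e^{-ν|x|}`. -/
def ExpBd (K ν : ℝ) (g : ℝ → ℝ) : Prop := ∀ x, |g x| ≤ K * expW ν x

namespace ExpBd

variable {K K' ν ν' : ℝ} {g h : ℝ → ℝ}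

lemma nonneg (hg : ExpBd K ν g) : 0 ≤ K := by
  have h1 := (abs_nonneg _).trans (hg 0)
  have h2 := expW_pos ν 0
  by_contra h3
  nlinarith [mul_neg_of_neg_of_pos (not_le.1 h3) h2]

lemma mono (hg : ExpBd K ν g) (hK : K ≤ K') (hν : ν' ≤ ν) : ExpBd K' ν' g := fun x =>
  (hg x).trans (mul_le_mul hK (expW_anti hν x) (expW_pos _ _).le (hg.nonneg.trans hK))

lemma le (hg : ExpBd K ν g) (hν : 0 ≤ ν) (x : ℝ) : |g x| ≤ K :=
  (hg x).trans (mul_le_of_le_one_right hg.nonneg (expW_le_one hν x))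

lemma add (hg : ExpBd K ν g) (hh : ExpBd K' ν h) : ExpBd (K + K') ν (fun x => g x + h x) :=
  fun x => (abs_add_le _ _).trans (by have := hg x; have := hh x; linarith)

lemma sub (hg : ExpBd K ν g) (hh : ExpBd K' ν h) : ExpBd (K + K') ν (fun x => g x - h x) :=
  fun x => (abs_sub _ _).trans (by have := hg x; have := hh x; linarith)

lemma mul_bdd (hg : ExpBd K ν g) (hh : ∀ x, |h x| ≤ K') : ExpBd (K' * K) ν (fun x => h x * g x) :=
  fun x => by
    rw [abs_mul, mul_assoc]
    exact mul_le_mul (hh x) (hg x) (abs_nonneg _) ((abs_nonneg _).trans (hh x))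

lemma const_mul (hg : ExpBd K ν g) (s : ℝ) : ExpBd (|s| * K) ν (fun x => s * g x) :=
  hg.mul_bdd (h := fun _ => s) fun _ => le_rfl

lemma id_mul (hg : ExpBd K ν g) (hν : 0 < ν) :
    ExpBd (K * (2 / ν)) (ν / 2) (fun x => x * g x) := fun x => by
  rw [abs_mul]
  calc |x| * |g x| ≤ |x| * (K * expW ν x) := mul_le_mul_of_nonneg_left (hg x) (abs_nonneg _)
    _ = K * (|x| * expW ν x) := by ring
    _ ≤ K * (2 / ν * expW (ν / 2) x) :=
      mul_le_mul_of_nonneg_left (abs_mul_expW_le hν x) hg.nonneg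
    _ = _ := by ring

lemma integrable (hg : ExpBd K ν g) (hν : 0 < ν) (hc : Continuous g) : Integrable g :=
  ((integrable_expW hν).const_mul K).mono' hc.aestronglyMeasurable
    (.of_forall fun x => by simpa using hg x)

lemma abs_integral_le (hg : ExpBd K ν g) (hν : 0 < ν) : |∫ x, g x| ≤ 2 * K / ν := by
  have := norm_integral_le_of_norm_le (f := g) ((integrable_expW hν).const_mul K)
    (.of_forall fun x => by simpa using hg x)
  rw [integral_const_mul, integral_expW hν, Real.norm_eq_abs] at this
  calc _ ≤ _ := this
    _ = _ := by ring

lemma memLp (hg : ExpBd K ν g) (hν : 0 < ν) (hc : Continuous g) : MemLp g 2 volume := by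
  refine (memLp_two_iff_integrable_sq hc.aestronglyMeasurable).2 ?_
  have hb : ExpBd (K * K) ν (fun x => g x * g x) := hg.mul_bdd (hg.le hν.le)
  have := hb.integrable hν (hc.mul hc)
  simpa [sq] using this

lemma l2_le (hg : ExpBd K ν g) (hν : 0 < ν) : l2 g ≤ K * √(2 / ν) := by
  have hb : ExpBd (K * K) ν (fun x => g x * g x) := hg.mul_bdd (hg.le hν.le)
  have := (abs_le.1 (hb.abs_integral_le hν)).2
  apply le_of_sq_le_sq _ (mul_nonneg hg.nonneg (Real.sqrt_nonneg _))
  rw [l2_sq, mul_pow, Real.sq_sqrt (by positivity)]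
  simp only [sq]
  calc _ ≤ _ := this
    _ = _ := by ring

lemma tendsto_atTop (hg : ExpBd K ν g) (hν : 0 < ν) : Tendsto g atTop (𝓝 0) := by
  refine squeeze_zero_norm' (a := fun x => K * expW ν x) (.of_forall fun x => hg x) ?_
  have : Tendsto (fun x => K * Real.exp (-(ν * x))) atTop (𝓝 (K * 0)) := by
    refine (Real.tendsto_exp_neg_atTop_nhds_zero.comp ?_).const_mul K
    exact tendsto_id.const_mul_atTop hν
  rw [mul_zero] at this
  refine this.congr' ?_
  filter_upwards [eventually_ge_atTop 0] with x hx
  rw [expW_of_nonneg ν hx]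

lemma of_even_or_odd (hK : ∀ x, 0 ≤ x → |g x| ≤ K * expW ν x) (hs : ∀ x, |g (-x)| = |g x|) :
    ExpBd K ν g := fun x => by
  rcases le_total 0 x with h | h
  · exact hK x h
  · rw [← hs, ← expW_neg]; exact hK (-x) (by linarith)

end ExpBd

/-! ### Second order differential inequalities -/

/-- A second-order Grönwall estimate on `[0, X]`. -/
lemma abs_le_of_second_order {D D1 D2 : ℝ → ℝ} {δ K M X : ℝ} (hD : ∀ x, HasDerivAt D (D1 x) x)
    (hD1 : ∀ x, HasDerivAt D1 (D2 x) x) (hK : 0 ≤ K) (hM : 0 ≤ M)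
    (h : ∀ x, 0 ≤ x → x ≤ X → |D2 x| ≤ K * |D x| + M) (h0 : |D 0| ≤ δ) (h1 : |D1 0| ≤ δ) :
    ∀ x, 0 ≤ x → x ≤ X → |D x| ≤ (δ + M) * Real.exp ((K + 1) * X) ∧
      |D1 x| ≤ (δ + M) * Real.exp ((K + 1) * X) := by
  intro x hx hxX
  have hδ : 0 ≤ δ := (abs_nonneg _).trans h0
  have g := norm_le_gronwallBound_of_norm_deriv_right_le (f := fun x => (D x, D1 x))
    (f' := fun x => (D1 x, D2 x)) (δ := δ) (K := K + 1) (ε := M) (a := 0) (b := X)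
    (fun y _ => ((hD y).continuousAt.prodMk (hD1 y).continuousAt).continuousWithinAt)
    (fun y _ => ((hD y).prodMk (hD1 y)).hasDerivWithinAt)
    (by simp only [Prod.norm_def, Real.norm_eq_abs]; exact max_le h0 h1)
    (fun y hy => by
      simp only [Prod.norm_def, Real.norm_eq_abs]
      have a1 := le_max_left |D y| |D1 y|
      have a2 := le_max_right |D y| |D1 y|
      have a3 := h y hy.1 hy.2.le
      have a4 := abs_nonneg (D y)
      have a5 := mul_le_mul_of_nonneg_left a1 hK
      apply max_le <;> nlinarith [abs_nonneg (D y), abs_nonneg (D1 y)]) x ⟨hx, hxX⟩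
  have hb : gronwallBound δ (K + 1) M (x - 0) ≤ (δ + M) * Real.exp ((K + 1) * X) := by
    rw [gronwallBound_of_K_ne_0 (by positivity), sub_zero]
    have e1 : Real.exp ((K + 1) * x) ≤ Real.exp ((K + 1) * X) :=
      Real.exp_le_exp.2 (mul_le_mul_of_nonneg_left hxX (by positivity))
    have e2 : M / (K + 1) ≤ M := div_le_self hM (by linarith)
    have e3 : 1 ≤ Real.exp ((K + 1) * x) := Real.one_le_exp (by positivity)
    have e4 : M / (K + 1) * (Real.exp ((K + 1) * x) - 1) ≤ M * Real.exp ((K + 1) * X) :=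
      mul_le_mul e2 (by linarith) (by linarith) hM
    nlinarith [mul_le_mul_of_nonneg_left e1 hδ]
  have := g.trans hb
  simp only [Prod.norm_def, Real.norm_eq_abs] at this
  exact ⟨(le_max_left _ _).trans this, (le_max_right _ _).trans this⟩

/-- The maximum principle on a half-line: a function that tends to zero, is nonpositive at the
endpoint and satisfies `g'' > 0` wherever `g > 0`, is nonpositive. -/
lemma nonpos_of_max_principle {g g1 g2 : ℝ → ℝ} {X : ℝ} (hg : ∀ x, HasDerivAt g (g1 x) x)
    (hg1 : ∀ x, HasDerivAt g1 (g2 x) x) (h : ∀ x, X ≤ x → 0 < g x → 0 < g2 x)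
    (hX : g X ≤ 0) (hlim : Tendsto g atTop (𝓝 0)) : ∀ x, X ≤ x → g x ≤ 0 := by
  by_contra hne
  push Not at hne
  obtain ⟨x₀, hx₀, hpos⟩ := hne
  obtain ⟨Y, hY⟩ := eventually_atTop.1 (hlim.eventually (gt_mem_nhds hpos))
  have hc : Continuous g := continuous_iff_continuousAt.2 fun x => (hg x).continuousAt
  have hYx : x₀ < max Y (x₀ + 1) := lt_of_lt_of_le (by linarith) (le_max_right _ _)
  obtain ⟨x₁, hx₁, hmax⟩ := (isCompact_Icc (a := X) (b := max Y (x₀ + 1))).exists_isMaxOn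
    ⟨x₀, hx₀, hYx.le⟩ hc.continuousOn
  have h1 : g x₀ ≤ g x₁ := hmax ⟨hx₀, hYx.le⟩
  have hXx : X < x₁ := lt_of_le_of_ne hx₁.1 fun e => by rw [← e] at h1; linarith
  have hxY : x₁ < max Y (x₀ + 1) := lt_of_le_of_ne hx₁.2 fun e => by
    have := hY x₁ (e ▸ le_max_left _ _); linarith
  have hloc : IsLocalMax g x₁ := hmax.isLocalMax (Icc_mem_nhds hXx hxY)
  have hz : g1 x₁ = 0 := hloc.hasDerivAt_eq_zero (hg x₁)
  have hp : 0 < g2 x₁ := h x₁ hXx.le (by linarith)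
  have hev : ∀ᶠ y in 𝓝[>] x₁, 0 < g1 y := by
    have hs := (hasDerivAt_iff_tendsto_slope.1 (hg1 x₁)).mono_left
      (nhdsWithin_mono x₁ (fun y (hy : x₁ < y) => hy.ne'))
    filter_upwards [hs.eventually (lt_mem_nhds hp), self_mem_nhdsWithin] with y hy hxy
    rw [slope_def_field, hz, sub_zero] at hy
    have hxy' : 0 < y - x₁ := sub_pos.2 hxy
    by_contra hn
    have := div_nonpos_of_nonpos_of_nonneg (not_lt.1 hn) hxy'.le
    linarith
  obtain ⟨z, hz1, hz2⟩ := mem_nhdsGT_iff_exists_Ioo_subset.1 hev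
  have hz1' : x₁ < z := hz1
  set y := min ((x₁ + z) / 2) (max Y (x₀ + 1))
  have hy1 : x₁ < y := lt_min (by linarith) hxY
  have hy2 : y < z := (min_le_left _ _).trans_lt (by linarith)
  have hmono : StrictMonoOn g (Icc x₁ y) :=
    strictMonoOn_of_deriv_pos (convex_Icc _ _) hc.continuousOn fun t ht => by
      rw [interior_Icc] at ht
      rw [(hg t).deriv]
      exact hz2 ⟨ht.1, ht.2.trans hy2⟩
  have := hmono ⟨le_rfl, hy1.le⟩ ⟨hy1.le, le_rfl⟩ hy1
  have h2 : g y ≤ g x₁ := hmax ⟨by linarith, min_le_right _ _⟩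
  linarith

/-- Decay of solutions of `D'' = V D + R` with `V` bounded below by `2ν²` and `R` of size
`e^{-νx}`, by comparison with a multiple of `e^{-νx}`. -/
lemma exp_decay {D D1 D2 V : ℝ → ℝ} {X ν A B : ℝ} (hD : ∀ x, HasDerivAt D (D1 x) x)
    (hD1 : ∀ x, HasDerivAt D1 (D2 x) x) (hν : 0 < ν) (hB : 0 ≤ B)
    (hV : ∀ x, X ≤ x → 2 * ν ^ 2 ≤ V x)
    (h : ∀ x, X ≤ x → |D2 x - V x * D x| ≤ B * Real.exp (-(ν * x)))
    (hlim : Tendsto D atTop (𝓝 0)) (hA : |D X| ≤ A) :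
    ∀ x, X ≤ x → |D x| ≤ (A * Real.exp (ν * X) + B / ν ^ 2) * Real.exp (-(ν * x)) := by
  set T := A * Real.exp (ν * X) + B / ν ^ 2
  have hA0 : 0 ≤ A := (abs_nonneg _).trans hA
  have hT : 0 ≤ T := by positivity
  have hTB : B ≤ ν ^ 2 * T := by
    have : ν ^ 2 * T = ν ^ 2 * (A * Real.exp (ν * X)) + B := by
      simp only [T]; field_simp
    rw [this]
    have : 0 ≤ ν ^ 2 * (A * Real.exp (ν * X)) := by positivity
    linarith
  have hTX : A ≤ T * Real.exp (-(ν * X)) := by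
    have h1 : A * Real.exp (ν * X) * Real.exp (-(ν * X)) = A := by
      rw [mul_assoc, ← Real.exp_add]; simp
    have h2 : 0 ≤ B / ν ^ 2 * Real.exp (-(ν * X)) := by positivity
    simp only [T, add_mul]; linarith
  have he : ∀ x, HasDerivAt (fun x => T * Real.exp (-(ν * x)))
      (-ν * (T * Real.exp (-(ν * x)))) x := fun x => by
    have := (((hasDerivAt_id' x).const_mul ν).fun_neg.exp).const_mul T
    refine this.congr_deriv ?_
    ring
  have hlimE : Tendsto (fun x => T * Real.exp (-(ν * x))) atTop (𝓝 0) := by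
    have : Tendsto (fun x => T * Real.exp (-(ν * x))) atTop (𝓝 (T * 0)) := by
      refine (Real.tendsto_exp_neg_atTop_nhds_zero.comp ?_).const_mul T
      exact tendsto_id.const_mul_atTop hν
    simpa using this
  have key : ∀ s : ℝ, |s| = 1 → ∀ x, X ≤ x → s * D x - T * Real.exp (-(ν * x)) ≤ 0 := by
    intro s hs
    refine nonpos_of_max_principle (g1 := fun x => s * D1 x - -ν * (T * Real.exp (-(ν * x))))
      (g2 := fun x => s * D2 x - -ν * (-ν * (T * Real.exp (-(ν * x)))))
      (fun x => ((hD x).const_mul s).sub (he x))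
      (fun x => ((hD1 x).const_mul s).sub ((he x).const_mul (-ν))) ?_ ?_ ?_
    · intro x hx hpos
      have hr : |s * (D2 x - V x * D x)| ≤ B * Real.exp (-(ν * x)) := by
        rw [abs_mul, hs, one_mul]; exact h x hx
      have hr' := (abs_le.1 hr).1
      have ep := Real.exp_pos (-(ν * x))
      have h3 : B * Real.exp (-(ν * x)) ≤ ν ^ 2 * T * Real.exp (-(ν * x)) :=
        mul_le_mul_of_nonneg_right hTB ep.le
      have hVx := hV x hx
      have hν2 : 0 < ν ^ 2 := by positivity
      have h5 : 0 ≤ T * Real.exp (-(ν * x)) := by positivity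
      have h4 : 2 * ν ^ 2 * (s * D x) ≤ V x * (s * D x) :=
        mul_le_mul_of_nonneg_right hVx (by linarith)
      nlinarith
    · have h6 : s * D X ≤ |D X| := by
        calc s * D X ≤ |s * D X| := le_abs_self _
          _ = |D X| := by rw [abs_mul, hs, one_mul]
      linarith
    · simpa using (hlim.const_mul s).sub hlimE
  intro x hx
  have k1 := key 1 (by simp) x hx
  have k2 := key (-1) (by simp) x hx
  rw [abs_le]; constructor <;> linarith

/-- If a function and its second derivative decay exponentially, then so does its derivative. -/
lemma ExpBd.deriv_of_second {D D1 D2 : ℝ → ℝ} {K ν : ℝ} (hD : ∀ x, HasDerivAt D (D1 x) x)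
    (hD1 : ∀ x, HasDerivAt D1 (D2 x) x) (hν : 0 ≤ ν) (h : ExpBd K ν D) (h2 : ExpBd K ν D2) :
    ExpBd (3 * K * Real.exp ν) ν D1 := by
  intro x
  obtain ⟨θ, hθ, e⟩ := exists_hasDerivAt_eq_slope D D1 (show x < x + 1 by linarith)
    (fun y _ => (hD y).continuousAt.continuousWithinAt) (fun y _ => hD y)
  obtain ⟨τ, hτ, e'⟩ := exists_hasDerivAt_eq_slope D1 D2 hθ.1
    (fun y _ => (hD1 y).continuousAt.continuousWithinAt) (fun y _ => hD1 y)
  have hx1 : x + 1 - x = 1 := by ring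
  rw [hx1, div_one] at e
  have hθx : 0 < θ - x := by linarith [hθ.1]
  rw [eq_div_iff hθx.ne'] at e'
  have hK := h.nonneg
  have b : ∀ z, |z - x| ≤ 1 → K * expW ν z ≤ K * Real.exp ν * expW ν x := fun z hz => by
    rw [mul_assoc]
    refine mul_le_mul_of_nonneg_left ((expW_shift hν z x).trans ?_) hK
    refine mul_le_mul_of_nonneg_right (Real.exp_le_exp.2 ?_) (expW_pos _ _).le
    nlinarith
  have b1 := (h (x + 1)).trans (b (x + 1) (by simp))
  have b2 := (h x).trans (b x (by simp))
  have b3 := (h2 τ).trans (b τ (by rw [abs_le]; constructor <;> linarith [hτ.1, hτ.2, hθ.2]))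
  have b4 : |D2 τ * (θ - x)| ≤ |D2 τ| := by
    rw [abs_mul, abs_of_pos hθx]
    exact mul_le_of_le_one_right (abs_nonneg _) (by linarith [hθ.2])
  have e3 : D1 x = D (x + 1) - D x - D2 τ * (θ - x) := by linarith
  rw [e3]
  calc _ ≤ |D (x + 1)| + |D x| + |D2 τ * (θ - x)| := by
        refine (abs_sub _ _).trans ?_
        have := abs_sub (D (x + 1)) (D x)
        linarith
    _ ≤ _ := by linarith

/-! ### Taylor estimates -/

/-- The first-order Taylor estimate for a function with Lipschitz derivative on `[-R, R]`. -/
lemma taylor_le {g g' : ℝ → ℝ} {R K : ℝ} (hg : ∀ s, HasDerivAt g (g' s) s)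
    (hK : ∀ s t, |s| ≤ R → |t| ≤ R → |g' s - g' t| ≤ K * |s - t|) {s t : ℝ} (hs : |s| ≤ R)
    (ht : |t| ≤ R) : |g t - g s - g' s * (t - s)| ≤ K * (t - s) ^ 2 := by
  have hK0 : 0 ≤ K ∨ s = t := by
    by_contra h
    push Not at h
    have := (abs_nonneg _).trans (hK s t hs ht)
    nlinarith [abs_pos.2 (sub_ne_zero.2 h.2)]
  rcases hK0 with hK0 | rfl
  · have hconv : Convex ℝ (uIcc s t) := convex_uIcc s t
    have hsub : ∀ y ∈ uIcc s t, |y| ≤ R := fun y hy => by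
      have : uIcc s t ⊆ Icc (-R) R := uIcc_subset_Icc (abs_le.1 hs) (abs_le.1 ht)
      exact abs_le.2 (this hy)
    have := hconv.norm_image_sub_le_of_norm_hasDerivWithin_le
      (f := fun y => g y - g' s * y) (f' := fun y => g' y - g' s * 1) (C := K * |t - s|)
      (fun y _ => ((hg y).sub ((hasDerivAt_id y).const_mul (g' s))).hasDerivWithinAt)
      (fun y hy => by
        rw [mul_one, Real.norm_eq_abs]
        refine (hK y s (hsub y hy) hs).trans (mul_le_mul_of_nonneg_left ?_ hK0)
        rw [abs_sub_comm t s]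
        exact abs_sub_left_of_mem_uIcc hy |>.trans (by rw [abs_sub_comm]))
      left_mem_uIcc right_mem_uIcc
    rw [Real.norm_eq_abs, Real.norm_eq_abs] at this
    calc _ = |g t - g' s * t - (g s - g' s * s)| := by congr 1; ring
      _ ≤ K * |t - s| * |t - s| := this
      _ = _ := by rw [mul_assoc, ← sq, sq_abs]
  · simp

/-- Bounds for a nonlinearity and its derivatives on `[-R, R]`. -/
structure NonlinBounds (f : ℝ → ℝ) (R K : ℝ) : Prop where
  nonneg : 0 ≤ K
  le : ∀ s, |s| ≤ R → |f s| ≤ K * |s|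
  deriv_le : ∀ s, |s| ≤ R → |deriv f s| ≤ K * |s|
  lip : ∀ s t, |s| ≤ R → |t| ≤ R → |f s - f t| ≤ K * |s - t|
  deriv_lip : ∀ s t, |s| ≤ R → |t| ≤ R → |deriv f s - deriv f t| ≤ K * |s - t|
  deriv2_le : ∀ s, |s| ≤ R → |deriv (deriv f) s| ≤ K
  deriv2_lip : ∀ s t, |s| ≤ R → |t| ≤ R → |deriv (deriv f) s - deriv (deriv f) t| ≤ K * |s - t|

lemma lip_of_continuous_deriv {g g' : ℝ → ℝ} (hg : ∀ s, HasDerivAt g (g' s) s)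
    (hc : Continuous g') (R : ℝ) :
    ∃ K, 0 ≤ K ∧ (∀ s, |s| ≤ R → |g' s| ≤ K) ∧
      ∀ s t, |s| ≤ R → |t| ≤ R → |g s - g t| ≤ K * |s - t| := by
  obtain ⟨K, hK⟩ := (isCompact_Icc (a := -R) (b := R)).exists_bound_of_continuousOn
    hc.continuousOn
  have hK' : ∀ s, |s| ≤ R → |g' s| ≤ max K 0 := fun s hs =>
    (hK s (abs_le.1 hs)).trans (le_max_left _ _)
  refine ⟨max K 0, le_max_right _ _, hK', fun s t hs ht => ?_⟩
  exact (convex_Icc (-R) R).norm_image_sub_le_of_norm_hasDerivWithin_le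
    (fun y _ => (hg y).hasDerivWithinAt) (fun y hy => hK' y (abs_le.2 hy))
    (abs_le.1 ht) (abs_le.1 hs)

namespace IsNonlinearity

variable {f : ℝ → ℝ}

lemma contDiff (hf : IsNonlinearity f) : ContDiff ℝ 3 f := by
  obtain ⟨k, hk, h, -⟩ := hf.smooth
  exact h.of_le (by exact_mod_cast hk)

lemma hasDerivAt (hf : IsNonlinearity f) (s : ℝ) : HasDerivAt f (deriv f s) s :=
  (hf.contDiff.differentiable (by norm_num) s).hasDerivAt

lemma contDiff_deriv (hf : IsNonlinearity f) : ContDiff ℝ 2 (deriv f) :=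
  ((contDiff_succ_iff_deriv (n := 2)).1 hf.contDiff).2.2

lemma contDiff_deriv2 (hf : IsNonlinearity f) : ContDiff ℝ 1 (deriv (deriv f)) :=
  ((contDiff_succ_iff_deriv (n := 1)).1 hf.contDiff_deriv).2.2

lemma hasDerivAt_deriv (hf : IsNonlinearity f) (s : ℝ) :
    HasDerivAt (deriv f) (deriv (deriv f) s) s :=
  (hf.contDiff_deriv.differentiable (by norm_num) s).hasDerivAt

lemma continuous (hf : IsNonlinearity f) : Continuous f := hf.contDiff.continuous

lemma continuous_deriv (hf : IsNonlinearity f) : Continuous (deriv f) :=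
  hf.contDiff_deriv.continuous

lemma hasDerivAt_antideriv (hf : IsNonlinearity f) (s : ℝ) :
    HasDerivAt (antideriv f) (f s) s :=
  intervalIntegral.integral_hasDerivAt_right (hf.continuous.intervalIntegrable _ _)
    (hf.continuous.stronglyMeasurableAtFilter _ _) hf.continuous.continuousAt

lemma exists_bounds (hf : IsNonlinearity f) (R : ℝ) : ∃ K, NonlinBounds f R K := by
  obtain ⟨K₁, h₁, -, l₁⟩ := lip_of_continuous_deriv hf.hasDerivAt hf.continuous_deriv R
  obtain ⟨K₂, h₂, b₂, l₂⟩ :=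
    lip_of_continuous_deriv hf.hasDerivAt_deriv hf.contDiff_deriv2.continuous R
  have hd3 : ∀ s, HasDerivAt (deriv (deriv f)) (deriv (deriv (deriv f)) s) s := fun s =>
    (hf.contDiff_deriv2.differentiable (by norm_num) s).hasDerivAt
  have hc3 : Continuous (deriv (deriv (deriv f))) :=
    ((contDiff_succ_iff_deriv (n := 0)).1 hf.contDiff_deriv2).2.2.continuous
  obtain ⟨K₃, h₃, -, l₃⟩ := lip_of_continuous_deriv hd3 hc3 R
  have up : ∀ {a b t : ℝ}, a ≤ b → 0 ≤ t → a * t ≤ b * t := fun h h' =>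
    mul_le_mul_of_nonneg_right h h'
  have a1 : K₁ ≤ K₁ + K₂ + K₃ := by linarith
  have a2 : K₂ ≤ K₁ + K₂ + K₃ := by linarith
  have a3 : K₃ ≤ K₁ + K₂ + K₃ := by linarith
  have z : ∀ s : ℝ, |s| ≤ R → |(0 : ℝ)| ≤ R := fun s hs => by simpa using (abs_nonneg _).trans hs
  exact ⟨K₁ + K₂ + K₃, by positivity,
    fun s hs => by
      have := l₁ s 0 hs (z s hs)
      rw [hf.zero, sub_zero, sub_zero] at this
      exact this.trans (up a1 (abs_nonneg _)),
    fun s hs => by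
      have := l₂ s 0 hs (z s hs)
      rw [hf.deriv_zero, sub_zero, sub_zero] at this
      exact this.trans (up a2 (abs_nonneg _)),
    fun s t hs ht => (l₁ s t hs ht).trans (up a1 (abs_nonneg _)),
    fun s t hs ht => (l₂ s t hs ht).trans (up a2 (abs_nonneg _)),
    fun s hs => (b₂ s hs).trans a2,
    fun s t hs ht => (l₃ s t hs ht).trans (up a3 (abs_nonneg _))⟩

lemma abs_antideriv_le {R K : ℝ} (hf : IsNonlinearity f) (hK : NonlinBounds f R K) {s : ℝ}
    (hs : |s| ≤ R) : |antideriv f s| ≤ K * s ^ 2 := by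
  have hR : |(0 : ℝ)| ≤ R := by simpa using (abs_nonneg _).trans hs
  have := taylor_le hf.hasDerivAt_antideriv hK.lip hR hs
  simpa [antideriv, hf.zero] using this

end IsNonlinearity

/-! ### The profile equation at a fixed speed -/

/-- A positive even solution `q` of `q'' = c q - f(q)` that decays at infinity, with `q₁ = q'`. -/
structure IsProfile (f : ℝ → ℝ) (c : ℝ) (q q₁ : ℝ → ℝ) : Prop where
  speed_pos : 0 < c
  hasDerivAt : ∀ x, HasDerivAt q (q₁ x) x
  hasDerivAt_deriv : ∀ x, HasDerivAt q₁ (c * q x - f (q x)) x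
  pos : ∀ x, 0 < q x
  even : ∀ x, q (-x) = q x
  decay : Tendsto q atTop (𝓝 0)

lemma IsSolitaryWaveFamily.isProfile {f : ℝ → ℝ} {I₀ : Set ℝ} {Q : ℝ → ℝ → ℝ}
    (hQ : IsSolitaryWaveFamily f I₀ Q) {c : ℝ} (hc : c ∈ I₀) :
    IsProfile f c (Q c) (deriv (Q c)) where
  speed_pos := hQ.pos_speed c hc
  hasDerivAt x := ((hQ.contDiff c hc).differentiable (by norm_num) x).hasDerivAt
  hasDerivAt_deriv x := by
    have h1 : ContDiff ℝ 1 (deriv (Q c)) :=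
      ((contDiff_succ_iff_deriv (n := 1)).1 (hQ.contDiff c hc)).2.2
    have h2 := (h1.differentiable (by norm_num) x).hasDerivAt
    refine h2.congr_deriv ?_
    have := hQ.eqn c hc x
    rw [iteratedDeriv_succ, iteratedDeriv_one] at this
    linarith
  pos := hQ.pos c hc
  even := hQ.even c hc
  decay := hQ.decay c hc

namespace IsProfile

variable {f : ℝ → ℝ} {c : ℝ} {q q₁ : ℝ → ℝ}

lemma continuous (h : IsProfile f c q q₁) : Continuous q :=
  continuous_iff_continuousAt.2 fun x => (h.hasDerivAt x).continuousAt

lemma continuous_deriv (h : IsProfile f c q q₁) : Continuous q₁ :=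
  continuous_iff_continuousAt.2 fun x => (h.hasDerivAt_deriv x).continuousAt

lemma deriv_odd (h : IsProfile f c q q₁) (x : ℝ) : q₁ (-x) = -q₁ x := by
  have h1 : HasDerivAt (fun y => q (-y)) (q₁ (-x) * -1) x :=
    (h.hasDerivAt (-x)).comp x (hasDerivAt_neg x)
  have h2 : HasDerivAt (fun y => q (-y)) (q₁ x) x := by
    simp only [h.even]; exact h.hasDerivAt x
  have := h1.unique h2
  linarith

lemma deriv_zero (h : IsProfile f c q q₁) : q₁ 0 = 0 := by
  have := h.deriv_odd 0
  rw [neg_zero] at this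
  linarith

lemma exists_bound (h : IsProfile f c q q₁) : ∃ R, ∀ x, |q x| ≤ R := by
  obtain ⟨X, hX⟩ := eventually_atTop.1 (h.decay.eventually (gt_mem_nhds zero_lt_one))
  obtain ⟨R, hR⟩ := (isCompact_Icc (a := 0) (b := max X 0)).exists_bound_of_continuousOn
    h.continuous.continuousOn
  have key : ∀ x, 0 ≤ x → |q x| ≤ max R 1 := fun x hx => by
    rcases le_total x (max X 0) with h1 | h1
    · exact (hR x ⟨hx, h1⟩).trans (le_max_left _ _)
    · rw [abs_of_pos (h.pos x)]
      exact (hX x ((le_max_left _ _).trans h1)).le.trans (le_max_right _ _)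
  refine ⟨max R 1, fun x => ?_⟩
  rcases le_total 0 x with hx | hx
  · exact key x hx
  · rw [← h.even]; exact key (-x) (by linarith)

lemma tendsto_antideriv (hf : IsNonlinearity f) (h : IsProfile f c q q₁) :
    Tendsto (fun x => antideriv f (q x)) atTop (𝓝 0) := by
  have h1 := (hf.hasDerivAt_antideriv 0).continuousAt.tendsto.comp h.decay
  have h2 : antideriv f 0 = 0 := by simp [antideriv]
  rw [h2] at h1
  exact h1

/-- Conservation of energy along the profile equation. -/
lemma first_integral (hf : IsNonlinearity f) (h : IsProfile f c q q₁) (x : ℝ) :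
    q₁ x ^ 2 = c * q x ^ 2 - 2 * antideriv f (q x) := by
  set E : ℝ → ℝ := fun x => q₁ x ^ 2 - (c * q x ^ 2 - 2 * antideriv f (q x))
  have hE : ∀ x, HasDerivAt E 0 x := fun x => by
    have a1 := (h.hasDerivAt_deriv x).fun_pow 2
    have a2 := ((h.hasDerivAt x).fun_pow 2).const_mul c
    have a3 := ((hf.hasDerivAt_antideriv (q x)).comp x (h.hasDerivAt x)).const_mul 2
    refine (a1.fun_sub (a2.fun_sub a3)).congr_deriv ?_
    push_cast
    ring
  have hconst : ∀ y, E y = E x := fun y =>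
    is_const_of_deriv_eq_zero (fun z => (hE z).differentiableAt) (fun z => (hE z).deriv) y x
  have hlim : Tendsto (fun y => q₁ y ^ 2) atTop (𝓝 (E x)) := by
    have a : Tendsto (fun y => E x + (c * q y ^ 2 - 2 * antideriv f (q y))) atTop
        (𝓝 (E x + (c * 0 ^ 2 - 2 * 0))) :=
      (((h.decay.pow 2).const_mul c).sub ((tendsto_antideriv hf h).const_mul 2)).const_add _
    simp only [ne_eq, OfNat.ofNat_ne_zero, not_false_eq_true, zero_pow, mul_zero, sub_self,
      add_zero] at a
    refine a.congr fun y => ?_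
    rw [← hconst y]; simp only [E]; ring
  have hE0 : 0 ≤ E x := ge_of_tendsto' hlim fun y => sq_nonneg _
  have hle : E x ≤ 0 := by
    by_contra hpos
    push Not at hpos
    -- `|q'|` would stay away from zero while the increments of `q` over unit intervals vanish.
    obtain ⟨X, hX⟩ := eventually_atTop.1 (hlim.eventually (lt_mem_nhds (half_lt_self hpos)))
    have hinc : Tendsto (fun y => (q (y + 1) - q y) ^ 2) atTop (𝓝 0) := by
      have := ((h.decay.comp (tendsto_atTop_add_const_right atTop 1 tendsto_id)).sub
        h.decay).pow 2
      simpa using this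
    obtain ⟨Y, hY⟩ := eventually_atTop.1 (hinc.eventually (gt_mem_nhds (half_pos hpos)))
    set y := max X Y
    obtain ⟨θ, hθ, e⟩ := exists_hasDerivAt_eq_slope q q₁ (show y < y + 1 by linarith)
      h.continuous.continuousOn (fun z _ => h.hasDerivAt z)
    rw [add_sub_cancel_left, div_one] at e
    have b1 := hX θ ((le_max_left X Y).trans hθ.1.le)
    have b2 := hY y (le_max_right X Y)
    rw [← e] at b2
    linarith
  have : E x = 0 := le_antisymm hle hE0
  simp only [E] at this
  linarith

/-- A further critical point of the profile would make it periodic. -/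
lemma deriv_ne_zero (hf : IsNonlinearity f) (h : IsProfile f c q q₁) {x : ℝ} (hx : 0 < x) :
    q₁ x ≠ 0 := by
  intro hz
  obtain ⟨R, hR⟩ := h.exists_bound
  obtain ⟨K, hK⟩ := hf.exists_bounds R
  have hsub : ∀ s, HasDerivAt (fun s => x - s) (-1) s := fun s => by
    simpa using (hasDerivAt_id' s).const_sub x
  have hadd : ∀ s, HasDerivAt (fun s => x + s) 1 s := fun s => by
    simpa using (hasDerivAt_id' s).const_add x
  have hsym : ∀ s, 0 ≤ s → q (x + s) = q (x - s) := by
    intro s hs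
    have := abs_le_of_second_order (D := fun s => q (x + s) - q (x - s))
      (D1 := fun s => q₁ (x + s) * 1 - q₁ (x - s) * -1)
      (D2 := fun s => (c * q (x + s) - f (q (x + s))) * 1 * 1
        - (c * q (x - s) - f (q (x - s))) * -1 * -1)
      (δ := 0) (K := c + K) (M := 0) (X := s)
      (fun s => ((h.hasDerivAt _).comp s (hadd s)).sub ((h.hasDerivAt _).comp s (hsub s)))
      (fun s => (((h.hasDerivAt_deriv _).comp s (hadd s)).mul_const 1).sub
        (((h.hasDerivAt_deriv _).comp s (hsub s)).mul_const (-1)))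
      (add_nonneg h.speed_pos.le hK.nonneg) le_rfl (fun y _ _ => by
        have l := hK.lip _ _ (hR (x + y)) (hR (x - y))
        have e : (c * q (x + y) - f (q (x + y))) * 1 * 1
            - (c * q (x - y) - f (q (x - y))) * -1 * -1
            = c * (q (x + y) - q (x - y)) - (f (q (x + y)) - f (q (x - y))) := by ring
        rw [e]
        refine (abs_sub _ _).trans ?_
        rw [abs_mul, abs_of_pos h.speed_pos]
        linarith) (by simp) (by simp [hz]) s hs le_rfl
    have h0 := this.1
    rw [add_zero, zero_mul] at h0
    have := abs_nonpos_iff.1 h0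
    linarith
  have hper : ∀ n : ℕ, q (n * (2 * x)) = q 0 := by
    intro n
    induction n with
    | zero => simp
    | succ n ih =>
      have := hsym (x + n * (2 * x)) (by positivity)
      rw [show x - (x + n * (2 * x)) = -(n * (2 * x)) by ring, h.even, ih] at this
      rw [← this]
      congr 1
      push_cast
      ring
  have hlim : Tendsto (fun n : ℕ => q (n * (2 * x))) atTop (𝓝 0) :=
    h.decay.comp (tendsto_natCast_atTop_atTop.atTop_mul_const (by linarith))
  simp only [hper] at hlim
  have := tendsto_nhds_unique hlim tendsto_const_nhds
  have := h.pos 0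
  linarith

lemma deriv_neg (hf : IsNonlinearity f) (h : IsProfile f c q q₁) {x : ℝ} (hx : 0 < x) :
    q₁ x < 0 := by
  by_contra hne
  have hx' : 0 < q₁ x := lt_of_le_of_ne (not_lt.1 hne) (h.deriv_ne_zero hf hx).symm
  have hall : ∀ y, 0 < y → 0 < q₁ y := by
    intro y hy
    by_contra hy'
    obtain ⟨z, hz, e⟩ := (isPreconnected_Ioi (a := (0 : ℝ))).intermediate_value
      (show y ∈ Ioi 0 from hy) (show x ∈ Ioi 0 from hx) h.continuous_deriv.continuousOn
      ⟨not_lt.1 hy', hx'.le⟩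
    exact h.deriv_ne_zero hf hz e
  have hmono : StrictMonoOn q (Ici 0) :=
    strictMonoOn_of_deriv_pos (convex_Ici 0) h.continuous.continuousOn fun t ht => by
      rw [interior_Ici] at ht
      rw [(h.hasDerivAt t).deriv]
      exact hall t ht
  have := ge_of_tendsto h.decay (b := q 0) ((eventually_ge_atTop 0).mono fun t ht =>
    hmono.monotoneOn self_mem_Ici ht ht)
  have := h.pos 0
  linarith

lemma antitoneOn (hf : IsNonlinearity f) (h : IsProfile f c q q₁) : AntitoneOn q (Ici 0) :=
  (strictAntiOn_of_deriv_neg (convex_Ici 0) h.continuous.continuousOn fun t ht => by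
      rw [interior_Ici] at ht
      rw [(h.hasDerivAt t).deriv]
      exact h.deriv_neg hf ht).antitoneOn

lemma le_zero (hf : IsNonlinearity f) (h : IsProfile f c q q₁) (x : ℝ) : q x ≤ q 0 := by
  rcases le_total 0 x with hx | hx
  · exact h.antitoneOn hf self_mem_Ici hx hx
  · rw [← h.even]
    exact h.antitoneOn hf self_mem_Ici (show -x ∈ Ici (0 : ℝ) from by simpa using hx)
      (by simpa using hx)

lemma hasDerivAt_deriv2 (hf : IsNonlinearity f) (h : IsProfile f c q q₁) (x : ℝ) :
    HasDerivAt (fun x => c * q x - f (q x)) (c * q₁ x - deriv f (q x) * q₁ x) x :=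
  ((h.hasDerivAt x).const_mul c).fun_sub ((hf.hasDerivAt (q x)).comp x (h.hasDerivAt x))

/-- The maximum of the profile is nondegenerate. -/
lemma second_deriv_zero_ne (hf : IsNonlinearity f) (h : IsProfile f c q q₁) :
    c * q 0 - f (q 0) ≠ 0 := by
  intro hz
  obtain ⟨R, hR⟩ := h.exists_bound
  obtain ⟨K, hK⟩ := hf.exists_bounds R
  have hR0 : 0 ≤ R := (abs_nonneg _).trans (hR 0)
  have := abs_le_of_second_order (δ := 0) (K := c + K * R) (M := 0) (X := 1)
    h.hasDerivAt_deriv (h.hasDerivAt_deriv2 hf)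
    (add_nonneg h.speed_pos.le (mul_nonneg hK.nonneg hR0)) le_rfl (fun y _ _ => by
      rw [← sub_mul, abs_mul, add_zero]
      refine mul_le_mul_of_nonneg_right ?_ (abs_nonneg _)
      refine (abs_sub _ _).trans ?_
      rw [abs_of_pos h.speed_pos]
      have := (hK.deriv_le _ (hR y)).trans (mul_le_mul_of_nonneg_left (hR y) hK.nonneg)
      linarith) (by simp [h.deriv_zero]) (by simp [hz]) 1 zero_le_one le_rfl
  have h0 := this.1
  rw [add_zero, zero_mul] at h0
  exact h.deriv_ne_zero hf one_pos (abs_nonpos_iff.1 h0)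

end IsProfile

/-! ### Locally uniform estimates for the family of solitary waves -/

/-- The normalization vector `∂_c Q_c` of the centred wave. -/
def zc (Q : ℝ → ℝ → ℝ) (c x : ℝ) : ℝ := deriv (fun c' => Q c' x) c

/-- The second speed derivative `∂_c² Q_c` of the centred wave. -/
def zzc (Q : ℝ → ℝ → ℝ) (c x : ℝ) : ℝ := deriv (fun c' => zc Q c' x) c

lemma NonlinBounds.secant {f : ℝ → ℝ} {R K : ℝ} (hf : IsNonlinearity f) (h : NonlinBounds f R K)
    {s t r : ℝ} (hr : r ≤ R) (hs : |s| ≤ r) (ht : |t| ≤ r) : |f s - f t| ≤ K * r * |s - t| :=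
  (convex_Icc (-r) r).norm_image_sub_le_of_norm_hasDerivWithin_le
    (fun y _ => (hf.hasDerivAt y).hasDerivWithinAt) (fun y hy => by
      have hy' : |y| ≤ r := abs_le.2 hy
      exact (h.deriv_le y (hy'.trans hr)).trans (mul_le_mul_of_nonneg_left hy' h.nonneg))
    (abs_le.1 ht) (abs_le.1 hs)

/-- Preliminary data on a neighbourhood `S` of a speed. Beyond `X` the waves are so small that the
linearized equations are uniformly elliptic: there `c - f'(Q_c) ≥ 2ν²`. -/
structure IsWaveNhd (f : ℝ → ℝ) (Q : ℝ → ℝ → ℝ) (S : Set ℝ) (K A X ν : ℝ) : Prop where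
  isOpen : IsOpen S
  nonlin : IsNonlinearity f
  bounds : NonlinBounds f A K
  nu_pos : 0 < ν
  cut_nonneg : 0 ≤ X
  smooth : ∀ x, ContDiffOn ℝ 3 (fun c => Q c x) S
  profile : ∀ c ∈ S, IsProfile f c (Q c) (deriv (Q c))
  speed_le : ∀ c ∈ S, c ≤ A
  speed_ge : ∀ c ∈ S, 4 * ν ^ 2 ≤ c
  le : ∀ c ∈ S, ∀ x, |Q c x| ≤ A
  small : ∃ r ≤ A, K * r ≤ 2 * ν ^ 2 ∧ ∀ c ∈ S, ∀ x, X ≤ x → |Q c x| ≤ r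
  lip_zero : ∀ c ∈ S, ∀ c' ∈ S, |Q c 0 - Q c' 0| ≤ A * |c - c'|
  lip_zero' : ∀ c ∈ S, ∀ c' ∈ S, |zc Q c 0 - zc Q c' 0| ≤ A * |c - c'|

section smooth

variable {Q : ℝ → ℝ → ℝ} {S : Set ℝ}

lemma contDiffOn_zc (hS : IsOpen S) {x : ℝ} (h : ContDiffOn ℝ 3 (fun c => Q c x) S) :
    ContDiffOn ℝ 2 (fun c => zc Q c x) S :=
  ((contDiffOn_succ_iff_deriv_of_isOpen (n := 2) hS).1 h).2.2

lemma contDiffOn_zzc (hS : IsOpen S) {x : ℝ} (h : ContDiffOn ℝ 3 (fun c => Q c x) S) :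
    ContDiffOn ℝ 1 (fun c => zzc Q c x) S :=
  ((contDiffOn_succ_iff_deriv_of_isOpen (n := 1) hS).1 (contDiffOn_zc hS h)).2.2

lemma hasDerivAt_zc (hS : IsOpen S) {x c : ℝ} (hc : c ∈ S)
    (h : ContDiffOn ℝ 3 (fun c => Q c x) S) : HasDerivAt (fun c' => Q c' x) (zc Q c x) c :=
  ((h.differentiableOn (by norm_num)).differentiableAt (hS.mem_nhds hc)).hasDerivAt

lemma hasDerivAt_zzc (hS : IsOpen S) {x c : ℝ} (hc : c ∈ S)
    (h : ContDiffOn ℝ 3 (fun c => Q c x) S) :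
    HasDerivAt (fun c' => zc Q c' x) (zzc Q c x) c :=
  (((contDiffOn_zc hS h).differentiableOn (by norm_num)).differentiableAt
    (hS.mem_nhds hc)).hasDerivAt

end smooth

lemma abs_sub_le_of_deriv_continuousOn {g g' : ℝ → ℝ} {c₀ r : ℝ}
    (hg : ∀ c ∈ Metric.closedBall c₀ r, HasDerivAt g (g' c) c)
    (hc : ContinuousOn g' (Metric.closedBall c₀ r)) :
    ∃ K, ∀ c ∈ Metric.closedBall c₀ r, ∀ c' ∈ Metric.closedBall c₀ r,
      |g c - g c'| ≤ K * |c - c'| := by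
  obtain ⟨K, hK⟩ := (isCompact_closedBall c₀ r).exists_bound_of_continuousOn hc
  exact ⟨K, fun c h c' h' => (convex_closedBall c₀ r).norm_image_sub_le_of_norm_hasDerivWithin_le
    (fun y hy => (hg y hy).hasDerivWithinAt) hK h' h⟩

/-- Profiles decrease on the half-line, so continuity in the speed at the two points `0` and `X` bounds
all nearby profiles and makes them uniformly small beyond `X`. -/
lemma IsSolitaryWaveFamily.exists_waveNhd {f : ℝ → ℝ} {I₀ : Set ℝ} {Q : ℝ → ℝ → ℝ}
    (hf : IsNonlinearity f) (hQ : IsSolitaryWaveFamily f I₀ Q) {c₀ : ℝ} (hc₀ : c₀ ∈ I₀) :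
    ∃ ρ K A X ν, 0 < ρ ∧ Metric.ball c₀ ρ ⊆ I₀ ∧
      IsWaveNhd f Q (Metric.ball c₀ ρ) K A X ν := by
  have hp := hQ.pos_speed c₀ hc₀
  obtain ⟨r₁, hr₁, hball⟩ := Metric.nhds_basis_closedBall.mem_iff.1 (hQ.isOpen.mem_nhds hc₀)
  obtain ⟨A₁, hA₁⟩ := abs_sub_le_of_deriv_continuousOn (g := fun c => Q c 0)
    (g' := fun c => zc Q c 0) (fun c hc => hasDerivAt_zc hQ.isOpen (hball hc) (hQ.smooth_speed 0))
    ((contDiffOn_zc hQ.isOpen (hQ.smooth_speed 0)).continuousOn.mono hball)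
  obtain ⟨A₂, hA₂⟩ := abs_sub_le_of_deriv_continuousOn (g := fun c => zc Q c 0)
    (g' := fun c => zzc Q c 0)
    (fun c hc => hasDerivAt_zzc hQ.isOpen (hball hc) (hQ.smooth_speed 0))
    ((contDiffOn_zzc hQ.isOpen (hQ.smooth_speed 0)).continuousOn.mono hball)
  set A := max (max A₁ A₂) (max (2 * c₀) (Q c₀ 0 + 1))
  have hA1 : A₁ ≤ A := (le_max_left _ _).trans (le_max_left _ _)
  have hA2 : A₂ ≤ A := (le_max_right _ _).trans (le_max_left _ _)
  have hA3 : 2 * c₀ ≤ A := (le_max_left _ _).trans (le_max_right _ _)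
  have hA4 : Q c₀ 0 + 1 ≤ A := (le_max_right _ _).trans (le_max_right _ _)
  obtain ⟨K, hK⟩ := hf.exists_bounds A
  set ν := √(c₀ / 8)
  have hν : 0 < ν := Real.sqrt_pos.2 (by positivity)
  have hν2 : ν ^ 2 = c₀ / 8 := Real.sq_sqrt (by positivity)
  have hApos : 0 < A := by linarith
  set r := min A (2 * ν ^ 2 / (K + 1))
  have hK0 := hK.nonneg
  have hr : 0 < r := lt_min hApos (by positivity)
  have hKr : K * r ≤ 2 * ν ^ 2 := by
    have h1 : r ≤ 2 * ν ^ 2 / (K + 1) := min_le_right _ _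
    rw [le_div_iff₀ (by positivity)] at h1
    nlinarith
  have hp₀ := hQ.isProfile hc₀
  obtain ⟨X, hX⟩ := eventually_atTop.1 (hp₀.decay.eventually (gt_mem_nhds hr))
  have hcont : ∀ x, ContinuousAt (fun c => Q c x) c₀ := fun x =>
    (hQ.smooth_speed x).continuousOn.continuousAt (hQ.isOpen.mem_nhds hc₀)
  have e1 : ∀ᶠ c in 𝓝 c₀, Q c (max X 0) < r :=
    (hcont _).eventually (gt_mem_nhds (hX _ (le_max_left _ _)))
  have e2 : ∀ᶠ c in 𝓝 c₀, Q c 0 < Q c₀ 0 + 1 := (hcont _).eventually (gt_mem_nhds (by linarith))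
  have e3 : ∀ᶠ c in 𝓝 c₀, c < 2 * c₀ := gt_mem_nhds (by linarith)
  have e4 : ∀ᶠ c in 𝓝 c₀, c₀ / 2 < c := lt_mem_nhds (by linarith)
  have e5 : ∀ᶠ c in 𝓝 c₀, c ∈ Metric.closedBall c₀ r₁ := Metric.closedBall_mem_nhds _ hr₁
  obtain ⟨ρ, hρ, hS⟩ := Metric.eventually_nhds_iff_ball.1 (e1.and (e2.and (e3.and (e4.and e5))))
  have hsub : Metric.ball c₀ ρ ⊆ I₀ := fun c hc => hball (hS c hc).2.2.2.2
  have habs : ∀ c ∈ Metric.ball c₀ ρ, ∀ x, |Q c x| = Q c x := fun c hc x =>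
    abs_of_pos (hQ.pos c (hsub hc) x)
  refine ⟨ρ, K, A, max X 0, ν, hρ, hsub, ⟨Metric.isOpen_ball, hf, hK, hν, le_max_right _ _,
    fun x => (hQ.smooth_speed x).mono hsub, fun c hc => hQ.isProfile (hsub hc),
    fun c hc => by linarith [(hS c hc).2.2.1], fun c hc => by linarith [(hS c hc).2.2.2.1],
    fun c hc x => ?_, ⟨r, min_le_left _ _, hKr, fun c hc x hx => ?_⟩,
    fun c hc c' hc' => ?_, fun c hc c' hc' => ?_⟩⟩
  · rw [habs c hc]
    have := (hQ.isProfile (hsub hc)).le_zero hf x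
    linarith [(hS c hc).2.1]
  · rw [habs c hc]
    have h0 : (0 : ℝ) ≤ max X 0 := le_max_right _ _
    have := (hQ.isProfile (hsub hc)).antitoneOn hf h0 (h0.trans hx) hx
    linarith [(hS c hc).1]
  · exact (hA₁ c (hS c hc).2.2.2.2 c' (hS c' hc').2.2.2.2).trans
      (mul_le_mul_of_nonneg_right hA1 (abs_nonneg _))
  · exact (hA₂ c (hS c hc).2.2.2.2 c' (hS c' hc').2.2.2.2).trans
      (mul_le_mul_of_nonneg_right hA2 (abs_nonneg _))

/-- Exponential decay, linear in the data, for an even or odd function controlled by an initial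
value problem up to `X` and by an elliptic equation beyond `X`. -/
lemma expBd_of_ivp_of_elliptic {D D1 D2 V : ℝ → ℝ} {K X ν δ M : ℝ}
    (hD : ∀ x, HasDerivAt D (D1 x) x) (hD1 : ∀ x, HasDerivAt D1 (D2 x) x) (hν : 0 < ν)
    (hK : 0 ≤ K) (hX : 0 ≤ X) (hM : 0 ≤ M) (h0 : |D 0| ≤ δ) (h1 : |D1 0| ≤ δ)
    (hin : ∀ x, 0 ≤ x → x ≤ X → |D2 x| ≤ K * |D x| + M)
    (hV : ∀ x, X ≤ x → 2 * ν ^ 2 ≤ V x)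
    (hout : ∀ x, X ≤ x → |D2 x - V x * D x| ≤ M * expW ν x)
    (hlim : Tendsto D atTop (𝓝 0)) (hsym : ∀ x, |D (-x)| = |D x|) :
    ExpBd ((Real.exp ((K + 1) * X) * Real.exp (ν * X) + 1 / ν ^ 2) * (δ + M)) ν D := by
  have hδ : 0 ≤ δ := (abs_nonneg _).trans h0
  have g := abs_le_of_second_order hD hD1 hK hM hin h0 h1
  have d := exp_decay hD hD1 hν hM hV
    (fun x hx => by rw [← expW_of_nonneg ν (hX.trans hx)]; exact hout x hx) hlim
    (g X hX le_rfl).1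
  refine ExpBd.of_even_or_odd (fun x hx => ?_) hsym
  have hn : M / ν ^ 2 ≤ (δ + M) / ν ^ 2 := by gcongr; linarith
  rcases le_total x X with hxX | hxX
  · have e1 : 1 ≤ Real.exp (ν * X) * expW ν x := by
      rw [expW_of_nonneg ν hx, ← Real.exp_add]
      apply Real.one_le_exp
      nlinarith
    have e2 : 0 ≤ 1 / ν ^ 2 * (δ + M) * expW ν x := by
      have := (expW_pos ν x).le
      positivity
    have e3 : 0 ≤ (δ + M) * Real.exp ((K + 1) * X) := by positivity
    calc |D x| ≤ (δ + M) * Real.exp ((K + 1) * X) := (g x hx hxX).1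
      _ ≤ (δ + M) * Real.exp ((K + 1) * X) * (Real.exp (ν * X) * expW ν x) :=
        le_mul_of_one_le_right e3 e1
      _ ≤ _ := by linarith
  · refine (d x hxX).trans ?_
    rw [expW_of_nonneg ν hx]
    apply mul_le_mul_of_nonneg_right _ (Real.exp_pos _).le
    calc _ ≤ (δ + M) * Real.exp ((K + 1) * X) * Real.exp (ν * X) + (δ + M) / ν ^ 2 := by
          linarith
      _ = _ := by ring

namespace IsWaveNhd

variable {f : ℝ → ℝ} {Q : ℝ → ℝ → ℝ} {S : Set ℝ} {K A X ν : ℝ}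

lemma amp_nonneg (h : IsWaveNhd f Q S K A X ν) {c : ℝ} (hc : c ∈ S) : 0 ≤ A :=
  (abs_nonneg _).trans (h.le c hc 0)

lemma speed_abs_le (h : IsWaveNhd f Q S K A X ν) {c : ℝ} (hc : c ∈ S) : |c| ≤ A := by
  rw [abs_of_pos (h.profile c hc).speed_pos]; exact h.speed_le c hc

/-- The profiles solve `Q'' = (c - f(Q)/Q) Q`, with a coefficient bounded below beyond the common
cut. -/
lemma exists_expBd (h : IsWaveNhd f Q S K A X ν) :
    ∃ C, ∀ c ∈ S, ExpBd C ν (Q c) := by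
  refine ⟨(Real.exp ((A + K + 1) * X) * Real.exp (ν * X) + 1 / ν ^ 2) * (A + 0),
    fun c hc => ?_⟩
  have hp := h.profile c hc
  obtain ⟨r, hrA, hKr, hr⟩ := h.small
  refine expBd_of_ivp_of_elliptic (D2 := fun x => c * Q c x - f (Q c x))
    (V := fun x => c - f (Q c x) / Q c x) (K := A + K) (X := X) (δ := A) (M := 0)
    hp.hasDerivAt hp.hasDerivAt_deriv
    h.nu_pos (add_nonneg (h.amp_nonneg hc) h.bounds.nonneg) h.cut_nonneg le_rfl (h.le c hc 0)
    (by rw [hp.deriv_zero]; simpa using h.amp_nonneg hc) ?_ ?_ ?_ hp.decay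
    (fun x => by rw [hp.even])
  · intro x _ _
    refine (abs_sub _ _).trans ?_
    rw [abs_mul]
    have := h.bounds.le _ (h.le c hc x)
    have := mul_le_mul_of_nonneg_right (h.speed_abs_le hc) (abs_nonneg (Q c x))
    linarith
  · intro x hx
    have h1 := h.bounds.secant h.nonlin hrA (hr c hc x hx)
      (show |(0 : ℝ)| ≤ r by simpa using (abs_nonneg _).trans (hr c hc x hx))
    rw [h.nonlin.zero, sub_zero, sub_zero] at h1
    have h2 : f (Q c x) / Q c x ≤ 2 * ν ^ 2 := by
      rw [div_le_iff₀ (hp.pos x)]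
      have := (le_abs_self _).trans h1
      rw [abs_of_pos (hp.pos x)] at this
      exact this.trans (mul_le_mul_of_nonneg_right hKr (hp.pos x).le)
    linarith [h.speed_ge c hc]
  · intro x _
    have : c * Q c x - f (Q c x) - (c - f (Q c x) / Q c x) * Q c x = 0 := by
      have := (hp.pos x).ne'
      field_simp
      ring
    rw [this]; simp

/-- Lipschitz dependence of the waves on the speed, with exponential weights. -/
lemma exists_lip (h : IsWaveNhd f Q S K A X ν) :
    ∃ C, ∀ c ∈ S, ∀ c' ∈ S, ExpBd (C * |c - c'|) ν (fun x => Q c x - Q c' x) ∧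
      ExpBd (C * |c - c'|) ν (fun x => deriv (Q c) x - deriv (Q c') x) ∧
      ExpBd (C * |c - c'|) ν
        (fun x => (c * Q c x - f (Q c x)) - (c' * Q c' x - f (Q c' x))) := by
  obtain ⟨B, hB⟩ := h.exists_expBd
  have h1 : ∃ C, ∀ c ∈ S, ∀ c' ∈ S, ExpBd (C * |c - c'|) ν (fun x => Q c x - Q c' x) := by
    refine ⟨(Real.exp ((A + K + 1) * X) * Real.exp (ν * X) + 1 / ν ^ 2) * (A + B),
      fun c hc c' hc' => ?_⟩
    have hp := h.profile c hc
    have hp' := h.profile c' hc'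
    obtain ⟨r, hrA, hKr, hr⟩ := h.small
    have hB0 : 0 ≤ B := (hB c hc).nonneg
    have key := expBd_of_ivp_of_elliptic (D := fun x => Q c x - Q c' x)
      (D2 := fun x => (c * Q c x - f (Q c x)) - (c' * Q c' x - f (Q c' x)))
      (V := fun x => c - (f (Q c x) - f (Q c' x)) / (Q c x - Q c' x)) (K := A + K) (X := X)
      (δ := A * |c - c'|) (M := B * |c - c'|)
      (fun x => (hp.hasDerivAt x).sub (hp'.hasDerivAt x))
      (fun x => (hp.hasDerivAt_deriv x).sub (hp'.hasDerivAt_deriv x))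
      h.nu_pos (add_nonneg (h.amp_nonneg hc) h.bounds.nonneg) h.cut_nonneg
      (mul_nonneg hB0 (abs_nonneg _)) (h.lip_zero c hc c' hc')
      (by
        rw [hp.deriv_zero, hp'.deriv_zero]
        simpa using mul_nonneg (h.amp_nonneg hc) (abs_nonneg _))
      ?_ ?_ ?_ (by simpa using hp.decay.sub hp'.decay) (fun x => by simp only [hp.even, hp'.even])
    · refine key.mono (le_of_eq ?_) le_rfl
      ring
    · intro x _ _
      have e : (c * Q c x - f (Q c x)) - (c' * Q c' x - f (Q c' x))
          = c * (Q c x - Q c' x) - (f (Q c x) - f (Q c' x)) + (c - c') * Q c' x := by ring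
      rw [e]
      refine (abs_add_le _ _).trans ?_
      have a1 := abs_sub (c * (Q c x - Q c' x)) (f (Q c x) - f (Q c' x))
      rw [abs_mul] at a1
      have a2 := h.bounds.lip _ _ (h.le c hc x) (h.le c' hc' x)
      have a3 := mul_le_mul_of_nonneg_right (h.speed_abs_le hc) (abs_nonneg (Q c x - Q c' x))
      have a4 : |(c - c') * Q c' x| ≤ B * |c - c'| := by
        rw [abs_mul, mul_comm]
        exact mul_le_mul_of_nonneg_right ((hB c' hc').le h.nu_pos.le x) (abs_nonneg _)
      linarith
    · intro x hx
      have h2 := h.bounds.secant h.nonlin hrA (hr c hc x hx) (hr c' hc' x hx)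
      have h3 : (f (Q c x) - f (Q c' x)) / (Q c x - Q c' x) ≤ 2 * ν ^ 2 := by
        refine (le_abs_self _).trans ?_
        rw [abs_div]
        refine div_le_of_le_mul₀ (abs_nonneg _) (by positivity) (h2.trans ?_)
        exact mul_le_mul_of_nonneg_right hKr (abs_nonneg _)
      linarith [h.speed_ge c hc]
    · intro x _
      have e : (c * Q c x - f (Q c x)) - (c' * Q c' x - f (Q c' x))
          - (c - (f (Q c x) - f (Q c' x)) / (Q c x - Q c' x)) * (Q c x - Q c' x)
          = (c - c') * Q c' x := by
        by_cases hD : Q c x - Q c' x = 0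
        · have : Q c x = Q c' x := sub_eq_zero.1 hD
          rw [this]; simp; ring
        · field_simp
          ring
      rw [e, abs_mul, mul_comm B, mul_assoc]
      exact mul_le_mul_of_nonneg_left (hB c' hc' x) (abs_nonneg _)
  obtain ⟨C, hC⟩ := h1
  refine ⟨max (max C (3 * ((A + K) * C + B + C) * Real.exp ν)) ((A + K) * C + B + C),
    fun c hc c' hc' => ?_⟩
  have hp := h.profile c hc
  have hp' := h.profile c' hc'
  have h2 : ∀ x, |Q c x - Q c' x| ≤ C * |c - c'| * expW ν x := hC c hc c' hc'
  have hB0 : 0 ≤ B := (hB c hc).nonneg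
  have hAK := add_nonneg (h.amp_nonneg hc) h.bounds.nonneg
  have h3 : ExpBd (((A + K) * C + B + C) * |c - c'|) ν
      (fun x => (c * Q c x - f (Q c x)) - (c' * Q c' x - f (Q c' x))) := by
    intro x
    have e : (c * Q c x - f (Q c x)) - (c' * Q c' x - f (Q c' x))
        = c * (Q c x - Q c' x) - (f (Q c x) - f (Q c' x)) + (c - c') * Q c' x := by ring
    beta_reduce
    rw [e]
    have a0 := abs_add_le (c * (Q c x - Q c' x) - (f (Q c x) - f (Q c' x))) ((c - c') * Q c' x)
    have a1 := abs_sub (c * (Q c x - Q c' x)) (f (Q c x) - f (Q c' x))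
    rw [abs_mul] at a1
    have a2 := h.bounds.lip _ _ (h.le c hc x) (h.le c' hc' x)
    have a3 := mul_le_mul_of_nonneg_right (h.speed_abs_le hc) (abs_nonneg (Q c x - Q c' x))
    have a4 : |(c - c') * Q c' x| ≤ |c - c'| * (B * expW ν x) := by
      rw [abs_mul]
      exact mul_le_mul_of_nonneg_left (hB c' hc' x) (abs_nonneg _)
    have a5 := mul_le_mul_of_nonneg_left (h2 x) hAK
    have a6 := (abs_nonneg _).trans (h2 x)
    nlinarith
  have h4 : ExpBd (((A + K) * C + B + C) * |c - c'|) ν (fun x => Q c x - Q c' x) := by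
    intro x
    have a6 := (abs_nonneg _).trans (h2 x)
    have a7 := mul_nonneg hAK a6
    have a8 : 0 ≤ B * (|c - c'| * expW ν x) :=
      mul_nonneg hB0 (mul_nonneg (abs_nonneg _) (expW_pos _ _).le)
    refine (h2 x).trans ?_
    nlinarith
  have h5 := ExpBd.deriv_of_second (fun x => (hp.hasDerivAt x).sub (hp'.hasDerivAt x))
    (fun x => (hp.hasDerivAt_deriv x).sub (hp'.hasDerivAt_deriv x)) h.nu_pos.le h4 h3
  refine ⟨(hC c hc c' hc').mono (mul_le_mul_of_nonneg_right
      ((le_max_left _ _).trans (le_max_left _ _)) (abs_nonneg _)) le_rfl, h5.mono ?_ le_rfl,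
    h3.mono (mul_le_mul_of_nonneg_right (le_max_right _ _) (abs_nonneg _)) le_rfl⟩
  calc _ = 3 * ((A + K) * C + B + C) * Real.exp ν * |c - c'| := by ring
    _ ≤ _ := mul_le_mul_of_nonneg_right ((le_max_right _ _).trans (le_max_left _ _)) (abs_nonneg _)

end IsWaveNhd

lemma abs_deriv_le_of_lip {S : Set ℝ} {g : ℝ → ℝ} {g' c B : ℝ} (hS : IsOpen S) (hc : c ∈ S)
    (hg : HasDerivAt g g' c) (hB : ∀ c' ∈ S, |g c' - g c| ≤ B * |c' - c|) : |g'| ≤ B := by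
  have hB0 : 0 ≤ B := by
    obtain ⟨ρ, hρ, hb⟩ := Metric.isOpen_iff.1 hS c hc
    have := hB (c + ρ / 2) (hb (by simp [abs_of_pos hρ, hρ]))
    have h2 := (abs_nonneg _).trans this
    rw [add_sub_cancel_left, abs_of_pos (half_pos hρ)] at h2
    by_contra h3
    nlinarith
  exact hg.le_of_lip' hB0 (by filter_upwards [hS.mem_nhds hc] with c' h' using hB c' h')

lemma abs_image_sub_le {D D1 : ℝ → ℝ} {B : ℝ} (hD : ∀ x, HasDerivAt D (D1 x) x)
    (hB : ∀ x, |D1 x| ≤ B) (x y : ℝ) : |D x - D y| ≤ B * |x - y| :=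
  convex_univ.norm_image_sub_le_of_norm_hasDerivWithin_le
    (fun z _ => (hD z).hasDerivWithinAt) (fun z _ => hB z) (mem_univ y) (mem_univ x)

/-- The speed derivative of a family inherits Lipschitz continuity in space from the increments
of the family. -/
lemma continuous_speedDeriv {S : Set ℝ} {G G1 : ℝ → ℝ → ℝ} {g : ℝ → ℝ} {c B : ℝ} (hS : IsOpen S)
    (hc : c ∈ S) (hG : ∀ c' ∈ S, ∀ x, HasDerivAt (G c') (G1 c' x) x)
    (hg : ∀ x, HasDerivAt (fun c' => G c' x) (g x) c)
    (hB : ∀ c' ∈ S, ∀ x, |G1 c' x - G1 c x| ≤ B * |c' - c|) : Continuous g := by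
  have hl : ∀ x y, |g x - g y| ≤ B * |x - y| := by
    intro x y
    refine abs_deriv_le_of_lip hS hc ((hg x).sub (hg y)) fun c' hc' => ?_
    have := abs_image_sub_le (D := fun x => G c' x - G c x)
      (fun x => (hG c' hc' x).sub (hG c hc x)) (hB c' hc') x y
    simp only [Pi.sub_apply]
    calc _ = |G c' x - G c x - (G c' y - G c y)| := by congr 1; ring
      _ ≤ _ := this
      _ = _ := by ring
  have : LipschitzWith (Real.nnabs B) g := LipschitzWith.of_dist_le_mul fun x y => by
    rw [Real.dist_eq, Real.dist_eq]
    refine (hl x y).trans (mul_le_mul_of_nonneg_right ?_ (abs_nonneg _))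
    simpa using le_abs_self B
  exact this.continuous

lemma hasDerivAt_intervalIntegral_of_lip {S : Set ℝ} {G : ℝ → ℝ → ℝ} {g : ℝ → ℝ} {c B : ℝ}
    (hS : IsOpen S) (hc : c ∈ S) (hG : ∀ c' ∈ S, Continuous (G c'))
    (hg : ∀ x, HasDerivAt (fun c' => G c' x) (g x) c) (hgc : Continuous g)
    (hB : ∀ c₁ ∈ S, ∀ c₂ ∈ S, ∀ x, |G c₁ x - G c₂ x| ≤ B * |c₁ - c₂|) (x : ℝ) :
    HasDerivAt (fun c' => ∫ y in (0 : ℝ)..x, G c' y) (∫ y in (0 : ℝ)..x, g y) c :=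
  (intervalIntegral.hasDerivAt_integral_of_dominated_loc_of_lip (bound := fun _ => B)
    (hS.mem_nhds hc)
    (by filter_upwards [hS.mem_nhds hc] with c' h' using (hG c' h').aestronglyMeasurable)
    ((hG c hc).intervalIntegrable _ _) hgc.aestronglyMeasurable
    (.of_forall fun y _ => LipschitzOnWith.of_dist_le_mul fun c₁ h₁ c₂ h₂ => by
      rw [Real.dist_eq, Real.dist_eq]
      refine (hB c₁ h₁ c₂ h₂ y).trans (mul_le_mul_of_nonneg_right ?_ (abs_nonneg _))
      simpa using le_abs_self B)
    intervalIntegrable_const (.of_forall fun y _ => hg y)).2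

/-- Estimates for the waves and their first two speed derivatives, uniform for speeds in `S`. -/
structure IsWaveData (f : ℝ → ℝ) (Q : ℝ → ℝ → ℝ) (S : Set ℝ) (K ν : ℝ) : Prop where
  isOpen : IsOpen S
  nonlin : IsNonlinearity f
  nu_pos : 0 < ν
  bound_nonneg : 0 ≤ K
  profile : ∀ c ∈ S, IsProfile f c (Q c) (deriv (Q c))
  speed_le : ∀ c ∈ S, c ≤ K
  speed_ge : ∀ c ∈ S, ν ^ 2 ≤ c
  q_bd : ∀ c ∈ S, ExpBd K ν (Q c)
  q1_bd : ∀ c ∈ S, ExpBd K ν (deriv (Q c))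
  z_bd : ∀ c ∈ S, ExpBd K ν (zc Q c)
  z1_bd : ∀ c ∈ S, ExpBd K ν (deriv (zc Q c))
  zz_bd : ∀ c ∈ S, ExpBd K ν (zzc Q c)
  zz_cont : ∀ c ∈ S, Continuous (zzc Q c)
  q_lip : ∀ c ∈ S, ∀ c' ∈ S, ExpBd (K * |c - c'|) ν (fun x => Q c x - Q c' x)
  q1_lip : ∀ c ∈ S, ∀ c' ∈ S, ExpBd (K * |c - c'|) ν (fun x => deriv (Q c) x - deriv (Q c') x)
  z_lip : ∀ c ∈ S, ∀ c' ∈ S, ExpBd (K * |c - c'|) ν (fun x => zc Q c x - zc Q c' x)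
  q_speed : ∀ c ∈ S, ∀ x, HasDerivAt (fun c' => Q c' x) (zc Q c x) c
  z_speed : ∀ c ∈ S, ∀ x, HasDerivAt (fun c' => zc Q c' x) (zzc Q c x) c
  z_hasDerivAt : ∀ c ∈ S, ∀ x, HasDerivAt (zc Q c) (deriv (zc Q c) x) x
  z1_hasDerivAt : ∀ c ∈ S, ∀ x, HasDerivAt (deriv (zc Q c))
    (c * zc Q c x + Q c x - deriv f (Q c x) * zc Q c x) x
  z_even : ∀ c ∈ S, ∀ x, zc Q c (-x) = zc Q c x

namespace IsWaveNhd

variable {f : ℝ → ℝ} {Q : ℝ → ℝ → ℝ} {S : Set ℝ} {K A X ν : ℝ}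

lemma q_speed (h : IsWaveNhd f Q S K A X ν) {c : ℝ} (hc : c ∈ S) (x : ℝ) :
    HasDerivAt (fun c' => Q c' x) (zc Q c x) c := hasDerivAt_zc h.isOpen hc (h.smooth x)

lemma z_speed (h : IsWaveNhd f Q S K A X ν) {c : ℝ} (hc : c ∈ S) (x : ℝ) :
    HasDerivAt (fun c' => zc Q c' x) (zzc Q c x) c := hasDerivAt_zzc h.isOpen hc (h.smooth x)

lemma z_even (h : IsWaveNhd f Q S K A X ν) {c : ℝ} (hc : c ∈ S) (x : ℝ) :
    zc Q c (-x) = zc Q c x := by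
  apply Filter.EventuallyEq.deriv_eq
  filter_upwards [h.isOpen.mem_nhds hc] with c' h' using (h.profile c' h').even x

lemma exists_z_bd (h : IsWaveNhd f Q S K A X ν) :
    ∃ C, ∀ c ∈ S, ExpBd C ν (zc Q c) ∧ Continuous (zc Q c) := by
  obtain ⟨C, hC⟩ := h.exists_lip
  refine ⟨C, fun c hc => ⟨fun x => ?_, ?_⟩⟩
  · refine abs_deriv_le_of_lip h.isOpen hc (h.q_speed hc x) fun c' hc' => ?_
    refine ((hC c' hc' c hc).1 x).trans (le_of_eq ?_)
    ring
  · exact continuous_speedDeriv h.isOpen hc (fun c' hc' => (h.profile c' hc').hasDerivAt)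
      (h.q_speed hc) (fun c' hc' => (hC c' hc' c hc).2.1.le h.nu_pos.le)

/-- The linearized profile equation `L ∂_c Q_c = -Q_c`, obtained by differentiating the profile
equation in its integrated form. -/
lemma z_equation (h : IsWaveNhd f Q S K A X ν) {c : ℝ} (hc : c ∈ S) :
    (∀ x, HasDerivAt (zc Q c) (deriv (zc Q c) x) x) ∧ deriv (zc Q c) 0 = 0 ∧
    ∀ x, HasDerivAt (deriv (zc Q c)) (c * zc Q c x + Q c x - deriv f (Q c x) * zc Q c x) x := by
  obtain ⟨C, hC⟩ := h.exists_lip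
  obtain ⟨B, hB⟩ := h.exists_z_bd
  have hzc := (hB c hc).2
  have hqc : ∀ c' ∈ S, Continuous (Q c') := fun c' h' => (h.profile c' h').continuous
  set w : ℝ → ℝ := fun x => c * zc Q c x + Q c x - deriv f (Q c x) * zc Q c x
  have hwc : Continuous w := ((continuous_const.mul hzc).add (hqc c hc)).sub
    ((h.nonlin.continuous_deriv.comp (hqc c hc)).mul hzc)
  set Z : ℝ → ℝ := fun x => ∫ y in (0 : ℝ)..x, w y
  have hZ : ∀ x, HasDerivAt Z (w x) x := fun x =>
    intervalIntegral.integral_hasDerivAt_right (hwc.intervalIntegrable _ _)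
      (hwc.stronglyMeasurableAtFilter _ _) hwc.continuousAt
  have hZc : Continuous Z := continuous_iff_continuousAt.2 fun x => (hZ x).continuousAt
  have h1 : ∀ x, HasDerivAt (fun c' => deriv (Q c') x) (Z x) c := by
    intro x
    have := hasDerivAt_intervalIntegral_of_lip (G := fun c' y => c' * Q c' y - f (Q c' y))
      h.isOpen hc (fun c' h' => (continuous_const.mul (hqc c' h')).sub
        (h.nonlin.continuous.comp (hqc c' h')))
      (fun y => (((hasDerivAt_id' c).fun_mul (h.q_speed hc y)).fun_sub
        ((h.nonlin.hasDerivAt _).comp c (h.q_speed hc y))).congr_deriv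
          (show _ = w y by simp only [w]; ring)) hwc
      (fun c₁ h₁ c₂ h₂ y => ((hC c₁ h₁ c₂ h₂).2.2.le h.nu_pos.le y)) x
    refine this.congr_of_eventuallyEq ?_
    filter_upwards [h.isOpen.mem_nhds hc] with c' h'
    have hp := h.profile c' h'
    rw [intervalIntegral.integral_eq_sub_of_hasDerivAt (fun y _ => hp.hasDerivAt_deriv y),
      hp.deriv_zero, sub_zero]
    exact ((continuous_const.mul (hqc c' h')).sub
        (h.nonlin.continuous.comp (hqc c' h'))).intervalIntegrable _ _
  have h2 : ∀ x, zc Q c x = zc Q c 0 + ∫ y in (0 : ℝ)..x, Z y := by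
    intro x
    have := hasDerivAt_intervalIntegral_of_lip (G := fun c' y => deriv (Q c') y)
      h.isOpen hc (fun c' h' => (h.profile c' h').continuous_deriv) h1 hZc
      (fun c₁ h₁ c₂ h₂ y => ((hC c₁ h₁ c₂ h₂).2.1.le h.nu_pos.le y)) x
    refine (h.q_speed hc x).unique (((h.q_speed hc 0).fun_add this).congr_of_eventuallyEq ?_)
    filter_upwards [h.isOpen.mem_nhds hc] with c' h'
    have hp := h.profile c' h'
    rw [intervalIntegral.integral_eq_sub_of_hasDerivAt (fun y _ => hp.hasDerivAt y)
      (hp.continuous_deriv.intervalIntegrable _ _)]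
    ring
  have h3 : ∀ x, HasDerivAt (zc Q c) (Z x) x := by
    intro x
    have : HasDerivAt (fun x => zc Q c 0 + ∫ y in (0 : ℝ)..x, Z y) (Z x) x :=
      (intervalIntegral.integral_hasDerivAt_right (hZc.intervalIntegrable _ _)
        (hZc.stronglyMeasurableAtFilter _ _) hZc.continuousAt).const_add _
    rwa [← funext h2] at this
  have h4 : deriv (zc Q c) = Z := funext fun x => (h3 x).deriv
  rw [h4]
  exact ⟨h3, by simp [Z], hZ⟩

/-- Differences of `∂_c Q_c` at two speeds solve a linearized profile equation, which is elliptic beyond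
the common cut. They decay like the waves, with a constant proportional to the difference of the
speeds; this bounds the second speed derivative as well. -/
lemma exists_waveData (h : IsWaveNhd f Q S K A X ν) (hne : S.Nonempty) :
    ∃ K', IsWaveData f Q S K' ν := by
  obtain ⟨B₁, hB₁⟩ := h.exists_expBd
  obtain ⟨C, hC⟩ := h.exists_lip
  obtain ⟨B₂, hB₂⟩ := h.exists_z_bd
  obtain ⟨s₀, hs₀⟩ := hne
  have hA : 0 ≤ A := h.amp_nonneg hs₀
  have hK : 0 ≤ K := h.bounds.nonneg
  -- all first-order quantities are bounded by one constant `B`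
  set B := max (max B₁ B₂) (max C 0)
  have hB0 : 0 ≤ B := (le_max_right _ _).trans (le_max_right _ _)
  have hq : ∀ c ∈ S, ExpBd B ν (Q c) := fun c hc =>
    (hB₁ c hc).mono ((le_max_left _ _).trans (le_max_left _ _)) le_rfl
  have hz : ∀ c ∈ S, ExpBd B ν (zc Q c) := fun c hc =>
    (hB₂ c hc).1.mono ((le_max_right _ _).trans (le_max_left _ _)) le_rfl
  have hCB : C ≤ B := (le_max_left _ _).trans (le_max_right _ _)
  have hql : ∀ c ∈ S, ∀ c' ∈ S, ExpBd (B * |c - c'|) ν (fun x => Q c x - Q c' x) :=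
    fun c hc c' hc' => (hC c hc c' hc').1.mono
      (mul_le_mul_of_nonneg_right hCB (abs_nonneg _)) le_rfl
  have hq1l : ∀ c ∈ S, ∀ c' ∈ S,
      ExpBd (B * |c - c'|) ν (fun x => deriv (Q c) x - deriv (Q c') x) :=
    fun c hc c' hc' => (hC c hc c' hc').2.1.mono
      (mul_le_mul_of_nonneg_right hCB (abs_nonneg _)) le_rfl
  have hq2 : ∀ c ∈ S, ExpBd ((A + K + 1) * B) ν (fun x => c * Q c x - f (Q c x)) := by
    intro c hc x
    refine (abs_sub _ _).trans ?_
    rw [abs_mul]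
    have a1 := h.bounds.le _ (h.le c hc x)
    have a2 := mul_le_mul_of_nonneg_right (h.speed_abs_le hc) (abs_nonneg (Q c x))
    have a3 := mul_le_mul_of_nonneg_left (hq c hc x) (add_nonneg hA hK)
    have a4 := (abs_nonneg _).trans (hq c hc x)
    linarith
  have hfq : ∀ c ∈ S, ∀ x, |deriv f (Q c x)| ≤ K * A := fun c hc x =>
    (h.bounds.deriv_le _ (h.le c hc x)).trans (mul_le_mul_of_nonneg_left (h.le c hc x) hK)
  have hz2 : ∀ c ∈ S, ExpBd ((A + K * A + 1) * B) ν
      (fun x => c * zc Q c x + Q c x - deriv f (Q c x) * zc Q c x) := by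
    intro c hc x
    refine (abs_sub _ _).trans ?_
    have a0 := abs_add_le (c * zc Q c x) (Q c x)
    rw [abs_mul] at a0 ⊢
    have a1 := mul_le_mul_of_nonneg_right (hfq c hc x) (abs_nonneg (zc Q c x))
    have a2 := mul_le_mul_of_nonneg_right (h.speed_abs_le hc) (abs_nonneg (zc Q c x))
    have a3 := mul_le_mul_of_nonneg_left (hz c hc x) (add_nonneg hA (mul_nonneg hK hA))
    have a4 := hq c hc x
    linarith
  -- the increments of `∂_c Q_c` in the speed solve the linearized equation with small data
  set M := B + B + K * B * B
  have hM : 0 ≤ M := by positivity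
  have hdiff : ∀ c ∈ S, ∀ c' ∈ S, ∀ x,
      |c * zc Q c x + Q c x - deriv f (Q c x) * zc Q c x
        - (c' * zc Q c' x + Q c' x - deriv f (Q c' x) * zc Q c' x)
        - (c - deriv f (Q c x)) * (zc Q c x - zc Q c' x)| ≤ M * |c - c'| * expW ν x := by
    intro c hc c' hc' x
    have e : c * zc Q c x + Q c x - deriv f (Q c x) * zc Q c x
        - (c' * zc Q c' x + Q c' x - deriv f (Q c' x) * zc Q c' x)
        - (c - deriv f (Q c x)) * (zc Q c x - zc Q c' x)
        = (c - c') * zc Q c' x + (Q c x - Q c' x)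
          - (deriv f (Q c x) - deriv f (Q c' x)) * zc Q c' x := by ring
    rw [e]
    refine (abs_sub _ _).trans ?_
    have a0 := abs_add_le ((c - c') * zc Q c' x) (Q c x - Q c' x)
    rw [abs_mul] at a0 ⊢
    have a1 := mul_le_mul_of_nonneg_left (hz c' hc' x) (abs_nonneg (c - c'))
    have a2 : |Q c x - Q c' x| ≤ B * |c - c'| * expW ν x := hql c hc c' hc' x
    have a3 := h.bounds.deriv_lip _ _ (h.le c hc x) (h.le c' hc' x)
    have a4 : |deriv f (Q c x) - deriv f (Q c' x)| * |zc Q c' x|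
        ≤ K * (B * |c - c'| * expW ν x) * B :=
      mul_le_mul (a3.trans (mul_le_mul_of_nonneg_left a2 hK))
        ((hz c' hc').le h.nu_pos.le x) (abs_nonneg _)
        (mul_nonneg hK ((abs_nonneg _).trans a2))
    simp only [M]
    nlinarith
  set T := (Real.exp ((A + K * A + 1) * X) * Real.exp (ν * X) + 1 / ν ^ 2) * (A + M)
  have hT : 0 ≤ T := by positivity
  have hzl : ∀ c ∈ S, ∀ c' ∈ S, ExpBd (T * |c - c'|) ν (fun x => zc Q c x - zc Q c' x) := by
    intro c hc c' hc'
    obtain ⟨r, hrA, hKr, hr⟩ := h.small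
    have hd := h.z_equation hc
    have hd' := h.z_equation hc'
    have key := expBd_of_ivp_of_elliptic (D := fun x => zc Q c x - zc Q c' x)
      (V := fun x => c - deriv f (Q c x)) (K := A + K * A) (X := X)
      (δ := A * |c - c'|) (M := M * |c - c'|)
      (fun x => (hd.1 x).sub (hd'.1 x)) (fun x => (hd.2.2 x).sub (hd'.2.2 x))
      h.nu_pos (add_nonneg hA (mul_nonneg hK hA)) h.cut_nonneg
      (mul_nonneg hM (abs_nonneg _)) (h.lip_zero' c hc c' hc')
      (by
        rw [hd.2.1, hd'.2.1]
        simpa using mul_nonneg hA (abs_nonneg _))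
      (fun x _ _ => by
        have a1 := (hdiff c hc c' hc' x).trans
          (mul_le_of_le_one_right (mul_nonneg hM (abs_nonneg _)) (expW_le_one h.nu_pos.le x))
        have a2 := abs_sub_abs_le_abs_sub
          (c * zc Q c x + Q c x - deriv f (Q c x) * zc Q c x
            - (c' * zc Q c' x + Q c' x - deriv f (Q c' x) * zc Q c' x))
          ((c - deriv f (Q c x)) * (zc Q c x - zc Q c' x))
        have a3 : |(c - deriv f (Q c x)) * (zc Q c x - zc Q c' x)|
            ≤ (A + K * A) * |zc Q c x - zc Q c' x| := by
          rw [abs_mul]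
          refine mul_le_mul_of_nonneg_right ((abs_sub _ _).trans ?_) (abs_nonneg _)
          exact add_le_add (h.speed_abs_le hc) (hfq c hc x)
        linarith)
      (fun x hx => by
        have a1 := (le_abs_self _).trans (h.bounds.deriv_le _ (h.le c hc x))
        have a2 := mul_le_mul_of_nonneg_left (hr c hc x hx) hK
        linarith [h.speed_ge c hc])
      (fun x _ => hdiff c hc c' hc' x)
      (by simpa using ((hz c hc).tendsto_atTop h.nu_pos).sub ((hz c' hc').tendsto_atTop h.nu_pos))
      (fun x => by simp only [h.z_even hc, h.z_even hc'])
    refine key.mono (le_of_eq ?_) le_rfl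
    simp only [T]; ring
  have hz1l : ∀ c ∈ S, ∀ c' ∈ S, ∀ x, |deriv (zc Q c) x - deriv (zc Q c') x|
      ≤ 3 * ((M + (A + K * A) * T + T)) * Real.exp ν * |c - c'| := by
    intro c hc c' hc' x
    have hd := h.z_equation hc
    have hd' := h.z_equation hc'
    have hAK : 0 ≤ A + K * A := add_nonneg hA (mul_nonneg hK hA)
    have b1 : ExpBd ((M + (A + K * A) * T + T) * |c - c'|) ν
        (fun x => zc Q c x - zc Q c' x) := by
      refine (hzl c hc c' hc').mono (mul_le_mul_of_nonneg_right ?_ (abs_nonneg _)) le_rfl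
      nlinarith [mul_nonneg hAK hT]
    have b2 : ExpBd ((M + (A + K * A) * T + T) * |c - c'|) ν
        (fun x => c * zc Q c x + Q c x - deriv f (Q c x) * zc Q c x
        - (c' * zc Q c' x + Q c' x - deriv f (Q c' x) * zc Q c' x)) := by
      intro x
      have a1 := hdiff c hc c' hc' x
      have a2 := abs_sub_abs_le_abs_sub
        (c * zc Q c x + Q c x - deriv f (Q c x) * zc Q c x
          - (c' * zc Q c' x + Q c' x - deriv f (Q c' x) * zc Q c' x))
        ((c - deriv f (Q c x)) * (zc Q c x - zc Q c' x))
      have a4 : |zc Q c x - zc Q c' x| ≤ T * |c - c'| * expW ν x := hzl c hc c' hc' x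
      have a3 : |(c - deriv f (Q c x)) * (zc Q c x - zc Q c' x)|
          ≤ (A + K * A) * (T * |c - c'| * expW ν x) := by
        rw [abs_mul]
        refine mul_le_mul ((abs_sub _ _).trans ?_) a4 (abs_nonneg _) hAK
        exact add_le_add (h.speed_abs_le hc) (hfq c hc x)
      have a5 := (abs_nonneg _).trans a4
      beta_reduce
      nlinarith
    have := ExpBd.deriv_of_second (fun x => (hd.1 x).sub (hd'.1 x))
      (fun x => (hd.2.2 x).sub (hd'.2.2 x)) h.nu_pos.le b1 b2
    refine (this.le h.nu_pos.le x).trans (le_of_eq ?_)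
    ring
  set K' := max (max (max (3 * max B ((A + K + 1) * B) * Real.exp ν) B)
    (max (3 * max B ((A + K * A + 1) * B) * Real.exp ν) T)) A
  have k1 : 3 * max B ((A + K + 1) * B) * Real.exp ν ≤ K' :=
    (le_max_left _ _).trans ((le_max_left _ _).trans (le_max_left _ _))
  have k2 : B ≤ K' := (le_max_right _ _).trans ((le_max_left _ _).trans (le_max_left _ _))
  have k3 : 3 * max B ((A + K * A + 1) * B) * Real.exp ν ≤ K' :=
    (le_max_left _ _).trans ((le_max_right _ _).trans (le_max_left _ _))
  have k4 : T ≤ K' := (le_max_right _ _).trans ((le_max_right _ _).trans (le_max_left _ _))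
  have k5 : A ≤ K' := le_max_right _ _
  refine ⟨K', h.isOpen, h.nonlin, h.nu_pos, hA.trans k5, h.profile,
    fun c hc => (h.speed_le c hc).trans k5,
    fun c hc => by nlinarith [h.speed_ge c hc, sq_nonneg ν], fun c hc => (hq c hc).mono k2 le_rfl,
    fun c hc => ?_, fun c hc => (hz c hc).mono k2 le_rfl, fun c hc => ?_, fun c hc x => ?_,
    fun c hc => ?_, fun c hc c' hc' => (hql c hc c' hc').mono
      (mul_le_mul_of_nonneg_right k2 (abs_nonneg _)) le_rfl,
    fun c hc c' hc' => (hq1l c hc c' hc').mono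
      (mul_le_mul_of_nonneg_right k2 (abs_nonneg _)) le_rfl,
    fun c hc c' hc' => (hzl c hc c' hc').mono
      (mul_le_mul_of_nonneg_right k4 (abs_nonneg _)) le_rfl,
    fun c hc => h.q_speed hc, fun c hc => h.z_speed hc, fun c hc => (h.z_equation hc).1,
    fun c hc => (h.z_equation hc).2.2, fun c hc => h.z_even hc⟩
  · have hp := h.profile c hc
    exact (ExpBd.deriv_of_second hp.hasDerivAt hp.hasDerivAt_deriv h.nu_pos.le
      ((hq c hc).mono (le_max_left _ _) le_rfl)
      ((hq2 c hc).mono (le_max_right _ _) le_rfl)).mono k1 le_rfl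
  · have hd := h.z_equation hc
    exact (ExpBd.deriv_of_second hd.1 hd.2.2 h.nu_pos.le
      ((hz c hc).mono (le_max_left _ _) le_rfl)
      ((hz2 c hc).mono (le_max_right _ _) le_rfl)).mono k3 le_rfl
  · refine abs_deriv_le_of_lip h.isOpen hc (h.z_speed hc x) fun c' hc' => ?_
    have a : |zc Q c' x - zc Q c x| ≤ T * |c' - c| * expW ν x := hzl c' hc' c hc x
    have b := mul_le_mul_of_nonneg_right k4
      (mul_nonneg (abs_nonneg (c' - c)) (expW_pos ν x).le)
    linarith
  · exact continuous_speedDeriv h.isOpen hc (fun c' hc' => (h.z_equation hc').1)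
      (h.z_speed hc) (fun c' hc' => hz1l c' hc' c hc)

end IsWaveNhd

/-! ### The regularized primitive -/

lemma continuous_of_hasDerivAt {g g' : ℝ → ℝ} (h : ∀ x, HasDerivAt g (g' x) x) : Continuous g :=
  continuous_iff_continuousAt.2 fun x => (h x).continuousAt

/-- Smooth exponentially decaying functions belong to `H¹`. -/
lemma ExpBd.memH1 {g g' : ℝ → ℝ} {K K' ν ν' : ℝ} (hg : ExpBd K ν g) (hν : 0 < ν)
    (hg' : ExpBd K' ν' g') (hν' : 0 < ν') (h : ∀ x, HasDerivAt g (g' x) x) (hc : Continuous g') :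
    MemH1 g ∧ weakDeriv g =ᵐ[volume] g' :=
  MemH1.of_primitive (.of_hasDerivAt h hc) (hg.memLp hν (continuous_of_hasDerivAt h))
    (hg'.memLp hν' hc)

lemma symp_eq_regSymp (g : ℝ → ℝ) : symp g = regSymp 0 g := by
  funext x; simp [symp, regSymp]

lemma regSymp_shift (α a : ℝ) (g : ℝ → ℝ) (x : ℝ) :
    regSymp α (fun y => g (y - a)) x = regSymp α g (x - a) := by
  unfold regSymp
  have h := (measurePreserving_sub_right volume a).setIntegral_preimage_emb
    (Homeomorph.subRight a).measurableEmbedding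
    (fun y => g y * Real.exp (α * (y - (x - a)))) (Iic (x - a))
  rw [← h]
  have e : (fun y : ℝ => y - a) ⁻¹' Iic (x - a) = Iic x := by ext y; simp
  rw [e]
  congr 1
  funext y
  rw [sub_sub_sub_cancel_right]

section regSymp

variable {K ν α : ℝ} {g : ℝ → ℝ}

lemma integrableOn_regSymp (hg : ExpBd K ν g) (hν : 0 < ν) (hc : Continuous g) (hα : 0 ≤ α)
    (x : ℝ) : IntegrableOn (fun y => g y * Real.exp (α * (y - x))) (Iic x) := by
  refine Integrable.mono' (((integrable_expW hν).const_mul K).integrableOn)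
    (by fun_prop) ?_
  refine (ae_restrict_iff' measurableSet_Iic).2 (.of_forall fun y hy => ?_)
  rw [Real.norm_eq_abs, abs_mul, Real.abs_exp]
  have h1 : Real.exp (α * (y - x)) ≤ 1 := by
    rw [Real.exp_le_one_iff]
    have : y ≤ x := hy
    nlinarith
  exact (mul_le_of_le_one_right (abs_nonneg _) h1).trans (hg y)

lemma hasDerivAt_regSymp (hg : ExpBd K ν g) (hν : 0 < ν) (hc : Continuous g) (hα : 0 ≤ α)
    (x : ℝ) : HasDerivAt (regSymp α g) (g x - α * regSymp α g x) x := by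
  set k : ℝ → ℝ := fun y => g y * Real.exp (α * y)
  have hk : Continuous k := by simp only [k]; fun_prop
  have e0 : ∀ x y, g y * Real.exp (α * (y - x)) = Real.exp (-(α * x)) * k y := fun x y => by
    simp only [k]
    rw [mul_sub, sub_eq_add_neg, Real.exp_add]; ring
  have hki : ∀ x, IntegrableOn k (Iic x) := fun x => by
    have h1 := integrableOn_regSymp hg hν hc hα x
    have h2 := h1.const_mul (Real.exp (α * x))
    refine h2.congr (.of_forall fun y => ?_)
    simp only
    rw [e0, ← mul_assoc, ← Real.exp_add]; simp
  have e1 : regSymp α g = fun x => Real.exp (-(α * x)) *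
      ((∫ y in Iic 0, k y) + ∫ y in (0 : ℝ)..x, k y) := by
    funext x
    have := intervalIntegral.integral_Iic_sub_Iic (hki 0) (hki x)
    rw [← this, add_sub_cancel]
    unfold regSymp
    rw [← integral_const_mul]
    simp only [e0]
  have d1 : HasDerivAt (fun x => (∫ y in Iic 0, k y) + ∫ y in (0 : ℝ)..x, k y) (k x) x :=
    (intervalIntegral.integral_hasDerivAt_right (hk.intervalIntegrable _ _)
      (hk.stronglyMeasurableAtFilter _ _) hk.continuousAt).const_add _
  have d2 : HasDerivAt (fun x : ℝ => Real.exp (-(α * x))) (Real.exp (-(α * x)) * -(α * 1)) x :=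
    ((hasDerivAt_id' x).const_mul α).fun_neg.exp
  have d3 := d2.fun_mul d1
  have e2 := congrFun e1 x
  beta_reduce at e2
  rw [e2]
  rw [e1]
  refine d3.congr_deriv ?_
  have e3 : Real.exp (-(α * x)) * k x = g x := by
    rw [← e0]; simp
  rw [e3]
  ring

lemma continuous_regSymp (hg : ExpBd K ν g) (hν : 0 < ν) (hc : Continuous g) (hα : 0 ≤ α) :
    Continuous (regSymp α g) := continuous_of_hasDerivAt (hasDerivAt_regSymp hg hν hc hα)

lemma abs_regSymp_le (hg : ExpBd K ν g) (hν : 0 < ν) (hα : 0 ≤ α) (x : ℝ) :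
    |regSymp α g x| ≤ 2 * K / ν := by
  have h := norm_integral_le_of_norm_le (μ := volume.restrict (Iic x))
    (f := fun y => g y * Real.exp (α * (y - x)))
    (((integrable_expW hν).const_mul K).integrableOn (s := Iic x))
    ((ae_restrict_iff' measurableSet_Iic).2 (.of_forall fun y hy => by
      rw [Real.norm_eq_abs, abs_mul, Real.abs_exp]
      have h1 : Real.exp (α * (y - x)) ≤ 1 := by
        rw [Real.exp_le_one_iff]
        have : y ≤ x := hy
        nlinarith
      exact (mul_le_of_le_one_right (abs_nonneg _) h1).trans (hg y)))
  refine h.trans ((setIntegral_le_integral ((integrable_expW hν).const_mul K)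
    (.of_forall fun y => mul_nonneg hg.nonneg (expW_pos _ _).le)).trans (le_of_eq ?_))
  rw [integral_const_mul, integral_expW hν]
  ring

/-- For `α > 0` the regularized primitive decays exponentially, at a rate depending on `α`. -/
lemma expBd_regSymp (hg : ExpBd K ν g) (hν : 0 < ν) (hα : 0 ≤ α) :
    ExpBd (4 * K / ν) (min α (ν / 2)) (regSymp α g) := by
  intro x
  set β := min α (ν / 2)
  have hβ : 0 ≤ β := le_min hα (by positivity)
  have hν2 : 0 < ν / 2 := by positivity
  have key : ∀ y ≤ x, |g y * Real.exp (α * (y - x))| ≤ K * expW β x * expW (ν / 2) y := by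
    intro y hy
    rw [abs_mul, Real.abs_exp]
    have h1 : expW ν y * Real.exp (α * (y - x)) ≤ expW β x * expW (ν / 2) y := by
      rw [expW, expW, expW, ← Real.exp_add, ← Real.exp_add, Real.exp_le_exp]
      have a1 : β ≤ α := min_le_left _ _
      have a2 : β ≤ ν / 2 := min_le_right _ _
      have a3 : |x| ≤ |y| + (x - y) := by
        have := abs_add_le y (x - y)
        rw [add_sub_cancel, abs_of_nonneg (sub_nonneg.2 hy)] at this
        exact this
      have a4 := mul_le_mul_of_nonneg_left a3 hβ
      have a5 := mul_le_mul_of_nonneg_right a1 (sub_nonneg.2 hy)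
      have a6 := mul_le_mul_of_nonneg_right a2 (abs_nonneg y)
      linarith
    calc |g y| * Real.exp (α * (y - x)) ≤ K * expW ν y * Real.exp (α * (y - x)) :=
          mul_le_mul_of_nonneg_right (hg y) (Real.exp_pos _).le
      _ = K * (expW ν y * Real.exp (α * (y - x))) := by ring
      _ ≤ K * (expW β x * expW (ν / 2) y) := mul_le_mul_of_nonneg_left h1 hg.nonneg
      _ = _ := by ring
  have hi := (integrable_expW hν2).const_mul (K * expW β x)
  have h := norm_integral_le_of_norm_le (μ := volume.restrict (Iic x))
    (f := fun y => g y * Real.exp (α * (y - x))) (hi.integrableOn (s := Iic x))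
    ((ae_restrict_iff' measurableSet_Iic).2 (.of_forall fun y hy => key y hy))
  refine h.trans ((setIntegral_le_integral hi (.of_forall fun y =>
    mul_nonneg (mul_nonneg hg.nonneg (expW_pos _ _).le) (expW_pos _ _).le)).trans (le_of_eq ?_))
  rw [integral_const_mul, integral_expW hν2]
  field_simp
  ring

lemma regSymp_sub {h : ℝ → ℝ} {K' : ℝ} (hg : ExpBd K ν g) (hh : ExpBd K' ν h) (hν : 0 < ν)
    (hc : Continuous g) (hc' : Continuous h) (hα : 0 ≤ α) (x : ℝ) :
    regSymp α (fun y => g y - h y) x = regSymp α g x - regSymp α h x := by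
  unfold regSymp
  rw [← integral_sub (integrableOn_regSymp hg hν hc hα x) (integrableOn_regSymp hh hν hc' hα x)]
  congr 1
  funext y
  ring

section pos

variable (hg : ExpBd K ν g) (hν : 0 < ν) (hc : Continuous g) (hα : 0 < α)

include hν hα in
lemma regSymp_rate_pos : 0 < min α (ν / 2) := lt_min hα (by positivity)

include hg hν hc hα

lemma memLp_regSymp : MemLp (regSymp α g) 2 volume :=
  (expBd_regSymp hg hν hα.le).memLp (regSymp_rate_pos hν hα) (continuous_regSymp hg hν hc hα.le)

/-- The energy identity for `w' + α w = g`. -/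
lemma regSymp_energy : α * ∫ x, regSymp α g x ^ 2 = ∫ x, g x * regSymp α g x := by
  have hβ := regSymp_rate_pos hν hα
  have hW := expBd_regSymp hg hν hα.le (α := α)
  have hd := hasDerivAt_regSymp hg hν hc hα.le
  have hWc := continuous_regSymp hg hν hc hα.le
  have hm := memLp_regSymp hg hν hc hα
  have hgm := hg.memLp hν hc
  have h0 : ∫ x, (2 * (g x * regSymp α g x) - 2 * α * regSymp α g x ^ 2) = 0 := by
    refine integral_eq_zero_of_hasDerivAt_of_integrable (f := fun x => regSymp α g x ^ 2)
      (fun x => ((hd x).fun_pow 2).congr_deriv ?_) ?_ hm.integrable_sq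
    · push_cast; ring
    · exact ((integrable_mul_of_memLp hgm hm).const_mul 2).sub (hm.integrable_sq.const_mul _)
  rw [integral_sub ((integrable_mul_of_memLp hgm hm).const_mul 2) (hm.integrable_sq.const_mul _),
    integral_const_mul, integral_const_mul] at h0
  linarith

lemma regSymp_l2_sq_le : α * l2 (regSymp α g) ^ 2 ≤ (2 * K / ν) ^ 2 := by
  rw [l2_sq, regSymp_energy hg hν hc hα]
  have hb : ExpBd (2 * K / ν * K) ν (fun x => regSymp α g x * g x) :=
    hg.mul_bdd (abs_regSymp_le hg hν hα.le)
  have := (abs_le.1 (hb.abs_integral_le hν)).2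
  simp only [mul_comm (g _)]
  refine this.trans (le_of_eq ?_)
  ring

lemma sqrt_mul_l2_regSymp_le : √α * l2 (regSymp α g) ≤ 2 * K / ν := by
  have hK := hg.nonneg
  apply le_of_sq_le_sq _ (by positivity)
  rw [mul_pow, Real.sq_sqrt hα.le]
  exact regSymp_l2_sq_le hg hν hc hα

end pos

/-- The symmetric part of the primitive is the projection on constants:
`∫ g 𝒦g = (∫ g)² / 2`. -/
lemma integral_mul_symp (hg : ExpBd K ν g) (hν : 0 < ν) (hc : Continuous g) :
    ∫ x, g x * regSymp 0 g x = (1 / 2) * (∫ x, g x) ^ 2 := by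
  have hi := hg.integrable hν hc
  have hd : ∀ x, HasDerivAt (fun x => (1 / 2) * regSymp 0 g x ^ 2) (g x * regSymp 0 g x) x :=
    fun x => by
      refine (((hasDerivAt_regSymp hg hν hc le_rfl x).fun_pow 2).const_mul (1 / 2)).congr_deriv ?_
      push_cast; ring
  have hb : ExpBd (2 * K / ν * K) ν (fun x => regSymp 0 g x * g x) :=
    hg.mul_bdd (abs_regSymp_le hg hν le_rfl)
  have hi2 : Integrable (fun x => g x * regSymp 0 g x) := by
    have := hb.integrable hν ((continuous_regSymp hg hν hc le_rfl).mul hc)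
    simpa [mul_comm] using this
  have t1 : Tendsto (regSymp 0 g) atTop (𝓝 (∫ x, g x)) := by
    have := intervalIntegral_tendsto_integral_Ioi 0 (hi.integrableOn (s := Ioi 0)) tendsto_id
    have h2 := this.const_add (∫ x in Iic 0, g x)
    rw [intervalIntegral.integral_Iic_add_Ioi hi.integrableOn hi.integrableOn] at h2
    refine h2.congr fun x => ?_
    rw [← symp_eq_regSymp, symp,
      ← intervalIntegral.integral_Iic_sub_Iic hi.integrableOn hi.integrableOn]
    simp
  have t2 : Tendsto (regSymp 0 g) atBot (𝓝 0) := by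
    have := intervalIntegral_tendsto_integral_Iic 0 (hi.integrableOn (s := Iic 0)) tendsto_id
    have h2 := this.const_sub (∫ x in Iic 0, g x)
    rw [sub_self] at h2
    refine h2.congr fun x => ?_
    rw [← symp_eq_regSymp, symp,
      ← intervalIntegral.integral_Iic_sub_Iic hi.integrableOn hi.integrableOn]
    simp
  rw [integral_of_hasDerivAt_of_tendsto hd hi2 ((t2.pow 2).const_mul _) ((t1.pow 2).const_mul _)]
  ring

/-- As `α → 0`, `∫ g (∂ₓ + α)⁻¹ g` tends to `(∫ g)² / 2`, at a linear rate. -/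
lemma integral_mul_regSymp_ge (hg : ExpBd K ν g) (hν : 0 < ν) (hc : Continuous g) (hα : 0 < α) :
    (1 / 2) * (∫ x, g x) ^ 2 - 32 * K ^ 2 / ν ^ 3 * α ≤ ∫ x, g x * regSymp α g x := by
  have hK := hg.nonneg
  -- the two primitives differ by at most `α ∫ |x - y| |g(y)| dy`
  have hx2 : ∀ x, |regSymp α g x - regSymp 0 g x|
      ≤ α * (K * (2 / ν)) * (|x| + 2 / ν * 2) := by
    intro x
    have e : regSymp α g x - regSymp 0 g x
        = ∫ y in Iic x, g y * (Real.exp (α * (y - x)) - 1) := by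
      unfold regSymp
      rw [← integral_sub (integrableOn_regSymp hg hν hc hα.le x)
        (integrableOn_regSymp hg hν hc le_rfl x)]
      congr 1
      funext y
      simp
      ring
    rw [e]
    have hν2 : 0 < ν / 2 := by positivity
    have hi : Integrable (fun y => α * K * (|x| * expW ν y + 2 / ν * expW (ν / 2) y)) :=
      (((integrable_expW hν).const_mul _).add ((integrable_expW hν2).const_mul _)).const_mul _
    have h := norm_integral_le_of_norm_le (μ := volume.restrict (Iic x))
      (f := fun y => g y * (Real.exp (α * (y - x)) - 1)) (hi.integrableOn (s := Iic x))
      ((ae_restrict_iff' measurableSet_Iic).2 (.of_forall fun y hy => by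
        have hy' : y ≤ x := hy
        have b1 : |Real.exp (α * (y - x)) - 1| ≤ α * (|x| + |y|) := by
          have c1 : Real.exp (α * (y - x)) ≤ 1 := by
            rw [Real.exp_le_one_iff]; nlinarith
          rw [abs_of_nonpos (by linarith)]
          have c2 := Real.add_one_le_exp (α * (y - x))
          have c3 := mul_le_mul_of_nonneg_left (add_le_add (le_abs_self x) (neg_abs_le y |> fun h =>
            (by linarith : -y ≤ |y|))) hα.le
          linarith
        rw [Real.norm_eq_abs, abs_mul]
        have b2 := mul_le_mul (hg y) b1 (abs_nonneg _) (mul_nonneg hK (expW_pos _ _).le)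
        have b3 := mul_le_mul_of_nonneg_left (abs_mul_expW_le hν y) (mul_nonneg hα.le hK)
        refine b2.trans ?_
        nlinarith))
    refine h.trans ((setIntegral_le_integral hi (.of_forall fun y => ?_)).trans (le_of_eq ?_))
    · have := (expW_pos ν y).le
      have := (expW_pos (ν / 2) y).le
      positivity
    · rw [integral_const_mul, integral_add ((integrable_expW hν).const_mul _)
        ((integrable_expW hν2).const_mul _), integral_const_mul, integral_const_mul,
        integral_expW hν, integral_expW hν2]
      field_simp
  have hν2 : 0 < ν / 2 := by positivity
  have hbound : ∀ x, |g x * (regSymp α g x - regSymp 0 g x)|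
      ≤ α * (K * (2 / ν)) * K * (2 / ν * expW (ν / 2) x + 2 / ν * 2 * expW ν x) := by
    intro x
    rw [abs_mul]
    have hw := (expW_pos ν x).le
    have b1 := mul_le_mul (hg x) (hx2 x) (abs_nonneg _) (mul_nonneg hK hw)
    have b2 := mul_le_mul_of_nonneg_left (abs_mul_expW_le hν x)
      (show 0 ≤ α * (K * (2 / ν)) * K by positivity)
    refine b1.trans ?_
    nlinarith
  have hWi : ∀ β : ℝ, 0 ≤ β → Integrable (fun x => g x * regSymp β g x) := fun β hβ => by
    have hb : ExpBd (2 * K / ν * K) ν (fun x => regSymp β g x * g x) :=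
      hg.mul_bdd (abs_regSymp_le hg hν hβ)
    have := hb.integrable hν ((continuous_regSymp hg hν hc hβ).mul hc)
    simpa [mul_comm] using this
  have h3 := norm_integral_le_of_norm_le (f := fun x => g x * (regSymp α g x - regSymp 0 g x))
    ((((integrable_expW hν2).const_mul (2 / ν)).add
      ((integrable_expW hν).const_mul (2 / ν * 2))).const_mul (α * (K * (2 / ν)) * K))
    (.of_forall hbound)
  simp only [Pi.add_apply] at h3
  rw [integral_const_mul, integral_add ((integrable_expW hν2).const_mul _)
    ((integrable_expW hν).const_mul _), integral_const_mul, integral_const_mul,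
    integral_expW hν, integral_expW hν2, Real.norm_eq_abs] at h3
  simp only [mul_sub] at h3
  rw [integral_sub (hWi α hα.le) (hWi 0 le_rfl), integral_mul_symp hg hν hc] at h3
  have h4 := (abs_le.1 h3).1
  have e : α * (K * (2 / ν)) * K * (2 / ν * (2 / (ν / 2)) + 2 / ν * 2 * (2 / ν))
      ≤ 32 * K ^ 2 / ν ^ 3 * α := by
    apply le_of_eq; field_simp; ring
  linarith

end regSymp

/-! ### Translations -/

lemma integral_shift (F : ℝ → ℝ) (a : ℝ) : ∫ x, F (x + a) = ∫ x, F x :=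
  integral_add_right_eq_self F a

lemma ae_shift {p : ℝ → Prop} (h : ∀ᵐ x, p x) (a : ℝ) : ∀ᵐ x : ℝ, p (x + a) :=
  (measurePreserving_add_right (volume : Measure ℝ) a).quasiMeasurePreserving.ae h

lemma l2_shift (g : ℝ → ℝ) (a : ℝ) : l2 (fun x => g (x + a)) = l2 g := by
  unfold l2
  rw [integral_shift (fun x => g x ^ 2) a]

lemma MemH1.shift {v : ℝ → ℝ} (h : MemH1 v) (a : ℝ) : MemH1 (fun x => v (x + a)) ∧
    weakDeriv (fun x => v (x + a)) =ᵐ[volume] fun x => weakDeriv v (x + a) := by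
  obtain ⟨r, hr, er⟩ := h.exists_primitive
  exact MemH1.weakDeriv_ae_eq (memLp_comp_add h.memLp a) (memLp_comp_add h.memLp_weakDeriv a)
    ((hr.comp_add a).isWeakDeriv.congr ((ae_shift er a).mono fun x hx => hx.symm) .rfl)

/-! ### The constraint functions and the derivatives of the conserved quantities -/

lemma zetaN_eq (Q : ℝ → ℝ → ℝ) (c a x : ℝ) : zetaN Q c a x = zc Q c (x - a) := rfl

lemma zetaTr_eq (Q : ℝ → ℝ → ℝ) (c a x : ℝ) : zetaTr Q c a x = -deriv (Q c) (x - a) := by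
  unfold zetaTr wave
  rw [deriv_comp_sub_const]

/-- The regularized primitive `(∂ₓ + α)⁻¹ ∂_c Q_c` of the normalization vector. -/
def wc (Q : ℝ → ℝ → ℝ) (α c : ℝ) : ℝ → ℝ := regSymp α (zc Q c)

/-- The speed derivative `(∂ₓ + α)⁻¹ ∂_c² Q_c` of `wc`. -/
def wzc (Q : ℝ → ℝ → ℝ) (α c : ℝ) : ℝ → ℝ := regSymp α (zzc Q c)

lemma integral_eq_zero_of_odd {g : ℝ → ℝ} (h : ∀ x, g (-x) = -g x) : ∫ x, g x = 0 := by
  have := integral_neg_eq_self g volume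
  simp only [h, integral_neg] at this
  linarith

namespace IsWaveData

variable {f : ℝ → ℝ} {Q : ℝ → ℝ → ℝ} {S : Set ℝ} {K ν c : ℝ}

lemma q_hasDerivAt (h : IsWaveData f Q S K ν) (hc : c ∈ S) (x : ℝ) :
    HasDerivAt (Q c) (deriv (Q c) x) x := (h.profile c hc).hasDerivAt x

lemma q1_hasDerivAt (h : IsWaveData f Q S K ν) (hc : c ∈ S) (x : ℝ) :
    HasDerivAt (deriv (Q c)) (c * Q c x - f (Q c x)) x := (h.profile c hc).hasDerivAt_deriv x

lemma q_cont (h : IsWaveData f Q S K ν) (hc : c ∈ S) : Continuous (Q c) :=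
  (h.profile c hc).continuous

lemma q1_cont (h : IsWaveData f Q S K ν) (hc : c ∈ S) : Continuous (deriv (Q c)) :=
  (h.profile c hc).continuous_deriv

lemma q2_cont (h : IsWaveData f Q S K ν) (hc : c ∈ S) :
    Continuous (fun x => c * Q c x - f (Q c x)) :=
  (continuous_const.mul (h.q_cont hc)).sub (h.nonlin.continuous.comp (h.q_cont hc))

lemma z_cont (h : IsWaveData f Q S K ν) (hc : c ∈ S) : Continuous (zc Q c) :=
  continuous_of_hasDerivAt (h.z_hasDerivAt c hc)

lemma z1_cont (h : IsWaveData f Q S K ν) (hc : c ∈ S) : Continuous (deriv (zc Q c)) :=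
  continuous_of_hasDerivAt (h.z1_hasDerivAt c hc)

lemma q_memLp (h : IsWaveData f Q S K ν) (hc : c ∈ S) : MemLp (Q c) 2 volume :=
  (h.q_bd c hc).memLp h.nu_pos (h.q_cont hc)

lemma q1_memLp (h : IsWaveData f Q S K ν) (hc : c ∈ S) : MemLp (deriv (Q c)) 2 volume :=
  (h.q1_bd c hc).memLp h.nu_pos (h.q1_cont hc)

lemma z_memLp (h : IsWaveData f Q S K ν) (hc : c ∈ S) : MemLp (zc Q c) 2 volume :=
  (h.z_bd c hc).memLp h.nu_pos (h.z_cont hc)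

lemma z1_memLp (h : IsWaveData f Q S K ν) (hc : c ∈ S) : MemLp (deriv (zc Q c)) 2 volume :=
  (h.z1_bd c hc).memLp h.nu_pos (h.z1_cont hc)

lemma q_memH1 (h : IsWaveData f Q S K ν) (hc : c ∈ S) :
    MemH1 (Q c) ∧ weakDeriv (Q c) =ᵐ[volume] deriv (Q c) :=
  (h.q_bd c hc).memH1 h.nu_pos (h.q1_bd c hc) h.nu_pos (h.q_hasDerivAt hc) (h.q1_cont hc)

/-- `Q'' = c Q - f(Q)` decays like the wave. -/
lemma q2_bd (h : IsWaveData f Q S K ν) {M : ℝ} (hM : NonlinBounds f K M) (hc : c ∈ S) :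
    ExpBd ((K + M) * K) ν (fun x => c * Q c x - f (Q c x)) := fun x => by
  refine (abs_sub _ _).trans ?_
  rw [abs_mul]
  have hq := (h.q_bd c hc).le h.nu_pos.le x
  have a1 := hM.le _ hq
  have a2 : |c| ≤ K := by
    rw [abs_of_pos (h.profile c hc).speed_pos]; exact h.speed_le c hc
  have a3 := mul_le_mul_of_nonneg_right a2 (abs_nonneg (Q c x))
  have a4 := mul_le_mul_of_nonneg_left (h.q_bd c hc x) (add_nonneg h.bound_nonneg hM.nonneg)
  linarith

lemma deriv_f_bd (h : IsWaveData f Q S K ν) {M : ℝ} (hM : NonlinBounds f K M) (hc : c ∈ S) :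
    ExpBd (M * K) ν (fun x => deriv f (Q c x)) := fun x => by
  have := mul_le_mul_of_nonneg_left (h.q_bd c hc x) hM.nonneg
  have h2 := hM.deriv_le _ ((h.q_bd c hc).le h.nu_pos.le x)
  linarith

lemma deriv_f_cont (h : IsWaveData f Q S K ν) (hc : c ∈ S) :
    Continuous (fun x => deriv f (Q c x)) := h.nonlin.continuous_deriv.comp (h.q_cont hc)

lemma q1_sq_pos (h : IsWaveData f Q S K ν) (hc : c ∈ S) : 0 < ∫ x, deriv (Q c) x ^ 2 := by
  refine (integral_pos_iff_support_of_nonneg (fun x => sq_nonneg _)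
    (h.q1_memLp hc).integrable_sq).2 ?_
  refine (IsOpen.measure_pos volume (isOpen_Ioi (a := (0 : ℝ))) ⟨1, mem_Ioi.2 one_pos⟩).trans_le
    (measure_mono fun x hx => ?_)
  exact pow_ne_zero 2 ((h.profile c hc).deriv_ne_zero h.nonlin hx)

lemma q_sq_pos (h : IsWaveData f Q S K ν) (hc : c ∈ S) : 0 < ∫ x, Q c x ^ 2 := by
  refine (integral_pos_iff_support_of_nonneg (fun x => sq_nonneg _)
    (h.q_memLp hc).integrable_sq).2 ?_
  refine (IsOpen.measure_pos volume (isOpen_Ioi (a := (0 : ℝ))) ⟨1, mem_Ioi.2 one_pos⟩).trans_le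
    (measure_mono fun x _ => ?_)
  exact pow_ne_zero 2 ((h.profile c hc).pos x).ne'

/-- The projection fixes the translation mode, whose primitive is `-Q`. -/
lemma anisoSymp_zetaTr (h : IsWaveData f Q S K ν) (hc : c ∈ S) (α a : ℝ) :
    anisoSymp Q α c a (zetaTr Q c a) = fun x => -Q c (x - a) := by
  have h0 : ip (zetaTr Q c a) (zetaTr Q c a) ≠ 0 := by
    unfold ip
    simp only [zetaTr_eq]
    have := integral_shift (fun x => -deriv (Q c) x * -deriv (Q c) x) (-a)
    simp only [← sub_eq_add_neg] at this
    rw [this]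
    have h2 := h.q1_sq_pos hc
    simp only [sq] at h2
    simp only [neg_mul_neg]
    exact h2.ne'
  have hp : projTr Q c a (zetaTr Q c a) = zetaTr Q c a := by
    funext x; rw [projTr, div_self h0, one_mul]
  funext x
  rw [anisoSymp, hp, symp_eq_regSymp]
  have e1 : regSymp α (fun y => zetaTr Q c a y - zetaTr Q c a y) x = 0 := by
    simp [regSymp]
  have e2 : zetaTr Q c a = fun y => -deriv (Q c) (y - a) := funext fun y => zetaTr_eq Q c a y
  rw [e1, add_zero, e2, regSymp_shift 0 a (fun y => -deriv (Q c) y), ← symp_eq_regSymp, symp, integral_neg]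
  have hi := (h.q1_bd c hc).integrable h.nu_pos (h.q1_cont hc)
  have hlim : Tendsto (Q c) atBot (𝓝 0) := by
    have := (h.profile c hc).decay.comp tendsto_neg_atBot_atTop
    exact this.congr fun x => (h.profile c hc).even x
  rw [integral_Iic_of_hasDerivAt_of_tendsto' (fun y _ => h.q_hasDerivAt hc y) hi.integrableOn hlim,
    sub_zero]

/-- By parity the projection kills the normalization mode, so only the regularized primitive acts. -/
lemma anisoSymp_zetaN (h : IsWaveData f Q S K ν) (hc : c ∈ S) (α a : ℝ) :
    anisoSymp Q α c a (zetaN Q c a) = fun x => wc Q α c (x - a) := by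
  have h0 : ip (zetaN Q c a) (zetaTr Q c a) = 0 := by
    unfold ip
    simp only [zetaTr_eq, zetaN_eq]
    have := integral_shift (fun x => zc Q c x * -deriv (Q c) x) (-a)
    simp only [← sub_eq_add_neg] at this
    rw [this]
    apply integral_eq_zero_of_odd
    intro x
    rw [h.z_even c hc, (h.profile c hc).deriv_odd]
    ring
  have hp : projTr Q c a (zetaN Q c a) = fun _ => 0 := by
    funext x; rw [projTr, h0, zero_div, zero_mul]
  funext x
  rw [anisoSymp, hp]
  simp only [sub_zero]
  have e1 : symp (fun _ => 0) x = 0 := by simp [symp]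
  have e2 : zetaN Q c a = fun y => zc Q c (y - a) := rfl
  rw [e1, zero_add, e2, regSymp_shift, wc]

/-- In the moving frame the two constraints are orthogonality to `Q` and to `wc`. -/
lemma isSympOrth_iff (h : IsWaveData f Q S K ν) (hc : c ∈ S) (α a : ℝ) (v : ℝ → ℝ) :
    IsSympOrth Q α c a v ↔
      (∫ x, v (x + a) * Q c x = 0) ∧ ∫ x, v (x + a) * wc Q α c x = 0 := by
  rw [IsSympOrth, h.anisoSymp_zetaTr hc, h.anisoSymp_zetaN hc, ip, ip,
    ← integral_shift (fun x => v x * -Q c (x - a)) a,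
    ← integral_shift (fun x => v x * wc Q α c (x - a)) a]
  simp only [add_sub_cancel_right, mul_neg, integral_neg, neg_eq_zero]

/-- Differentiation under the integral sign with respect to the speed. -/
lemma hasDerivAt_integral_speed (h : IsWaveData f Q S K ν) (hc : c ∈ S) {G : ℝ → ℝ → ℝ}
    {g bd : ℝ → ℝ} (hG : ∀ c' ∈ S, Continuous (G c')) (hGi : Integrable (G c))
    (hg : Continuous g) (hbd : Integrable bd)
    (hl : ∀ c₁ ∈ S, ∀ c₂ ∈ S, ∀ x, |G c₁ x - G c₂ x| ≤ bd x * |c₁ - c₂|)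
    (hd : ∀ x, HasDerivAt (fun c' => G c' x) (g x) c) :
    HasDerivAt (fun c' => ∫ x, G c' x) (∫ x, g x) c :=
  (hasDerivAt_integral_of_dominated_loc_of_lip (bound := bd) (h.isOpen.mem_nhds hc)
    (by filter_upwards [h.isOpen.mem_nhds hc] with c' h' using (hG c' h').aestronglyMeasurable)
    hGi hg.aestronglyMeasurable
    (.of_forall fun y => LipschitzOnWith.of_dist_le_mul fun c₁ h₁ c₂ h₂ => by
      rw [Real.dist_eq, Real.dist_eq]
      refine (hl c₁ h₁ c₂ h₂ y).trans (mul_le_mul_of_nonneg_right ?_ (abs_nonneg _))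
      simpa using le_abs_self (bd y))
    hbd (.of_forall hd)).2

lemma q_sq_lip (h : IsWaveData f Q S K ν) {c₁ c₂ : ℝ} (h₁ : c₁ ∈ S) (h₂ : c₂ ∈ S) (x : ℝ) :
    |Q c₁ x ^ 2 - Q c₂ x ^ 2| ≤ 2 * K * K * expW ν x * |c₁ - c₂| := by
  have e : Q c₁ x ^ 2 - Q c₂ x ^ 2 = (Q c₁ x + Q c₂ x) * (Q c₁ x - Q c₂ x) := by ring
  rw [e, abs_mul]
  have a1 : |Q c₁ x - Q c₂ x| ≤ K * |c₁ - c₂| * expW ν x := h.q_lip c₁ h₁ c₂ h₂ x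
  have a2 : |Q c₁ x + Q c₂ x| ≤ 2 * K := by
    have b1 := (h.q_bd c₁ h₁).le h.nu_pos.le x
    have b2 := (h.q_bd c₂ h₂).le h.nu_pos.le x
    have b3 := abs_add_le (Q c₁ x) (Q c₂ x)
    linarith
  refine (mul_le_mul a2 a1 (abs_nonneg _) (by linarith [h.bound_nonneg])).trans (le_of_eq ?_)
  ring

lemma hasDerivAt_delta (h : IsWaveData f Q S K ν) (hc : c ∈ S) :
    HasDerivAt (delta Q) (∫ x, Q c x * zc Q c x) c := by
  have hw := (integrable_expW h.nu_pos).const_mul (2 * K * K)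
  have := (h.hasDerivAt_integral_speed hc (G := fun c x => Q c x ^ 2)
    (g := fun x => 2 * (Q c x * zc Q c x)) (fun c' h' => (h.q_cont h').pow 2)
    (h.q_memLp hc).integrable_sq
    (continuous_const.mul ((h.q_cont hc).mul (h.z_cont hc))) hw
    (fun c₁ h₁ c₂ h₂ x => h.q_sq_lip h₁ h₂ x) (fun x => by
      refine ((h.q_speed c hc x).fun_pow 2).congr_deriv ?_
      push_cast; ring)).const_mul (1 / 2)
  rw [integral_const_mul] at this
  refine this.congr_deriv ?_
  ring

/-- The Wronskian of `∂_c Q_c` and `Q_c'`. -/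
lemma wronskian (h : IsWaveData f Q S K ν) (hc : c ∈ S) (x : ℝ) :
    deriv (zc Q c) x * deriv (Q c) x - zc Q c x * (c * Q c x - f (Q c x))
      = (1 / 2) * Q c x ^ 2 := by
  set E : ℝ → ℝ := fun x => deriv (zc Q c) x * deriv (Q c) x
    - zc Q c x * (c * Q c x - f (Q c x)) - (1 / 2) * Q c x ^ 2
  have hE : ∀ x, HasDerivAt E 0 x := fun x => by
    have a1 := (h.z1_hasDerivAt c hc x).fun_mul (h.q1_hasDerivAt hc x)
    have a2 := (h.z_hasDerivAt c hc x).fun_mul ((h.profile c hc).hasDerivAt_deriv2 h.nonlin x)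
    have a3 := ((h.q_hasDerivAt hc x).fun_pow 2).const_mul (1 / 2)
    refine ((a1.fun_sub a2).fun_sub a3).congr_deriv ?_
    push_cast
    ring
  have hlim : Tendsto E atTop (𝓝 0) := by
    obtain ⟨M, hM⟩ := h.nonlin.exists_bounds K
    have t1 := (h.q_bd c hc).tendsto_atTop h.nu_pos
    have t2 := (h.q1_bd c hc).tendsto_atTop h.nu_pos
    have t3 := (h.z_bd c hc).tendsto_atTop h.nu_pos
    have t4 := (h.z1_bd c hc).tendsto_atTop h.nu_pos
    have t5 := (h.q2_bd hM hc).tendsto_atTop h.nu_pos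
    simpa using ((t4.mul t2).sub (t3.mul t5)).sub ((t1.pow 2).const_mul (1 / 2))
  have hconst : ∀ y, E y = E x := fun y =>
    is_const_of_deriv_eq_zero (fun z => (hE z).differentiableAt) (fun z => (hE z).deriv) y x
  have h0 : E x = 0 := tendsto_nhds_unique (tendsto_const_nhds.congr fun y => (hconst y).symm) hlim
  simp only [E] at h0
  linarith

lemma integrable_antideriv (h : IsWaveData f Q S K ν) (hc : c ∈ S) :
    Integrable (fun x => antideriv f (Q c x)) := by
  obtain ⟨M, hM⟩ := h.nonlin.exists_bounds K
  refine ((h.q_memLp hc).integrable_sq.const_mul M).mono' ?_ (.of_forall fun x =>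
    h.nonlin.abs_antideriv_le hM ((h.q_bd c hc).le h.nu_pos.le x))
  exact ((continuous_of_hasDerivAt h.nonlin.hasDerivAt_antideriv).comp
    (h.q_cont hc)).aestronglyMeasurable

/-- Along the solitary waves the first integral turns `Λ` into an integral without derivatives. -/
lemma lam_wave (h : IsWaveData f Q S K ν) (hc : c ∈ S) (a : ℝ) :
    lam f c (wave Q c a) = ∫ x, (c * Q c x ^ 2 - 2 * antideriv f (Q c x)) := by
  have hH := (h.q_memH1 hc).1.shift (-a)
  have hw : wave Q c a = fun x => Q c (x + -a) := rfl
  have hd : weakDeriv (wave Q c a) =ᵐ[volume] fun x => deriv (Q c) (x + -a) := by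
    rw [hw]; exact hH.2.trans (ae_shift (h.q_memH1 hc).2 (-a))
  have hi1 := (h.q_memLp hc).integrable_sq
  have hi2 := h.integrable_antideriv hc
  have hi3 := (h.q1_memLp hc).integrable_sq
  have e1 : hamiltonian f (fun _ => 0) (wave Q c a)
      = ∫ x, ((1 / 2) * deriv (Q c) x ^ 2 - antideriv f (Q c x)) := by
    rw [← integral_shift (fun x => (1 / 2) * deriv (Q c) x ^ 2 - antideriv f (Q c x)) (-a)]
    refine integral_congr_ae ?_
    filter_upwards [hd] with x hx
    rw [hx, hw]
    ring
  have e2 : momentum (wave Q c a) = (1 / 2) * ∫ x, Q c x ^ 2 := by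
    rw [← integral_shift (fun x => Q c x ^ 2) (-a)]
    rfl
  have i1 : Integrable (fun x => (1 / 2) * deriv (Q c) x ^ 2 - antideriv f (Q c x)) :=
    (hi3.const_mul _).sub hi2
  rw [lam, e1, e2, ← integral_const_mul, ← integral_const_mul,
    ← integral_add i1 ((hi1.const_mul _).const_mul _)]
  congr 1
  funext x
  rw [(h.profile c hc).first_integral h.nonlin]
  ring

/-- `dΛ_c(Q_c)/dc = P(Q_c)`, as `Q_c` is a critical point of `Λ_c`. -/
lemma hasDerivAt_lam (h : IsWaveData f Q S K ν) (hc : c ∈ S) :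
    HasDerivAt (fun c' => ∫ x, (c' * Q c' x ^ 2 - 2 * antideriv f (Q c' x)))
      ((1 / 2) * ∫ x, Q c x ^ 2) c := by
  obtain ⟨M, hM⟩ := h.nonlin.exists_bounds K
  have hK := h.bound_nonneg
  have hM0 := hM.nonneg
  have hFc : Continuous (antideriv f) := continuous_of_hasDerivAt h.nonlin.hasDerivAt_antideriv
  have hw := (integrable_expW h.nu_pos).const_mul (K * K + K * (2 * K * K) + 2 * (M * K * K))
  have hwm := h.hasDerivAt_integral_speed hc
    (G := fun c' x => c' * Q c' x ^ 2 - 2 * antideriv f (Q c' x))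
    (g := fun x => Q c x ^ 2 + 2 * (zc Q c x * (c * Q c x - f (Q c x))))
    (fun c' h' => (continuous_const.mul ((h.q_cont h').pow 2)).sub
      (continuous_const.mul (hFc.comp (h.q_cont h'))))
    (((h.q_memLp hc).integrable_sq.const_mul c).sub ((h.integrable_antideriv hc).const_mul 2))
    (((h.q_cont hc).pow 2).add (continuous_const.mul ((h.z_cont hc).mul (h.q2_cont hc)))) hw
    (fun c₁ h₁ c₂ h₂ x => by
      have e : c₁ * Q c₁ x ^ 2 - 2 * antideriv f (Q c₁ x)
          - (c₂ * Q c₂ x ^ 2 - 2 * antideriv f (Q c₂ x))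
          = (c₁ - c₂) * Q c₁ x ^ 2 + c₂ * (Q c₁ x ^ 2 - Q c₂ x ^ 2)
            - 2 * (antideriv f (Q c₁ x) - antideriv f (Q c₂ x)) := by ring
      rw [e]
      have hE := (expW_pos ν x).le
      have q1 := (h.q_bd c₁ h₁).le h.nu_pos.le x
      have q2 := (h.q_bd c₂ h₂).le h.nu_pos.le x
      have b1 : |(c₁ - c₂) * Q c₁ x ^ 2| ≤ |c₁ - c₂| * (K * (K * expW ν x)) := by
        rw [abs_mul, abs_pow, sq]
        exact mul_le_mul_of_nonneg_left (mul_le_mul q1 (h.q_bd c₁ h₁ x) (abs_nonneg _) hK)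
          (abs_nonneg _)
      have b2 : |c₂ * (Q c₁ x ^ 2 - Q c₂ x ^ 2)| ≤ K * (2 * K * K * expW ν x * |c₁ - c₂|) := by
        rw [abs_mul, abs_of_pos (h.profile c₂ h₂).speed_pos]
        exact mul_le_mul (h.speed_le c₂ h₂) (h.q_sq_lip h₁ h₂ x) (abs_nonneg _) hK
      have b3 : |antideriv f (Q c₁ x) - antideriv f (Q c₂ x)|
          ≤ M * K * (K * |c₁ - c₂| * expW ν x) := by
        have := (convex_Icc (-K) K).norm_image_sub_le_of_norm_hasDerivWithin_le
          (fun y _ => (h.nonlin.hasDerivAt_antideriv y).hasDerivWithinAt) (fun y hy => by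
            have hy' : |y| ≤ K := abs_le.2 hy
            exact (hM.le y hy').trans (mul_le_mul_of_nonneg_left hy' hM0))
          (abs_le.1 q2) (abs_le.1 q1)
        refine this.trans (mul_le_mul_of_nonneg_left (h.q_lip c₁ h₁ c₂ h₂ x) (by positivity))
      have b4 := abs_sub ((c₁ - c₂) * Q c₁ x ^ 2 + c₂ * (Q c₁ x ^ 2 - Q c₂ x ^ 2))
        (2 * (antideriv f (Q c₁ x) - antideriv f (Q c₂ x)))
      have b5 := abs_add_le ((c₁ - c₂) * Q c₁ x ^ 2) (c₂ * (Q c₁ x ^ 2 - Q c₂ x ^ 2))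
      rw [abs_mul 2, abs_two] at b4
      linarith)
    (fun x => by
      refine (((hasDerivAt_id' c).fun_mul ((h.q_speed c hc x).fun_pow 2)).fun_sub
        (((h.nonlin.hasDerivAt_antideriv _).comp c (h.q_speed c hc x)).const_mul 2)).congr_deriv ?_
      push_cast
      ring)
  refine hwm.congr_deriv ?_
  -- `∫ z Q'' = -∫ z' Q'` and the Wronskian identity give `∫ z Q'' = -(1/4) ∫ Q²`
  have i1 := (h.q_memLp hc).integrable_sq
  have i2 : Integrable (fun x => zc Q c x * (c * Q c x - f (Q c x))) :=
    integrable_mul_of_memLp (h.z_memLp hc) ((h.q2_bd hM hc).memLp h.nu_pos (h.q2_cont hc))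
  have i3 : Integrable (fun x => deriv (zc Q c) x * deriv (Q c) x) :=
    integrable_mul_of_memLp (h.z1_memLp hc) (h.q1_memLp hc)
  have ibp : ∫ x, (deriv (zc Q c) x * deriv (Q c) x + zc Q c x * (c * Q c x - f (Q c x))) = 0 := by
    refine integral_eq_zero_of_hasDerivAt_of_integrable (f := fun x => zc Q c x * deriv (Q c) x)
      (fun x => (h.z_hasDerivAt c hc x).fun_mul (h.q1_hasDerivAt hc x)) (i3.add i2)
      (integrable_mul_of_memLp (h.z_memLp hc) (h.q1_memLp hc))
  have wr : ∫ x, (deriv (zc Q c) x * deriv (Q c) x - zc Q c x * (c * Q c x - f (Q c x)))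
      = ∫ x, (1 / 2) * Q c x ^ 2 := by
    congr 1; funext x; exact h.wronskian hc x
  rw [integral_add i3 i2] at ibp
  rw [integral_sub i3 i2, integral_const_mul] at wr
  rw [integral_add i1 (i2.const_mul 2), integral_const_mul]
  linarith

end IsWaveData

/-! ### A weighted estimate on the half-line -/

lemma ac_of_hasDerivAt {g g' : ℝ → ℝ} {a b : ℝ} (hg : ∀ x ∈ uIcc a b, HasDerivAt g (g' x) x)
    (hc : ContinuousOn g' (uIcc a b)) : AbsolutelyContinuousOnInterval g a b := by
  obtain ⟨C, hC⟩ := isCompact_uIcc.exists_bound_of_continuousOn hc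
  have : LipschitzOnWith (Real.nnabs C) g (uIcc a b) :=
    (convex_uIcc a b).lipschitzOnWith_of_nnnorm_hasDerivWithin_le
      (fun x hx => (hg x hx).hasDerivWithinAt) (fun x hx => by
        rw [← NNReal.coe_le_coe]
        simpa using (hC x hx).trans (le_abs_self C))
  exact this.absolutelyContinuousOnInterval

/-- The Cauchy–Schwarz inequality for the mean of a function on an interval. -/
lemma sq_intervalIntegral_le {G : ℝ → ℝ} {x y : ℝ} (hxy : x ≤ y)
    (h1 : IntervalIntegrable G volume x y) (h2 : IntervalIntegrable (fun s => G s ^ 2) volume x y) :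
    (∫ s in x..y, G s) ^ 2 ≤ (y - x) * ∫ s in x..y, G s ^ 2 := by
  rcases hxy.eq_or_lt with rfl | hlt
  · simp
  have hp : 0 < y - x := sub_pos.2 hlt
  set m := (∫ s in x..y, G s) / (y - x)
  have h0 : 0 ≤ ∫ s in x..y, (G s - m) ^ 2 :=
    intervalIntegral.integral_nonneg hxy fun s _ => sq_nonneg _
  have e : ∫ s in x..y, (G s - m) ^ 2
      = (∫ s in x..y, G s ^ 2) - 2 * m * (∫ s in x..y, G s) + (y - x) * m ^ 2 := by
    have : (fun s => (G s - m) ^ 2) = fun s => G s ^ 2 - (2 * m) * G s + m ^ 2 := by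
      funext s; ring
    rw [this, intervalIntegral.integral_add (h2.sub (h1.const_mul _)) intervalIntegrable_const,
      intervalIntegral.integral_sub h2 (h1.const_mul _), intervalIntegral.integral_const_mul,
      intervalIntegral.integral_const, smul_eq_mul]
  have hm : m * (y - x) = ∫ s in x..y, G s := div_mul_cancel₀ _ hp.ne'
  rw [e, ← hm] at h0
  rw [← hm]
  nlinarith

/-- A function `p` that is negative on the half-line, has a simple zero at the origin, solves
`p'' = V p` and whose logarithmic derivative is asymptotically between two negative constants. -/
structure IsGroundState (p p₂ V : ℝ → ℝ) (X μ Λ : ℝ) : Prop where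
  hasDerivAt : ∀ x, HasDerivAt p (p₂ x) x
  hasDerivAt' : ∀ x, HasDerivAt p₂ (V x * p x) x
  V_cont : Continuous V
  V_bdd : ∃ B, ∀ x, |V x| ≤ B
  neg : ∀ x, 0 < x → p x < 0
  zero : p 0 = 0
  simple : p₂ 0 ≠ 0
  cut_pos : 0 < X
  rate_pos : 0 < μ
  log_deriv_le : ∀ x, X ≤ x → p₂ x / p x ≤ -μ
  log_deriv_ge : ∀ x, X ≤ x → -Λ ≤ p₂ x / p x

namespace IsGroundState

variable {p p₂ V : ℝ → ℝ} {X μ Λ : ℝ}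

/-- Near its simple zero the ground state is comparable with `x`. -/
lemma exists_linear_bounds (h : IsGroundState p p₂ V X μ Λ) :
    ∃ k C, 0 < k ∧ 0 < C ∧ ∀ x, 0 < x → x ≤ X → k * x ≤ |p x| ∧ |p x| ≤ C * x ∧ |p₂ x| ≤ C := by
  have hpc : Continuous p := continuous_of_hasDerivAt h.hasDerivAt
  have hp2c : Continuous p₂ := continuous_of_hasDerivAt h.hasDerivAt'
  have hd : Continuous (dslope p 0) := by
    rw [continuous_iff_continuousAt]
    intro x
    by_cases hx : x = 0
    · rw [hx, continuousAt_dslope_same]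
      exact (h.hasDerivAt 0).differentiableAt
    · exact (continuousAt_dslope_of_ne hx).2 hpc.continuousAt
  have hval : ∀ x, 0 < x → dslope p 0 x = p x / x := fun x hx => by
    rw [dslope_of_ne _ hx.ne', slope_def_field, h.zero, sub_zero, sub_zero]
  have hne : ∀ x ∈ Icc 0 X, dslope p 0 x ≠ 0 := fun x hx => by
    rcases hx.1.eq_or_lt with rfl | h0
    · rw [dslope_same, (h.hasDerivAt 0).deriv]; exact h.simple
    · rw [hval x h0]; exact div_ne_zero (h.neg x h0).ne h0.ne'
  obtain ⟨y, hy, hmin⟩ := (isCompact_Icc (a := 0) (b := X)).exists_isMinOn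
    ⟨0, le_rfl, h.cut_pos.le⟩ hd.abs.continuousOn
  obtain ⟨C₁, hC₁⟩ := (isCompact_Icc (a := 0) (b := X)).exists_bound_of_continuousOn
    hd.continuousOn
  obtain ⟨C₂, hC₂⟩ := (isCompact_Icc (a := 0) (b := X)).exists_bound_of_continuousOn
    hp2c.continuousOn
  refine ⟨|dslope p 0 y|, max (max C₁ C₂) 1, abs_pos.2 (hne y hy), by positivity,
    fun x hx hxX => ⟨?_, ?_, ?_⟩⟩
  · have : |dslope p 0 y| ≤ |dslope p 0 x| := hmin ⟨hx.le, hxX⟩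
    rw [hval x hx, abs_div, abs_of_pos hx, le_div_iff₀ hx] at this
    exact this
  · have : |dslope p 0 x| ≤ C₁ := hC₁ x ⟨hx.le, hxX⟩
    rw [hval x hx, abs_div, abs_of_pos hx, div_le_iff₀ hx] at this
    exact this.trans (mul_le_mul_of_nonneg_right ((le_max_left _ _).trans (le_max_left _ _)) hx.le)
  · exact (hC₂ x ⟨hx.le, hxX⟩).trans ((le_max_right _ _).trans (le_max_left _ _))

variable {r w : ℝ → ℝ}

/-- Jacobi's identity: completing the square with the logarithmic derivative of the ground
state. -/
lemma jacobi (h : IsGroundState p p₂ V X μ Λ) (hr : IsPrimitive r w)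
    (hrm : MemLp r 2 volume) (hwm : MemLp w 2 volume) {a b : ℝ} (ha : 0 < a) (hab : a ≤ b) :
    IntervalIntegrable (fun x => (w x - p₂ x / p x * r x) ^ 2) volume a b ∧
    ∫ x in a..b, (w x - p₂ x / p x * r x) ^ 2
      = (∫ x in a..b, (w x ^ 2 + V x * r x ^ 2))
        - (p₂ b / p b * r b ^ 2 - p₂ a / p a * r a ^ 2) := by
  obtain ⟨B, hB⟩ := h.V_bdd
  have hpos : ∀ x ∈ uIcc a b, 0 < x := fun x hx => by
    rw [uIcc_of_le hab] at hx; exact ha.trans_le hx.1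
  have hpc : Continuous p := continuous_of_hasDerivAt h.hasDerivAt
  have hp2c : Continuous p₂ := continuous_of_hasDerivAt h.hasDerivAt'
  have hh : ∀ x, 0 < x → HasDerivAt (fun x => p₂ x / p x) (V x - (p₂ x / p x) ^ 2) x := by
    intro x hx
    have hne := (h.neg x hx).ne
    refine ((h.hasDerivAt' x).fun_div (h.hasDerivAt x) hne).congr_deriv ?_
    field_simp
  have hhc : ContinuousOn (fun x => V x - (p₂ x / p x) ^ 2) (uIcc a b) :=
    h.V_cont.continuousOn.sub ((hp2c.continuousOn.div hpc.continuousOn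
      fun x hx => (h.neg x (hpos x hx)).ne).pow 2)
  have hac : AbsolutelyContinuousOnInterval (fun x => p₂ x / p x * (r x * r x)) a b :=
    (ac_of_hasDerivAt (fun x hx => hh x (hpos x hx)) hhc).fun_mul ((hr.ac a b).fun_mul (hr.ac a b))
  obtain ⟨i1, e1⟩ := ac_integral_eq (g' := fun x => (V x - (p₂ x / p x) ^ 2) * (r x * r x)
      + p₂ x / p x * (w x * r x + r x * w x)) hac (by
    filter_upwards [hr.ae_hasDerivAt] with x hx hxab
    exact (hh x (hpos x hxab)).fun_mul (hx.fun_mul hx))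
  have i2 : IntervalIntegrable (fun x => w x ^ 2 + V x * r x ^ 2) volume a b :=
    (hwm.integrable_sq.add (hrm.integrable_sq.bdd_mul h.V_cont.aestronglyMeasurable
      (.of_forall hB))).intervalIntegrable
  have e2 : (fun x => (w x - p₂ x / p x * r x) ^ 2) = fun x => (w x ^ 2 + V x * r x ^ 2)
      - ((V x - (p₂ x / p x) ^ 2) * (r x * r x) + p₂ x / p x * (w x * r x + r x * w x)) := by
    funext x; ring
  rw [e2]
  refine ⟨i2.sub i1, ?_⟩
  rw [intervalIntegral.integral_sub i2 i1, e1]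
  ring

/-- The boundary terms of Jacobi's identity disappear: at infinity because the logarithmic derivative
of `p` is bounded below, and at the origin because `r(ε)² = o(ε)` while `p₂ / p` is of order `1 / ε`. -/
lemma integral_sq_le (h : IsGroundState p p₂ V X μ Λ) (hr : IsPrimitive r w)
    (hrm : MemLp r 2 volume) (hwm : MemLp w 2 volume) (hr0 : r 0 = 0) {a b : ℝ} (ha : 0 < a)
    (hab : a ≤ b) :
    ∫ x in a..b, (w x - p₂ x / p x * r x) ^ 2 ≤ ∫ x in Ioi 0, (w x ^ 2 + V x * r x ^ 2) := by
  obtain ⟨B, hB⟩ := h.V_bdd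
  have hi : Integrable (fun x => w x ^ 2 + V x * r x ^ 2) :=
    hwm.integrable_sq.add (hrm.integrable_sq.bdd_mul h.V_cont.aestronglyMeasurable
      (.of_forall hB))
  -- letting the right endpoint tend to infinity
  have step1 : ∀ ε, 0 < ε → ε ≤ a → ∫ x in a..b, (w x - p₂ x / p x * r x) ^ 2
      ≤ (∫ x in Ioi ε, (w x ^ 2 + V x * r x ^ 2)) + p₂ ε / p ε * r ε ^ 2 := by
    intro ε hε hεa
    have t1 := intervalIntegral_tendsto_integral_Ioi ε (hi.integrableOn (s := Ioi ε)) tendsto_id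
    have t2 : Tendsto (fun R => Λ * r R ^ 2) atTop (𝓝 0) := by
      simpa using ((hr.tendsto_atTop hrm hwm).pow 2).const_mul Λ
    have t3 := (t1.add t2).add_const (p₂ ε / p ε * r ε ^ 2)
    rw [add_zero] at t3
    refine ge_of_tendsto t3 ?_
    filter_upwards [eventually_ge_atTop (max b X)] with R hR
    have hbR : b ≤ R := (le_max_left _ _).trans hR
    have hεR : ε ≤ R := hεa.trans (hab.trans hbR)
    obtain ⟨j1, j2⟩ := h.jacobi hr hrm hwm hε hεR
    have m1 : ∫ x in a..b, (w x - p₂ x / p x * r x) ^ 2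
        ≤ ∫ x in ε..R, (w x - p₂ x / p x * r x) ^ 2 :=
      intervalIntegral.integral_mono_interval hεa hab hbR (.of_forall fun x => sq_nonneg _) j1
    have m2 := mul_le_mul_of_nonneg_right (h.log_deriv_ge R ((le_max_right _ _).trans hR))
      (sq_nonneg (r R))
    rw [j2] at m1
    simp only [id]
    linarith
  -- letting the left endpoint tend to zero: `r(ε)² ≤ ε ∫₀^ε w²`, and `p₂ / p` is of size `1/ε`
  obtain ⟨k, C, hk, hC, hkC⟩ := h.exists_linear_bounds
  have hN : Continuous (fun ε => ∫ x in (0 : ℝ)..ε, w x ^ 2) :=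
    intervalIntegral.continuous_primitive (fun a b => hwm.integrable_sq.intervalIntegrable) 0
  have hJ : Continuous (fun ε => ∫ x in (0 : ℝ)..ε, (w x ^ 2 + V x * r x ^ 2)) :=
    intervalIntegral.continuous_primitive (fun a b => hi.intervalIntegrable) 0
  have t4 : Tendsto (fun ε => ((∫ x in Ioi 0, (w x ^ 2 + V x * r x ^ 2))
      - ∫ x in (0 : ℝ)..ε, (w x ^ 2 + V x * r x ^ 2)) + C / k * ∫ x in (0 : ℝ)..ε, w x ^ 2)
      (𝓝[>] 0) (𝓝 (∫ x in Ioi 0, (w x ^ 2 + V x * r x ^ 2))) := by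
    have := ((hJ.tendsto 0).const_sub (∫ x in Ioi 0, (w x ^ 2 + V x * r x ^ 2))).add
      ((hN.tendsto 0).const_mul (C / k))
    simp only [intervalIntegral.integral_same, sub_zero, mul_zero, add_zero] at this
    exact this.mono_left nhdsWithin_le_nhds
  refine ge_of_tendsto t4 ?_
  filter_upwards [Ioc_mem_nhdsGT (lt_min ha h.cut_pos)] with ε hε
  have hεa : ε ≤ a := hε.2.trans (min_le_left _ _)
  have hεX : ε ≤ X := hε.2.trans (min_le_right _ _)
  refine (step1 ε hε.1 hεa).trans ?_
  have e1 := intervalIntegral.integral_Ioi_sub_Ioi (hi.integrableOn (s := Ioi 0)) hε.1.le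
  have e2 : r ε ^ 2 ≤ ε * ∫ x in (0 : ℝ)..ε, w x ^ 2 := by
    have := sq_intervalIntegral_le hε.1.le (intervalIntegrable_of_locallyIntegrable hr.locInt 0 ε)
      hwm.integrable_sq.intervalIntegrable
    rw [← hr.sub_eq, hr0, sub_zero, sub_zero] at this
    exact this
  obtain ⟨b1, -, b3⟩ := hkC ε hε.1 hεX
  have e3 : p₂ ε / p ε ≤ C / (k * ε) := by
    refine (le_abs_self _).trans ?_
    rw [abs_div]
    exact div_le_div₀ hC.le b3 (mul_pos hk hε.1) b1
  have e4 : p₂ ε / p ε * r ε ^ 2 ≤ C / k * ∫ x in (0 : ℝ)..ε, w x ^ 2 := by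
    have hn : 0 ≤ ∫ x in (0 : ℝ)..ε, w x ^ 2 :=
      intervalIntegral.integral_nonneg hε.1.le fun x _ => sq_nonneg _
    calc p₂ ε / p ε * r ε ^ 2 ≤ C / (k * ε) * (ε * ∫ x in (0 : ℝ)..ε, w x ^ 2) :=
          mul_le_mul e3 e2 (sq_nonneg _) (div_nonneg hC.le (mul_pos hk hε.1).le)
      _ = _ := by
        have := hε.1.ne'
        field_simp
  linarith

/-- On functions vanishing at the origin the quadratic form of `-∂ₓ² + V` on the half-line is
nonnegative, and it controls the distance to the multiples of the ground state. -/
lemma exists_gap (h : IsGroundState p p₂ V X μ Λ) : ∃ C, 0 ≤ C ∧ ∀ r w : ℝ → ℝ,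
    IsPrimitive r w → MemLp r 2 volume → MemLp w 2 volume → r 0 = 0 →
    ∃ κ : ℝ, ∫ x in Ioi 0, (r x - κ * p x) ^ 2 ≤ C * ∫ x in Ioi 0, (w x ^ 2 + V x * r x ^ 2) := by
  obtain ⟨k, C, hk, hC, hkC⟩ := h.exists_linear_bounds
  have hX := h.cut_pos
  have hμ := h.rate_pos
  refine ⟨(C / k) ^ 2 * X * X + 1 / μ ^ 2, by positivity, fun r w hr hrm hwm hr0 => ?_⟩
  have key := fun a b (ha : 0 < a) (hab : a ≤ b) => h.integral_sq_le hr hrm hwm hr0 ha hab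
  set B := ∫ x in Ioi 0, (w x ^ 2 + V x * r x ^ 2)
  have hB : 0 ≤ B := by
    have := key 1 1 one_pos le_rfl
    simpa using this
  have hpX := (h.neg X hX).ne
  set κ := r X / p X
  have hpp : IsPrimitive p p₂ := .of_hasDerivAt h.hasDerivAt (continuous_of_hasDerivAt h.hasDerivAt')
  set ρ : ℝ → ℝ := fun x => r x + -κ * p x
  have hρp : IsPrimitive ρ (fun x => w x + -κ * p₂ x) := hr.add (hpp.const_mul (-κ))
  have hρX : ρ X = 0 := by simp only [ρ, κ]; field_simp; ring
  have hρc : Continuous ρ := hρp.continuous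
  have hg : ∀ x, 0 < x → w x + -κ * p₂ x = p₂ x / p x * ρ x + (w x - p₂ x / p x * r x) := by
    intro x hx
    have := (h.neg x hx).ne
    simp only [ρ]
    field_simp
    ring
  -- beyond `X`, by an energy estimate
  have far : ∀ R, X ≤ R → ∫ x in X..R, ρ x ^ 2 ≤ B / μ ^ 2 := by
    intro R hXR
    obtain ⟨i1, e1⟩ := hρp.integral_mul hρp X R
    rw [hρX, zero_mul, sub_zero] at e1
    have j := (h.jacobi hr hrm hwm hX hXR).1
    have jr : IntervalIntegrable (fun x => ρ x ^ 2) volume X R :=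
      (hρc.pow 2).intervalIntegrable _ _
    have m : ∫ x in X..R, ((w x + -κ * p₂ x) * ρ x + ρ x * (w x + -κ * p₂ x))
        ≤ ∫ x in X..R, (-μ * ρ x ^ 2 + 1 / μ * (w x - p₂ x / p x * r x) ^ 2) := by
      refine intervalIntegral.integral_mono_on hXR i1 ((jr.const_mul _).add (j.const_mul _))
        fun x hx => ?_
      have hx0 : 0 < x := hX.trans_le hx.1
      rw [hg x hx0]
      set g := w x - p₂ x / p x * r x
      have l1 := mul_le_mul_of_nonneg_right (h.log_deriv_le x hx.1) (sq_nonneg (ρ x))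
      have l2 : 2 * (ρ x * g) ≤ μ * ρ x ^ 2 + 1 / μ * g ^ 2 := by
        have : 0 ≤ (1 / μ) * (μ * ρ x - g) ^ 2 := by positivity
        have e : (1 / μ) * (μ * ρ x - g) ^ 2 = μ * ρ x ^ 2 + 1 / μ * g ^ 2 - 2 * (ρ x * g) := by
          field_simp; ring
        linarith
      linarith
    rw [intervalIntegral.integral_add (jr.const_mul _) (j.const_mul _),
      intervalIntegral.integral_const_mul, intervalIntegral.integral_const_mul, e1] at m
    have l3 := mul_le_mul_of_nonneg_left (key X R hX hXR) (one_div_pos.2 hμ).le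
    have l4 := mul_self_nonneg (ρ R)
    rw [le_div_iff₀ (by positivity)]
    have l5 : μ * (∫ x in X..R, ρ x ^ 2) ≤ 1 / μ * B := by linarith
    have l6 := mul_le_mul_of_nonneg_left l5 hμ.le
    have l7 : μ * (1 / μ * B) = B := by field_simp
    nlinarith
  -- near the origin, from the variation of constants formula
  have near : ∀ x, 0 < x → x ≤ X → ρ x ^ 2 ≤ (C / k) ^ 2 * X * B := by
    intro x hx hxX
    have hpos : ∀ y ∈ uIcc x X, 0 < y := fun y hy => by
      rw [uIcc_of_le hxX] at hy; exact hx.trans_le hy.1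
    have hpc : Continuous p := continuous_of_hasDerivAt h.hasDerivAt
    have hp2c : Continuous p₂ := continuous_of_hasDerivAt h.hasDerivAt'
    have hinv : ∀ y ∈ uIcc x X, HasDerivAt (fun y => (p y)⁻¹) (-p₂ y / p y ^ 2) y := fun y hy =>
      (h.hasDerivAt y).fun_inv (h.neg y (hpos y hy)).ne
    have hinvc : ContinuousOn (fun y => -p₂ y / p y ^ 2) (uIcc x X) :=
      hp2c.neg.continuousOn.div (hpc.pow 2).continuousOn
        fun y hy => pow_ne_zero 2 (h.neg y (hpos y hy)).ne
    obtain ⟨i1, e1⟩ := ac_integral_eq (g := fun y => ρ y * (p y)⁻¹)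
      (g' := fun y => (w y - p₂ y / p y * r y) / p y)
      ((hρp.ac x X).fun_mul (ac_of_hasDerivAt hinv hinvc)) (by
        filter_upwards [hρp.ae_hasDerivAt] with y hy hyab
        refine (hy.fun_mul (hinv y hyab)).congr_deriv ?_
        rw [hg y (hpos y hyab)]
        have := (h.neg y (hpos y hyab)).ne
        field_simp
        ring)
    have hpx := (h.neg x hx).ne
    have j := (h.jacobi hr hrm hwm hx hxX).1
    have lowp : ∀ y ∈ uIcc x X, (k / C) ^ 2 * p x ^ 2 ≤ p y ^ 2 := by
      intro y hy
      have hy' := hy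
      rw [uIcc_of_le hxX] at hy'
      obtain ⟨-, b2, -⟩ := hkC x hx hxX
      obtain ⟨b1, -, -⟩ := hkC y (hpos y hy) hy'.2
      have : k / C * |p x| ≤ |p y| := by
        calc k / C * |p x| ≤ k / C * (C * x) := by gcongr
          _ = k * x := by field_simp
          _ ≤ k * y := by gcongr; exact hy'.1
          _ ≤ |p y| := b1
      have h2 := pow_le_pow_left₀ (by positivity) this 2
      rwa [mul_pow, sq_abs, sq_abs] at h2
    have hm : 0 < (k / C) ^ 2 * p x ^ 2 := by positivity
    have i2 : IntervalIntegrable (fun y => ((w y - p₂ y / p y * r y) / p y) ^ 2) volume x X := by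
      have hc2 : ContinuousOn (fun y => (p y ^ 2)⁻¹) (uIcc x X) :=
        (hpc.pow 2).continuousOn.inv₀ fun y hy => pow_ne_zero 2 (h.neg y (hpos y hy)).ne
      have := j.mul_continuousOn hc2
      refine this.congr (fun y _ => ?_)
      rw [div_pow, div_eq_mul_inv (_ ^ 2)]
    have cs := sq_intervalIntegral_le hxX i1 i2
    rw [e1, hρX, zero_mul, zero_sub] at cs
    have m : ∫ y in x..X, ((w y - p₂ y / p y * r y) / p y) ^ 2
        ≤ ∫ y in x..X, ((k / C) ^ 2 * p x ^ 2)⁻¹ * (w y - p₂ y / p y * r y) ^ 2 := by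
      refine intervalIntegral.integral_mono_on hxX i2 (j.const_mul _) fun y hy => ?_
      rw [div_pow, div_eq_mul_inv, mul_comm]
      refine mul_le_mul_of_nonneg_right ?_ (sq_nonneg _)
      exact inv_anti₀ hm (lowp y (by rwa [uIcc_of_le hxX]))
    rw [intervalIntegral.integral_const_mul] at m
    have m2 := mul_le_mul_of_nonneg_left (key x X hx hxX) (inv_pos.2 hm).le
    have m3 : (X - x) * ∫ y in x..X, ((w y - p₂ y / p y * r y) / p y) ^ 2
        ≤ X * (((k / C) ^ 2 * p x ^ 2)⁻¹ * B) := by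
      refine mul_le_mul (by linarith) (m.trans m2) ?_ hX.le
      exact intervalIntegral.integral_nonneg hxX fun y _ => sq_nonneg _
    have m4 := cs.trans m3
    have e5 : (-(ρ x * (p x)⁻¹)) ^ 2 = ρ x ^ 2 / p x ^ 2 := by
      rw [neg_sq, mul_pow, inv_pow, div_eq_mul_inv]
    rw [e5, div_le_iff₀ (by positivity)] at m4
    refine m4.trans (le_of_eq ?_)
    field_simp
  refine ⟨κ, ?_⟩
  have e : (fun x => (r x - κ * p x) ^ 2) = fun x => ρ x ^ 2 := by
    funext x; simp only [ρ]; ring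
  rw [e]
  have tot : ∀ R, X ≤ R → ∫ x in (0 : ℝ)..R, ρ x ^ 2
      ≤ ((C / k) ^ 2 * X * X + 1 / μ ^ 2) * B := by
    intro R hXR
    have jr : ∀ a b, IntervalIntegrable (fun x => ρ x ^ 2) volume a b := fun a b =>
      (hρc.pow 2).intervalIntegrable _ _
    rw [← intervalIntegral.integral_add_adjacent_intervals (jr 0 X) (jr X R)]
    have n1 : ∫ x in (0 : ℝ)..X, ρ x ^ 2 ≤ ∫ _ in (0 : ℝ)..X, (C / k) ^ 2 * X * B := by
      refine intervalIntegral.integral_mono_on_of_le_Ioo hX.le (jr 0 X) intervalIntegrable_const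
        fun x hx => near x hx.1 hx.2.le
    rw [intervalIntegral.integral_const, smul_eq_mul, sub_zero] at n1
    have n2 := far R hXR
    have n3 : B / μ ^ 2 = 1 / μ ^ 2 * B := by ring
    rw [n3] at n2
    linarith
  by_cases hint : IntegrableOn (fun x => ρ x ^ 2) (Ioi 0)
  · have t := intervalIntegral_tendsto_integral_Ioi 0 hint tendsto_id
    refine le_of_tendsto t ?_
    filter_upwards [eventually_ge_atTop X] with R hR using tot R hR
  · rw [integral_undef hint]
    positivity

end IsGroundState

/-! ### Coercivity of the Hessian up to two directions -/

lemma sq_integral_mul_le {g h : ℝ → ℝ} (hg : MemLp g 2 volume) (hh : MemLp h 2 volume) :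
    (∫ x, g x * h x) ^ 2 ≤ (∫ x, g x ^ 2) * ∫ x, h x ^ 2 := by
  have h1 := abs_integral_mul_le hg hh
  have h2 := sq_le_sq' (by linarith [(abs_le.1 h1).1]) (abs_le.1 h1).2
  rwa [mul_pow, l2_sq, l2_sq] at h2

lemma four_sq_le (a b c d : ℝ) :
    (a + b + c - d) ^ 2 ≤ 4 * (a ^ 2 + b ^ 2 + c ^ 2 + d ^ 2) := by
  nlinarith [sq_nonneg (a - b), sq_nonneg (a - c), sq_nonneg (a + d),
      sq_nonneg (b - c), sq_nonneg (b + d), sq_nonneg (c + d)]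

lemma three_sq_le (a b c : ℝ) : (a - (b + c)) ^ 2 ≤ 3 * (a ^ 2 + b ^ 2 + c ^ 2) := by
  nlinarith [sq_nonneg (a + b), sq_nonneg (a + c), sq_nonneg (b - c)]

lemma two_sq_le (a b : ℝ) : (a - b) ^ 2 ≤ 2 * (a ^ 2 + b ^ 2) := by
  nlinarith [sq_nonneg (a + b)]

lemma integral_sq_comb_le {p e z r : ℝ → ℝ} (hp : MemLp p 2 volume) (he : MemLp e 2 volume)
    (hz : MemLp z 2 volume) (hr : MemLp r 2 volume) (σ τ t : ℝ)
    (h : ∀ x, r x = σ * p x + τ * -|p x| + e x - t * z x) :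
    ∫ x, r x ^ 2 ≤ 4 * (σ ^ 2 * (∫ x, p x ^ 2) + τ ^ 2 * (∫ x, p x ^ 2) + (∫ x, e x ^ 2)
      + t ^ 2 * ∫ x, z x ^ 2) := by
  have i1 := hp.integrable_sq
  have i2 := he.integrable_sq
  have i3 := hz.integrable_sq
  have e1 : 4 * (σ ^ 2 * (∫ x, p x ^ 2) + τ ^ 2 * (∫ x, p x ^ 2) + (∫ x, e x ^ 2)
      + t ^ 2 * ∫ x, z x ^ 2)
      = ∫ x, 4 * (σ ^ 2 * p x ^ 2 + τ ^ 2 * p x ^ 2 + e x ^ 2 + t ^ 2 * z x ^ 2) := by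
    simp (disch := fun_prop) only [integral_add, integral_const_mul]
  rw [e1]
  refine integral_mono hr.integrable_sq (by fun_prop) fun x => ?_
  have := four_sq_le (σ * p x) (τ * -|p x|) (e x) (t * z x)
  rw [← h x, mul_pow, mul_pow, mul_pow, neg_sq, sq_abs] at this
  exact this

lemma integral_eq_add_reflect {F : ℝ → ℝ} (hF : Integrable F) :
    ∫ x, F x = (∫ x in Ioi 0, F x) + ∫ x in Ioi 0, F (-x) := by
  have := integral_comp_neg_Ioi 0 F
  rw [this, neg_zero, ← intervalIntegral.integral_Iic_add_Ioi hF.integrableOn hF.integrableOn (b := 0)]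
  ring

namespace IsGroundState

variable {p p₂ V : ℝ → ℝ} {X μ Λ : ℝ}

lemma energy_nonneg (h : IsGroundState p p₂ V X μ Λ) {r w : ℝ → ℝ} (hr : IsPrimitive r w)
    (hrm : MemLp r 2 volume) (hwm : MemLp w 2 volume) (hr0 : r 0 = 0) :
    0 ≤ ∫ x in Ioi 0, (w x ^ 2 + V x * r x ^ 2) := by
  simpa using h.integral_sq_le hr hrm hwm hr0 one_pos le_rfl

/-- For odd `p` and even `V`, functions on the line that vanish at the origin are controlled by the
quadratic form of `-∂ₓ² + V` up to a combination of `p` and `-|p|`. -/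
lemma exists_gap_line (h : IsGroundState p p₂ V X μ Λ) (hp : ∀ x, p (-x) = -p x)
    (hV : ∀ x, V (-x) = V x) (hpm : MemLp p 2 volume) : ∃ C, 0 ≤ C ∧ ∀ r w : ℝ → ℝ,
    IsPrimitive r w → MemLp r 2 volume → MemLp w 2 volume → r 0 = 0 →
    0 ≤ ∫ x, (w x ^ 2 + V x * r x ^ 2) ∧
    ∃ σ τ : ℝ, ∫ x, (r x - (σ * p x + τ * -|p x|)) ^ 2 ≤ C * ∫ x, (w x ^ 2 + V x * r x ^ 2) := by
  obtain ⟨C, hC, key⟩ := h.exists_gap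
  refine ⟨C, hC, fun r w hr hrm hwm hr0 => ?_⟩
  obtain ⟨B, hB⟩ := h.V_bdd
  have hi : Integrable (fun x => w x ^ 2 + V x * r x ^ 2) :=
    hwm.integrable_sq.add (hrm.integrable_sq.bdd_mul h.V_cont.aestronglyMeasurable
      (.of_forall hB))
  have hr' := hr.comp_neg
  have hrm' := memLp_comp_neg hrm
  have hwm' : MemLp (fun x => -w (-x)) 2 volume := (memLp_comp_neg hwm).neg
  have hr0' : r (-0) = 0 := by rw [neg_zero, hr0]
  obtain ⟨κ₁, h₁⟩ := key r w hr hrm hwm hr0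
  obtain ⟨κ₂, h₂⟩ := key _ _ hr' hrm' hwm' hr0'
  have n1 := h.energy_nonneg hr hrm hwm hr0
  have n2 := h.energy_nonneg hr' hrm' hwm' hr0'
  have e := integral_eq_add_reflect hi
  have e2 : ∫ x in Ioi 0, (w (-x) ^ 2 + V (-x) * r (-x) ^ 2)
      = ∫ x in Ioi 0, ((-w (-x)) ^ 2 + V x * r (-x) ^ 2) := by
    simp only [hV, neg_sq]
  rw [e2] at e
  refine ⟨by rw [e]; exact add_nonneg n1 n2, (κ₁ - κ₂) / 2, (κ₁ + κ₂) / 2, ?_⟩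
  have hem : MemLp (fun x => r x - ((κ₁ - κ₂) / 2 * p x + (κ₁ + κ₂) / 2 * -|p x|)) 2 volume :=
    hrm.sub ((hpm.const_mul _).add ((hpm.abs.neg).const_mul _))
  rw [integral_eq_add_reflect hem.integrable_sq, e, mul_add]
  refine add_le_add (le_of_eq_of_le ?_ h₁) (le_of_eq_of_le ?_ h₂)
  · refine setIntegral_congr_fun measurableSet_Ioi fun x hx => ?_
    have := abs_of_neg (h.neg x hx)
    simp only [this]
    ring
  · refine setIntegral_congr_fun measurableSet_Ioi fun x hx => ?_
    have := abs_of_neg (h.neg x hx)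
    simp only [hp, abs_neg, this]
    ring

end IsGroundState

/-- The quadratic form of the Hessian at the centred wave. -/
def quad (f : ℝ → ℝ) (Q : ℝ → ℝ → ℝ) (c : ℝ) (v : ℝ → ℝ) : ℝ :=
  ∫ x, (weakDeriv v x ^ 2 + (c - deriv f (Q c x)) * v x ^ 2)

lemma hessForm_eq_quad (f : ℝ → ℝ) (Q : ℝ → ℝ → ℝ) (c a : ℝ) {v : ℝ → ℝ} (hv : MemH1 v) :
    hessForm f Q c a v = quad f Q c (fun x => v (x + a)) := by
  rw [hessForm, ← integral_shift _ a, quad]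
  refine integral_congr_ae ?_
  filter_upwards [(hv.shift a).2] with x hx
  rw [hx, wave, add_sub_cancel_right]
  ring

namespace IsWaveData

variable {f : ℝ → ℝ} {Q : ℝ → ℝ → ℝ} {S : Set ℝ} {K ν c : ℝ}

/-- `Q'` has no zero on the half-line and solves the linearized profile equation; its logarithmic
derivative is controlled by the first integral `Q'² = c Q² - 2 F(Q)`. -/
lemma exists_isGroundState (h : IsWaveData f Q S K ν) (hc : c ∈ S) : ∃ X μ Λ,
    IsGroundState (deriv (Q c)) (fun x => c * Q c x - f (Q c x)) (fun x => c - deriv f (Q c x))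
      X μ Λ := by
  have P := h.profile c hc
  have hf := h.nonlin
  obtain ⟨M, hM⟩ := hf.exists_bounds K
  have hM0 := hM.nonneg
  have c0 := P.speed_pos
  have hr : 0 < c / (4 * (M + 1)) := by positivity
  obtain ⟨X₀, hX₀⟩ := eventually_atTop.1 (P.decay.eventually (gt_mem_nhds hr))
  set s := √c
  have hs : 0 < s := Real.sqrt_pos.2 c0
  have hs2 : s ^ 2 = c := Real.sq_sqrt c0.le
  have hlog : ∀ x, max X₀ 1 ≤ x → (c * Q c x - f (Q c x)) / deriv (Q c) x ≤ -(s / 4) ∧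
      -(3 * s) ≤ (c * Q c x - f (Q c x)) / deriv (Q c) x := by
    intro x hx
    have hx0 : 0 < x := one_pos.trans_le ((le_max_right _ _).trans hx)
    have hq := P.pos x
    set q := Q c x
    set q1 := deriv (Q c) x
    have hqr : q < c / (4 * (M + 1)) := hX₀ x ((le_max_left _ _).trans hx)
    have hqK : |q| ≤ K := (h.q_bd c hc).le h.nu_pos.le x
    have hMq : M * q ≤ c / 4 := by
      rw [lt_div_iff₀ (by positivity)] at hqr
      nlinarith
    have f0 : |f q| ≤ c / 4 * q := by
      have := hM.secant hf (s := q) (t := 0) (r := |q|) hqK le_rfl (by simp)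
      rw [hf.zero, sub_zero, sub_zero, abs_of_pos hq] at this
      exact this.trans (mul_le_mul_of_nonneg_right hMq hq.le)
    have F0 : |antideriv f q| ≤ c / 4 * q ^ 2 := by
      have := taylor_le (g := antideriv f) (R := |q|) (K := M * |q|) hf.hasDerivAt_antideriv
        (fun s t hs ht => hM.secant hf hqK hs ht) (s := 0) (t := q) (by simp) le_rfl
      simp only [antideriv, hf.zero, intervalIntegral.integral_same, sub_zero, zero_mul] at this
      rw [abs_of_pos hq] at this
      exact this.trans (mul_le_mul_of_nonneg_right hMq (sq_nonneg _))
    have fi : q1 ^ 2 = c * q ^ 2 - 2 * antideriv f q := P.first_integral hf x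
    have hn : q1 < 0 := P.deriv_neg hf hx0
    have g1 := abs_le.1 f0
    have g2 := abs_le.1 F0
    have cq : c = s ^ 2 := hs2.symm
    have up : -q1 ≤ 2 * s * q := by
      apply le_of_sq_le_sq _ (by positivity)
      rw [neg_sq, fi]
      have : (2 * s * q) ^ 2 = 4 * c * q ^ 2 := by rw [cq]; ring
      rw [this]
      have := mul_pos c0 (pow_pos hq 2)
      linarith [g2.1]
    have lo : s / 2 * q ≤ -q1 := by
      apply le_of_sq_le_sq _ (by linarith)
      rw [neg_sq, fi]
      have : (s / 2 * q) ^ 2 = c / 4 * q ^ 2 := by rw [cq]; ring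
      rw [this]
      have := mul_pos c0 (pow_pos hq 2)
      linarith [g2.2]
    have sq0 := mul_pos hs hq
    constructor
    · rw [div_le_iff_of_neg hn]
      have : s / 4 * (-q1) ≤ s / 4 * (2 * s * q) := by gcongr
      have e : s / 4 * (2 * s * q) = c / 2 * q := by rw [cq]; ring
      nlinarith
    · rw [le_div_iff_of_neg hn]
      have : 3 * s * (s / 2 * q) ≤ 3 * s * (-q1) := by gcongr
      have e : 3 * s * (s / 2 * q) = 3 * c / 2 * q := by rw [cq]; ring
      nlinarith
  refine ⟨max X₀ 1, s / 4, 3 * s, h.q1_hasDerivAt hc, fun x => ?_,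
    continuous_const.sub (h.deriv_f_cont hc), ⟨c + M * K, fun x => ?_⟩,
    fun x hx => P.deriv_neg hf hx, P.deriv_zero, P.second_deriv_zero_ne hf,
    lt_max_of_lt_right one_pos, by positivity, fun x hx => (hlog x hx).1, fun x hx => (hlog x hx).2⟩
  · exact (P.hasDerivAt_deriv2 hf x).congr_deriv (by ring)
  · have := (h.deriv_f_bd hM hc).le h.nu_pos.le x
    refine (abs_sub _ _).trans ?_
    rw [abs_of_pos c0]
    linarith

lemma integrable_quad (h : IsWaveData f Q S K ν) (hc : c ∈ S) {v g : ℝ → ℝ}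
    (hv : MemLp v 2 volume) (hg : MemLp g 2 volume) :
    Integrable (fun x => g x ^ 2 + (c - deriv f (Q c x)) * v x ^ 2) := by
  obtain ⟨X, μ, Λ, G⟩ := h.exists_isGroundState hc
  obtain ⟨B, hB⟩ := G.V_bdd
  exact hg.integrable_sq.add (hv.integrable_sq.bdd_mul G.V_cont.aestronglyMeasurable
    (.of_forall hB))

lemma z_zero_ne (h : IsWaveData f Q S K ν) (hc : c ∈ S) : zc Q c 0 ≠ 0 := by
  intro h0
  have := h.wronskian hc 0
  rw [h0, (h.profile c hc).deriv_zero] at this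
  have h2 := pow_pos ((h.profile c hc).pos 0) 2
  linarith

/-- Integration by parts: if `p'' = (c - f'(Q)) p + s`, then `⟨L v, p⟩ = -⟨v, s⟩`. -/
lemma hess_pairing (h : IsWaveData f Q S K ν) (hc : c ∈ S) {v g p p₁ s : ℝ → ℝ}
    (hv : IsPrimitive v g) (hvm : MemLp v 2 volume) (hgm : MemLp g 2 volume)
    (hp : ∀ x, HasDerivAt p (p₁ x) x)
    (hp₁ : ∀ x, HasDerivAt p₁ ((c - deriv f (Q c x)) * p x + s x) x) (hs : Continuous s)
    (hpm : MemLp p 2 volume) (hp₁m : MemLp p₁ 2 volume) (hsm : MemLp s 2 volume) :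
    Integrable (fun x => g x * p₁ x + (c - deriv f (Q c x)) * (v x * p x)) ∧
    ∫ x, (g x * p₁ x + (c - deriv f (Q c x)) * (v x * p x)) = -∫ x, v x * s x := by
  obtain ⟨X, μ, Λ, G⟩ := h.exists_isGroundState hc
  obtain ⟨B, hB⟩ := G.V_bdd
  have hVp : MemLp (fun x => (c - deriv f (Q c x)) * p x) 2 volume := by
    refine (hpm.const_mul B).of_le (G.V_cont.aestronglyMeasurable.mul hpm.1) (.of_forall fun x => ?_)
    rw [norm_mul, norm_mul]
    exact mul_le_mul_of_nonneg_right ((hB x).trans (le_abs_self B)) (norm_nonneg _)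
  have hp₂m : MemLp (fun x => (c - deriv f (Q c x)) * p x + s x) 2 volume := hVp.add hsm
  have hp₁p : IsPrimitive p₁ _ := .of_hasDerivAt hp₁
    ((G.V_cont.mul (continuous_of_hasDerivAt hp)).add hs)
  have b1 := hv.integral_by_parts hp₁p hvm hgm hp₁m hp₂m
  have i1 := integrable_mul_of_memLp hgm hp₁m
  have i2 := integrable_mul_of_memLp hvm hp₂m
  have i3 := integrable_mul_of_memLp hvm hsm
  have e : (fun x => g x * p₁ x + (c - deriv f (Q c x)) * (v x * p x))
      = fun x => g x * p₁ x + v x * ((c - deriv f (Q c x)) * p x + s x) - v x * s x := by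
    funext x; ring
  rw [e]
  refine ⟨by fun_prop, ?_⟩
  simp (disch := fun_prop) only [integral_add, integral_sub]
  linarith

/-- The effect on the quadratic form of adding a multiple of `p`, where `L p = -s`. -/
lemma quad_add (h : IsWaveData f Q S K ν) (hc : c ∈ S) {v g p p₁ s : ℝ → ℝ}
    (hv : IsPrimitive v g) (hvm : MemLp v 2 volume) (hgm : MemLp g 2 volume)
    (hp : ∀ x, HasDerivAt p (p₁ x) x)
    (hp₁ : ∀ x, HasDerivAt p₁ ((c - deriv f (Q c x)) * p x + s x) x) (hs : Continuous s)
    (hpm : MemLp p 2 volume) (hp₁m : MemLp p₁ 2 volume) (hsm : MemLp s 2 volume) (t : ℝ) :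
    ∫ x, ((g x + t * p₁ x) ^ 2 + (c - deriv f (Q c x)) * (v x + t * p x) ^ 2)
      = (∫ x, (g x ^ 2 + (c - deriv f (Q c x)) * v x ^ 2))
        - 2 * t * (∫ x, v x * s x) - t ^ 2 * ∫ x, p x * s x := by
  have hp₁c : Continuous p₁ := continuous_of_hasDerivAt hp₁
  obtain ⟨i1, e1⟩ := h.hess_pairing hc hv hvm hgm hp hp₁ hs hpm hp₁m hsm
  obtain ⟨i2, e2⟩ := h.hess_pairing hc (.of_hasDerivAt hp hp₁c) hpm hp₁m hp hp₁ hs hpm hp₁m hsm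
  have i0 := h.integrable_quad hc hvm hgm
  have e : (fun x => (g x + t * p₁ x) ^ 2 + (c - deriv f (Q c x)) * (v x + t * p x) ^ 2)
      = fun x => (g x ^ 2 + (c - deriv f (Q c x)) * v x ^ 2)
        + (2 * t) * (g x * p₁ x + (c - deriv f (Q c x)) * (v x * p x))
        + t ^ 2 * (p₁ x * p₁ x + (c - deriv f (Q c x)) * (p x * p x)) := by
    funext x; ring
  have j1 := i1.const_mul (2 * t)
  have j2 := i2.const_mul (t ^ 2)
  rw [e, integral_add (by fun_prop) j2, integral_add i0 j1, integral_const_mul, integral_const_mul,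
    e1, e2]
  ring

lemma z1_hasDerivAt' (h : IsWaveData f Q S K ν) (hc : c ∈ S) (x : ℝ) :
    HasDerivAt (deriv (zc Q c)) ((c - deriv f (Q c x)) * zc Q c x + Q c x) x :=
  (h.z1_hasDerivAt c hc x).congr_deriv (by ring)

/-- Coercivity at a fixed speed: the Hessian is positive up to the directions `Q` and `Q'`. -/
lemma exists_coercive (h : IsWaveData f Q S K ν) (hc : c ∈ S) (hd : 0 < ∫ x, Q c x * zc Q c x) :
    ∃ k T, 0 < k ∧ 0 ≤ T ∧ ∀ v, MemH1 v → k * l2 v ^ 2 ≤ quad f Q c v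
      + T * ((∫ x, v x * Q c x) ^ 2 + (∫ x, v x * deriv (Q c) x) ^ 2) := by
  obtain ⟨X, μ, Λ, G⟩ := h.exists_isGroundState hc
  have P := h.profile c hc
  have hpm := h.q1_memLp hc
  have hpa : MemLp (fun x => |deriv (Q c) x|) 2 volume := hpm.abs
  have hqm := h.q_memLp hc
  have hzm := h.z_memLp hc
  obtain ⟨C, hC, gap⟩ := G.exists_gap_line P.deriv_odd (fun x => by simp only [P.even]) hpm
  set d := ∫ x, Q c x * zc Q c x
  set A := ∫ x, deriv (Q c) x ^ 2
  set Z := ∫ x, zc Q c x ^ 2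
  set N := ∫ x, Q c x ^ 2
  set D := ∫ x, |deriv (Q c) x| * Q c x
  have hA : 0 < A := h.q1_sq_pos hc
  have hZ : 0 ≤ Z := integral_nonneg fun x => sq_nonneg _
  have hN : 0 ≤ N := integral_nonneg fun x => sq_nonneg _
  have iD : Integrable (fun x => |deriv (Q c) x| * Q c x) := integrable_mul_of_memLp hpa hqm
  have hD : 0 < D := by
    refine (integral_pos_iff_support_of_nonneg
      (fun x => mul_nonneg (abs_nonneg _) (P.pos x).le) iD).2 ?_
    refine (IsOpen.measure_pos volume (isOpen_Ioi (a := (0 : ℝ))) ⟨1, mem_Ioi.2 one_pos⟩).trans_le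
      (measure_mono fun x hx => ?_)
    exact mul_ne_zero (abs_ne_zero.2 (P.deriv_ne_zero h.nonlin hx)) (P.pos x).ne'
  have o1 : ∫ x, deriv (Q c) x * Q c x = 0 := integral_eq_zero_of_odd fun x => by
    rw [P.deriv_odd, P.even]; ring
  have o2 : ∫ x, |deriv (Q c) x| * deriv (Q c) x = 0 := integral_eq_zero_of_odd fun x => by
    rw [P.deriv_odd, abs_neg]; ring
  have o3 : ∫ x, zc Q c x * deriv (Q c) x = 0 := integral_eq_zero_of_odd fun x => by
    rw [P.deriv_odd, h.z_even c hc]; ring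
  have hz0 := h.z_zero_ne hc
  set a₁ := 3 / D ^ 2 * (1 + 2 * d + C * N)
  set a₂ := 2 / A ^ 2 * (1 + C * A)
  have ha₁ : 0 ≤ a₁ := by positivity
  have ha₂ : 0 ≤ a₂ := by positivity
  set C₁ := 4 * (A * a₂ + A * a₁ + C + 2 / d * Z) + 1
  have hC₁ : 0 < C₁ := by positivity
  refine ⟨1 / C₁, 2 / d + 1, by positivity, by positivity, fun v hv => ?_⟩
  obtain ⟨r₀, hr₀, er⟩ := hv.exists_primitive
  have hgm := hv.memLp_weakDeriv
  have hrm₀ : MemLp r₀ 2 volume := hv.memLp.ae_eq er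
  have eq₁ : ∫ x, v x * Q c x = ∫ x, r₀ x * Q c x :=
    integral_congr_ae (er.mono fun x hx => by simp only [hx])
  have eq₂ : ∫ x, v x * deriv (Q c) x = ∫ x, r₀ x * deriv (Q c) x :=
    integral_congr_ae (er.mono fun x hx => by simp only [hx])
  have eq₃ : quad f Q c v = ∫ x, (weakDeriv v x ^ 2 + (c - deriv f (Q c x)) * r₀ x ^ 2) :=
    integral_congr_ae (er.mono fun x hx => by simp only [hx])
  rw [eq₁, eq₂, l2_congr er]
  -- subtract a multiple of `∂_c Q` to obtain a function vanishing at the origin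
  set t := -r₀ 0 / zc Q c 0
  have hzp : IsPrimitive (zc Q c) (deriv (zc Q c)) := .of_hasDerivAt (h.z_hasDerivAt c hc)
    (h.z1_cont hc)
  have hr := hr₀.add (hzp.const_mul t)
  have hrm : MemLp (fun x => r₀ x + t * zc Q c x) 2 volume := hrm₀.add (hzm.const_mul t)
  have hwm : MemLp (fun x => weakDeriv v x + t * deriv (zc Q c) x) 2 volume :=
    hgm.add ((h.z1_memLp hc).const_mul t)
  have hr0 : r₀ 0 + t * zc Q c 0 = 0 := by simp only [t]; field_simp; ring
  obtain ⟨hB, σ, τ, he⟩ := gap _ _ hr hrm hwm hr0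
  have hBe := h.quad_add hc hr₀ hrm₀ hgm (h.z_hasDerivAt c hc) (h.z1_hasDerivAt' hc)
    (h.q_cont hc) hzm (h.z1_memLp hc) hqm t
  rw [← eq₃] at hBe
  have comm : ∫ x, zc Q c x * Q c x = d := by simp only [d, mul_comm]
  rw [comm] at hBe
  set B := ∫ x, ((weakDeriv v x + t * deriv (zc Q c) x) ^ 2
        + (c - deriv f (Q c x)) * (r₀ x + t * zc Q c x) ^ 2)
  set e : ℝ → ℝ := fun x => r₀ x + t * zc Q c x - (σ * deriv (Q c) x + τ * -|deriv (Q c) x|)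
  have hem : MemLp e 2 volume :=
    hrm.sub ((hpm.const_mul _).add ((hpa.neg).const_mul _))
  set q₁ := ∫ x, r₀ x * Q c x
  set q₂ := ∫ x, r₀ x * deriv (Q c) x
  set E := quad f Q c v + 2 / d * q₁ ^ 2
  -- completing the square in `t`: here `δ' > 0` makes the term `t² d` favourable
  have hE : B + t ^ 2 * d / 2 ≤ E := by
    have : 0 ≤ (t * d + 2 * q₁) ^ 2 / (2 * d) := by positivity
    have e2 : (t * d + 2 * q₁) ^ 2 / (2 * d) = t ^ 2 * d / 2 + 2 * t * q₁ + 2 / d * q₁ ^ 2 := by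
      field_simp; ring
    simp only [E]
    linarith
  have ht0 : 0 ≤ t ^ 2 * d / 2 := by positivity
  have hE0 : 0 ≤ E := by linarith
  have ht : t ^ 2 ≤ 2 / d * E := by
    rw [div_mul_eq_mul_div, le_div_iff₀ hd]; linarith
  have hn : ∫ x, e x ^ 2 ≤ C * E := he.trans (mul_le_mul_of_nonneg_left (by linarith) hC)
  have ieq := integrable_mul_of_memLp hem hqm
  have iep := integrable_mul_of_memLp hem hpm
  have irq := integrable_mul_of_memLp hrm₀ hqm
  have irp := integrable_mul_of_memLp hrm₀ hpm
  have izq := integrable_mul_of_memLp hqm hzm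
  have izp := integrable_mul_of_memLp hzm hpm
  have ipq := integrable_mul_of_memLp hpm hqm
  have ipp := integrable_mul_of_memLp hpa hpm
  have ipp' := hpm.integrable_sq
  -- the two coefficients are determined by the pairings with `Q` and `Q'`
  have hτ : τ * D = ∫ x, e x * Q c x - (r₀ x * Q c x + t * (Q c x * zc Q c x)
      - σ * (deriv (Q c) x * Q c x)) := by
    rw [← integral_const_mul]
    congr 1; funext x; simp only [e]; ring
  have hτ' : τ * D = (∫ x, e x * Q c x) - (q₁ + t * d) := by
    have s1 := integral_sub ieq ((irq.add (izq.const_mul t)).sub (ipq.const_mul σ))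
    have s2 := integral_sub (irq.add (izq.const_mul t)) (ipq.const_mul σ)
    have s3 := integral_add irq (izq.const_mul t)
    simp only [Pi.add_apply, Pi.sub_apply, integral_const_mul] at s1 s2 s3
    rw [hτ, s1, s2, s3, o1]
    ring
  have hσ : σ * A = q₂ - ∫ x, e x * deriv (Q c) x := by
    have e1 : σ * A = ∫ x, (r₀ x * deriv (Q c) x + t * (zc Q c x * deriv (Q c) x)
        + τ * (|deriv (Q c) x| * deriv (Q c) x) - e x * deriv (Q c) x) := by
      rw [← integral_const_mul]
      congr 1; funext x; simp only [e]; ring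
    have s1 := integral_sub ((irp.add (izp.const_mul t)).add (ipp.const_mul τ)) iep
    have s2 := integral_add (irp.add (izp.const_mul t)) (ipp.const_mul τ)
    have s3 := integral_add irp (izp.const_mul t)
    simp only [Pi.add_apply, integral_const_mul] at s1 s2 s3
    rw [e1, s1, s2, s3, o2, o3]
    ring
  have csq : (∫ x, e x * Q c x) ^ 2 ≤ C * E * N := by
    exact (sq_integral_mul_le hem hqm).trans (mul_le_mul_of_nonneg_right hn hN)
  have csp : (∫ x, e x * deriv (Q c) x) ^ 2 ≤ C * E * A := by
    exact (sq_integral_mul_le hem hpm).trans (mul_le_mul_of_nonneg_right hn hA.le)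
  set s := E + q₁ ^ 2 + q₂ ^ 2
  have hq₁ := sq_nonneg q₁
  have hq₂ := sq_nonneg q₂
  have hs1 : E ≤ s := by simp only [s]; linarith
  have hs2 : q₁ ^ 2 ≤ s := by simp only [s]; linarith
  have hs3 : q₂ ^ 2 ≤ s := by simp only [s]; linarith
  have hs0 : 0 ≤ s := hE0.trans hs1
  have bτ : τ ^ 2 ≤ a₁ * s := by
    have e1 : τ ^ 2 = (τ * D) ^ 2 / D ^ 2 := by field_simp
    have e2 : a₁ * s = 3 * ((1 + 2 * d + C * N) * s) / D ^ 2 := by simp only [a₁]; ring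
    rw [e1, e2]
    refine div_le_div_of_nonneg_right ?_ (sq_nonneg D)
    rw [hτ']
    have m1 : (∫ x, e x * Q c x) ^ 2 ≤ C * N * s := csq.trans (by
      rw [mul_right_comm]; exact mul_le_mul_of_nonneg_left hs1 (mul_nonneg hC hN))
    have m2 : (t * d) ^ 2 ≤ 2 * d * s := by
      have := mul_le_mul_of_nonneg_right ht (sq_nonneg d)
      have e3 : 2 / d * E * d ^ 2 = 2 * d * E := by field_simp
      rw [e3, ← mul_pow] at this
      exact this.trans (mul_le_mul_of_nonneg_left hs1 (mul_pos two_pos hd).le)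
    refine (three_sq_le _ _ _).trans (mul_le_mul_of_nonneg_left ?_ (by norm_num))
    calc _ ≤ C * N * s + s + 2 * d * s := add_le_add (add_le_add m1 hs2) m2
      _ = _ := by ring
  have bσ : σ ^ 2 ≤ a₂ * s := by
    have e1 : σ ^ 2 = (σ * A) ^ 2 / A ^ 2 := by field_simp
    have e2 : a₂ * s = 2 * ((1 + C * A) * s) / A ^ 2 := by simp only [a₂]; ring
    rw [e1, e2]
    refine div_le_div_of_nonneg_right ?_ (sq_nonneg A)
    rw [hσ]
    have m1 : (∫ x, e x * deriv (Q c) x) ^ 2 ≤ C * A * s := csp.trans (by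
      rw [mul_right_comm]; exact mul_le_mul_of_nonneg_left hs1 (mul_nonneg hC hA.le))
    refine (two_sq_le _ _).trans (mul_le_mul_of_nonneg_left ?_ (by norm_num))
    calc _ ≤ s + C * A * s := add_le_add hs3 m1
      _ = _ := by ring
  have fin : l2 r₀ ^ 2 ≤ 4 * (σ ^ 2 * A + τ ^ 2 * A + (∫ x, e x ^ 2) + t ^ 2 * Z) := by
    rw [l2_sq]
    exact integral_sq_comb_le hpm hem hzm hrm₀ σ τ t fun x => by simp only [e]; ring
  have fin2 : l2 r₀ ^ 2 ≤ C₁ * s := by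
    have m1 := mul_le_mul_of_nonneg_right bσ hA.le
    have m2 := mul_le_mul_of_nonneg_right bτ hA.le
    have m3 : t ^ 2 * Z ≤ 2 / d * Z * s := by
      refine (mul_le_mul_of_nonneg_right (ht.trans (mul_le_mul_of_nonneg_left hs1
        (by positivity))) hZ).trans (le_of_eq ?_)
      ring
    have m4 := hn.trans (mul_le_mul_of_nonneg_left hs1 hC)
    calc l2 r₀ ^ 2 ≤ 4 * (a₂ * s * A + a₁ * s * A + C * s + 2 / d * Z * s) := fin.trans
          (mul_le_mul_of_nonneg_left (add_le_add (add_le_add (add_le_add m1 m2) m4) m3)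
            (by norm_num))
      _ = C₁ * s - s := by simp only [C₁]; ring
      _ ≤ C₁ * s := sub_le_self _ hs0
  rw [div_mul_eq_mul_div, one_mul, div_le_iff₀ hC₁]
  have e5 : quad f Q c v + (2 / d + 1) * (q₁ ^ 2 + q₂ ^ 2) = s + 2 / d * q₂ ^ 2 := by
    simp only [s, E]; ring
  rw [e5]
  have : 0 ≤ 2 / d * q₂ ^ 2 := by positivity
  refine fin2.trans ?_
  rw [mul_comm]
  exact mul_le_mul_of_nonneg_right (le_add_of_nonneg_right this) hC₁.le

/-- Coercivity holds with the same constants at all nearby speeds. -/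
lemma exists_coercive_nhds (h : IsWaveData f Q S K ν) (hc : c ∈ S)
    (hd : 0 < ∫ x, Q c x * zc Q c x) :
    ∃ k T ρ, 0 < k ∧ 0 ≤ T ∧ 0 < ρ ∧ ∀ c' ∈ S, |c' - c| < ρ → ∀ v, MemH1 v →
      k * l2 v ^ 2 ≤ quad f Q c' v
        + T * ((∫ x, v x * Q c' x) ^ 2 + (∫ x, v x * deriv (Q c') x) ^ 2) := by
  obtain ⟨k, T, hk, hT, key⟩ := h.exists_coercive hc hd
  obtain ⟨M, hM⟩ := h.nonlin.exists_bounds K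
  have hM0 := hM.nonneg
  have hK := h.bound_nonneg
  have hν := h.nu_pos
  set m := 1 + M * K + 4 * T * (K ^ 2 * (2 / ν))
  have hm : 0 < m := by positivity
  refine ⟨k / 2, 2 * T, min 1 (k / (2 * m)), by positivity, by positivity, by positivity,
    fun c' hc' hρ v hv => ?_⟩
  have h0 := key v hv
  set δ := |c' - c|
  have hδ1 : δ ≤ 1 := (hρ.trans_le (min_le_left _ _)).le
  have hδm : m * δ ≤ k / 2 := by
    have := (hρ.trans_le (min_le_right _ _)).le
    rw [le_div_iff₀ (by positivity)] at this
    linarith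
  have hδ0 : 0 ≤ δ := abs_nonneg _
  have hvm := hv.memLp
  have q0 : quad f Q c v ≤ quad f Q c' v + (1 + M * K) * δ * l2 v ^ 2 := by
    have i1 := h.integrable_quad hc' hvm hv.memLp_weakDeriv
    rw [l2_sq, quad, quad, ← integral_const_mul,
      ← integral_add i1 (hvm.integrable_sq.const_mul _)]
    refine integral_mono (h.integrable_quad hc hvm hv.memLp_weakDeriv)
      (i1.add (hvm.integrable_sq.const_mul _)) fun x => ?_
    have b1 := hM.deriv_lip _ _ ((h.q_bd c' hc').le hν.le x) ((h.q_bd c hc).le hν.le x)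
    have b2 := (h.q_lip c' hc' c hc).le hν.le x
    have b3 := b1.trans (mul_le_mul_of_nonneg_left b2 hM0)
    have b4 : (c - deriv f (Q c x)) ≤ (c' - deriv f (Q c' x)) + (1 + M * K) * δ := by
      have := abs_le.1 b3
      have := neg_abs_le (c' - c)
      simp only [δ] at *
      linarith
    have := mul_le_mul_of_nonneg_right b4 (sq_nonneg (v x))
    linarith
  have pert : ∀ g g' : ℝ → ℝ, MemLp g 2 volume → MemLp g' 2 volume →
      ExpBd (K * δ) ν (fun x => g' x - g x) →
      (∫ x, v x * g x) ^ 2 ≤ 2 * (∫ x, v x * g' x) ^ 2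
        + 2 * (K ^ 2 * (2 / ν)) * δ * l2 v ^ 2 := by
    intro g g' hg hg' hb
    have hgg : MemLp (fun x => g' x - g x) 2 volume := hg'.sub hg
    have e : ∫ x, v x * g x = (∫ x, v x * g' x) - ∫ x, v x * (g' x - g x) := by
      rw [← integral_sub (integrable_mul_of_memLp hvm hg') (integrable_mul_of_memLp hvm hgg)]
      congr 1; funext x; ring
    have b := abs_integral_mul_le hvm hgg
    have b2 := b.trans (mul_le_mul_of_nonneg_left (hb.l2_le hν) (l2_nonneg v))
    have b3 := sq_le_sq' (by linarith [(abs_le.1 b2).1]) (abs_le.1 b2).2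
    have e2 : (l2 v * (K * δ * √(2 / ν))) ^ 2 = K ^ 2 * (2 / ν) * (δ * δ) * l2 v ^ 2 := by
      have : √(2 / ν) ^ 2 = 2 / ν := Real.sq_sqrt (by positivity)
      rw [mul_pow, mul_pow, mul_pow, this]; ring
    rw [e2] at b3
    have b4 : δ * δ ≤ δ := by nlinarith
    have b5 : K ^ 2 * (2 / ν) * (δ * δ) * l2 v ^ 2 ≤ K ^ 2 * (2 / ν) * δ * l2 v ^ 2 := by
      gcongr
    rw [e]
    nlinarith [sq_nonneg ((∫ x, v x * g' x) + ∫ x, v x * (g' x - g x))]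
  have p1 := pert _ _ (h.q_memLp hc) (h.q_memLp hc') (h.q_lip c' hc' c hc)
  have p2 := pert _ _ (h.q1_memLp hc) (h.q1_memLp hc') (h.q1_lip c' hc' c hc)
  have p3 := mul_le_mul_of_nonneg_left (add_le_add p1 p2) hT
  have p4 := mul_le_mul_of_nonneg_right hδm (sq_nonneg (l2 v))
  simp only [m] at p4
  nlinarith

end IsWaveData

/-! ### Uniform constants near a stable speed -/

/-- Wave data with constants that express stability, uniformly in the speed: a lower bound `k` for
the momentum derivative, for the squared mass of `∂_c Q_c` and for the norms of `Q_c` and `Q_c'`,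
and the coercivity of the Hessian up to the directions `Q_c` and `Q_c'`. -/
structure IsStableData (f : ℝ → ℝ) (Q : ℝ → ℝ → ℝ) (S : Set ℝ) (K ν k T : ℝ) : Prop extends
    IsWaveData f Q S K ν where
  gap_pos : 0 < k
  slope_ge : ∀ c ∈ S, k ≤ ∫ x, Q c x * zc Q c x
  mass_ge : ∀ c ∈ S, k ≤ (∫ x, zc Q c x) ^ 2
  q_sq_ge : ∀ c ∈ S, k ≤ ∫ x, Q c x ^ 2
  q1_sq_ge : ∀ c ∈ S, k ≤ ∫ x, deriv (Q c) x ^ 2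
  coercive : ∀ c ∈ S, ∀ v, MemH1 v → k * l2 v ^ 2 ≤ quad f Q c v
      + T * ((∫ x, v x * Q c x) ^ 2 + (∫ x, v x * deriv (Q c) x) ^ 2)

namespace IsWaveData

variable {f : ℝ → ℝ} {Q : ℝ → ℝ → ℝ} {S : Set ℝ} {K ν c : ℝ}

lemma mono_set (h : IsWaveData f Q S K ν) {S' : Set ℝ} (hS : S' ⊆ S) (ho : IsOpen S') :
    IsWaveData f Q S' K ν where
  isOpen := ho
  nonlin := h.nonlin
  nu_pos := h.nu_pos
  bound_nonneg := h.bound_nonneg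
  profile c hc := h.profile c (hS hc)
  speed_le c hc := h.speed_le c (hS hc)
  speed_ge c hc := h.speed_ge c (hS hc)
  q_bd c hc := h.q_bd c (hS hc)
  q1_bd c hc := h.q1_bd c (hS hc)
  z_bd c hc := h.z_bd c (hS hc)
  z1_bd c hc := h.z1_bd c (hS hc)
  zz_bd c hc := h.zz_bd c (hS hc)
  zz_cont c hc := h.zz_cont c (hS hc)
  q_lip c hc c' hc' := h.q_lip c (hS hc) c' (hS hc')
  q1_lip c hc c' hc' := h.q1_lip c (hS hc) c' (hS hc')
  z_lip c hc c' hc' := h.z_lip c (hS hc) c' (hS hc')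
  q_speed c hc := h.q_speed c (hS hc)
  z_speed c hc := h.z_speed c (hS hc)
  z_hasDerivAt c hc := h.z_hasDerivAt c (hS hc)
  z1_hasDerivAt c hc := h.z1_hasDerivAt c (hS hc)
  z_even c hc := h.z_even c (hS hc)

/-- Integrals of products of functions depending on the speed in a Lipschitz way are continuous. -/
lemma abs_integral_mul_sub_le {g₁ g₂ h₁ h₂ : ℝ → ℝ} {δ : ℝ} (hν : 0 < ν)
    (hg₁ : ExpBd K ν g₁) (hg₂ : ExpBd K ν g₂) (hh₁ : ExpBd K ν h₁) (hh₂ : ExpBd K ν h₂)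
    (cg₁ : Continuous g₁) (cg₂ : Continuous g₂) (ch₁ : Continuous h₁) (ch₂ : Continuous h₂)
    (hg : ExpBd (K * δ) ν (fun x => g₁ x - g₂ x)) (hh : ExpBd (K * δ) ν (fun x => h₁ x - h₂ x)) :
    |(∫ x, g₁ x * h₁ x) - ∫ x, g₂ x * h₂ x| ≤ 4 * K ^ 2 / ν * δ := by
  have i1 := integrable_mul_of_memLp (hg₁.memLp hν cg₁) (hh₁.memLp hν ch₁)
  have i2 := integrable_mul_of_memLp (hg₂.memLp hν cg₂) (hh₂.memLp hν ch₂)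
  rw [← integral_sub i1 i2]
  have hb : ExpBd (K * (K * δ) + K * (K * δ)) ν
      (fun x => h₁ x * (g₁ x - g₂ x) + g₂ x * (h₁ x - h₂ x)) :=
    (hg.mul_bdd (hh₁.le hν.le)).add (hh.mul_bdd (hg₂.le hν.le))
  have := hb.abs_integral_le hν
  have e : (fun x => g₁ x * h₁ x - g₂ x * h₂ x)
      = fun x => h₁ x * (g₁ x - g₂ x) + g₂ x * (h₁ x - h₂ x) := by funext x; ring
  rw [e]
  refine this.trans (le_of_eq ?_)
  ring

/-- Stability at one speed extends to nearby speeds with uniform constants. -/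
lemma exists_stableData (h : IsWaveData f Q S K ν) (hc : c ∈ S)
    (hd : 0 < ∫ x, Q c x * zc Q c x) (hm : ∫ x, zc Q c x ≠ 0) :
    ∃ S' k T, c ∈ S' ∧ S' ⊆ S ∧ IsStableData f Q S' K ν k T := by
  obtain ⟨k₀, T, ρ, hk₀, -, hρ, key⟩ := h.exists_coercive_nhds hc hd
  have hν := h.nu_pos
  have hK := h.bound_nonneg
  have hqq := h.q_sq_pos hc
  have hpp := h.q1_sq_pos hc
  have hmm : 0 < |∫ x, zc Q c x| := abs_pos.2 hm
  set L := 4 * K ^ 2 / ν + 2 * K / ν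
  have hL1 : 4 * K ^ 2 / ν ≤ L := le_add_of_nonneg_right (by positivity)
  have hL2 : 2 * K / ν ≤ L := le_add_of_nonneg_left (by positivity)
  have hL0 : 0 ≤ L := by positivity
  set m := min (min (∫ x, Q c x * zc Q c x) |∫ x, zc Q c x|)
    (min (∫ x, Q c x ^ 2) (∫ x, deriv (Q c) x ^ 2))
  have hm0 : 0 < m := by positivity
  set r := min ρ (m / (2 * (L + 1)))
  have hr : 0 < r := by positivity
  set k := min k₀ (min (m / 2) ((m / 2) ^ 2))
  have hclose : ∀ c' ∈ S ∩ Metric.ball c r, c' ∈ S ∧ |c' - c| < ρ ∧ L * |c' - c| ≤ m / 2 := by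
    intro c' hc'
    have h1 : |c' - c| < r := by simpa [Real.dist_eq] using hc'.2
    refine ⟨hc'.1, h1.trans_le (min_le_left _ _), ?_⟩
    have h2 := (h1.trans_le (min_le_right _ _)).le
    rw [le_div_iff₀ (by positivity)] at h2
    have := abs_nonneg (c' - c)
    linarith
  have hm1 : m ≤ ∫ x, Q c x * zc Q c x := (min_le_left _ _).trans (min_le_left _ _)
  have hm2 : m ≤ |∫ x, zc Q c x| := (min_le_left _ _).trans (min_le_right _ _)
  have hm3 : m ≤ ∫ x, Q c x ^ 2 := (min_le_right _ _).trans (min_le_left _ _)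
  have hm4 : m ≤ ∫ x, deriv (Q c) x ^ 2 := (min_le_right _ _).trans (min_le_right _ _)
  have hk1 : k ≤ m / 2 := (min_le_right _ _).trans (min_le_left _ _)
  have hk2 : k ≤ (m / 2) ^ 2 := (min_le_right _ _).trans (min_le_right _ _)
  have lower : ∀ x y δ : ℝ, 0 ≤ δ → |x - y| ≤ 4 * K ^ 2 / ν * δ → L * δ ≤ m / 2 → m ≤ y →
      m / 2 ≤ x := by
    intro x y δ hδ h1 h2 h3
    have := (abs_le.1 h1).1
    have := mul_le_mul_of_nonneg_right hL1 hδ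
    linarith
  refine ⟨S ∩ Metric.ball c r, k, T, ⟨hc, Metric.mem_ball_self hr⟩, inter_subset_left,
    { toIsWaveData := h.mono_set inter_subset_left (h.isOpen.inter Metric.isOpen_ball)
      gap_pos := by positivity
      slope_ge := fun c' hc' => ?_
      mass_ge := fun c' hc' => ?_
      q_sq_ge := fun c' hc' => ?_
      q1_sq_ge := fun c' hc' => ?_
      coercive := fun c' hc' v hv => ?_ }⟩
  all_goals obtain ⟨h1, h2, h3⟩ := hclose c' hc'
  · exact hk1.trans (lower _ _ _ (abs_nonneg _) (abs_integral_mul_sub_le hν (h.q_bd c' h1)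
      (h.q_bd c hc) (h.z_bd c' h1) (h.z_bd c hc) (h.q_cont h1) (h.q_cont hc) (h.z_cont h1)
      (h.z_cont hc) (h.q_lip c' h1 c hc) (h.z_lip c' h1 c hc)) h3 hm1)
  · have b := (h.z_lip c' h1 c hc).abs_integral_le hν
    rw [integral_sub ((h.z_bd c' h1).integrable hν (h.z_cont h1))
      ((h.z_bd c hc).integrable hν (h.z_cont hc))] at b
    have b1 := abs_sub_abs_le_abs_sub (∫ x, zc Q c x) (∫ x, zc Q c' x)
    rw [abs_sub_comm] at b1
    have b2 := mul_le_mul_of_nonneg_right hL2 (abs_nonneg (c' - c))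
    have e : 2 * (K * |c' - c|) / ν = 2 * K / ν * |c' - c| := by ring
    rw [e] at b
    refine hk2.trans ?_
    rw [← sq_abs (∫ x, zc Q c' x)]
    exact pow_le_pow_left₀ (by positivity) (by linarith) 2
  · have := lower _ _ _ (abs_nonneg _) (abs_integral_mul_sub_le hν (h.q_bd c' h1)
      (h.q_bd c hc) (h.q_bd c' h1) (h.q_bd c hc) (h.q_cont h1) (h.q_cont hc) (h.q_cont h1)
      (h.q_cont hc) (h.q_lip c' h1 c hc) (h.q_lip c' h1 c hc)) h3 (by simpa only [sq] using hm3)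
    simp only [← sq] at this
    exact hk1.trans this
  · have := lower _ _ _ (abs_nonneg _) (abs_integral_mul_sub_le hν (h.q1_bd c' h1)
      (h.q1_bd c hc) (h.q1_bd c' h1) (h.q1_bd c hc) (h.q1_cont h1) (h.q1_cont hc) (h.q1_cont h1)
      (h.q1_cont hc) (h.q1_lip c' h1 c hc) (h.q1_lip c' h1 c hc)) h3 (by simpa only [sq] using hm4)
    simp only [← sq] at this
    exact hk1.trans this
  · refine le_trans ?_ (key c' h1 h2 v hv)
    exact mul_le_mul_of_nonneg_right (min_le_left _ _) (sq_nonneg _)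

/-! ### The regularized primitive of the normalization vector -/

variable {α : ℝ}

lemma wc_hasDerivAt (h : IsWaveData f Q S K ν) (hc : c ∈ S) (hα : 0 ≤ α) (x : ℝ) :
    HasDerivAt (wc Q α c) (zc Q c x - α * wc Q α c x) x :=
  hasDerivAt_regSymp (h.z_bd c hc) h.nu_pos (h.z_cont hc) hα x

lemma wc_cont (h : IsWaveData f Q S K ν) (hc : c ∈ S) (hα : 0 ≤ α) : Continuous (wc Q α c) :=
  continuous_regSymp (h.z_bd c hc) h.nu_pos (h.z_cont hc) hα

lemma wc_memLp (h : IsWaveData f Q S K ν) (hc : c ∈ S) (hα : 0 < α) :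
    MemLp (wc Q α c) 2 volume := memLp_regSymp (h.z_bd c hc) h.nu_pos (h.z_cont hc) hα

lemma abs_wc_le (h : IsWaveData f Q S K ν) (hc : c ∈ S) (hα : 0 ≤ α) (x : ℝ) :
    |wc Q α c x| ≤ 2 * K / ν := abs_regSymp_le (h.z_bd c hc) h.nu_pos hα x

lemma sqrt_mul_l2_wc_le (h : IsWaveData f Q S K ν) (hc : c ∈ S) (hα : 0 < α) :
    √α * l2 (wc Q α c) ≤ 2 * K / ν :=
  sqrt_mul_l2_regSymp_le (h.z_bd c hc) h.nu_pos (h.z_cont hc) hα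

lemma wc1_memLp (h : IsWaveData f Q S K ν) (hc : c ∈ S) (hα : 0 < α) :
    MemLp (fun x => zc Q c x - α * wc Q α c x) 2 volume :=
  (h.z_memLp hc).sub ((h.wc_memLp hc hα).const_mul α)

lemma wc1_cont (h : IsWaveData f Q S K ν) (hc : c ∈ S) (hα : 0 ≤ α) :
    Continuous (fun x => zc Q c x - α * wc Q α c x) :=
  (h.z_cont hc).sub ((h.wc_cont hc hα).const_mul α)

lemma wc_isPrimitive (h : IsWaveData f Q S K ν) (hc : c ∈ S) (hα : 0 ≤ α) :
    IsPrimitive (wc Q α c) (fun x => zc Q c x - α * wc Q α c x) :=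
  .of_hasDerivAt (h.wc_hasDerivAt hc hα) (h.wc1_cont hc hα)

lemma abs_integral_mul_wc_le (h : IsWaveData f Q S K ν) (hc : c ∈ S) (hα : 0 ≤ α) {g : ℝ → ℝ}
    (hg : ExpBd K ν g) : |∫ x, g x * wc Q α c x| ≤ (2 * K / ν) ^ 2 := by
  have := (hg.mul_bdd (h.abs_wc_le hc hα)).abs_integral_le h.nu_pos
  simp only [mul_comm (wc Q α c _)] at this
  refine this.trans (le_of_eq ?_)
  ring

end IsWaveData

/-! ### The constrained minimizer is almost a translation mode -/

lemma quad_of_isPrimitive (f : ℝ → ℝ) (Q : ℝ → ℝ → ℝ) (c : ℝ) {v g : ℝ → ℝ}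
    (hv : IsPrimitive v g) (hvm : MemLp v 2 volume) (hgm : MemLp g 2 volume) :
    quad f Q c v = ∫ x, (g x ^ 2 + (c - deriv f (Q c x)) * v x ^ 2) :=
  integral_congr_ae ((MemH1.of_primitive hv hvm hgm).2.mono fun x hx => by simp only [hx])

lemma quad_const_mul (f : ℝ → ℝ) (Q : ℝ → ℝ → ℝ) (c t : ℝ) {v : ℝ → ℝ} (hv : MemH1 v) :
    quad f Q c (fun x => t * v x) = t ^ 2 * quad f Q c v := by
  rw [quad, quad, ← integral_const_mul]
  refine integral_congr_ae ((hv.const_mul t).2.mono fun x hx => ?_)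
  simp only [hx]
  ring

/-- The algebra behind the trial function: coefficients of size `α` that restore the two
orthogonality conditions. -/
lemma exists_trial_coeff {α k B C N q p W : ℝ} (hk : 0 < k) (hα : 0 < α) (hB : 0 ≤ B)
    (hN : k ≤ N) (hq : |q| ≤ B) (hp : |p| ≤ B) (hW : (1 / 2) * k - C * α ≤ α * W)
    (hsmall : α * (C + B ^ 2 / k) ≤ k / 4) :
    ∃ β γ : ℝ, |β| ≤ 4 * B / k * α ∧ |γ| ≤ 4 * B / k * (B / k) * α ∧
      β * q + γ * N = 0 ∧ p + β * W + γ * q = 0 := by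
  have hN0 : 0 < N := hk.trans_le hN
  have hq2 : q ^ 2 / N ≤ B ^ 2 / k :=
    div_le_div₀ (sq_nonneg B) (sq_le_sq' (by linarith [(abs_le.1 hq).1]) (abs_le.1 hq).2) hk hN
  set D := W - q ^ 2 / N
  have hD : k / 4 ≤ α * D := by
    have : α * (q ^ 2 / N) ≤ α * (B ^ 2 / k) := mul_le_mul_of_nonneg_left hq2 hα.le
    simp only [D]
    linarith
  have hD0 : 0 < D := by
    have : 0 < α * D := by linarith
    exact pos_of_mul_pos_right this hα.le
  have hβ : |-p / D| ≤ 4 * B / k * α := by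
    rw [abs_div, abs_neg, abs_of_pos hD0, div_le_iff₀ hD0]
    have : 4 * B / k * (k / 4) ≤ 4 * B / k * (α * D) :=
      mul_le_mul_of_nonneg_left hD (by positivity)
    have e : 4 * B / k * (k / 4) = B := by field_simp
    linarith
  refine ⟨-p / D, -(-p / D * q) / N, hβ, ?_, ?_, ?_⟩
  · rw [abs_div, abs_neg, abs_mul, abs_of_pos hN0, mul_right_comm]
    have : |q| / N ≤ B / k := div_le_div₀ hB hq hk hN
    rw [mul_div_assoc]
    exact mul_le_mul hβ this (by positivity) (by positivity)
  · field_simp; ring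
  · have : -p / D * D = -p := div_mul_cancel₀ _ hD0.ne'
    have e : p + -p / D * W + -(-p / D * q) / N * q = p + -p / D * D := by
      simp only [D]; ring
    rw [e, this]; ring

namespace IsWaveData

variable {f : ℝ → ℝ} {Q : ℝ → ℝ → ℝ} {S : Set ℝ} {K ν c : ℝ}

lemma quad_le (h : IsWaveData f Q S K ν) {M : ℝ} (hM : NonlinBounds f K M) (hc : c ∈ S)
    {v g : ℝ → ℝ} (hv : MemLp v 2 volume) (hg : MemLp g 2 volume) :
    ∫ x, (g x ^ 2 + (c - deriv f (Q c x)) * v x ^ 2)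
      ≤ (1 + K + M * K) * (l2 v ^ 2 + l2 g ^ 2) := by
  have hK := h.bound_nonneg
  have hM0 := hM.nonneg
  have i1 := hv.integrable_sq
  have i2 := hg.integrable_sq
  have e : (1 + K + M * K) * (l2 v ^ 2 + l2 g ^ 2)
      = ∫ x, (1 + K + M * K) * (v x ^ 2 + g x ^ 2) := by
    rw [l2_sq, l2_sq]
    simp (disch := fun_prop) only [integral_add, integral_const_mul]
  rw [e]
  refine integral_mono (h.integrable_quad hc hv hg) (by fun_prop) fun x => ?_
  have b := abs_le.1 ((h.deriv_f_bd hM hc).le h.nu_pos.le x)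
  have b2 := h.speed_le c hc
  have b3 := mul_le_mul_of_nonneg_right (show c - deriv f (Q c x) ≤ K + M * K by linarith)
    (sq_nonneg (v x))
  have b4 : 0 ≤ (K + M * K) * g x ^ 2 := by positivity
  have b5 := sq_nonneg (v x)
  simp only
  linarith

lemma quad_add_q1 (h : IsWaveData f Q S K ν) (hc : c ∈ S) {v g : ℝ → ℝ}
    (hv : IsPrimitive v g) (hvm : MemLp v 2 volume) (hgm : MemLp g 2 volume) (t : ℝ) :
    ∫ x, ((g x + t * (c * Q c x - f (Q c x))) ^ 2
        + (c - deriv f (Q c x)) * (v x + t * deriv (Q c) x) ^ 2)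
      = ∫ x, (g x ^ 2 + (c - deriv f (Q c x)) * v x ^ 2) := by
  have hm0 : MemLp (fun _ : ℝ => (0 : ℝ)) 2 volume := MemLp.zero'
  obtain ⟨M, hM⟩ := h.nonlin.exists_bounds K
  have := h.quad_add hc hv hvm hgm (h.q1_hasDerivAt hc) (fun x =>
    ((h.profile c hc).hasDerivAt_deriv2 h.nonlin x).congr_deriv
      (show _ = (c - deriv f (Q c x)) * deriv (Q c) x + 0 by ring)) continuous_const
    (h.q1_memLp hc) ((h.q2_bd hM hc).memLp h.nu_pos (h.q2_cont hc)) hm0 t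
  simpa using this

end IsWaveData

namespace IsStableData

variable {f : ℝ → ℝ} {Q : ℝ → ℝ → ℝ} {S : Set ℝ} {K ν k T : ℝ}

/-- The trial function `Q' + β w + γ Q`, with `β` and `γ` of size `α`, shows that the constrained
minimum of the Hessian is of size `α`. -/
lemma exists_hessForm_le (h : IsStableData f Q S K ν k T) : ∃ α₀ C, 0 < α₀ ∧ α₀ ≤ 1 ∧ 0 ≤ C ∧
    ∀ c ∈ S, ∀ α, 0 < α → α ≤ α₀ → ∀ a η, IsHessMinimizer f Q α c a η →
      hessForm f Q c a η ≤ C * α := by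
  obtain ⟨M, hM⟩ := h.nonlin.exists_bounds K
  have hM0 := hM.nonneg
  have hK := h.bound_nonneg
  have hν := h.nu_pos
  have hk := h.gap_pos
  set B := (2 * K / ν) ^ 2
  have hB : 0 ≤ B := sq_nonneg _
  set C₃ := 32 * K ^ 2 / ν ^ 3
  have hC₃ : 0 ≤ C₃ := by positivity
  set R := 2 * K / ν
  have hR : 0 ≤ R := by positivity
  set G := K * √(2 / ν)
  have hG : 0 ≤ G := by positivity
  set C₅ := 4 * B / k * (G + R + G * (B / k))
  have hC₅ : 0 ≤ C₅ := by positivity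
  set α₀ := min 1 (min (k / 4 / (C₃ + B ^ 2 / k + 1)) (k / 2 / (4 * B ^ 2 / k + 1)))
  refine ⟨α₀, (1 + K + M * K) * (2 * C₅ ^ 2) * (4 / k), by positivity, min_le_left _ _,
    by positivity, fun c hc α hα hα₀ a η hη => ?_⟩
  have hα1 : α ≤ 1 := hα₀.trans (min_le_left _ _)
  have hs1 : α * (C₃ + B ^ 2 / k) ≤ k / 4 := by
    have := hα₀.trans ((min_le_right _ _).trans (min_le_left _ _))
    rw [le_div_iff₀ (by positivity)] at this
    linarith
  have hs2 : α * (4 * B ^ 2 / k) ≤ k / 2 := by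
    have := hα₀.trans ((min_le_right _ _).trans (min_le_right _ _))
    rw [le_div_iff₀ (by positivity)] at this
    linarith
  have hqm := h.q_memLp hc
  have hpm := h.q1_memLp hc
  have hWm := h.wc_memLp hc hα
  have hW1m := h.wc1_memLp hc hα
  -- `α ‖w‖²` is close to half the square of `∫ ∂_c Q`, so that a coefficient `β` of size `α` is enough
  have hmass : (1 / 2) * k - C₃ * α ≤ α * l2 (wc Q α c) ^ 2 := by
    have b1 := integral_mul_regSymp_ge (h.z_bd c hc) hν (h.z_cont hc) hα
    have b2 := regSymp_energy (h.z_bd c hc) hν (h.z_cont hc) hα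
    have b3 := h.mass_ge c hc
    rw [← l2_sq] at b2
    have : α * l2 (wc Q α c) ^ 2 = ∫ x, zc Q c x * regSymp α (zc Q c) x := b2
    rw [this]
    linarith
  obtain ⟨β, γ, hβ, hγ, o1, o2⟩ := exists_trial_coeff hk hα hB (h.q_sq_ge c hc)
    (h.abs_integral_mul_wc_le hc hα.le (h.q_bd c hc))
    (h.abs_integral_mul_wc_le hc hα.le (h.q1_bd c hc)) hmass hs1
  rw [l2_sq] at o2
  set x : ℝ → ℝ := fun y => β * wc Q α c y + γ * Q c y
  set x₁ : ℝ → ℝ := fun y => β * (zc Q c y - α * wc Q α c y) + γ * deriv (Q c) y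
  have hqp : IsPrimitive (Q c) (deriv (Q c)) := .of_hasDerivAt (h.q_hasDerivAt hc) (h.q1_cont hc)
  have hxp : IsPrimitive x x₁ := ((h.wc_isPrimitive hc hα.le).const_mul β).add (hqp.const_mul γ)
  have hxm : MemLp x 2 volume := (hWm.const_mul β).add (hqm.const_mul γ)
  have hx₁m : MemLp x₁ 2 volume := (hW1m.const_mul β).add (hpm.const_mul γ)
  have hq₁p : IsPrimitive (deriv (Q c)) (fun y => c * Q c y - f (Q c y)) :=
    .of_hasDerivAt (h.q1_hasDerivAt hc) (h.q2_cont hc)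
  have hq₂m : MemLp (fun y => c * Q c y - f (Q c y)) 2 volume :=
    (h.q2_bd hM hc).memLp hν (h.q2_cont hc)
  set v : ℝ → ℝ := fun y => x y + 1 * deriv (Q c) y
  have hvp : IsPrimitive v _ := hxp.add (hq₁p.const_mul 1)
  have hvm : MemLp v 2 volume := hxm.add (hpm.const_mul 1)
  have hv₁m : MemLp (fun y => x₁ y + 1 * (c * Q c y - f (Q c y))) 2 volume :=
    hx₁m.add (hq₂m.const_mul 1)
  have hvH := (MemH1.of_primitive hvp hvm hv₁m).1
  have iqw : Integrable (fun y => Q c y * wc Q α c y) := integrable_mul_of_memLp hqm hWm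
  have ipw : Integrable (fun y => deriv (Q c) y * wc Q α c y) := integrable_mul_of_memLp hpm hWm
  have iqq := hqm.integrable_sq
  have ipp := hpm.integrable_sq
  have iww := hWm.integrable_sq
  have ipq : Integrable (fun y => deriv (Q c) y * Q c y) := integrable_mul_of_memLp hpm hqm
  have opq : ∫ y, deriv (Q c) y * Q c y = 0 := integral_eq_zero_of_odd fun y => by
    rw [(h.profile c hc).deriv_odd, (h.profile c hc).even]; ring
  have orth1 : ∫ y, v y * Q c y = 0 := by
    have e : (fun y => v y * Q c y) = fun y => β * (Q c y * wc Q α c y) + γ * Q c y ^ 2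
        + deriv (Q c) y * Q c y := by funext y; simp only [v, x]; ring
    rw [e]
    simp (disch := fun_prop) only [integral_add, integral_const_mul]
    rw [opq, add_zero, o1]
  have orth2 : ∫ y, v y * wc Q α c y = 0 := by
    have e : (fun y => v y * wc Q α c y) = fun y => deriv (Q c) y * wc Q α c y
        + β * wc Q α c y ^ 2 + γ * (Q c y * wc Q α c y) := by funext y; simp only [v, x]; ring
    rw [e]
    simp (disch := fun_prop) only [integral_add, integral_const_mul]
    exact o2
  have pair : ∫ y, v y * deriv (Q c) y
      = β * (∫ y, deriv (Q c) y * wc Q α c y) + ∫ y, deriv (Q c) y ^ 2 := by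
    have e : (fun y => v y * deriv (Q c) y) = fun y => β * (deriv (Q c) y * wc Q α c y)
        + γ * (deriv (Q c) y * Q c y) + deriv (Q c) y ^ 2 := by funext y; simp only [v, x]; ring
    rw [e]
    simp (disch := fun_prop) only [integral_add, integral_const_mul]
    rw [opq, mul_zero, add_zero]
  have hA := h.q1_sq_ge c hc
  set A := ∫ y, deriv (Q c) y ^ 2
  have hvn : k / 4 ≤ l2 v ^ 2 := by
    have b0 := sq_integral_mul_le hvm hpm
    have b1 : |β * (∫ y, deriv (Q c) y * wc Q α c y)| ≤ k / 2 := by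
      rw [abs_mul]
      refine (mul_le_mul hβ (h.abs_integral_mul_wc_le hc hα.le (h.q1_bd c hc)) (abs_nonneg _)
        (by positivity)).trans ?_
      refine le_trans (le_of_eq ?_) hs2
      simp only [B]; ring
    have b2 : A / 2 ≤ ∫ y, v y * deriv (Q c) y := by
      rw [pair]; linarith [(abs_le.1 b1).1]
    have hA0 : 0 < A := hk.trans_le hA
    have b3 := pow_le_pow_left₀ (by positivity) b2 2
    have b4 := b3.trans b0
    rw [← l2_sq] at b4
    have b5 : A / 4 ≤ l2 v ^ 2 := le_of_mul_le_mul_right (by linarith) hA0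
    linarith
  set n := l2 v
  have hn : 0 < n := by
    have : n ≠ 0 := fun h0 => by rw [h0] at hvn; linarith
    exact lt_of_le_of_ne (l2_nonneg v) this.symm
  -- the size of the trial function
  have hsq : √α * √α = α := Real.mul_self_sqrt hα.le
  have hs0 : 0 < √α := Real.sqrt_pos.2 hα
  have hsle : √α ≤ 1 := Real.sqrt_le_one.2 hα1
  have hαs : α ≤ √α := hsq.ge.trans (mul_le_of_le_one_right hs0.le hsle)
  have hlW := h.sqrt_mul_l2_wc_le hc hα
  have hlq : l2 (Q c) ≤ G := (h.q_bd c hc).l2_le hν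
  have hlp : l2 (deriv (Q c)) ≤ G := (h.q1_bd c hc).l2_le hν
  have hlz : l2 (zc Q c) ≤ G := (h.z_bd c hc).l2_le hν
  have bβW : |β| * l2 (wc Q α c) ≤ 4 * B / k * R * √α := by
    calc |β| * l2 (wc Q α c) ≤ 4 * B / k * α * l2 (wc Q α c) :=
          mul_le_mul_of_nonneg_right hβ (l2_nonneg _)
      _ = 4 * B / k * (√α * √α) * l2 (wc Q α c) := by rw [hsq]
      _ = 4 * B / k * √α * (√α * l2 (wc Q α c)) := by ring
      _ ≤ 4 * B / k * √α * R := mul_le_mul_of_nonneg_left hlW (by positivity)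
      _ = _ := by ring
  have bγ : |γ| * G ≤ 4 * B / k * (G * (B / k)) * √α := by
    calc |γ| * G ≤ 4 * B / k * (B / k) * √α * G := mul_le_mul_of_nonneg_right
          (hγ.trans (mul_le_mul_of_nonneg_left hαs (by positivity))) hG
      _ = _ := by ring
  have bx : l2 x ≤ C₅ * √α := by
    refine (l2_add_le (hWm.const_mul β) (hqm.const_mul γ)).trans ?_
    rw [l2_const_mul, l2_const_mul]
    have b2 := mul_le_mul_of_nonneg_left hlq (abs_nonneg γ)
    have b3 : 0 ≤ 4 * B / k * G * √α := by positivity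
    calc _ ≤ 4 * B / k * R * √α + 4 * B / k * (G * (B / k)) * √α :=
          add_le_add bβW (b2.trans bγ)
      _ ≤ 4 * B / k * G * √α + (4 * B / k * R * √α + 4 * B / k * (G * (B / k)) * √α) :=
          le_add_of_nonneg_left b3
      _ = _ := by simp only [C₅]; ring
  have bx₁ : l2 x₁ ≤ C₅ * √α := by
    refine (l2_add_le (hW1m.const_mul β) (hpm.const_mul γ)).trans ?_
    rw [l2_const_mul, l2_const_mul]
    have b1 : l2 (fun y => zc Q c y - α * wc Q α c y) ≤ G + l2 (wc Q α c) := by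
      have := l2_add_le (h.z_memLp hc) (hWm.const_mul (-α))
      rw [l2_const_mul, abs_neg, abs_of_pos hα] at this
      have e : (fun y => zc Q c y - α * wc Q α c y) = fun y => zc Q c y + -α * wc Q α c y := by
        funext y; ring
      rw [e]
      refine this.trans (add_le_add hlz (mul_le_of_le_one_left (l2_nonneg _) hα1))
    have b2 := mul_le_mul_of_nonneg_left hlp (abs_nonneg γ)
    have b3 : |β| * G ≤ 4 * B / k * G * √α := by
      calc |β| * G ≤ 4 * B / k * √α * G := mul_le_mul_of_nonneg_right
            (hβ.trans (mul_le_mul_of_nonneg_left hαs (by positivity))) hG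
        _ = _ := by ring
    calc _ ≤ |β| * (G + l2 (wc Q α c)) + |γ| * G :=
          add_le_add (mul_le_mul_of_nonneg_left b1 (abs_nonneg _)) b2
      _ = |β| * G + |β| * l2 (wc Q α c) + |γ| * G := by ring
      _ ≤ 4 * B / k * G * √α + 4 * B / k * R * √α + 4 * B / k * (G * (B / k)) * √α :=
          add_le_add (add_le_add b3 bβW) bγ
      _ = _ := by simp only [C₅]; ring
  have hquad : quad f Q c v ≤ (1 + K + M * K) * (2 * C₅ ^ 2) * α := by
    rw [quad_of_isPrimitive f Q c hvp hvm hv₁m, h.quad_add_q1 hc hxp hxm hx₁m 1]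
    refine (h.quad_le hM hc hxm hx₁m).trans ?_
    rw [mul_assoc (1 + K + M * K)]
    refine mul_le_mul_of_nonneg_left ?_ (by positivity)
    have b1 := pow_le_pow_left₀ (l2_nonneg _) bx 2
    have b2 := pow_le_pow_left₀ (l2_nonneg _) bx₁ 2
    rw [mul_pow, Real.sq_sqrt hα.le] at b1 b2
    linarith
  -- the normalized and translated trial function is admissible
  have hsh := hvH.shift (-a)
  have hV : MemH1 (fun y => n⁻¹ * v (y + -a)) := (hsh.1.const_mul n⁻¹).1
  have hback : (fun y => n⁻¹ * v (y + a + -a)) = fun y => n⁻¹ * v y := by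
    funext y; rw [add_neg_cancel_right]
  have adm : IsAdmissible Q α c a (fun y => n⁻¹ * v (y + -a)) := by
    refine ⟨hV, (h.isSympOrth_iff hc α a _).2 ⟨?_, ?_⟩, ?_⟩
    · simp only [add_neg_cancel_right, mul_assoc]
      rw [integral_const_mul, orth1, mul_zero]
    · simp only [add_neg_cancel_right, mul_assoc]
      rw [integral_const_mul, orth2, mul_zero]
    · rw [← l2_sq, l2_const_mul, l2_shift, abs_of_pos (inv_pos.2 hn), inv_mul_cancel₀ hn.ne',
        one_pow]
  refine (hη.2 _ adm).trans ?_
  rw [hessForm_eq_quad f Q c a hV, hback, quad_const_mul f Q c _ hvH]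
  have hn2 : n⁻¹ ^ 2 ≤ 4 / k := by
    rw [inv_pow, inv_le_comm₀ (by positivity) (by positivity), inv_div]
    exact hvn
  calc n⁻¹ ^ 2 * quad f Q c v ≤ n⁻¹ ^ 2 * ((1 + K + M * K) * (2 * C₅ ^ 2) * α) :=
        mul_le_mul_of_nonneg_left hquad (sq_nonneg _)
    _ ≤ 4 / k * ((1 + K + M * K) * (2 * C₅ ^ 2) * α) :=
        mul_le_mul_of_nonneg_right hn2 (by positivity)
    _ = _ := by ring

/-- The minimizer differs from a multiple of the translation mode `Q'` by `O(√α)`: subtracting its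
projection to `Q'` does not change the quadratic form, which is `O(α)` and coercive on the rest. -/
lemma exists_minimizer_close (h : IsStableData f Q S K ν k T) :
    ∃ α₀ C, 0 < α₀ ∧ α₀ ≤ 1 ∧ 0 ≤ C ∧
    ∀ c ∈ S, ∀ α, 0 < α → α ≤ α₀ → ∀ a η, IsHessMinimizer f Q α c a η →
      ∃ e, |e| ≤ C ∧ l2 (fun x => η (x + a) - e * deriv (Q c) x) ≤ C * √α := by
  obtain ⟨α₀, C, h0, h1, hC, key⟩ := h.exists_hessForm_le
  obtain ⟨M, hM⟩ := h.nonlin.exists_bounds K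
  have hk := h.gap_pos
  refine ⟨α₀, (1 + 1 / k) + √(C / k), h0, h1, by positivity, fun c hc α hα hα₀ a η hη => ?_⟩
  have hb := key c hc α hα hα₀ a η hη
  obtain ⟨⟨hηH, horth, hnorm⟩, -⟩ := hη
  rw [hessForm_eq_quad f Q c a hηH] at hb
  have horth1 := ((h.isSympOrth_iff hc α a η).1 horth).1
  have hnorm' : ∫ x, η (x + a) ^ 2 = 1 := (integral_shift (fun x => η x ^ 2) a).trans hnorm
  have hζ := (hηH.shift a).1
  set ζ : ℝ → ℝ := fun x => η (x + a)
  have hpm := h.q1_memLp hc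
  have hqm := h.q_memLp hc
  have hA := h.q1_sq_ge c hc
  set A := ∫ x, deriv (Q c) x ^ 2
  have hA0 : 0 < A := hk.trans_le hA
  set e := (∫ x, ζ x * deriv (Q c) x) / A
  have heA : e * A = ∫ x, ζ x * deriv (Q c) x := div_mul_cancel₀ _ hA0.ne'
  have he : |e| ≤ 1 + 1 / k := by
    have b := sq_integral_mul_le hζ.memLp hpm
    rw [hnorm', ← heA, one_mul, mul_pow] at b
    have b2 : e ^ 2 * A ≤ 1 := le_of_mul_le_mul_right (by linarith) hA0
    have b3 : e ^ 2 * k ≤ 1 := (mul_le_mul_of_nonneg_left hA (sq_nonneg e)).trans b2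
    have b4 : e ^ 2 ≤ 1 / k := by rwa [le_div_iff₀ hk]
    have hk' : 0 < 1 / k := by positivity
    apply abs_le_of_sq_le_sq _ (by positivity)
    nlinarith
  refine ⟨e, he.trans (le_add_of_nonneg_right (Real.sqrt_nonneg _)), ?_⟩
  obtain ⟨r, hr, er⟩ := hζ.exists_primitive
  have hrm : MemLp r 2 volume := hζ.memLp.ae_eq er
  have hq₁p : IsPrimitive (deriv (Q c)) (fun y => c * Q c y - f (Q c y)) :=
    .of_hasDerivAt (h.q1_hasDerivAt hc) (h.q2_cont hc)
  have hq₂m : MemLp (fun y => c * Q c y - f (Q c y)) 2 volume :=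
    (h.q2_bd hM hc).memLp h.nu_pos (h.q2_cont hc)
  have hyp := hr.add (hq₁p.const_mul (-e))
  have hym : MemLp (fun x => r x + -e * deriv (Q c) x) 2 volume := hrm.add (hpm.const_mul (-e))
  have hy₁m : MemLp (fun x => weakDeriv ζ x + -e * (c * Q c x - f (Q c x))) 2 volume :=
    hζ.memLp_weakDeriv.add (hq₂m.const_mul (-e))
  have hyH := (MemH1.of_primitive hyp hym hy₁m).1
  have hquad : quad f Q c (fun x => r x + -e * deriv (Q c) x) ≤ C * α := by
    rw [quad_of_isPrimitive f Q c hyp hym hy₁m, h.quad_add_q1 hc hr hrm hζ.memLp_weakDeriv]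
    refine le_of_eq_of_le (integral_congr_ae ?_) hb
    exact er.mono fun x hx => by simp only [hx]
  have i1 := integrable_mul_of_memLp hrm hqm
  have i2 := integrable_mul_of_memLp hpm hqm
  have i3 := integrable_mul_of_memLp hrm hpm
  have i4 := hpm.integrable_sq
  have opq : ∫ y, deriv (Q c) y * Q c y = 0 := integral_eq_zero_of_odd fun y => by
    rw [(h.profile c hc).deriv_odd, (h.profile c hc).even]; ring
  have p1 : ∫ x, (r x + -e * deriv (Q c) x) * Q c x = 0 := by
    have e1 : (fun x => (r x + -e * deriv (Q c) x) * Q c x)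
        = fun x => r x * Q c x + -e * (deriv (Q c) x * Q c x) := by funext x; ring
    rw [e1]
    simp (disch := fun_prop) only [integral_add, integral_const_mul]
    rw [opq, mul_zero, add_zero, ← horth1]
    exact integral_congr_ae (er.mono fun x hx => by
      change r x * _ = ζ x * _
      rw [hx])
  have p2 : ∫ x, (r x + -e * deriv (Q c) x) * deriv (Q c) x = 0 := by
    have e1 : (fun x => (r x + -e * deriv (Q c) x) * deriv (Q c) x)
        = fun x => r x * deriv (Q c) x + -e * deriv (Q c) x ^ 2 := by funext x; ring
    rw [e1]
    simp (disch := fun_prop) only [integral_add, integral_const_mul]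
    have e2 : ∫ x, r x * deriv (Q c) x = e * A := by
      rw [heA]
      exact integral_congr_ae (er.mono fun x hx => by simp only [hx])
    rw [e2]
    simp only [A]
    ring
  have hco := h.coercive c hc _ hyH
  rw [p1, p2] at hco
  have e3 : l2 (fun x => ζ x - e * deriv (Q c) x) = l2 (fun x => r x + -e * deriv (Q c) x) :=
    l2_congr (er.mono fun x hx => by simp only [hx]; ring)
  have b1 : l2 (fun x => r x + -e * deriv (Q c) x) ^ 2 ≤ C / k * α := by
    rw [div_mul_eq_mul_div, le_div_iff₀ hk]
    linarith
  rw [e3]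
  have b2 : l2 (fun x => r x + -e * deriv (Q c) x) ≤ √(C / k) * √α := by
    rw [← Real.sqrt_mul (by positivity)]
    exact Real.le_sqrt_of_sq_le b1
  refine b2.trans (mul_le_mul_of_nonneg_right ?_ (Real.sqrt_nonneg _))
  exact le_add_of_nonneg_left (by positivity)

end IsStableData

/-! ### Time derivatives of pairings with moving profiles -/

lemma hasDerivAt_integral_of_lip_at {F : ℝ → ℝ → ℝ} {F' bound : ℝ → ℝ} {t : ℝ}
    (hm : ∀ᶠ s in 𝓝 t, AEStronglyMeasurable (F s) volume) (hi : Integrable (F t))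
    (hm' : AEStronglyMeasurable F' volume) (hb : Integrable bound)
    (hl : ∀ᶠ s in 𝓝 t, ∀ x, |F s x - F t x| ≤ bound x * |s - t|)
    (hd : ∀ x, HasDerivAt (fun s => F s x) (F' x) t) :
    Integrable F' ∧ HasDerivAt (fun s => ∫ x, F s x) (∫ x, F' x) t := by
  have key := hasFDerivAt_integral_of_dominated_loc_of_lip' (F := F)
    (F' := fun x => ContinuousLinearMap.toSpanSingleton ℝ (F' x)) (hm.and hl)
    (fun s hs => hs.1) hi
    ((ContinuousLinearMap.toSpanSingletonCLE (𝕜 := ℝ) (E := ℝ)).continuous.comp_aestronglyMeasurable hm')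
    (.of_forall fun x s hs => hs.2 x) hb (.of_forall fun x => (hd x).hasFDerivAt)
  have e : ∀ x, (ContinuousLinearMap.toSpanSingleton ℝ (F' x)) (1 : ℝ) = F' x := fun x => by simp
  have hi' : Integrable F' := by
    refine (key.1.apply_continuousLinearMap 1).congr (.of_forall fun x => e x)
  refine ⟨hi', ?_⟩
  have := key.2.hasDerivAt
  rw [ContinuousLinearMap.integral_apply key.1] at this
  simpa only [e] using this

lemma exists_lip_at {c : ℝ → ℝ} {c' t : ℝ} (h : HasDerivAt c c' t) :
    ∃ L, 0 ≤ L ∧ ∀ᶠ s in 𝓝 t, |c s - c t| ≤ L * |s - t| := by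
  obtain ⟨L, hL, hb⟩ := h.isBigO_sub.exists_nonneg
  exact ⟨L, hL, hb.bound⟩

/-- A family of exponentially decaying profiles `Φ c` with space derivatives `Φ₁ c` and `Φ₂ c` and
speed derivative `Φc c`, Lipschitz in the speed. -/
structure IsSpeedFamily (S : Set ℝ) (Φ Φ₁ Φ₂ Φc : ℝ → ℝ → ℝ) (L ν : ℝ) : Prop where
  isOpen : IsOpen S
  rate_pos : 0 < ν
  bd : ∀ c ∈ S, ExpBd L ν (Φ c)
  bd₁ : ∀ c ∈ S, ExpBd L ν (Φ₁ c)
  bd₂ : ∀ c ∈ S, ExpBd L ν (Φ₂ c)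
  hasDerivAt : ∀ c ∈ S, ∀ x, HasDerivAt (Φ c) (Φ₁ c x) x
  hasDerivAt₁ : ∀ c ∈ S, ∀ x, HasDerivAt (Φ₁ c) (Φ₂ c x) x
  cont₂ : ∀ c ∈ S, Continuous (Φ₂ c)
  speed : ∀ c ∈ S, ∀ x, HasDerivAt (fun c' => Φ c' x) (Φc c x) c
  speed_cont : ∀ c ∈ S, Continuous (Φc c)
  lip : ∀ c ∈ S, ∀ c' ∈ S, ExpBd (L * |c - c'|) ν (fun x => Φ c x - Φ c' x)
  lip₁ : ∀ c ∈ S, ∀ c' ∈ S, ∀ x, |Φ₁ c x - Φ₁ c' x| ≤ L * |c - c'|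

namespace IsSpeedFamily

variable {S : Set ℝ} {Φ Φ₁ Φ₂ Φc : ℝ → ℝ → ℝ} {L ν : ℝ}

lemma cont (h : IsSpeedFamily S Φ Φ₁ Φ₂ Φc L ν) {c : ℝ} (hc : c ∈ S) : Continuous (Φ c) :=
  continuous_of_hasDerivAt (h.hasDerivAt c hc)

lemma cont₁ (h : IsSpeedFamily S Φ Φ₁ Φ₂ Φc L ν) {c : ℝ} (hc : c ∈ S) : Continuous (Φ₁ c) :=
  continuous_of_hasDerivAt (h.hasDerivAt₁ c hc)

lemma memLp (h : IsSpeedFamily S Φ Φ₁ Φ₂ Φc L ν) {c : ℝ} (hc : c ∈ S) : MemLp (Φ c) 2 volume :=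
  (h.bd c hc).memLp h.rate_pos (h.cont hc)

lemma memLp₁ (h : IsSpeedFamily S Φ Φ₁ Φ₂ Φc L ν) {c : ℝ} (hc : c ∈ S) : MemLp (Φ₁ c) 2 volume :=
  (h.bd₁ c hc).memLp h.rate_pos (h.cont₁ hc)

lemma memLp₂ (h : IsSpeedFamily S Φ Φ₁ Φ₂ Φc L ν) {c : ℝ} (hc : c ∈ S) : MemLp (Φ₂ c) 2 volume :=
  (h.bd₂ c hc).memLp h.rate_pos (h.cont₂ c hc)

lemma speed_bd (h : IsSpeedFamily S Φ Φ₁ Φ₂ Φc L ν) {c : ℝ} (hc : c ∈ S) : ExpBd L ν (Φc c) :=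
  fun x => abs_deriv_le_of_lip h.isOpen hc (h.speed c hc x) fun c' hc' =>
    (h.lip c' hc' c hc x).trans (le_of_eq (by ring))

lemma memLp_speed (h : IsSpeedFamily S Φ Φ₁ Φ₂ Φc L ν) {c : ℝ} (hc : c ∈ S) :
    MemLp (Φc c) 2 volume := (h.speed_bd hc).memLp h.rate_pos (h.speed_cont c hc)

lemma memH2 (h : IsSpeedFamily S Φ Φ₁ Φ₂ Φc L ν) {c : ℝ} (hc : c ∈ S) (a : ℝ) :
    MemH2 (fun x => Φ c (x - a)) ∧
    weakDeriv (fun x => Φ c (x - a)) =ᵐ[volume] (fun x => Φ₁ c (x - a)) ∧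
    weakDeriv (weakDeriv (fun x => Φ c (x - a))) =ᵐ[volume] fun x => Φ₂ c (x - a) := by
  have h1 := (h.bd c hc).memH1 h.rate_pos (h.bd₁ c hc) h.rate_pos (h.hasDerivAt c hc) (h.cont₁ hc)
  have h2 := (h.bd₁ c hc).memH1 h.rate_pos (h.bd₂ c hc) h.rate_pos (h.hasDerivAt₁ c hc)
    (h.cont₂ c hc)
  have s1 := h1.1.shift (-a)
  have s2 := h2.1.shift (-a)
  have e1 : weakDeriv (fun x => Φ c (x - a)) =ᵐ[volume] fun x => Φ₁ c (x - a) :=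
    s1.2.trans (ae_shift h1.2 (-a))
  have e2 := s2.1.congr e1.symm
  exact ⟨⟨s1.1, e2.1⟩, e1, e2.2.trans (s2.2.trans (ae_shift h2.2 (-a)))⟩

/-- The increments of the moving profile. -/
lemma expBd_increment (h : IsSpeedFamily S Φ Φ₁ Φ₂ Φc L ν) {c c' d : ℝ} (hc : c ∈ S)
    (hc' : c' ∈ S) (hd : |d| ≤ 1) :
    ExpBd (L * Real.exp ν * |d| + L * |c' - c|) ν (fun x => Φ c' (x - d) - Φ c x) := by
  intro x
  have hL := (h.bd c hc).nonneg
  have hν := h.rate_pos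
  have b1 : |Φ c' (x - d) - Φ c' x| ≤ L * Real.exp ν * expW ν x * |x - d - x| := by
    refine (convex_uIcc x (x - d)).norm_image_sub_le_of_norm_hasDerivWithin_le
      (fun z _ => (h.hasDerivAt c' hc' z).hasDerivWithinAt) (fun z hz => ?_) left_mem_uIcc
      right_mem_uIcc
    refine (h.bd₁ c' hc' z).trans ?_
    rw [mul_assoc]
    refine mul_le_mul_of_nonneg_left ((expW_shift hν.le z x).trans ?_) hL
    refine mul_le_mul_of_nonneg_right (Real.exp_le_exp.2 ?_) (expW_pos _ _).le
    have hzx : |z - x| ≤ |d| := by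
      have := abs_sub_left_of_mem_uIcc hz
      rwa [sub_sub_cancel_left, abs_neg] at this
    exact mul_le_of_le_one_right hν.le (hzx.trans hd)
  rw [sub_sub_cancel_left, abs_neg] at b1
  have b2 := h.lip c' hc' c hc x
  have b3 := abs_add_le (Φ c' (x - d) - Φ c' x) (Φ c' x - Φ c x)
  rw [sub_add_sub_cancel] at b3
  linarith

/-- A chain rule for a profile moving with `a` and deforming with `c`, although `Φ` is not assumed to
be jointly differentiable in speed and position. -/
lemma hasDerivAt_moving (h : IsSpeedFamily S Φ Φ₁ Φ₂ Φc L ν) {a c : ℝ → ℝ} {a' c' t : ℝ}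
    (hc : c t ∈ S) (ha : HasDerivAt a a' t) (hcd : HasDerivAt c c' t) (x : ℝ) :
    HasDerivAt (fun s => Φ (c s) (x - a s))
      (c' * Φc (c t) (x - a t) - a' * Φ₁ (c t) (x - a t)) t := by
  have hcS : ∀ᶠ s in 𝓝 t, c s ∈ S := hcd.continuousAt.eventually (h.isOpen.mem_nhds hc)
  have d1 : HasDerivAt (fun s => Φ (c s) (x - a t)) (Φc (c t) (x - a t) * c') t :=
    (h.speed (c t) hc (x - a t)).comp t hcd
  have d2 : HasDerivAt (fun s => Φ (c t) (x - a s)) (Φ₁ (c t) (x - a t) * (-a')) t :=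
    (h.hasDerivAt (c t) hc (x - a t)).comp t (ha.const_sub x)
  -- the mixed increment is quadratic in the time step
  have d3 : HasDerivAt (fun s => (Φ (c s) (x - a s) - Φ (c t) (x - a s))
      - (Φ (c s) (x - a t) - Φ (c t) (x - a t))) 0 t := by
    obtain ⟨A, hA, ea⟩ := exists_lip_at ha
    obtain ⟨C, hC, ec⟩ := exists_lip_at hcd
    rw [hasDerivAt_iff_isLittleO]
    have hO : (fun s => (Φ (c s) (x - a s) - Φ (c t) (x - a s))
        - (Φ (c s) (x - a t) - Φ (c t) (x - a t))) =O[𝓝 t] fun s => (s - t) ^ 2 := by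
      refine Asymptotics.IsBigO.of_bound (L * C * A) ?_
      filter_upwards [hcS, ea, ec] with s hs ha' hc'
      have b := abs_image_sub_le (D := fun y => Φ (c s) y - Φ (c t) y)
        (fun y => (h.hasDerivAt _ hs y).sub (h.hasDerivAt _ hc y)) (h.lip₁ _ hs _ hc)
        (x - a s) (x - a t)
      rw [sub_sub_sub_cancel_left, abs_sub_comm (a t)] at b
      have hL := (h.bd _ hc).nonneg
      rw [Real.norm_eq_abs, Real.norm_eq_abs, abs_pow]
      refine b.trans ?_
      calc L * |c s - c t| * |a s - a t| ≤ L * (C * |s - t|) * (A * |s - t|) := by gcongr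
        _ = _ := by ring
    simp only [sub_self, smul_zero, sub_zero]
    refine hO.trans_isLittleO ?_
    have := Asymptotics.isLittleO_pow_sub_sub t (m := 2) (by norm_num)
    simpa using this
  have d4 := ((d1.fun_add d2).fun_add d3).add_const (-Φ (c t) (x - a t))
  have e : (fun s => Φ (c s) (x - a t) + Φ (c t) (x - a s) + (Φ (c s) (x - a s) - Φ (c t) (x - a s)
      - (Φ (c s) (x - a t) - Φ (c t) (x - a t))) + -Φ (c t) (x - a t))
      = fun s => Φ (c s) (x - a s) := by funext s; ring
  rw [e] at d4
  exact d4.congr_deriv (by ring)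

/-- Eventually, the increment of the moving profile is bounded by the time step. -/
lemma eventually_expBd (h : IsSpeedFamily S Φ Φ₁ Φ₂ Φc L ν) {a c : ℝ → ℝ} {a' c' t : ℝ}
    (hc : c t ∈ S) (ha : HasDerivAt a a' t) (hcd : HasDerivAt c c' t) :
    ∃ B, 0 ≤ B ∧ ∀ᶠ s in 𝓝 t, c s ∈ S ∧
      ExpBd (B * |s - t|) ν (fun x => Φ (c s) (x - (a s - a t)) - Φ (c t) x) := by
  have hcS : ∀ᶠ s in 𝓝 t, c s ∈ S := hcd.continuousAt.eventually (h.isOpen.mem_nhds hc)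
  obtain ⟨A, hA, ea⟩ := exists_lip_at ha
  obtain ⟨C, hC, ec⟩ := exists_lip_at hcd
  have hL := (h.bd _ hc).nonneg
  have ea1 : ∀ᶠ s in 𝓝 t, |a s - a t| < 1 := by
    have := ha.continuousAt.eventually (Metric.ball_mem_nhds (a t) one_pos)
    simpa [Real.dist_eq] using this
  refine ⟨L * Real.exp ν * A + L * C, by positivity, ?_⟩
  filter_upwards [hcS, ea, ec, ea1] with s hs h1 h2 h3
  refine ⟨hs, (h.expBd_increment hc hs h3.le).mono ?_ le_rfl⟩
  calc L * Real.exp ν * |a s - a t| + L * |c s - c t|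
      ≤ L * Real.exp ν * (A * |s - t|) + L * (C * |s - t|) := by gcongr
    _ = _ := by ring

/-- The pairing of a fixed function with a moving profile. -/
lemma hasDerivAt_pairing_const (h : IsSpeedFamily S Φ Φ₁ Φ₂ Φc L ν) {a c : ℝ → ℝ} {a' c' t : ℝ}
    (hc : c t ∈ S) (ha : HasDerivAt a a' t) (hcd : HasDerivAt c c' t) {v : ℝ → ℝ}
    (hv : MemLp v 2 volume) :
    HasDerivAt (fun s => ∫ x, v x * Φ (c s) (x - a s))
      (∫ x, v x * (c' * Φc (c t) (x - a t) - a' * Φ₁ (c t) (x - a t))) t := by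
  obtain ⟨B, hB, ev⟩ := h.eventually_expBd hc ha hcd
  have hw : MemLp (fun x => expW ν (x - a t)) 2 volume := by
    have hb : ExpBd 1 ν (expW ν) := fun x => by
      rw [one_mul, abs_of_pos (expW_pos ν x)]
    exact memLp_comp_add (hb.memLp h.rate_pos (continuous_expW ν)) (-a t)
  have hb : Integrable (fun x => |v x| * expW ν (x - a t)) := integrable_mul_of_memLp hv.abs hw
  refine (hasDerivAt_integral_of_lip_at (F := fun s x => v x * Φ (c s) (x - a s))
    (bound := fun x => B * (|v x| * expW ν (x - a t))) ?_ ?_ ?_ (hb.const_mul B) ?_ ?_).2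
  · filter_upwards [ev] with s hs
    have := h.cont hs.1
    exact hv.1.mul (by fun_prop : Continuous fun x => Φ (c s) (x - a s)).aestronglyMeasurable
  · exact integrable_mul_of_memLp hv (memLp_comp_add (h.memLp hc) (-a t))
  · have h1 := h.cont₁ hc
    have h2 := h.speed_cont _ hc
    exact hv.1.mul (by fun_prop : Continuous fun x =>
      c' * Φc (c t) (x - a t) - a' * Φ₁ (c t) (x - a t)).aestronglyMeasurable
  · filter_upwards [ev] with s hs x
    have := hs.2 (x - a t)
    simp only [sub_sub_sub_cancel_right] at this
    rw [← mul_sub, abs_mul]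
    refine (mul_le_mul_of_nonneg_left this (abs_nonneg _)).trans (le_of_eq (by ring))
  · intro x
    exact (h.hasDerivAt_moving hc ha hcd x).const_mul (v x)

/-- The time derivative of the pairing of a solution with a moving profile. -/
lemma hasDerivAt_pairing (h : IsSpeedFamily S Φ Φ₁ Φ₂ Φc L ν) {f : ℝ → ℝ} {b : ℝ → ℝ → ℝ}
    {J : Set ℝ} {u : ℝ → ℝ → ℝ} (hu : IsSolution f b J u) (hJ : IsOpen J) {a c : ℝ → ℝ}
    {a' c' t : ℝ} (ht : t ∈ J) (hc : c t ∈ S) (ha : HasDerivAt a a' t) (hcd : HasDerivAt c c' t) :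
    HasDerivAt (fun s => ∫ x, u s x * Φ (c s) (x - a s))
      ((∫ x, (-(weakDeriv (u t) x * Φ₂ (c t) (x - a t))
        + (f (u t x) - b t x * u t x) * Φ₁ (c t) (x - a t)))
        + ∫ x, u t x * (c' * Φc (c t) (x - a t) - a' * Φ₁ (c t) (x - a t))) t := by
  obtain ⟨B, hB, ev⟩ := h.eventually_expBd hc ha hcd
  have hH2 := h.memH2 hc (a t)
  have d1 := hu.eqn t ht _ hH2.1
  have e1 : ∫ x, (-(weakDeriv (u t) x * weakDeriv (weakDeriv (fun x => Φ (c t) (x - a t))) x)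
        + (f (u t x) - b t x * u t x) * weakDeriv (fun x => Φ (c t) (x - a t)) x)
      = ∫ x, (-(weakDeriv (u t) x * Φ₂ (c t) (x - a t))
        + (f (u t x) - b t x * u t x) * Φ₁ (c t) (x - a t)) := by
    refine integral_congr_ae ?_
    filter_upwards [hH2.2.1, hH2.2.2] with x h1 h2
    rw [h1, h2]
  rw [e1] at d1
  have d2 := h.hasDerivAt_pairing_const hc ha hcd (hu.mem t ht).memLp
  have hΦm : ∀ s, c s ∈ S → MemLp (fun x => Φ (c s) (x - a s)) 2 volume := fun s hs =>
    memLp_comp_add (h.memLp hs) (-a s)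
  have hJn : J ∈ 𝓝 t := hJ.mem_nhds ht
  -- the product of the two increments does not contribute
  have d3 : HasDerivAt (fun s => ∫ x, (u s x - u t x) * (Φ (c s) (x - a s) - Φ (c t) (x - a t)))
      0 t := by
    have hcont := hu.cont t ht
    rw [hJ.nhdsWithin_eq ht] at hcont
    rw [hasDerivAt_iff_isLittleO]
    simp only [sub_self, smul_zero, sub_zero, zero_mul, integral_zero]
    rw [Asymptotics.isLittleO_iff]
    intro ε hε
    have hε' : 0 < ε / (B * √(2 / ν) + 1) := by positivity
    filter_upwards [ev, hJn, hcont.eventually (gt_mem_nhds hε')] with s hs hsJ hsm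
    have hum := (hu.mem s hsJ).sub (hu.mem t ht)
    have hΦd : MemLp (fun x => Φ (c s) (x - a s) - Φ (c t) (x - a t)) 2 volume :=
      (hΦm s hs.1).sub (hΦm t hc)
    have b1 := abs_integral_mul_le hum.1.memLp hΦd
    have b2 := hs.2.l2_le h.rate_pos
    rw [← l2_shift _ (-a t)] at b2
    have e2 : (fun x => Φ (c s) (x + -a t - (a s - a t)) - Φ (c t) (x + -a t))
        = fun x => Φ (c s) (x - a s) - Φ (c t) (x - a t) := by
      funext x
      rw [← sub_eq_add_neg, sub_sub_sub_cancel_right]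
    rw [e2] at b2
    have b3 := (l2_le_h1Norm _).trans hsm.le
    rw [Real.norm_eq_abs, Real.norm_eq_abs]
    refine b1.trans ((mul_le_mul b3 b2 (l2_nonneg _) hε'.le).trans ?_)
    have b4 : ε / (B * √(2 / ν) + 1) * (B * √(2 / ν)) ≤ ε := by
      rw [div_mul_eq_mul_div, div_le_iff₀ (by positivity)]
      linarith
    calc _ = ε / (B * √(2 / ν) + 1) * (B * √(2 / ν)) * |s - t| := by ring
      _ ≤ ε * |s - t| := mul_le_mul_of_nonneg_right b4 (abs_nonneg _)
  have d4 := (((d1.fun_add d2).fun_add d3).add_const (-∫ x, u t x * Φ (c t) (x - a t)))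
  rw [add_zero] at d4
  refine d4.congr_of_eventuallyEq ?_
  filter_upwards [ev, hJn] with s hs hsJ
  have hus := (hu.mem s hsJ).memLp
  have hut := (hu.mem t ht).memLp
  have i1 := integrable_mul_of_memLp hus (hΦm s hs.1)
  have i2 := integrable_mul_of_memLp hus (hΦm t hc)
  have i3 := integrable_mul_of_memLp hut (hΦm s hs.1)
  have i4 := integrable_mul_of_memLp hut (hΦm t hc)
  have e3 : (fun x => (u s x - u t x) * (Φ (c s) (x - a s) - Φ (c t) (x - a t)))
      = fun x => u s x * Φ (c s) (x - a s) - u s x * Φ (c t) (x - a t)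
        - u t x * Φ (c s) (x - a s) + u t x * Φ (c t) (x - a t) := by funext x; ring
  rw [e3]
  simp (disch := fun_prop) only [integral_add, integral_sub]
  ring

end IsSpeedFamily

/-! ### The test profiles of the constraints and of the correction -/

namespace IsWaveData

variable {f : ℝ → ℝ} {Q : ℝ → ℝ → ℝ} {S : Set ℝ} {K ν α : ℝ}

/-- The test profile of the first constraint. -/
lemma speedFamily_q (h : IsWaveData f Q S K ν) : ∃ L, IsSpeedFamily S Q (fun c => deriv (Q c))
    (fun c x => c * Q c x - f (Q c x)) (zc Q) L ν := by
  obtain ⟨M, hM⟩ := h.nonlin.exists_bounds K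
  have hM0 := hM.nonneg
  have hK := h.bound_nonneg
  have hp : 0 ≤ (K + M) * K := by positivity
  refine ⟨K + (K + M) * K, ?_⟩
  have hL : K ≤ K + (K + M) * K := by linarith
  exact {
    isOpen := h.isOpen
    rate_pos := h.nu_pos
    bd := fun c hc => (h.q_bd c hc).mono hL le_rfl
    bd₁ := fun c hc => (h.q1_bd c hc).mono hL le_rfl
    bd₂ := fun c hc => (h.q2_bd hM hc).mono (by linarith) le_rfl
    hasDerivAt := fun c hc => h.q_hasDerivAt hc
    hasDerivAt₁ := fun c hc => h.q1_hasDerivAt hc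
    cont₂ := fun c hc => h.q2_cont hc
    speed := h.q_speed
    speed_cont := fun c hc => h.z_cont hc
    lip := fun c hc c' hc' => (h.q_lip c hc c' hc').mono
      (mul_le_mul_of_nonneg_right hL (abs_nonneg _)) le_rfl
    lip₁ := fun c hc c' hc' x => ((h.q1_lip c hc c' hc').le h.nu_pos.le x).trans
      (mul_le_mul_of_nonneg_right hL (abs_nonneg _)) }

/-- The test profile of the correction term of the Lyapunov functional. -/
lemma speedFamily_id_mul_q (h : IsWaveData f Q S K ν) : ∃ L,
    IsSpeedFamily S (fun c x => x * Q c x) (fun c x => Q c x + x * deriv (Q c) x)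
      (fun c x => 2 * deriv (Q c) x + x * (c * Q c x - f (Q c x))) (fun c x => x * zc Q c x)
      L (ν / 2) := by
  obtain ⟨M, hM⟩ := h.nonlin.exists_bounds K
  have hM0 := hM.nonneg
  have hK := h.bound_nonneg
  have hν := h.nu_pos
  have p1 : 0 ≤ K * (2 / ν) := by positivity
  have p2 : 0 ≤ (K + M) * K * (2 / ν) := by positivity
  have hν2 : ν / 2 ≤ ν := by linarith
  refine ⟨2 * K + K * (2 / ν) + (K + M) * K * (2 / ν), ?_⟩
  exact {
    isOpen := h.isOpen
    rate_pos := by positivity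
    bd := fun c hc => ((h.q_bd c hc).id_mul hν).mono (by linarith) le_rfl
    bd₁ := fun c hc => (((h.q_bd c hc).mono le_rfl hν2).add ((h.q1_bd c hc).id_mul hν)).mono
      (by linarith) le_rfl
    bd₂ := fun c hc => ((((h.q1_bd c hc).const_mul 2).mono le_rfl hν2).add
      ((h.q2_bd hM hc).id_mul hν)).mono (by rw [abs_two]; linarith) le_rfl
    hasDerivAt := fun c hc x => ((hasDerivAt_id' x).fun_mul (h.q_hasDerivAt hc x)).congr_deriv
      (by ring)
    hasDerivAt₁ := fun c hc x => ((h.q_hasDerivAt hc x).fun_add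
      ((hasDerivAt_id' x).fun_mul (h.q1_hasDerivAt hc x))).congr_deriv (by ring)
    cont₂ := fun c hc => (continuous_const.mul (h.q1_cont hc)).add
      (continuous_id.mul (h.q2_cont hc))
    speed := fun c hc x => (h.q_speed c hc x).const_mul x
    speed_cont := fun c hc => continuous_id.mul (h.z_cont hc)
    lip := fun c hc c' hc' => by
      have := (h.q_lip c hc c' hc').id_mul hν
      have e : (fun x => x * (Q c x - Q c' x)) = fun x => x * Q c x - x * Q c' x := by
        funext x; ring
      rw [e] at this
      refine this.mono ?_ le_rfl
      have := abs_nonneg (c - c')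
      calc K * |c - c'| * (2 / ν) = K * (2 / ν) * |c - c'| := by ring
        _ ≤ _ := mul_le_mul_of_nonneg_right (by linarith) this
    lip₁ := fun c hc c' hc' x => by
      have b1 := (h.q_lip c hc c' hc').le hν.le x
      have b2 := ((h.q1_lip c hc c' hc').id_mul hν).le (by positivity) x
      have e : Q c x + x * deriv (Q c) x - (Q c' x + x * deriv (Q c') x)
          = (Q c x - Q c' x) + x * (deriv (Q c) x - deriv (Q c') x) := by ring
      rw [e]
      refine (abs_add_le _ _).trans ((add_le_add b1 b2).trans ?_)
      have := abs_nonneg (c - c')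
      calc K * |c - c'| + K * |c - c'| * (2 / ν) = (K + K * (2 / ν)) * |c - c'| := by ring
        _ ≤ _ := mul_le_mul_of_nonneg_right (by linarith) this }

lemma wc_speed (h : IsWaveData f Q S K ν) (hα : 0 ≤ α) {c : ℝ} (hc : c ∈ S) (x : ℝ) :
    HasDerivAt (fun c' => wc Q α c' x) (wzc Q α c x) c := by
  have hexp : ∀ y ∈ Iic x, Real.exp (α * (y - x)) ≤ 1 := fun y hy => by
    rw [Real.exp_le_one_iff]
    have : y ≤ x := hy
    nlinarith
  have hint : Integrable (fun y => K * expW ν y) (volume.restrict (Iic x)) :=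
    ((integrable_expW h.nu_pos).const_mul K).restrict
  refine (hasDerivAt_integral_of_dominated_loc_of_lip (μ := volume.restrict (Iic x))
    (F := fun c' y => zc Q c' y * Real.exp (α * (y - x)))
    (F' := fun y => zzc Q c y * Real.exp (α * (y - x)))
    (bound := fun y => K * expW ν y) (h.isOpen.mem_nhds hc) ?_ ?_ ?_ ?_ hint ?_).2
  · filter_upwards [h.isOpen.mem_nhds hc] with c' h'
    have := h.z_cont h'
    exact (by fun_prop : Continuous fun y => zc Q c' y * Real.exp (α * (y - x))).aestronglyMeasurable
  · exact integrableOn_regSymp (h.z_bd c hc) h.nu_pos (h.z_cont hc) hα x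
  · have := h.zz_cont c hc
    exact (by fun_prop : Continuous fun y => zzc Q c y * Real.exp (α * (y - x))).aestronglyMeasurable
  · refine (ae_restrict_iff' measurableSet_Iic).2 (.of_forall fun y hy =>
      LipschitzOnWith.of_dist_le_mul fun c₁ h₁ c₂ h₂ => ?_)
    rw [Real.dist_eq, Real.dist_eq, ← sub_mul, abs_mul, Real.abs_exp]
    have b := h.z_lip c₁ h₁ c₂ h₂ y
    have b2 := mul_le_of_le_one_right (abs_nonneg (zc Q c₁ y - zc Q c₂ y)) (hexp y hy)
    have e : ((Real.nnabs (K * expW ν y) : NNReal) : ℝ) = K * expW ν y := by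
      rw [Real.coe_nnabs, abs_of_nonneg (mul_nonneg h.bound_nonneg (expW_pos _ _).le)]
    rw [e]
    linarith
  · exact .of_forall fun y => (h.z_speed c hc y).mul_const _

/-- The test profile of the second constraint. Its bounds degenerate as `α → 0`, but they only serve
to differentiate the constraint in time. -/
lemma speedFamily_wc (h : IsWaveData f Q S K ν) (hα : 0 < α) : ∃ L,
    IsSpeedFamily S (wc Q α) (fun c x => zc Q c x - α * wc Q α c x)
      (fun c x => deriv (zc Q c) x - α * (zc Q c x - α * wc Q α c x)) (wzc Q α)
      L (min α (ν / 2)) := by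
  have hK := h.bound_nonneg
  have hν := h.nu_pos
  have hr : min α (ν / 2) ≤ ν := (min_le_right _ _).trans (by linarith)
  have bd : ∀ c ∈ S, ExpBd (4 * K / ν) (min α (ν / 2)) (wc Q α c) := fun c hc =>
    expBd_regSymp (h.z_bd c hc) hν hα.le
  have bd₁ : ∀ c ∈ S, ExpBd (K + α * (4 * K / ν)) (min α (ν / 2))
      (fun x => zc Q c x - α * wc Q α c x) := fun c hc => by
    have := (bd c hc).const_mul α
    rw [abs_of_pos hα] at this
    exact ((h.z_bd c hc).mono le_rfl hr).sub this
  have bd₂ : ∀ c ∈ S, ExpBd (K + α * (K + α * (4 * K / ν))) (min α (ν / 2))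
      (fun x => deriv (zc Q c) x - α * (zc Q c x - α * wc Q α c x)) := fun c hc => by
    have := (bd₁ c hc).const_mul α
    rw [abs_of_pos hα] at this
    exact ((h.z1_bd c hc).mono le_rfl hr).sub this
  have lip : ∀ c ∈ S, ∀ c' ∈ S, ExpBd (4 * (K * |c - c'|) / ν) (min α (ν / 2))
      (fun x => wc Q α c x - wc Q α c' x) := fun c hc c' hc' => by
    have b := expBd_regSymp (h.z_lip c hc c' hc') hν hα.le
    have e : regSymp α (fun x => zc Q c x - zc Q c' x) = fun x => wc Q α c x - wc Q α c' x :=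
      funext fun x => regSymp_sub (h.z_bd c hc) (h.z_bd c' hc') hν (h.z_cont hc) (h.z_cont hc')
        hα.le x
    rwa [e] at b
  have hrp : 0 < min α (ν / 2) := regSymp_rate_pos hν hα
  have p0 : 0 ≤ 4 * K / ν := by positivity
  have p1 : 0 ≤ α * K := by positivity
  have p2 : 0 ≤ α * (4 * K / ν) := by positivity
  have p3 : 0 ≤ α * (α * (4 * K / ν)) := by positivity
  refine ⟨K + 4 * K / ν + α * K + α * (4 * K / ν) + α * (α * (4 * K / ν)), ?_⟩
  exact {
    isOpen := h.isOpen
    rate_pos := hrp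
    bd := fun c hc => (bd c hc).mono (by linarith) le_rfl
    bd₁ := fun c hc => (bd₁ c hc).mono (by linarith) le_rfl
    bd₂ := fun c hc => (bd₂ c hc).mono (by linarith) le_rfl
    hasDerivAt := fun c hc => h.wc_hasDerivAt hc hα.le
    hasDerivAt₁ := fun c hc x => (h.z_hasDerivAt c hc x).fun_sub
      ((h.wc_hasDerivAt hc hα.le x).const_mul α)
    cont₂ := fun c hc => (h.z1_cont hc).sub ((h.wc1_cont hc hα.le).const_mul α)
    speed := fun c hc x => h.wc_speed hα.le hc x
    speed_cont := fun c hc => continuous_regSymp (h.zz_bd c hc) hν (h.zz_cont c hc) hα.le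
    lip := fun c hc c' hc' => (lip c hc c' hc').mono (by
      have e : 4 * (K * |c - c'|) / ν = 4 * K / ν * |c - c'| := by ring
      rw [e]
      exact mul_le_mul_of_nonneg_right (by linarith) (abs_nonneg _)) le_rfl
    lip₁ := fun c hc c' hc' x => by
      have b1 := (h.z_lip c hc c' hc').le hν.le x
      have b2 := mul_le_mul_of_nonneg_left ((lip c hc c' hc').le hrp.le x) hα.le
      have e : zc Q c x - α * wc Q α c x - (zc Q c' x - α * wc Q α c' x)
          = (zc Q c x - zc Q c' x) - α * (wc Q α c x - wc Q α c' x) := by ring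
      rw [e]
      refine (abs_sub _ _).trans ?_
      rw [abs_mul, abs_of_pos hα]
      calc _ ≤ K * |c - c'| + α * (4 * (K * |c - c'|) / ν) := add_le_add b1 b2
        _ = (K + α * (4 * K / ν)) * |c - c'| := by ring
        _ ≤ _ := mul_le_mul_of_nonneg_right (by linarith) (abs_nonneg _) }

variable {Φ Φ₁ Φ₂ Φc : ℝ → ℝ → ℝ} {L ν' : ℝ}

lemma hasDerivAt_wave_pairing (h : IsWaveData f Q S K ν)
    (hΦ : IsSpeedFamily S Φ Φ₁ Φ₂ Φc L ν') {c : ℝ} (hc : c ∈ S) :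
    HasDerivAt (fun c' => ∫ x, Q c' x * Φ c' x)
      (∫ x, (zc Q c x * Φ c x + Q c x * Φc c x)) c := by
  have hL := (hΦ.bd c hc).nonneg
  have hK := h.bound_nonneg
  refine h.hasDerivAt_integral_speed hc (G := fun c' x => Q c' x * Φ c' x)
    (bd := fun x => 2 * (L * K) * expW ν x)
    (fun c' h' => (h.q_cont h').mul (hΦ.cont h'))
    (integrable_mul_of_memLp (h.q_memLp hc) (hΦ.memLp hc))
    (((h.z_cont hc).mul (hΦ.cont hc)).add ((h.q_cont hc).mul (hΦ.speed_cont c hc)))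
    ((integrable_expW h.nu_pos).const_mul _) (fun c₁ h₁ c₂ h₂ x => ?_)
    (fun x => (h.q_speed c hc x).fun_mul (hΦ.speed c hc x))
  have e : Q c₁ x * Φ c₁ x - Q c₂ x * Φ c₂ x
      = (Q c₁ x - Q c₂ x) * Φ c₁ x + Q c₂ x * (Φ c₁ x - Φ c₂ x) := by ring
  rw [e]
  refine (abs_add_le _ _).trans ?_
  rw [abs_mul, abs_mul]
  have b1 := mul_le_mul (h.q_lip c₁ h₁ c₂ h₂ x) ((hΦ.bd c₁ h₁).le hΦ.rate_pos.le x) (abs_nonneg _)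
    ((abs_nonneg _).trans (h.q_lip c₁ h₁ c₂ h₂ x))
  have b2 := mul_le_mul (h.q_bd c₂ h₂ x) ((hΦ.lip c₁ h₁ c₂ h₂).le hΦ.rate_pos.le x) (abs_nonneg _)
    ((abs_nonneg _).trans (h.q_bd c₂ h₂ x))
  linarith

/-- The time derivative of the pairing of the fluctuation with a moving profile. -/
lemma hasDerivAt_fluct_pairing (h : IsWaveData f Q S K ν)
    (hΦ : IsSpeedFamily S Φ Φ₁ Φ₂ Φc L ν') {b : ℝ → ℝ → ℝ}
    {J : Set ℝ} {u : ℝ → ℝ → ℝ} (hu : IsSolution f b J u) (hJ : IsOpen J) {a c : ℝ → ℝ}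
    {a' c' t : ℝ} (ht : t ∈ J) (hc : c t ∈ S) (ha : HasDerivAt a a' t) (hcd : HasDerivAt c c' t) :
    HasDerivAt (fun s => ∫ x, fluct Q u a c s x * Φ (c s) (x - a s))
      ((∫ x, (-(weakDeriv (u t) x * Φ₂ (c t) (x - a t))
        + (f (u t x) - b t x * u t x) * Φ₁ (c t) (x - a t)))
        + (∫ x, u t x * (c' * Φc (c t) (x - a t) - a' * Φ₁ (c t) (x - a t)))
        - (∫ x, (zc Q (c t) x * Φ (c t) x + Q (c t) x * Φc (c t) x)) * c') t := by
  have d1 := hΦ.hasDerivAt_pairing hu hJ ht hc ha hcd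
  have d2 := (h.hasDerivAt_wave_pairing hΦ hc).comp t hcd
  refine (d1.fun_sub d2).congr_of_eventuallyEq ?_
  filter_upwards [hJ.mem_nhds ht, hcd.continuousAt.eventually (h.isOpen.mem_nhds hc)] with s hs hcs
  have hΦm := memLp_comp_add (hΦ.memLp hcs) (-a s)
  have hqm := memLp_comp_add (h.q_memLp hcs) (-a s)
  simp only [← sub_eq_add_neg] at hΦm hqm
  have i1 := integrable_mul_of_memLp (hu.mem s hs).memLp hΦm
  have i2 := integrable_mul_of_memLp hqm hΦm
  have e := integral_shift (fun x => Q (c s) x * Φ (c s) x) (-a s)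
  simp only [← sub_eq_add_neg] at e
  simp only [fluct, wave, sub_mul, Function.comp]
  rw [integral_sub i1 i2, e]

end IsWaveData

/-! ### Pairings with the fluctuation in the moving frame -/

/-- `Ξ` is an absolutely continuous representative of an `H¹` function of norm at most `r`, and
`g` is its derivative. -/
structure IsH1Rep (Ξ g : ℝ → ℝ) (r : ℝ) : Prop where
  prim : IsPrimitive Ξ g
  memLp : MemLp Ξ 2 volume
  memLp' : MemLp g 2 volume
  abs_le : ∀ x, |Ξ x| ≤ r
  l2_le : l2 Ξ ≤ r
  l2_le' : l2 g ≤ r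

/-- The potential at a fixed time in the moving frame, with its first two space derivatives. -/
structure IsFrozenPotential (B B₁ B₂ : ℝ → ℝ) (εa εx : ℝ) : Prop where
  hasDerivAt : ∀ x, HasDerivAt B (B₁ x) x
  hasDerivAt₁ : ∀ x, HasDerivAt B₁ (B₂ x) x
  measurable : Measurable B₂
  abs_le : ∀ x, |B x| ≤ εa
  abs_le₁ : ∀ x, |B₁ x| ≤ εa * εx
  abs_le₂ : ∀ x, |B₂ x| ≤ εa * εx ^ 2

namespace IsFrozenPotential

variable {B B₁ B₂ : ℝ → ℝ} {εa εx : ℝ}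

lemma cont (h : IsFrozenPotential B B₁ B₂ εa εx) : Continuous B :=
  continuous_of_hasDerivAt h.hasDerivAt

lemma cont₁ (h : IsFrozenPotential B B₁ B₂ εa εx) : Continuous B₁ :=
  continuous_of_hasDerivAt h.hasDerivAt₁

lemma abs_sub_le (h : IsFrozenPotential B B₁ B₂ εa εx) (x : ℝ) : |B x - B 0| ≤ εa * εx * |x| := by
  simpa using abs_image_sub_le h.hasDerivAt h.abs_le₁ x 0

lemma abs_sub_le₁ (h : IsFrozenPotential B B₁ B₂ εa εx) (x : ℝ) :
    |B₁ x - B₁ 0| ≤ εa * εx ^ 2 * |x| := by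
  simpa using abs_image_sub_le h.hasDerivAt₁ h.abs_le₂ x 0

end IsFrozenPotential

lemma memLp_bdd_mul {m v : ℝ → ℝ} {C : ℝ} (hv : MemLp v 2 volume)
    (hm : AEStronglyMeasurable m volume) (hb : ∀ x, |m x| ≤ C) :
    MemLp (fun x => m x * v x) 2 volume := by
  refine (hv.const_mul C).of_le (hm.mul hv.1) (.of_forall fun x => ?_)
  rw [norm_mul, norm_mul]
  exact mul_le_mul_of_nonneg_right ((hb x).trans (le_abs_self C)) (norm_nonneg _)

/-- The superlinear remainder `f(q + s) - f(q) - f'(q) s` of the nonlinearity. -/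
def nlRem (f : ℝ → ℝ) (q s : ℝ) : ℝ := f (q + s) - f q - deriv f q * s

lemma NonlinBounds.abs_nlRem_le {f : ℝ → ℝ} {R M : ℝ} (hf : IsNonlinearity f)
    (hM : NonlinBounds f R M) {q s : ℝ} (hq : |q| ≤ R) (hs : |q + s| ≤ R) :
    |nlRem f q s| ≤ M * s ^ 2 := by
  have := taylor_le hf.hasDerivAt hM.deriv_lip hq hs
  rwa [add_sub_cancel_left] at this

lemma NonlinBounds.mono {f : ℝ → ℝ} {R R' M : ℝ} (hM : NonlinBounds f R M) (h : R' ≤ R) :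
    NonlinBounds f R' M where
  nonneg := hM.nonneg
  le s hs := hM.le s (hs.trans h)
  deriv_le s hs := hM.deriv_le s (hs.trans h)
  lip s t hs ht := hM.lip s t (hs.trans h) (ht.trans h)
  deriv_lip s t hs ht := hM.deriv_lip s t (hs.trans h) (ht.trans h)
  deriv2_le s hs := hM.deriv2_le s (hs.trans h)
  deriv2_lip s t hs ht := hM.deriv2_lip s t (hs.trans h) (ht.trans h)

namespace IsWaveData

variable {f : ℝ → ℝ} {Q : ℝ → ℝ → ℝ} {S : Set ℝ} {K ν c : ℝ}
  {Ξ g : ℝ → ℝ} {r M : ℝ}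

lemma abs_nlRem_le (h : IsWaveData f Q S K ν) (hM : NonlinBounds f (K + 1) M) (hc : c ∈ S)
    (hX : IsH1Rep Ξ g r) (hr : r ≤ 1) (x : ℝ) : |nlRem f (Q c x) (Ξ x)| ≤ M * Ξ x ^ 2 := by
  have b1 := (h.q_bd c hc).le h.nu_pos.le x
  have b2 := hX.abs_le x
  have b3 := abs_add_le (Q c x) (Ξ x)
  exact hM.abs_nlRem_le h.nonlin (by linarith) (by linarith)

lemma memLp_nlRem (h : IsWaveData f Q S K ν) (hM : NonlinBounds f (K + 1) M) (hc : c ∈ S)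
    (hX : IsH1Rep Ξ g r) (hr : r ≤ 1) :
    MemLp (fun x => nlRem f (Q c x) (Ξ x)) 2 volume := by
  have c1 := h.q_cont hc
  have c2 := hX.prim.continuous
  have c3 := h.nonlin.continuous
  have c4 := h.nonlin.continuous_deriv
  have hcont : Continuous fun x => nlRem f (Q c x) (Ξ x) := by unfold nlRem; fun_prop
  refine (hX.memLp.const_mul M).of_le hcont.aestronglyMeasurable (.of_forall fun x => ?_)
  refine (h.abs_nlRem_le hM hc hX hr x).trans ?_
  rw [norm_mul, Real.norm_eq_abs, Real.norm_eq_abs, abs_of_nonneg hM.nonneg]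
  refine mul_le_mul_of_nonneg_left ?_ hM.nonneg
  rw [← sq_abs]
  have b2 := (hX.abs_le x).trans hr
  have := abs_nonneg (Ξ x)
  nlinarith

/-- The rate of change of `⟨ξ, Φ⟩`, expressed through the Hessian, the rate `c - ȧ - b(t,a)` of
slipping against the effective velocity, and the nonlinear remainder. -/
lemma pairing_rate_eq (h : IsWaveData f Q S K ν) (hM : NonlinBounds f (K + 1) M) (hc : c ∈ S)
    (hX : IsH1Rep Ξ g r) (hr : r ≤ 1) {B B₁ B₂ : ℝ → ℝ} {εa εx : ℝ}
    (hB : IsFrozenPotential B B₁ B₂ εa εx) {φ φ₁ φ₂ φc : ℝ → ℝ}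
    (hφ₁ : ∀ x, HasDerivAt φ₁ (φ₂ x) x) (hφ₂ : Continuous φ₂) (m : MemLp φ 2 volume)
    (m₁ : MemLp φ₁ 2 volume) (m₂ : MemLp φ₂ 2 volume) (mc : MemLp φc 2 volume) (a' c' : ℝ) :
    (∫ x, (-((deriv (Q c) x + g x) * φ₂ x)
        + (f (Q c x + Ξ x) - B x * (Q c x + Ξ x)) * φ₁ x))
      + (∫ x, (Q c x + Ξ x) * (c' * φc x - a' * φ₁ x))
      - (∫ x, (zc Q c x * φ x + Q c x * φc x)) * c'
    = -(∫ x, (g x * φ₂ x + (c - deriv f (Q c x)) * (Ξ x * φ₁ x)))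
      + (c - a' - B 0) * (∫ x, (Q c x + Ξ x) * φ₁ x)
      - (∫ x, (B x - B 0) * ((Q c x + Ξ x) * φ₁ x))
      + (∫ x, nlRem f (Q c x) (Ξ x) * φ₁ x)
      + c' * (∫ x, Ξ x * φc x) - c' * ∫ x, zc Q c x * φ x := by
  have hMK := hM.mono (show K ≤ K + 1 by linarith)
  have mq := h.q_memLp hc
  have mq1 := h.q1_memLp hc
  have mq2 : MemLp (fun x => c * Q c x - f (Q c x)) 2 volume :=
    (h.q2_bd hMK hc).memLp h.nu_pos (h.q2_cont hc)
  have mX := hX.memLp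
  have mU : MemLp (fun x => Q c x + Ξ x) 2 volume := mq.add mX
  have mBU : MemLp (fun x => (B x - B 0) * (Q c x + Ξ x)) 2 volume :=
    memLp_bdd_mul mU (hB.cont.sub continuous_const).aestronglyMeasurable
      (C := εa + εa) fun x => (abs_sub _ _).trans (add_le_add (hB.abs_le x) (hB.abs_le 0))
  have mfX : MemLp (fun x => deriv f (Q c x) * Ξ x) 2 volume :=
    memLp_bdd_mul mX (h.deriv_f_cont hc).aestronglyMeasurable
      ((h.deriv_f_bd hMK hc).le h.nu_pos.le)
  have mN := h.memLp_nlRem hM hc hX hr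
  have i1 := integrable_mul_of_memLp mq1 m₂
  have i2 := integrable_mul_of_memLp hX.memLp' m₂
  have i3 := integrable_mul_of_memLp mq2 m₁
  have i4 := integrable_mul_of_memLp mq m₁
  have i5 := integrable_mul_of_memLp mX m₁
  have i6 := integrable_mul_of_memLp mfX m₁
  have i7 := integrable_mul_of_memLp mN m₁
  have i8 := integrable_mul_of_memLp mBU m₁
  have i9 := integrable_mul_of_memLp mX mc
  have i10 := integrable_mul_of_memLp mq mc
  have i11 := integrable_mul_of_memLp (h.z_memLp hc) m
  have hq₁p : IsPrimitive (deriv (Q c)) (fun y => c * Q c y - f (Q c y)) :=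
    .of_hasDerivAt (h.q1_hasDerivAt hc) (h.q2_cont hc)
  have ibp := hq₁p.integral_by_parts (.of_hasDerivAt hφ₁ hφ₂) mq1 mq2 m₁ m₂
  have e1 : (fun x => -((deriv (Q c) x + g x) * φ₂ x)
        + (f (Q c x + Ξ x) - B x * (Q c x + Ξ x)) * φ₁ x)
      = fun x => c * (Q c x * φ₁ x) - (c * Q c x - f (Q c x)) * φ₁ x - deriv (Q c) x * φ₂ x
        - g x * φ₂ x + deriv f (Q c x) * Ξ x * φ₁ x + nlRem f (Q c x) (Ξ x) * φ₁ x
        - (B x - B 0) * (Q c x + Ξ x) * φ₁ x - B 0 * (Q c x * φ₁ x) - B 0 * (Ξ x * φ₁ x) := by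
    funext x; simp only [nlRem]; ring
  have e2 : (fun x => (Q c x + Ξ x) * (c' * φc x - a' * φ₁ x))
      = fun x => c' * (Q c x * φc x) + c' * (Ξ x * φc x) - a' * (Q c x * φ₁ x)
        - a' * (Ξ x * φ₁ x) := by funext x; ring
  have e3 : (fun x => g x * φ₂ x + (c - deriv f (Q c x)) * (Ξ x * φ₁ x))
      = fun x => g x * φ₂ x + c * (Ξ x * φ₁ x) - deriv f (Q c x) * Ξ x * φ₁ x := by
    funext x; ring
  have e4 : (fun x => (Q c x + Ξ x) * φ₁ x) = fun x => Q c x * φ₁ x + Ξ x * φ₁ x := by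
    funext x; ring
  have e5 : (fun x => (B x - B 0) * ((Q c x + Ξ x) * φ₁ x))
      = fun x => (B x - B 0) * (Q c x + Ξ x) * φ₁ x := by funext x; ring
  rw [e1, e2, e3, e4, e5]
  simp (disch := fun_prop) only [integral_add, integral_sub, integral_const_mul]
  linarith

/-- The rate of change of `⟨ξ, Φ⟩` along a solution, in the moving frame. -/
lemma hasDerivAt_fluct_pairing_frame (h : IsWaveData f Q S K ν) (hM : NonlinBounds f (K + 1) M)
    {Φ Φ₁ Φ₂ Φc : ℝ → ℝ → ℝ} {L ν' : ℝ}
    (hΦ : IsSpeedFamily S Φ Φ₁ Φ₂ Φc L ν') {b : ℝ → ℝ → ℝ}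
    {J : Set ℝ} {u : ℝ → ℝ → ℝ} (hu : IsSolution f b J u) (hJ : IsOpen J) {a c : ℝ → ℝ}
    {a' c' t : ℝ} (ht : t ∈ J) (hc : c t ∈ S) (ha : HasDerivAt a a' t) (hcd : HasDerivAt c c' t)
    (hX : IsH1Rep Ξ g r) (hr : r ≤ 1) {B₁ B₂ : ℝ → ℝ} {εa εx : ℝ}
    (hB : IsFrozenPotential (fun x => b t (x + a t)) B₁ B₂ εa εx)
    (eU : ∀ᵐ x, u t (x + a t) = Q (c t) x + Ξ x)
    (eU' : ∀ᵐ x, weakDeriv (u t) (x + a t) = deriv (Q (c t)) x + g x) :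
    HasDerivAt (fun s => ∫ x, fluct Q u a c s x * Φ (c s) (x - a s))
      (-(∫ x, (g x * Φ₂ (c t) x + (c t - deriv f (Q (c t) x)) * (Ξ x * Φ₁ (c t) x)))
      + (c t - a' - b t (a t)) * (∫ x, (Q (c t) x + Ξ x) * Φ₁ (c t) x)
      - (∫ x, (b t (x + a t) - b t (a t)) * ((Q (c t) x + Ξ x) * Φ₁ (c t) x))
      + (∫ x, nlRem f (Q (c t) x) (Ξ x) * Φ₁ (c t) x)
      + c' * (∫ x, Ξ x * Φc (c t) x) - c' * ∫ x, zc Q (c t) x * Φ (c t) x) t := by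
  have d := h.hasDerivAt_fluct_pairing hΦ hu hJ ht hc ha hcd
  have key := h.pairing_rate_eq hM hc hX hr hB (hΦ.hasDerivAt₁ _ hc) (hΦ.cont₂ _ hc)
    (hΦ.memLp hc) (hΦ.memLp₁ hc) (hΦ.memLp₂ hc) (hΦ.memLp_speed hc) a' c'
  simp only [zero_add] at key
  rw [← key]
  refine d.congr_deriv ?_
  congr 2
  · rw [← integral_shift _ (a t)]
    refine integral_congr_ae ?_
    filter_upwards [eU, eU'] with x h1 h2
    rw [h1, h2, add_sub_cancel_right]
  · rw [← integral_shift _ (a t)]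
    refine integral_congr_ae ?_
    filter_upwards [eU] with x h1
    rw [h1, add_sub_cancel_right]

end IsWaveData

/-! ### Modulation equations -/

/-- The linear growth of the potential away from the centre of the wave is absorbed by the decay of
`φ`. -/
lemma IsFrozenPotential.abs_integral_sub_mul_le {B B₁ B₂ : ℝ → ℝ} {εa εx : ℝ}
    (h : IsFrozenPotential B B₁ B₂ εa εx) {U φ : ℝ → ℝ} {A L ν : ℝ} (hν : 0 < ν)
    (hU : ∀ x, |U x| ≤ A) (hφ : ExpBd L ν φ) :
    |∫ x, (B x - B 0) * (U x * φ x)| ≤ A * (L * (8 / ν ^ 2)) * (εa * εx) := by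
  have hA : 0 ≤ A := (abs_nonneg _).trans (hU 0)
  have hb : ExpBd (εa * εx * A * (L * (2 / ν))) (ν / 2)
      (fun x => (B x - B 0) * (U x * φ x)) := fun x => by
    have b1 := h.abs_sub_le x
    have b2 := hφ.id_mul hν x
    rw [abs_mul] at b2
    have he : 0 ≤ εa * εx := (abs_nonneg _).trans (h.abs_le₁ 0)
    rw [abs_mul, abs_mul]
    calc |B x - B 0| * (|U x| * |φ x|) ≤ (εa * εx * |x|) * (A * |φ x|) := by
          gcongr
          exact hU x
      _ = εa * εx * A * (|x| * |φ x|) := by ring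
      _ ≤ εa * εx * A * (L * (2 / ν) * expW (ν / 2) x) := by gcongr
      _ = _ := by ring
  refine (hb.abs_integral_le (by positivity)).trans (le_of_eq ?_)
  field_simp
  ring

lemma abs_integral_le_of_sq_bound {N φ Ξ g : ℝ → ℝ} {M A r : ℝ} (hX : IsH1Rep Ξ g r) (hM : 0 ≤ M)
    (hN : ∀ x, |N x| ≤ M * Ξ x ^ 2) (hφ : ∀ x, |φ x| ≤ A) : |∫ x, N x * φ x| ≤ M * A * r ^ 2 := by
  have hA : 0 ≤ A := (abs_nonneg _).trans (hφ 0)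
  have := norm_integral_le_of_norm_le (f := fun x => N x * φ x)
    (hX.memLp.integrable_sq.const_mul (M * A)) (.of_forall fun x => by
      rw [norm_mul, Real.norm_eq_abs, Real.norm_eq_abs]
      calc |N x| * |φ x| ≤ (M * Ξ x ^ 2) * A := mul_le_mul (hN x) (hφ x) (abs_nonneg _)
            (by positivity)
        _ = _ := by ring)
  rw [Real.norm_eq_abs, integral_const_mul, ← l2_sq] at this
  exact this.trans (mul_le_mul_of_nonneg_left
    (pow_le_pow_left₀ (l2_nonneg _) hX.l2_le 2) (by positivity))

lemma l2_mul_le_of_bdd {m v : ℝ → ℝ} {A : ℝ} (hv : MemLp v 2 volume) (hm : ∀ x, |m x| ≤ A) :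
    l2 (fun x => m x * v x) ≤ A * l2 v := by
  have hA : 0 ≤ A := (abs_nonneg _).trans (hm 0)
  have := l2_mono (g := fun x => m x * v x) (hv.const_mul A) fun x => by
    rw [abs_mul, abs_mul, abs_of_nonneg hA]
    exact mul_le_mul_of_nonneg_right (hm x) (abs_nonneg _)
  rwa [l2_const_mul, abs_of_nonneg hA] at this

/-- The two modulation inequalities decouple for a small fluctuation. -/
lemma modulation_algebra {X Z C r ε Y : ℝ} (hX : 0 ≤ X) (hC : 0 ≤ C)
    (hr1 : r ≤ 1) (h1 : Z ≤ C * (r * X + ε + r ^ 2)) (h2 : X ≤ C * (Y + Z))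
    (hY : ε + r ^ 2 ≤ Y) (hsmall : C ^ 2 * r ≤ 1 / 2) :
    X ≤ 2 * (C + C ^ 2) * Y ∧ Z ≤ (C * (2 * (C + C ^ 2)) + C) * Y := by
  have a1 : C * Z ≤ C * (C * (r * X + Y)) := by
    refine mul_le_mul_of_nonneg_left (h1.trans ?_) hC
    exact mul_le_mul_of_nonneg_left (by linarith) hC
  have a2 := mul_le_mul_of_nonneg_right hsmall hX
  have a3 : X ≤ 2 * (C + C ^ 2) * Y := by nlinarith
  refine ⟨a3, h1.trans ?_⟩
  have a4 : r * X ≤ X := mul_le_of_le_one_left hX hr1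
  calc C * (r * X + ε + r ^ 2) ≤ C * (2 * (C + C ^ 2) * Y + Y) :=
        mul_le_mul_of_nonneg_left (by linarith) hC
    _ = _ := by ring

namespace IsStableData

variable {f : ℝ → ℝ} {Q : ℝ → ℝ → ℝ} {S : Set ℝ} {K ν k T c : ℝ}
  {Ξ g : ℝ → ℝ} {r M : ℝ}

lemma abs_integral_mul_le_rep (hX : IsH1Rep Ξ g r) {φ : ℝ → ℝ} {G : ℝ} (hφ : MemLp φ 2 volume)
    (hG : l2 φ ≤ G) : |∫ x, Ξ x * φ x| ≤ r * G :=
  (abs_integral_mul_le hX.memLp hφ).trans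
    (mul_le_mul hX.l2_le hG (l2_nonneg _) ((l2_nonneg _).trans hX.l2_le))

/-- The equation for the speed that follows from `⟨ξ, Q⟩ = 0`. -/
lemma speed_rate_le (h : IsStableData f Q S K ν k T) (hM : NonlinBounds f (K + 1) M) (hc : c ∈ S)
    (hX : IsH1Rep Ξ g r) (hr : r ≤ 1) {B B₁ B₂ : ℝ → ℝ} {εa εx : ℝ}
    (hB : IsFrozenPotential B B₁ B₂ εa εx) (hsmall : r * (K * √(2 / ν)) ≤ k / 2) {l c' : ℝ}
    (eq : -(∫ x, (g x * (c * Q c x - f (Q c x)) + (c - deriv f (Q c x)) * (Ξ x * deriv (Q c) x)))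
      + l * (∫ x, (Q c x + Ξ x) * deriv (Q c) x)
      - (∫ x, (B x - B 0) * ((Q c x + Ξ x) * deriv (Q c) x))
      + (∫ x, nlRem f (Q c x) (Ξ x) * deriv (Q c) x)
      + c' * (∫ x, Ξ x * zc Q c x) - c' * (∫ x, zc Q c x * Q c x) = 0) :
    |c'| ≤ 2 / k * (K * √(2 / ν) + (K + 1) * (K * (8 / ν ^ 2)) + M * K)
      * (r * |l| + εa * εx + r ^ 2) := by
  have hν := h.nu_pos
  have hK := h.bound_nonneg
  have hk := h.gap_pos
  have hM0 := hM.nonneg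
  have hr0 : 0 ≤ r := (abs_nonneg _).trans (hX.abs_le 0)
  have hε : 0 ≤ εa * εx := (abs_nonneg _).trans (hB.abs_le₁ 0)
  have mq1 := h.q1_memLp hc
  have m0 : MemLp (fun _ : ℝ => (0 : ℝ)) 2 volume := MemLp.zero'
  have mq2 : MemLp (fun x => c * Q c x - f (Q c x)) 2 volume :=
    (h.q2_bd (hM.mono (by linarith)) hc).memLp h.nu_pos (h.q2_cont hc)
  have z1 := (h.hess_pairing hc hX.prim hX.memLp hX.memLp' (h.q1_hasDerivAt hc) (fun x =>
    ((h.profile c hc).hasDerivAt_deriv2 h.nonlin x).congr_deriv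
      (show _ = (c - deriv f (Q c x)) * deriv (Q c) x + 0 by ring)) continuous_const
    mq1 mq2 m0).2
  simp only [mul_zero, integral_zero, neg_zero] at z1
  have opq : ∫ y, Q c y * deriv (Q c) y = 0 := integral_eq_zero_of_odd fun y => by
    rw [(h.profile c hc).deriv_odd, (h.profile c hc).even]; ring
  have z2 : ∫ x, (Q c x + Ξ x) * deriv (Q c) x = ∫ x, Ξ x * deriv (Q c) x := by
    have i1 := integrable_mul_of_memLp (h.q_memLp hc) mq1
    have i2 := integrable_mul_of_memLp hX.memLp mq1
    simp only [add_mul]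
    rw [integral_add i1 i2, opq, zero_add]
  rw [z1, z2] at eq
  have hU : ∀ x, |Q c x + Ξ x| ≤ K + 1 := fun x => (abs_add_le _ _).trans
    (add_le_add ((h.q_bd c hc).le hν.le x) ((hX.abs_le x).trans hr))
  have b1 := abs_integral_mul_le_rep hX mq1 ((h.q1_bd c hc).l2_le hν)
  have b2 := hB.abs_integral_sub_mul_le hν hU (h.q1_bd c hc)
  have b3 := abs_integral_le_of_sq_bound hX hM0 (h.abs_nlRem_le hM hc hX hr)
    ((h.q1_bd c hc).le hν.le)
  have b4 := abs_integral_mul_le_rep hX (h.z_memLp hc) ((h.z_bd c hc).l2_le hν)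
  have b5 := h.slope_ge c hc
  simp only [mul_comm (Q c _) (zc Q c _)] at b5
  set G := K * √(2 / ν)
  have hG : 0 ≤ G := by positivity
  set I1 := ∫ x, Ξ x * deriv (Q c) x
  set I2 := ∫ x, (B x - B 0) * ((Q c x + Ξ x) * deriv (Q c) x)
  set I3 := ∫ x, nlRem f (Q c x) (Ξ x) * deriv (Q c) x
  set I4 := ∫ x, Ξ x * zc Q c x
  set I5 := ∫ x, zc Q c x * Q c x
  have key : c' * (I5 - I4) = l * I1 - I2 + I3 := by linarith
  have lower : k / 2 ≤ |I5 - I4| := by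
    refine le_trans ?_ (le_abs_self _)
    linarith [(abs_le.1 (b4.trans hsmall)).2]
  have h1 : |c'| * (k / 2) ≤ |l| * (r * G) + (K + 1) * (K * (8 / ν ^ 2)) * (εa * εx)
      + M * K * r ^ 2 := by
    calc |c'| * (k / 2) ≤ |c'| * |I5 - I4| := mul_le_mul_of_nonneg_left lower (abs_nonneg _)
      _ = |l * I1 - I2 + I3| := by rw [← abs_mul, key]
      _ ≤ |l| * |I1| + |I2| + |I3| := by
          refine (abs_add_le _ _).trans (add_le_add_left ((abs_sub _ _).trans ?_) _)
          rw [abs_mul]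
      _ ≤ _ := add_le_add (add_le_add (mul_le_mul_of_nonneg_left b1 (abs_nonneg _)) b2) b3
  have h2 : |l| * (r * G) + (K + 1) * (K * (8 / ν ^ 2)) * (εa * εx) + M * K * r ^ 2
      ≤ (G + (K + 1) * (K * (8 / ν ^ 2)) + M * K) * (r * |l| + εa * εx + r ^ 2) := by
    have p1 : 0 ≤ (K + 1) * (K * (8 / ν ^ 2)) := by positivity
    have p2 : 0 ≤ M * K := by positivity
    have p3 : 0 ≤ r * |l| := by positivity
    have p4 := sq_nonneg r
    calc _ = G * (r * |l|) + (K + 1) * (K * (8 / ν ^ 2)) * (εa * εx) + M * K * r ^ 2 := by ring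
      _ ≤ G * (r * |l| + εa * εx + r ^ 2)
          + (K + 1) * (K * (8 / ν ^ 2)) * (r * |l| + εa * εx + r ^ 2)
          + M * K * (r * |l| + εa * εx + r ^ 2) := by
          gcongr <;> linarith
      _ = _ := by ring
  have h3 : |c'| = 2 / k * (|c'| * (k / 2)) := by field_simp
  rw [h3, mul_assoc (2 / k)]
  exact mul_le_mul_of_nonneg_left (h1.trans h2) (by positivity)

end IsStableData

/-- The splitting of the fluctuation into its good part, of norm at most `γ`, and a multiple of the
Hessian minimizer, which is nearly proportional to `Q'`: pairings with `Ξ` are controlled by `γ`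
and by the pairing with `Q'`. -/
def IsSplit (q₁ Ξ : ℝ → ℝ) (α γ r D : ℝ) : Prop :=
  ∀ φ, MemLp φ 2 volume →
    |∫ x, Ξ x * φ x| ≤ l2 φ * γ + r * D * (|∫ x, φ x * q₁ x| + √α * l2 φ)

namespace IsStableData

variable {f : ℝ → ℝ} {Q : ℝ → ℝ → ℝ} {S : Set ℝ} {K ν k T c α : ℝ}
  {Ξ g : ℝ → ℝ} {r M γ D : ℝ}

/-- The symplectic orthogonality makes the Hessian term of the slip equation of order `α ‖ξ‖`. -/
lemma abs_hess_slip_le (h : IsStableData f Q S K ν k T) (hM : NonlinBounds f (K + 1) M)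
    (hc : c ∈ S) (hX : IsH1Rep Ξ g r) (hα : 0 < α) (hα1 : α ≤ 1)
    (oQ : ∫ x, Ξ x * Q c x = 0) (oW : ∫ x, Ξ x * wc Q α c x = 0) :
    |∫ x, (g x * (deriv (zc Q c) x - α * (zc Q c x - α * wc Q α c x))
      + (c - deriv f (Q c x)) * (Ξ x * (zc Q c x - α * wc Q α c x)))|
      ≤ (K * √(2 / ν) + 2 * K / ν + 2 * K / ν * (M * K * √(2 / ν))) * (α * r) := by
  have hν := h.nu_pos
  have hK := h.bound_nonneg
  have hM0 := hM.nonneg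
  have hMK := hM.mono (show K ≤ K + 1 by linarith)
  have hr0 : 0 ≤ r := (abs_nonneg _).trans (hX.abs_le 0)
  have mz := h.z_memLp hc
  have mW := h.wc_memLp hc hα
  obtain ⟨i1, e1⟩ := h.hess_pairing hc hX.prim hX.memLp hX.memLp' (h.z_hasDerivAt c hc)
    (h.z1_hasDerivAt' hc) (h.q_cont hc) mz (h.z1_memLp hc) (h.q_memLp hc)
  rw [oQ, neg_zero] at e1
  have mfW : MemLp (fun x => wc Q α c x * deriv f (Q c x)) 2 volume :=
    memLp_bdd_mul ((h.deriv_f_bd hMK hc).memLp hν (h.deriv_f_cont hc))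
      (h.wc_cont hc hα.le).aestronglyMeasurable (h.abs_wc_le hc hα.le)
  have i2 := integrable_mul_of_memLp hX.memLp' mz
  have i3 := integrable_mul_of_memLp hX.memLp' mW
  have i4 := integrable_mul_of_memLp hX.memLp mW
  have i5 := integrable_mul_of_memLp hX.memLp mfW
  have e : (fun x => g x * (deriv (zc Q c) x - α * (zc Q c x - α * wc Q α c x))
      + (c - deriv f (Q c x)) * (Ξ x * (zc Q c x - α * wc Q α c x)))
      = fun x => (g x * deriv (zc Q c) x + (c - deriv f (Q c x)) * (Ξ x * zc Q c x))
        - α * (g x * zc Q c x) + α * α * (g x * wc Q α c x)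
        - α * c * (Ξ x * wc Q α c x) + α * (Ξ x * (wc Q α c x * deriv f (Q c x))) := by
    funext x; ring
  have hαW : α * l2 (wc Q α c) ≤ 2 * K / ν := by
    refine le_trans ?_ (h.sqrt_mul_l2_wc_le hc hα)
    refine mul_le_mul_of_nonneg_right ?_ (l2_nonneg _)
    calc α = √α * √α := (Real.mul_self_sqrt hα.le).symm
      _ ≤ √α * 1 := mul_le_mul_of_nonneg_left (Real.sqrt_le_one.2 hα1) (Real.sqrt_nonneg _)
      _ = √α := mul_one _
  have b1 : |∫ x, g x * zc Q c x| ≤ r * (K * √(2 / ν)) :=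
    (abs_integral_mul_le hX.memLp' mz).trans
      (mul_le_mul hX.l2_le' ((h.z_bd c hc).l2_le hν) (l2_nonneg _) hr0)
  have b2 : α * |∫ x, g x * wc Q α c x| ≤ r * (2 * K / ν) := by
    calc α * |∫ x, g x * wc Q α c x| ≤ α * (l2 g * l2 (wc Q α c)) :=
          mul_le_mul_of_nonneg_left (abs_integral_mul_le hX.memLp' mW) hα.le
      _ = l2 g * (α * l2 (wc Q α c)) := by ring
      _ ≤ _ := mul_le_mul hX.l2_le' hαW (mul_nonneg hα.le (l2_nonneg _)) hr0
  have b3 : |∫ x, Ξ x * (wc Q α c x * deriv f (Q c x))|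
      ≤ r * (2 * K / ν * (M * K * √(2 / ν))) := by
    refine abs_integral_mul_le_rep hX mfW ?_
    refine (l2_mul_le_of_bdd ((h.deriv_f_bd hMK hc).memLp hν (h.deriv_f_cont hc))
      (h.abs_wc_le hc hα.le)).trans ?_
    exact mul_le_mul_of_nonneg_left ((h.deriv_f_bd hMK hc).l2_le hν) (by positivity)
  rw [e]
  simp (disch := fun_prop) only [integral_add, integral_sub, integral_const_mul]
  rw [e1, oW]
  set J1 := ∫ x, g x * zc Q c x
  set J2 := ∫ x, g x * wc Q α c x
  set J3 := ∫ x, Ξ x * (wc Q α c x * deriv f (Q c x))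
  have e2 : 0 - α * J1 + α * α * J2 - α * c * 0 + α * J3 = α * (-J1 + α * J2 + J3) := by ring
  rw [e2, abs_mul, abs_of_pos hα]
  have e3 : |-J1 + α * J2 + J3| ≤ |J1| + α * |J2| + |J3| := by
    refine (abs_add_le _ _).trans (add_le_add_left ((abs_add_le _ _).trans ?_) _)
    rw [abs_neg, abs_mul, abs_of_pos hα]
  calc _ ≤ α * (r * (K * √(2 / ν)) + r * (2 * K / ν)
        + r * (2 * K / ν * (M * K * √(2 / ν)))) :=
        mul_le_mul_of_nonneg_left (e3.trans (add_le_add (add_le_add b1 b2) b3)) hα.le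
    _ = _ := by ring

/-- The equation for the slip rate `l = c - ȧ - b(t,a)` that follows from `⟨ξ, 𝒦_α ∂_c Q⟩ = 0`. -/
lemma slip_rate_le (h : IsStableData f Q S K ν k T) (hM : NonlinBounds f (K + 1) M)
    (hc : c ∈ S) (hX : IsH1Rep Ξ g r) (hr : r ≤ 1) (hα : 0 < α) (hα1 : α ≤ 1)
    (hD : 0 ≤ D) (hγ0 : 0 ≤ γ) (hγ : (√α)⁻¹ * γ ≤ 1)
    (hS : IsSplit (deriv (Q c)) Ξ α γ r D) (oQ : ∫ x, Ξ x * Q c x = 0)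
    (oW : ∫ x, Ξ x * wc Q α c x = 0) {B B₁ B₂ : ℝ → ℝ} {εa εx : ℝ}
    (hB : IsFrozenPotential B B₁ B₂ εa εx) (hεa : εa ≤ 1) (hε1 : εa * εx ≤ 1)
    (hαs : α * (2 * K / ν) ^ 2 ≤ k / 4) (hrs : r * (K * √(2 / ν)) ≤ k / 4) {l c' : ℝ}
    (eq : -(∫ x, (g x * (deriv (zc Q c) x - α * (zc Q c x - α * wc Q α c x))
        + (c - deriv f (Q c x)) * (Ξ x * (zc Q c x - α * wc Q α c x))))
      + l * (∫ x, (Q c x + Ξ x) * (zc Q c x - α * wc Q α c x))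
      - (∫ x, (B x - B 0) * ((Q c x + Ξ x) * (zc Q c x - α * wc Q α c x)))
      + (∫ x, nlRem f (Q c x) (Ξ x) * (zc Q c x - α * wc Q α c x))
      + c' * (∫ x, Ξ x * wzc Q α c x) - c' * (∫ x, zc Q c x * wc Q α c x) = 0) :
    |l| ≤ 2 / k * ((K * √(2 / ν) + 2 * K / ν + 2 * K / ν * (M * K * √(2 / ν)))
      + (K + 1 + 2 * K / ν) * (K * (8 / ν ^ 2)) + 4 * K / ν
      + D * (2 * K / ν * (K * (8 / ν ^ 2)) + 4 * K / ν)
      + M * (K + 2 * K / ν)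
      + (2 * K / ν + D * ((2 * K / ν) ^ 2 + 2 * K / ν) + (2 * K / ν) ^ 2))
      * ((εa * εx + √α * γ + α * r + r ^ 2) + |c'|) := by
  have hν := h.nu_pos
  have hK := h.bound_nonneg
  have hk := h.gap_pos
  have hM0 := hM.nonneg
  have hr0 : 0 ≤ r := (abs_nonneg _).trans (hX.abs_le 0)
  have hsα := Real.sqrt_pos.2 hα
  have hsα1 : √α ≤ 1 := Real.sqrt_le_one.2 hα1
  have hε : 0 ≤ εa * εx := (abs_nonneg _).trans (hB.abs_le₁ 0)
  have mz := h.z_memLp hc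
  have mW := h.wc_memLp hc hα
  have mX := hX.memLp
  have mq := h.q_memLp hc
  have hRW := h.sqrt_mul_l2_wc_le hc hα
  have hβ : ∀ x, |B x - B 0| ≤ 2 := fun x => (abs_sub _ _).trans (by
    linarith [hB.abs_le x, hB.abs_le 0])
  have cβ : Continuous fun x => B x - B 0 := hB.cont.sub continuous_const
  have b1 := h.abs_hess_slip_le hM hc hX hα hα1 oQ oW
  set R := 2 * K / ν with hR
  have hR0 : 0 ≤ R := by positivity
  set E := K * (8 / ν ^ 2)
  have hE : 0 ≤ E := by positivity
  set G := K * √(2 / ν)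
  have hG : 0 ≤ G := by positivity
  -- the coefficient of the slip rate is close to `δ'(c)`
  have b2 : k / 2 ≤ ∫ x, (Q c x + Ξ x) * (zc Q c x - α * wc Q α c x) := by
    have i1 := integrable_mul_of_memLp mq mz
    have i2 := integrable_mul_of_memLp mq mW
    have i3 := integrable_mul_of_memLp mX mz
    have i4 := integrable_mul_of_memLp mX mW
    have e : (fun x => (Q c x + Ξ x) * (zc Q c x - α * wc Q α c x))
        = fun x => Q c x * zc Q c x - α * (Q c x * wc Q α c x) + Ξ x * zc Q c x
          - α * (Ξ x * wc Q α c x) := by funext x; ring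
    rw [e]
    simp (disch := fun_prop) only [integral_add, integral_sub, integral_const_mul]
    rw [oW, mul_zero]
    have c1 := h.slope_ge c hc
    have c2 := mul_le_mul_of_nonneg_left
      (abs_le.1 (h.abs_integral_mul_wc_le hc hα.le (h.q_bd c hc))).2 hα.le
    have c3 := (abs_le.1 (abs_integral_mul_le_rep hX mz ((h.z_bd c hc).l2_le hν))).1
    linarith
  -- the variation of the potential over the support of the wave
  have b3 : |∫ x, (B x - B 0) * ((Q c x + Ξ x) * (zc Q c x - α * wc Q α c x))|
      ≤ (K + 1 + R) * E * (εa * εx) + 2 * R * (√α * γ) + D * (R * E + 2 * R) * (α * r) := by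
    have hU : ∀ x, |Q c x + Ξ x| ≤ K + 1 := fun x => (abs_add_le _ _).trans
      (add_le_add ((h.q_bd c hc).le hν.le x) ((hX.abs_le x).trans hr))
    have c1 := hB.abs_integral_sub_mul_le hν hU (h.z_bd c hc)
    have c2 := hB.abs_integral_sub_mul_le hν (h.abs_wc_le hc hα.le) (h.q_bd c hc)
    have c3 := hB.abs_integral_sub_mul_le hν (h.abs_wc_le hc hα.le) (h.q1_bd c hc)
    have mβW : MemLp (fun x => (B x - B 0) * wc Q α c x) 2 volume :=
      memLp_bdd_mul mW cβ.aestronglyMeasurable hβ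
    have mβU : MemLp (fun x => (B x - B 0) * (Q c x + Ξ x)) 2 volume :=
      memLp_bdd_mul (mq.add mX) cβ.aestronglyMeasurable hβ
    have lβW := l2_mul_le_of_bdd mW hβ
    have c4 := hS _ mβW
    simp only [mul_assoc] at c4
    have i1 := integrable_mul_of_memLp mβU mz
    have i2 := integrable_mul_of_memLp mβW mq
    have i3 := integrable_mul_of_memLp mX mβW
    have e : (fun x => (B x - B 0) * ((Q c x + Ξ x) * (zc Q c x - α * wc Q α c x)))
        = fun x => (B x - B 0) * (Q c x + Ξ x) * zc Q c x
          - α * ((B x - B 0) * wc Q α c x * Q c x)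
          - α * (Ξ x * ((B x - B 0) * wc Q α c x)) := by funext x; ring
    rw [e]
    simp (disch := fun_prop) only [integral_sub, integral_const_mul]
    simp only [mul_assoc]
    set J1 := ∫ x, (B x - B 0) * ((Q c x + Ξ x) * zc Q c x)
    set J2 := ∫ x, (B x - B 0) * (wc Q α c x * Q c x)
    set J3 := ∫ x, Ξ x * ((B x - B 0) * wc Q α c x)
    set J4 := ∫ x, (B x - B 0) * (wc Q α c x * deriv (Q c) x)
    set w := l2 (wc Q α c)
    have hw : 0 ≤ w := l2_nonneg _
    have c5 : α * |J3| ≤ 2 * R * (√α * γ) + D * (R * E + 2 * R) * (α * r) := by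
      have d1 : |J4| ≤ R * E := c3.trans (mul_le_of_le_one_right (by positivity) hε1)
      have d2 : |J3| ≤ 2 * w * γ + r * D * (R * E + 2 * R) := by
        refine c4.trans (add_le_add (mul_le_mul_of_nonneg_right lβW hγ0) ?_)
        refine (le_of_eq (mul_assoc r D _).symm).trans
          (mul_le_mul_of_nonneg_left (add_le_add d1 ?_) (by positivity))
        calc √α * _ ≤ √α * (2 * w) := mul_le_mul_of_nonneg_left lβW hsα.le
          _ = 2 * (√α * w) := by ring
          _ ≤ 2 * R := by linarith
      calc α * |J3| ≤ α * (2 * w * γ + r * D * (R * E + 2 * R)) :=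
            mul_le_mul_of_nonneg_left d2 hα.le
        _ = (√α * √α) * (2 * w * γ) + D * (R * E + 2 * R) * (α * r) := by
            rw [Real.mul_self_sqrt hα.le]; ring
        _ = 2 * (√α * w) * (√α * γ) + D * (R * E + 2 * R) * (α * r) := by ring
        _ ≤ _ := by gcongr
    have c6 : α * |J2| ≤ R * E * (εa * εx) :=
      (mul_le_of_le_one_left (abs_nonneg _) hα1).trans c2
    calc |J1 - α * J2 - α * J3| ≤ |J1| + α * |J2| + α * |J3| := by
          refine (abs_sub _ _).trans (add_le_add ((abs_sub _ _).trans ?_) ?_)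
          · rw [abs_mul α, abs_of_pos hα]
          · rw [abs_mul α, abs_of_pos hα]
      _ ≤ _ := add_le_add (add_le_add c1 c6) c5
      _ = _ := by ring
  have b4 : |∫ x, nlRem f (Q c x) (Ξ x) * (zc Q c x - α * wc Q α c x)| ≤ M * (K + R) * r ^ 2 := by
    refine abs_integral_le_of_sq_bound hX hM0 (h.abs_nlRem_le hM hc hX hr) fun x => ?_
    refine (abs_sub _ _).trans (add_le_add ((h.z_bd c hc).le hν.le x) ?_)
    rw [abs_mul, abs_of_pos hα]
    exact (mul_le_of_le_one_left (abs_nonneg _) hα1).trans (h.abs_wc_le hc hα.le x)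
  have b5 : |∫ x, Ξ x * wzc Q α c x| ≤ R + D * (R ^ 2 + R) := by
    have c1 := hS _ (memLp_regSymp (h.zz_bd c hc) hν (h.zz_cont c hc) hα)
    have c2 := sqrt_mul_l2_regSymp_le (h.zz_bd c hc) hν (h.zz_cont c hc) hα
    have c3 : |∫ x, wzc Q α c x * deriv (Q c) x| ≤ R ^ 2 := by
      have := ((h.q1_bd c hc).mul_bdd (abs_regSymp_le (h.zz_bd c hc) hν hα.le)).abs_integral_le hν
      exact this.trans (le_of_eq (by rw [hR]; ring))
    set w := l2 (wzc Q α c)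
    have hw : 0 ≤ w := l2_nonneg _
    have c4 : w * γ ≤ R := by
      calc w * γ = (√α * w) * ((√α)⁻¹ * γ) := by field_simp
        _ ≤ R * 1 := mul_le_mul c2 hγ (by positivity) hR0
        _ = R := mul_one R
    have c5 : r * D * (|∫ x, wzc Q α c x * deriv (Q c) x| + √α * w) ≤ D * (R ^ 2 + R) :=
      mul_le_mul (mul_le_of_le_one_left hD hr) (add_le_add c3 c2) (by positivity) hD
    exact c1.trans (add_le_add c4 c5)
  have b6 := h.abs_integral_mul_wc_le hc hα.le (h.z_bd c hc)
  set J1 := ∫ x, (g x * (deriv (zc Q c) x - α * (zc Q c x - α * wc Q α c x))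
        + (c - deriv f (Q c x)) * (Ξ x * (zc Q c x - α * wc Q α c x)))
  set J2 := ∫ x, (Q c x + Ξ x) * (zc Q c x - α * wc Q α c x)
  set J3 := ∫ x, (B x - B 0) * ((Q c x + Ξ x) * (zc Q c x - α * wc Q α c x))
  set J4 := ∫ x, nlRem f (Q c x) (Ξ x) * (zc Q c x - α * wc Q α c x)
  set J5 := ∫ x, Ξ x * wzc Q α c x
  set J6 := ∫ x, zc Q c x * wc Q α c x
  have key : l * J2 = J1 + J3 - J4 - c' * (J5 - J6) := by linarith
  set C1 := G + R + R * (M * K * √(2 / ν))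
  have hC1 : 0 ≤ C1 := by positivity
  set C5 := R + D * (R ^ 2 + R) + R ^ 2
  have hC5 : 0 ≤ C5 := by positivity
  have h1 : |l| * (k / 2) ≤ C1 * (α * r) + ((K + 1 + R) * E * (εa * εx) + 2 * R * (√α * γ)
      + D * (R * E + 2 * R) * (α * r)) + M * (K + R) * r ^ 2 + |c'| * C5 := by
    calc |l| * (k / 2) ≤ |l| * |J2| :=
          mul_le_mul_of_nonneg_left (b2.trans (le_abs_self _)) (abs_nonneg _)
      _ = |J1 + J3 - J4 - c' * (J5 - J6)| := by rw [← abs_mul, key]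
      _ ≤ |J1| + |J3| + |J4| + |c'| * (|J5| + |J6|) := by
          refine (abs_sub _ _).trans (add_le_add ((abs_sub _ _).trans
            (add_le_add_left (abs_add_le _ _) _)) ?_)
          rw [abs_mul]
          exact mul_le_mul_of_nonneg_left (abs_sub _ _) (abs_nonneg _)
      _ ≤ _ := add_le_add (add_le_add (add_le_add b1 b3) b4)
          (mul_le_mul_of_nonneg_left (add_le_add b5 b6) (abs_nonneg _))
  have h3 : |l| = 2 / k * (|l| * (k / 2)) := by field_simp
  rw [h3, mul_assoc (2 / k)]
  refine mul_le_mul_of_nonneg_left (h1.trans ?_) (by positivity)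
  have p1 : 0 ≤ √α * γ := by positivity
  have p2 : 0 ≤ α * r := by positivity
  have p3 := sq_nonneg r
  have p4 := abs_nonneg c'
  set Y := (εa * εx + √α * γ + α * r + r ^ 2) + |c'| with hY
  have q1 : εa * εx ≤ Y := by linarith
  have q2 : √α * γ ≤ Y := by linarith
  have q3 : α * r ≤ Y := by linarith
  have q4 : r ^ 2 ≤ Y := by linarith
  have q5 : |c'| ≤ Y := by linarith
  have e4 : 4 * K / ν = 2 * R := by rw [hR]; ring
  rw [e4]
  calc _ ≤ C1 * Y + ((K + 1 + R) * E * Y + 2 * R * Y + D * (R * E + 2 * R) * Y)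
        + M * (K + R) * Y + Y * C5 := by gcongr
    _ = _ := by ring

/-- Slip rate and acceleration are of the size of the data of the modulation problem: the slope of
the potential, the fluctuation weighted with `α`, its good part, and its square. -/
lemma exists_modulation_rates (h : IsStableData f Q S K ν k T) (hM : NonlinBounds f (K + 1) M)
    (hD : 0 ≤ D) :
    ∃ α₀ κ C, 0 < α₀ ∧ α₀ ≤ 1 ∧ 0 < κ ∧ κ ≤ 1 ∧ 0 ≤ C ∧ ∀ c ∈ S, ∀ α, 0 < α → α ≤ α₀ →
    ∀ Ξ g r γ, IsH1Rep Ξ g r → 0 ≤ γ → (√α)⁻¹ * γ + r ≤ κ →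
    IsSplit (deriv (Q c)) Ξ α γ r D → ∫ x, Ξ x * Q c x = 0 → ∫ x, Ξ x * wc Q α c x = 0 →
    ∀ B B₁ B₂ εa εx, IsFrozenPotential B B₁ B₂ εa εx → εa ≤ 1 → εa * εx ≤ 1 →
    ∀ l c' : ℝ,
    -(∫ x, (g x * (c * Q c x - f (Q c x)) + (c - deriv f (Q c x)) * (Ξ x * deriv (Q c) x)))
      + l * (∫ x, (Q c x + Ξ x) * deriv (Q c) x)
      - (∫ x, (B x - B 0) * ((Q c x + Ξ x) * deriv (Q c) x))
      + (∫ x, nlRem f (Q c x) (Ξ x) * deriv (Q c) x)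
      + c' * (∫ x, Ξ x * zc Q c x) - c' * (∫ x, zc Q c x * Q c x) = 0 →
    -(∫ x, (g x * (deriv (zc Q c) x - α * (zc Q c x - α * wc Q α c x))
        + (c - deriv f (Q c x)) * (Ξ x * (zc Q c x - α * wc Q α c x))))
      + l * (∫ x, (Q c x + Ξ x) * (zc Q c x - α * wc Q α c x))
      - (∫ x, (B x - B 0) * ((Q c x + Ξ x) * (zc Q c x - α * wc Q α c x)))
      + (∫ x, nlRem f (Q c x) (Ξ x) * (zc Q c x - α * wc Q α c x))
      + c' * (∫ x, Ξ x * wzc Q α c x) - c' * (∫ x, zc Q c x * wc Q α c x) = 0 →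
    |l| ≤ C * (εa * εx + √α * γ + α * r + r ^ 2) ∧
      |c'| ≤ C * (εa * εx + √α * γ + α * r + r ^ 2) := by
  have hν := h.nu_pos
  have hK := h.bound_nonneg
  have hk := h.gap_pos
  have hM0 := hM.nonneg
  obtain ⟨C₁, h1, hC₁⟩ : ∃ C₁, 0 ≤ C₁ ∧
      2 / k * (K * √(2 / ν) + (K + 1) * (K * (8 / ν ^ 2)) + M * K) = C₁ :=
    ⟨_, by positivity, rfl⟩
  obtain ⟨C₂, h2, hC₂⟩ : ∃ C₂, 0 ≤ C₂ ∧
      2 / k * ((K * √(2 / ν) + 2 * K / ν + 2 * K / ν * (M * K * √(2 / ν)))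
      + (K + 1 + 2 * K / ν) * (K * (8 / ν ^ 2)) + 4 * K / ν
      + D * (2 * K / ν * (K * (8 / ν ^ 2)) + 4 * K / ν)
      + M * (K + 2 * K / ν)
      + (2 * K / ν + D * ((2 * K / ν) ^ 2 + 2 * K / ν) + (2 * K / ν) ^ 2)) = C₂ :=
    ⟨_, by positivity, rfl⟩
  obtain ⟨G, hG0, hG⟩ : ∃ G, 0 ≤ G ∧ K * √(2 / ν) = G := ⟨_, by positivity, rfl⟩
  obtain ⟨R, hR0, hR⟩ : ∃ R, 0 ≤ R ∧ 2 * K / ν = R := ⟨_, by positivity, rfl⟩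
  obtain ⟨C, hC, hCe⟩ : ∃ C, 0 ≤ C ∧ C₁ + C₂ = C := ⟨_, by positivity, rfl⟩
  obtain ⟨C', hC', hC'e⟩ : ∃ C', 0 ≤ C' ∧ 2 * (C + C ^ 2) + (C * (2 * (C + C ^ 2)) + C) = C' :=
    ⟨_, by positivity, rfl⟩
  have hd1 : 0 < 1 + 4 * R ^ 2 / k := by positivity
  have hd2 : 0 < 1 + 4 * G / k + 2 * C ^ 2 := by positivity
  -- below these thresholds the rates enter their equations with coefficients at least `k / 2`, and
  -- the feedback of one rate on the other is at most `1 / 2`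
  refine ⟨1 / (1 + 4 * R ^ 2 / k), 1 / (1 + 4 * G / k + 2 * C ^ 2), C', by positivity,
    (div_le_one hd1).2 (le_add_of_nonneg_right (by positivity)), by positivity,
    (div_le_one hd2).2 (by rw [add_assoc]; exact le_add_of_nonneg_right (by positivity)),
    hC', ?_⟩
  intro c hc α hα hαs Ξ g r γ hX hγ hκ hS oQ oW B B₁ B₂ εa εx hB hεa hε l c' eq1 eq2
  have hr0 : 0 ≤ r := (abs_nonneg _).trans (hX.abs_le 0)
  have hε0 : 0 ≤ εa * εx := (abs_nonneg _).trans (hB.abs_le₁ 0)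
  have hg0 : 0 ≤ (√α)⁻¹ * γ := by positivity
  rw [le_div_iff₀ hd1] at hαs
  have p1 : 0 ≤ α * (4 * R ^ 2 / k) := by positivity
  have hα1 : α ≤ 1 := by linarith
  have hαR : α * R ^ 2 ≤ k / 4 := by
    have : α * R ^ 2 = k / 4 * (α * (4 * R ^ 2 / k)) := by field_simp
    rw [this]
    exact mul_le_of_le_one_right (by positivity) (by linarith)
  rw [le_div_iff₀ hd2] at hκ
  have hrw : r ≤ (√α)⁻¹ * γ + r := by linarith
  have hgw : (√α)⁻¹ * γ ≤ (√α)⁻¹ * γ + r := by linarith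
  generalize (√α)⁻¹ * γ + r = w at hκ hrw hgw
  have hw0 : 0 ≤ w := hr0.trans hrw
  have p2 : 0 ≤ w * (4 * G / k) := by positivity
  have p3 : 0 ≤ w * (2 * C ^ 2) := by positivity
  have hw1 : w ≤ 1 := by linarith
  have hr : r ≤ 1 := hrw.trans hw1
  have hrG : r * G ≤ k / 4 := by
    have e : w * G = k / 4 * (w * (4 * G / k)) := by field_simp
    refine (mul_le_mul_of_nonneg_right hrw hG0).trans ?_
    rw [e]
    exact mul_le_of_le_one_right (by positivity) (by linarith)
  have hrC : C ^ 2 * r ≤ 1 / 2 := by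
    have := mul_le_mul_of_nonneg_left hrw (sq_nonneg C)
    linarith
  have b1 := h.speed_rate_le hM hc hX hr hB (by rw [hG]; linarith) eq1
  have b2 := h.slip_rate_le hM hc hX hr hα hα1 hD hγ (by linarith) hS oQ oW hB hεa hε
    (by rw [hR]; exact hαR) (by rw [hG]; exact hrG) eq2
  rw [hC₁] at b1
  rw [hC₂] at b2
  clear hC₁ hC₂ hG hR eq1 eq2 oQ oW hS
  have p4 : 0 ≤ √α * γ := by positivity
  have p5 : 0 ≤ α * r := by positivity
  have p6 := sq_nonneg r
  obtain ⟨Y, hY⟩ : ∃ Y, εa * εx + √α * γ + α * r + r ^ 2 = Y := ⟨_, rfl⟩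
  rw [hY] at b2 ⊢
  have hY0 : 0 ≤ Y := by linarith
  have q1 : 0 ≤ r * |l| := mul_nonneg hr0 (abs_nonneg l)
  have a1 : |c'| ≤ C * (r * |l| + εa * εx + r ^ 2) :=
    b1.trans (mul_le_mul_of_nonneg_right (by linarith) (by linarith))
  have a2 : |l| ≤ C * (Y + |c'|) :=
    b2.trans (mul_le_mul_of_nonneg_right (by linarith) (by linarith [abs_nonneg c']))
  -- the acceleration depends on the slip rate with the small factor `r`, which closes the loop
  obtain ⟨d1, d2⟩ := modulation_algebra (abs_nonneg l) hC hr a1 a2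
    (show εa * εx + r ^ 2 ≤ Y by linarith) hrC
  have q2 : 0 ≤ C + C ^ 2 := by positivity
  have q3 : 0 ≤ C * (2 * (C + C ^ 2)) := by positivity
  exact ⟨d1.trans (mul_le_mul_of_nonneg_right (by linarith) hY0),
    d2.trans (mul_le_mul_of_nonneg_right (by linarith) hY0)⟩

end IsStableData

/-- A function orthogonally split along a unit vector close to a multiple of `q₁`. -/
lemma isSplit_of_minimizer {q₁ η ξ Ξ : ℝ → ℝ} {α r a e D : ℝ}
    (hη : MemLp η 2 volume) (hη1 : ∫ x, η x ^ 2 = 1) (hξ : MemLp ξ 2 volume)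
    (hq : MemLp q₁ 2 volume)
    (hΞ : ∀ᵐ x, Ξ x = ξ (x + a)) (hr : l2 ξ ≤ r) (he : |e| ≤ D)
    (hl : l2 (fun x => η (x + a) - e * q₁ x) ≤ D * √α) :
    IsSplit q₁ Ξ α (l2 (goodPart η ξ)) r D := by
  intro φ hφ
  have hθ : |ip ξ η| ≤ r := by
    refine (abs_integral_mul_le hξ hη).trans ?_
    rw [show l2 η = 1 by rw [l2, hη1, Real.sqrt_one], mul_one]
    exact hr
  have hr0 : 0 ≤ r := (abs_nonneg _).trans hθ
  have mg : MemLp (goodPart η ξ) 2 volume := hξ.sub (hη.const_mul _)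
  have mg' := memLp_comp_add mg a
  have mη : MemLp (fun x => η (x + a) - e * q₁ x) 2 volume :=
    (memLp_comp_add hη a).sub (hq.const_mul e)
  have i1 := integrable_mul_of_memLp mg' hφ
  have i2 := integrable_mul_of_memLp mη hφ
  have i3 := integrable_mul_of_memLp hφ hq
  have e1 : ∫ x, Ξ x * φ x = ∫ x, (goodPart η ξ (x + a) * φ x
      + ip ξ η * ((η (x + a) - e * q₁ x) * φ x) + ip ξ η * e * (φ x * q₁ x)) := by
    refine integral_congr_ae ?_
    filter_upwards [hΞ] with x hx
    rw [hx, goodPart]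
    ring
  rw [e1]
  simp (disch := fun_prop) only [integral_add, integral_const_mul]
  have b1 := abs_integral_mul_le mg' hφ
  have b2 := abs_integral_mul_le mη hφ
  rw [l2_shift] at b1
  have hp := l2_nonneg φ
  set J1 := ∫ x, goodPart η ξ (x + a) * φ x
  set J2 := ∫ x, (η (x + a) - e * q₁ x) * φ x
  set J3 := ∫ x, φ x * q₁ x
  calc |J1 + ip ξ η * J2 + ip ξ η * e * J3| ≤ |J1| + |ip ξ η| * |J2| + |ip ξ η| * |e| * |J3| := by
        refine (abs_add_le _ _).trans (add_le_add ((abs_add_le _ _).trans ?_) ?_)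
        · rw [abs_mul]
        · rw [abs_mul, abs_mul]
    _ ≤ l2 (goodPart η ξ) * l2 φ + r * (D * √α * l2 φ) + r * D * |J3| := by
        have := b2.trans (mul_le_mul_of_nonneg_right hl hp)
        gcongr
    _ = _ := by ring

/-! ### The flux of the energy through the slope of the potential -/

/-- The density that multiplies `∂ₓ b` in the rate of change of `Λ_c(u)` along the flow, as a
function of the values of `u` and `∂ₓ u`. -/
def fluxDens (f : ℝ → ℝ) (c U V : ℝ) : ℝ :=
  (1 / 2) * c * U ^ 2 - U * f U + (3 / 2) * V ^ 2 + antideriv f U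

/-- The superquadratic part of the flux density of `Q + ξ`. -/
def fluxRem (f : ℝ → ℝ) (c q p s w : ℝ) : ℝ :=
  fluxDens f c (q + s) (p + w) - fluxDens f c q p - ((c - deriv f q) * q * s + 3 * p * w)

/-- The linear parts of `-U f(U)` and `F(U)` at `U = q` add up to `-q f'(q)`, so that only Taylor
remainders of `f` and of its primitive are left. -/
lemma abs_fluxRem_le {f : ℝ → ℝ} {c q p s w K M : ℝ} (hf : IsNonlinearity f)
    (hM : NonlinBounds f (K + 1) M) (hc : |c| ≤ K) (hq : |q| ≤ K) (hs : |s| ≤ 1) :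
    |fluxRem f c q p s w| ≤ (K + 2 + (K + 2) * M) * (s ^ 2 + w ^ 2) := by
  have hM0 := hM.nonneg
  have hK : 0 ≤ K := (abs_nonneg _).trans hc
  have hq' : |q| ≤ K + 1 := by linarith
  have hqs : |q + s| ≤ K + 1 := (abs_add_le _ _).trans (add_le_add hq hs)
  have b1 := hM.abs_nlRem_le hf hq' hqs
  have b2 := hM.lip _ _ hqs hq'
  have b3 := taylor_le hf.hasDerivAt_antideriv hM.lip hq' hqs
  rw [add_sub_cancel_left] at b2 b3
  have e : fluxRem f c q p s w = (1 / 2) * c * s ^ 2 + (3 / 2) * w ^ 2 - q * nlRem f q s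
      - s * (f (q + s) - f q) + (antideriv f (q + s) - antideriv f q - f q * s) := by
    simp only [fluxRem, fluxDens, nlRem]; ring
  have c1 : |(1 / 2) * c * s ^ 2 + (3 / 2) * w ^ 2| ≤ (K + 2) * (s ^ 2 + w ^ 2) := by
    rw [abs_le] at hc ⊢
    have := sq_nonneg s
    have := sq_nonneg w
    constructor <;> nlinarith
  have c2 : |q * nlRem f q s| ≤ K * (M * s ^ 2) := by
    rw [abs_mul]; exact mul_le_mul hq b1 (abs_nonneg _) hK
  have c3 : |s * (f (q + s) - f q)| ≤ M * s ^ 2 := by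
    rw [abs_mul]
    calc |s| * |f (q + s) - f q| ≤ |s| * (M * |s|) := mul_le_mul_of_nonneg_left b2 (abs_nonneg _)
      _ = M * |s| ^ 2 := by ring
      _ = _ := by rw [sq_abs]
  rw [e]
  have hw := mul_nonneg (mul_nonneg (show 0 ≤ K + 2 by linarith) hM0) (sq_nonneg w)
  calc _ ≤ |(1 / 2) * c * s ^ 2 + (3 / 2) * w ^ 2| + |q * nlRem f q s|
        + |s * (f (q + s) - f q)| + |antideriv f (q + s) - antideriv f q - f q * s| :=
        (abs_add_le _ _).trans (add_le_add_left ((abs_sub _ _).trans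
          (add_le_add_left (abs_sub _ _) _)) _)
    _ ≤ (K + 2) * (s ^ 2 + w ^ 2) + K * (M * s ^ 2) + M * s ^ 2 + M * s ^ 2 :=
        add_le_add (add_le_add (add_le_add c1 c2) c3) b3
    _ ≤ _ := by linarith

lemma abs_integral_mul_bdd_le {h m φ : ℝ → ℝ} {E r L : ℝ} (hh : MemLp h 2 volume) (hr : l2 h ≤ r)
    (cm : AEStronglyMeasurable m volume) (hm : ∀ x, |m x| ≤ E) (hφ : MemLp φ 2 volume)
    (hL : l2 φ ≤ L) :
    Integrable (fun x => h x * (m x * φ x)) ∧ |∫ x, h x * (m x * φ x)| ≤ E * r * L := by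
  have hE : 0 ≤ E := (abs_nonneg _).trans (hm 0)
  have m1 := memLp_bdd_mul hφ cm hm
  refine ⟨integrable_mul_of_memLp hh m1, (abs_integral_mul_le hh m1).trans ?_⟩
  calc l2 h * l2 (fun x => m x * φ x) ≤ r * (E * L) :=
        mul_le_mul hr ((l2_mul_le_of_bdd hφ hm).trans (mul_le_mul_of_nonneg_left hL hE))
          (l2_nonneg _) ((l2_nonneg _).trans hr)
    _ = _ := by ring

/-- A coefficient of linear growth costs a moment of the decaying factor. -/
lemma abs_integral_mul_weight_le {h β φ : ℝ → ℝ} {E r L ν : ℝ} (hh : MemLp h 2 volume)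
    (hr : l2 h ≤ r) (hE : 0 ≤ E) (cβ : Continuous β) (hβ : ∀ x, |β x| ≤ E * |x|) (hν : 0 < ν)
    (hφ : ExpBd L ν φ) (cφ : Continuous φ) :
    Integrable (fun x => h x * (β x * φ x)) ∧
      |∫ x, h x * (β x * φ x)| ≤ E * r * (L * (2 / ν) * √(2 / (ν / 2))) := by
  have b1 := hφ.id_mul hν
  have m1 : MemLp (fun x => E * (x * φ x)) 2 volume :=
    (b1.memLp (by positivity) (continuous_id.mul cφ)).const_mul E
  have b2 : ∀ x, |β x * φ x| ≤ |E * (x * φ x)| := fun x => by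
    rw [abs_mul, abs_mul, abs_mul, abs_of_nonneg hE]
    calc |β x| * |φ x| ≤ E * |x| * |φ x| := mul_le_mul_of_nonneg_right (hβ x) (abs_nonneg _)
      _ = _ := by ring
  have m2 : MemLp (fun x => β x * φ x) 2 volume :=
    m1.of_le (cβ.mul cφ).aestronglyMeasurable (.of_forall b2)
  have l1 : l2 (fun x => β x * φ x) ≤ E * (L * (2 / ν) * √(2 / (ν / 2))) := by
    refine (l2_mono m1 b2).trans ?_
    rw [l2_const_mul, abs_of_nonneg hE]
    exact mul_le_mul_of_nonneg_left (b1.l2_le (by positivity)) hE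
  refine ⟨integrable_mul_of_memLp hh m2, (abs_integral_mul_le hh m2).trans ?_⟩
  calc _ ≤ r * (E * (L * (2 / ν) * √(2 / (ν / 2)))) :=
        mul_le_mul hr l1 (l2_nonneg _) ((l2_nonneg _).trans hr)
    _ = _ := by ring

namespace IsWaveData

variable {f : ℝ → ℝ} {Q : ℝ → ℝ → ℝ} {S : Set ℝ} {K ν c : ℝ}
  {Ξ g : ℝ → ℝ} {r M : ℝ}

/-- The flux of a solitary wave through any slowly varying potential vanishes, because its density
is the derivative of `Q Q'`. -/
lemma integral_flux_wave (h : IsWaveData f Q S K ν) (hc : c ∈ S) {B B₁ B₂ : ℝ → ℝ} {εa εx : ℝ}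
    (hB : IsFrozenPotential B B₁ B₂ εa εx) :
    Integrable (fun x => B₁ x * fluxDens f c (Q c x) (deriv (Q c) x)
      + B₂ x * (Q c x * deriv (Q c) x)) ∧
    ∫ x, (B₁ x * fluxDens f c (Q c x) (deriv (Q c) x) + B₂ x * (Q c x * deriv (Q c) x)) = 0 := by
  obtain ⟨M, hM⟩ := h.nonlin.exists_bounds K
  have e : ∀ x, fluxDens f c (Q c x) (deriv (Q c) x)
      = deriv (Q c) x * deriv (Q c) x + Q c x * (c * Q c x - f (Q c x)) := fun x => by
    have := (h.profile c hc).first_integral h.nonlin x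
    simp only [fluxDens]
    linarith
  simp only [e]
  have hν := h.nu_pos
  have i0 := integrable_mul_of_memLp (h.q_memLp hc) (h.q1_memLp hc)
  have i1 := integrable_mul_of_memLp (h.q1_memLp hc) (h.q1_memLp hc)
  have i2 := integrable_mul_of_memLp (h.q_memLp hc) ((h.q2_bd hM hc).memLp hν (h.q2_cont hc))
  have j : Integrable (fun x => B₁ x * (deriv (Q c) x * deriv (Q c) x
      + Q c x * (c * Q c x - f (Q c x))) + B₂ x * (Q c x * deriv (Q c) x)) :=
    ((i1.add i2).bdd_mul hB.cont₁.aestronglyMeasurable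
      (.of_forall fun x => hB.abs_le₁ x)).add
    (i0.bdd_mul hB.measurable.aestronglyMeasurable (.of_forall fun x => hB.abs_le₂ x))
  refine ⟨j, integral_eq_zero_of_hasDerivAt_of_integrable
    (f := fun x => B₁ x * (Q c x * deriv (Q c) x)) (fun x => ?_) j
    (i0.bdd_mul hB.cont₁.aestronglyMeasurable (.of_forall fun x => hB.abs_le₁ x))⟩
  exact ((hB.hasDerivAt₁ x).fun_mul
    ((h.q_hasDerivAt hc x).fun_mul (h.q1_hasDerivAt hc x))).congr_deriv (by ring)

/-- To first order in the fluctuation the flux pairs it, up to the factor `-∂ₓb(t,a)`, with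
`3 (c Q - f(Q)) - (c - f'(Q)) Q`, which is what the Hessian makes of `∂ₓ(x Q)`. -/
lemma exists_abs_flux_le (h : IsWaveData f Q S K ν) (hM : NonlinBounds f (K + 1) M) :
    ∃ C, 0 ≤ C ∧ ∀ c ∈ S, ∀ Ξ g r, IsH1Rep Ξ g r → r ≤ 1 → ∀ B B₁ B₂ εa εx,
    IsFrozenPotential B B₁ B₂ εa εx → 0 ≤ εx → εx ≤ 1 →
    |(∫ x, (B₁ x * fluxDens f c (Q c x + Ξ x) (deriv (Q c) x + g x)
        + B₂ x * ((Q c x + Ξ x) * (deriv (Q c) x + g x))))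
      + B₁ 0 * ∫ x, Ξ x * (3 * (c * Q c x - f (Q c x)) - (c - deriv f (Q c x)) * Q c x)|
      ≤ C * (εa * εx * (εx * r + r ^ 2)) := by
  have hν := h.nu_pos
  have hK := h.bound_nonneg
  have hM0 := hM.nonneg
  have hMK := hM.mono (show K ≤ K + 1 by linarith)
  obtain ⟨A, hA, hAe⟩ : ∃ A, 0 ≤ A ∧ K + 2 + (K + 2) * M = A := ⟨_, by positivity, rfl⟩
  obtain ⟨N, hN, hNe⟩ : ∃ N, 0 ≤ N ∧ (K + M * K) * K = N := ⟨_, by positivity, rfl⟩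
  obtain ⟨G, hG, hGe⟩ : ∃ G, 0 ≤ G ∧ K * √(2 / ν) = G := ⟨_, by positivity, rfl⟩
  obtain ⟨W, hW, hWe⟩ : ∃ W, 0 ≤ W ∧ 2 / ν * √(2 / (ν / 2)) = W := ⟨_, by positivity, rfl⟩
  refine ⟨3 * K * W + N * W + 2 * G + 2 * (A + 1), by positivity, ?_⟩
  intro c hc Ξ g r hX hr B B₁ B₂ εa εx hB hεx hεx1
  have hE : 0 ≤ εa * εx := (abs_nonneg _).trans (hB.abs_le₁ 0)
  have hr0 : 0 ≤ r := (abs_nonneg _).trans (hX.abs_le 0)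
  have hcK : |c| ≤ K := by
    rw [abs_of_pos (lt_of_lt_of_le (by positivity) (h.speed_ge c hc))]
    exact h.speed_le c hc
  have hE2 : 0 ≤ εa * εx ^ 2 := (abs_nonneg _).trans (hB.abs_le₂ 0)
  have vq_bd : ExpBd N ν (fun x => (c - deriv f (Q c x)) * Q c x) := by
    rw [← hNe]
    refine (h.q_bd c hc).mul_bdd fun x => (abs_sub _ _).trans (add_le_add hcK ?_)
    exact (h.deriv_f_bd hMK hc).le hν.le x
  have vq_cont : Continuous (fun x => (c - deriv f (Q c x)) * Q c x) :=
    (continuous_const.sub (h.deriv_f_cont hc)).mul (h.q_cont hc)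
  have cβ : Continuous fun x => B₁ x - B₁ 0 := hB.cont₁.sub continuous_const
  have mq := h.q_memLp hc
  have mq1 := h.q1_memLp hc
  have mq2 : MemLp (fun x => c * Q c x - f (Q c x)) 2 volume :=
    (h.q2_bd hMK hc).memLp hν (h.q2_cont hc)
  have mvq := vq_bd.memLp hν vq_cont
  obtain ⟨i0, e0⟩ := h.integral_flux_wave hc hB
  have q3 : ExpBd (3 * K) ν (fun x => 3 * deriv (Q c) x) := by
    have := (h.q1_bd c hc).const_mul 3
    rwa [abs_of_pos (by norm_num : (0 : ℝ) < 3)] at this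
  obtain ⟨i1, b1⟩ := abs_integral_mul_weight_le hX.memLp' hX.l2_le' hE2 cβ hB.abs_sub_le₁ hν q3
    (continuous_const.mul (h.q1_cont hc))
  obtain ⟨i2, b2⟩ := abs_integral_mul_weight_le hX.memLp hX.l2_le hE2 cβ hB.abs_sub_le₁ hν vq_bd
    vq_cont
  obtain ⟨i3, b3⟩ := abs_integral_mul_bdd_le hX.memLp hX.l2_le hB.measurable.aestronglyMeasurable
    hB.abs_le₂ mq1 ((h.q1_bd c hc).l2_le hν)
  obtain ⟨i4, b4⟩ := abs_integral_mul_bdd_le hX.memLp' hX.l2_le' hB.measurable.aestronglyMeasurable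
    hB.abs_le₂ mq ((h.q_bd c hc).l2_le hν)
  have i5 := integrable_mul_of_memLp hX.memLp mvq
  have i6 := integrable_mul_of_memLp hX.memLp' mq1
  have i7 := integrable_mul_of_memLp hX.memLp mq2
  have hs : Integrable (fun x => Ξ x ^ 2 + g x ^ 2) :=
    hX.memLp.integrable_sq.add hX.memLp'.integrable_sq
  have hrem : ∀ x, |B₁ x * fluxRem f c (Q c x) (deriv (Q c) x) (Ξ x) (g x) + B₂ x * (Ξ x * g x)|
      ≤ εa * εx * (A + 1) * (Ξ x ^ 2 + g x ^ 2) := fun x => by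
    have d1 := abs_fluxRem_le (p := deriv (Q c) x) (w := g x) h.nonlin hM hcK
      ((h.q_bd c hc).le hν.le x) ((hX.abs_le x).trans hr)
    rw [hAe] at d1
    have d2 : |Ξ x * g x| ≤ Ξ x ^ 2 + g x ^ 2 := by
      rw [abs_le]
      constructor <;> nlinarith [sq_nonneg (Ξ x + g x), sq_nonneg (Ξ x - g x)]
    have d3 : εa * εx ^ 2 ≤ εa * εx := by
      calc εa * εx ^ 2 = εa * εx * εx := by ring
        _ ≤ _ := mul_le_of_le_one_right hE hεx1
    refine (abs_add_le _ _).trans ?_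
    rw [abs_mul, abs_mul (B₂ x)]
    calc _ ≤ εa * εx * (A * (Ξ x ^ 2 + g x ^ 2)) + εa * εx * (Ξ x ^ 2 + g x ^ 2) :=
          add_le_add (mul_le_mul (hB.abs_le₁ x) d1 (abs_nonneg _) hE)
            (mul_le_mul ((hB.abs_le₂ x).trans d3) d2 (abs_nonneg _) hE)
      _ = _ := by ring
  have i8 : Integrable (fun x => B₁ x * fluxRem f c (Q c x) (deriv (Q c) x) (Ξ x) (g x)
      + B₂ x * (Ξ x * g x)) := by
    refine (hs.const_mul (εa * εx * (A + 1))).mono' ?_ (.of_forall hrem)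
    have c1 := h.q_cont hc
    have c2 := h.q1_cont hc
    have c3 := hX.prim.continuous
    have c4 := hX.memLp'.1
    have c5 := h.nonlin.continuous
    have c6 := h.deriv_f_cont hc
    have c7 : Continuous (antideriv f) := continuous_of_hasDerivAt h.nonlin.hasDerivAt_antideriv
    have c8 := hB.measurable.aestronglyMeasurable (μ := volume)
    have c9 := hB.cont₁
    unfold fluxRem fluxDens
    fun_prop
  have b8 : |∫ x, (B₁ x * fluxRem f c (Q c x) (deriv (Q c) x) (Ξ x) (g x) + B₂ x * (Ξ x * g x))|
      ≤ 2 * (A + 1) * (εa * εx * r ^ 2) := by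
    have := norm_integral_le_of_norm_le
      (f := fun x => B₁ x * fluxRem f c (Q c x) (deriv (Q c) x) (Ξ x) (g x) + B₂ x * (Ξ x * g x))
      (hs.const_mul (εa * εx * (A + 1))) (.of_forall hrem)
    rw [integral_const_mul, integral_add hX.memLp.integrable_sq hX.memLp'.integrable_sq,
      ← l2_sq, ← l2_sq] at this
    refine this.trans ?_
    have s1 := pow_le_pow_left₀ (l2_nonneg _) hX.l2_le 2
    have s2 := pow_le_pow_left₀ (l2_nonneg _) hX.l2_le' 2
    calc _ ≤ εa * εx * (A + 1) * (r ^ 2 + r ^ 2) :=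
          mul_le_mul_of_nonneg_left (add_le_add s1 s2) (by positivity)
      _ = _ := by ring
  have ibp := hX.prim.integral_by_parts (.of_hasDerivAt (h.q1_hasDerivAt hc) (h.q2_cont hc))
    hX.memLp hX.memLp' mq1 mq2
  have e1 : (fun x => B₁ x * fluxDens f c (Q c x + Ξ x) (deriv (Q c) x + g x)
        + B₂ x * ((Q c x + Ξ x) * (deriv (Q c) x + g x)))
      = fun x => (B₁ x * fluxDens f c (Q c x) (deriv (Q c) x) + B₂ x * (Q c x * deriv (Q c) x))
        + B₁ 0 * (Ξ x * ((c - deriv f (Q c x)) * Q c x)) + B₁ 0 * 3 * (g x * deriv (Q c) x)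
        + g x * ((B₁ x - B₁ 0) * (3 * deriv (Q c) x))
        + Ξ x * ((B₁ x - B₁ 0) * ((c - deriv f (Q c x)) * Q c x))
        + Ξ x * (B₂ x * deriv (Q c) x) + g x * (B₂ x * Q c x)
        + (B₁ x * fluxRem f c (Q c x) (deriv (Q c) x) (Ξ x) (g x) + B₂ x * (Ξ x * g x)) := by
    funext x; simp only [fluxRem]; ring
  have e2 : (fun x => Ξ x * (3 * (c * Q c x - f (Q c x)) - (c - deriv f (Q c x)) * Q c x))
      = fun x => 3 * (Ξ x * (c * Q c x - f (Q c x))) - Ξ x * ((c - deriv f (Q c x)) * Q c x) := by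
    funext x; ring
  rw [hGe] at b3 b4
  rw [mul_assoc (3 * K), hWe] at b1
  rw [mul_assoc N, hWe] at b2
  -- order zero integrates to zero; the first order terms with frozen slope cancel after an
  -- integration by parts; what is left carries `∂ₓ² b` or is quadratic in the fluctuation
  rw [e1, e2]
  generalize hx : (fun x => B₁ x * fluxDens f c (Q c x) (deriv (Q c) x)
    + B₂ x * (Q c x * deriv (Q c) x)) = X0 at i0 e0
  have hx' := congr_fun hx
  generalize hy : (fun x => B₁ x * fluxRem f c (Q c x) (deriv (Q c) x) (Ξ x) (g x)
    + B₂ x * (Ξ x * g x)) = X8 at i8 b8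
  have hy' := congr_fun hy
  simp only [hx', hy']
  simp (disch := fun_prop) only [integral_add, integral_sub, integral_const_mul]
  rw [e0, ibp]
  set J1 := ∫ x, g x * ((B₁ x - B₁ 0) * (3 * deriv (Q c) x))
  set J2 := ∫ x, Ξ x * ((B₁ x - B₁ 0) * ((c - deriv f (Q c x)) * Q c x))
  set J3 := ∫ x, Ξ x * (B₂ x * deriv (Q c) x)
  set J4 := ∫ x, g x * (B₂ x * Q c x)
  set J8 := ∫ x, X8 x
  set J5 := ∫ x, Ξ x * ((c - deriv f (Q c x)) * Q c x)
  set J7 := ∫ x, Ξ x * (c * Q c x - f (Q c x))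
  have e3 : 0 + B₁ 0 * J5 + B₁ 0 * 3 * -J7 + J1 + J2 + J3 + J4 + J8 + B₁ 0 * (3 * J7 - J5)
      = J1 + J2 + J3 + J4 + J8 := by ring
  rw [e3]
  have t1 : |J1 + J2 + J3 + J4 + J8| ≤ |J1| + |J2| + |J3| + |J4| + |J8| :=
    (abs_add_le _ _).trans (add_le_add_left ((abs_add_le _ _).trans (add_le_add_left
      ((abs_add_le _ _).trans (add_le_add_left (abs_add_le _ _) _)) _)) _)
  have t2 : 0 ≤ εa * εx * (εx * r) := by positivity
  have t3 : 0 ≤ εa * εx * r ^ 2 := by positivity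
  have t4 : 0 ≤ (3 * K * W + N * W + 2 * G) * (εa * εx * r ^ 2) := by positivity
  have t5 : 0 ≤ 2 * (A + 1) * (εa * εx * (εx * r)) := by positivity
  refine (t1.trans (add_le_add (add_le_add (add_le_add (add_le_add b1 b2) b3) b4) b8)).trans ?_
  linarith

end IsWaveData

/-! ### The potential along a trajectory -/

namespace IsPotential

variable {b : ℝ → ℝ → ℝ} {εa εt εx : ℝ}

lemma dx_eq (h : IsPotential b εa εt εx) (t x : ℝ) :
    dx b t x = fderiv ℝ (Function.uncurry b) (t, x) (0, 1) :=
  ((h.diff (t, x)).hasFDerivAt.comp_hasDerivAt x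
    ((hasDerivAt_const x t).prodMk (hasDerivAt_id x))).deriv

lemma dt_eq (h : IsPotential b εa εt εx) (t x : ℝ) :
    dt b t x = fderiv ℝ (Function.uncurry b) (t, x) (1, 0) := by
  have d : HasDerivAt (fun s => b s x) (fderiv ℝ (Function.uncurry b) (t, x) (1, 0)) t :=
    (h.diff (t, x)).hasFDerivAt.comp_hasDerivAt (f := fun s => (s, x)) t
      ((hasDerivAt_id t).prodMk (hasDerivAt_const t x))
  exact d.deriv

lemma hasDerivAt (h : IsPotential b εa εt εx) (t x : ℝ) : HasDerivAt (b t) (dx b t x) x :=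
  ((h.diff (t, x)).comp x ((differentiableAt_const t).prodMk differentiableAt_id)).hasDerivAt

lemma differentiable_dx (h : IsPotential b εa εt εx) :
    Differentiable ℝ (fun p : ℝ × ℝ => dx b p.1 p.2) := by
  have e : (fun p : ℝ × ℝ => dx b p.1 p.2)
      = fun p => fderiv ℝ (Function.uncurry b) p (0, 1) := funext fun p => h.dx_eq p.1 p.2
  rw [e]
  exact fun p => (h.diff_two p).clm_apply (differentiableAt_const _)

lemma hasDerivAt_dx (h : IsPotential b εa εt εx) (t x : ℝ) :
    HasDerivAt (dx b t) (dx (dx b) t x) x :=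
  ((h.differentiable_dx (t, x)).comp x
    ((differentiableAt_const t).prodMk differentiableAt_id)).hasDerivAt

lemma continuous_dt (h : IsPotential b εa εt εx) (t : ℝ) : Continuous (dt b t) := by
  have e : dt b t = fun x => fderiv ℝ (Function.uncurry b) (t, x) (1, 0) := funext (h.dt_eq t)
  rw [e]
  exact (h.diff_two.continuous.comp (by fun_prop : Continuous fun x : ℝ => (t, x))).clm_apply
    continuous_const

lemma measurable_dx_dx (t : ℝ) : Measurable (dx (dx b) t) := measurable_deriv _

lemma abs_le (h : IsPotential b εa εt εx) (t x : ℝ) : |b t x| ≤ εa := by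
  simpa using h.bound 0 0 (by norm_num) (by norm_num) (by norm_num) t x

lemma abs_dx_le (h : IsPotential b εa εt εx) (t x : ℝ) : |dx b t x| ≤ εa * εx := by
  have := h.bound 0 1 (by norm_num) (by norm_num) (by norm_num) t x
  simp [iteratedDeriv_one] at this
  exact this

lemma abs_dx_dx_le (h : IsPotential b εa εt εx) (t x : ℝ) :
    |dx (dx b) t x| ≤ εa * εx ^ 2 := by
  have := h.bound 0 2 (by norm_num) (by norm_num) (by norm_num) t x
  simp [iteratedDeriv_succ] at this
  exact this

lemma abs_dt_le (h : IsPotential b εa εt εx) (t x : ℝ) : |dt b t x| ≤ εa * εt := by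
  have := h.bound 1 0 (by norm_num) (by norm_num) (by norm_num) t x
  simp [iteratedDeriv_one] at this
  exact this

lemma abs_dt_dx_le (h : IsPotential b εa εt εx) (t x : ℝ) :
    |deriv (fun s => dx b s x) t| ≤ εa * εt * εx := by
  have := h.bound 1 1 (by norm_num) (by norm_num) (by norm_num) t x
  simp [iteratedDeriv_one] at this
  exact this

lemma frozen (h : IsPotential b εa εt εx) (t a : ℝ) :
    IsFrozenPotential (fun x => b t (x + a)) (fun x => dx b t (x + a))
      (fun x => dx (dx b) t (x + a)) εa εx where
  hasDerivAt x := (h.hasDerivAt t (x + a)).comp_add_const x a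
  hasDerivAt₁ x := (h.hasDerivAt_dx t (x + a)).comp_add_const x a
  measurable := (measurable_dx_dx t).comp (measurable_id.add_const a)
  abs_le _ := h.abs_le t _
  abs_le₁ _ := h.abs_dx_le t _
  abs_le₂ _ := h.abs_dx_dx_le t _

/-- The slope of the potential at the centre of the wave varies slowly. -/
lemma hasDerivAt_dx_moving (h : IsPotential b εa εt εx) {a : ℝ → ℝ} {a' t : ℝ}
    (ha : HasDerivAt a a' t) : ∃ B', |B'| ≤ εa * εt * εx + εa * εx ^ 2 * |a'| ∧
      HasDerivAt (fun s => dx b s (a s)) B' t := by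
  have hd := (h.differentiable_dx (t, a t)).hasFDerivAt
  have d0 := hd.comp_hasDerivAt (f := fun s => (s, a s)) t ((hasDerivAt_id t).prodMk ha)
  have d1 : deriv (fun s => dx b s (a t)) t
      = fderiv ℝ (fun p : ℝ × ℝ => dx b p.1 p.2) (t, a t) (1, 0) :=
    (hd.comp_hasDerivAt (f := fun s => (s, a t)) t
      ((hasDerivAt_id t).prodMk (hasDerivAt_const t (a t)))).deriv
  have d2 : dx (dx b) t (a t) = fderiv ℝ (fun p : ℝ × ℝ => dx b p.1 p.2) (t, a t) (0, 1) :=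
    (hd.comp_hasDerivAt (f := fun x => (t, x)) (a t)
      ((hasDerivAt_const (a t) t).prodMk (hasDerivAt_id (a t)))).deriv
  refine ⟨_, ?_, d0⟩
  have e : ((1 : ℝ), a') = (1, 0) + a' • ((0 : ℝ), (1 : ℝ)) := by simp
  rw [e, map_add, map_smul, ← d1, ← d2, smul_eq_mul, mul_comm a']
  refine (abs_add_le _ _).trans (add_le_add (h.abs_dt_dx_le t _) ?_)
  rw [abs_mul]
  exact mul_le_mul_of_nonneg_right (h.abs_dx_dx_le t _) (abs_nonneg _)

end IsPotential

/-! ### The rate of change of the energy -/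

lemma MemH1.integrable_antideriv {f v : ℝ → ℝ} (hf : IsNonlinearity f) (hv : MemH1 v) :
    Integrable (fun x => antideriv f (v x)) ∧ Integrable (fun x => v x * f (v x)) := by
  obtain ⟨M, hM⟩ := hf.exists_bounds (h1Norm v)
  have hb := hv.ae_abs_le
  have cF : Continuous (antideriv f) := continuous_of_hasDerivAt hf.hasDerivAt_antideriv
  refine ⟨(hv.memLp.integrable_sq.const_mul M).mono'
      (cF.comp_aestronglyMeasurable hv.memLp.1) ?_,
    (hv.memLp.integrable_sq.const_mul M).mono'
      (hv.memLp.1.mul (hf.continuous.comp_aestronglyMeasurable hv.memLp.1)) ?_⟩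
  · filter_upwards [hb] with x hx using hf.abs_antideriv_le hM hx
  · filter_upwards [hb] with x hx
    rw [norm_mul, Real.norm_eq_abs, Real.norm_eq_abs]
    calc |v x| * |f (v x)| ≤ |v x| * (M * |v x|) :=
          mul_le_mul_of_nonneg_left (hM.le _ hx) (abs_nonneg _)
      _ = M * |v x| ^ 2 := by ring
      _ = _ := by rw [sq_abs]

/-- The free energy is the Hamiltonian without its potential part. -/
lemma lam_eq {f : ℝ → ℝ} (hf : IsNonlinearity f) {b : ℝ → ℝ → ℝ} {εa εt εx : ℝ}
    (hb : IsPotential b εa εt εx) {v : ℝ → ℝ} (hv : MemH1 v) (t c : ℝ) :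
    lam f c v = hamiltonian f (b t) v - (1 / 2) * (∫ x, b t x * v x ^ 2) + c * momentum v := by
  have i1 := hv.memLp_weakDeriv.integrable_sq
  have i2 := (hv.integrable_antideriv hf).1
  have i3 : Integrable (fun x => b t x * v x ^ 2) := hv.memLp.integrable_sq.bdd_mul
    (continuous_of_hasDerivAt (hb.hasDerivAt t)).aestronglyMeasurable
    (.of_forall fun x => hb.abs_le t x)
  have e1 : (fun x => (1 / 2) * weakDeriv v x ^ 2 - antideriv f (v x) + (1 / 2) * b t x * v x ^ 2)
      = fun x => (1 / 2) * weakDeriv v x ^ 2 - antideriv f (v x)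
        + (1 / 2) * (b t x * v x ^ 2) := by funext x; ring
  have e2 : (fun x => (1 / 2) * weakDeriv v x ^ 2 - antideriv f (v x) + (1 / 2) * 0 * v x ^ 2)
      = fun x => (1 / 2) * weakDeriv v x ^ 2 - antideriv f (v x) := by funext x; ring
  rw [lam, hamiltonian, hamiltonian, e1, e2]
  simp (disch := fun_prop) only [integral_add, integral_sub, integral_const_mul]
  ring

/-- The rate of change of `Λ_c(u)` along the flow: the flux through the slope of the potential, and
the change of the multiplier `c`. -/
lemma hasDerivAt_lam_solution {f : ℝ → ℝ} (hf : IsNonlinearity f) {b : ℝ → ℝ → ℝ} {εa εt εx : ℝ}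
    (hb : IsPotential b εa εt εx) {J : Set ℝ} (hJ : IsOpen J) {u : ℝ → ℝ → ℝ}
    (hu : IsSolution f b J u) (hlaw : HasBalanceLaws f b J u) {c : ℝ → ℝ} {c' t : ℝ} (ht : t ∈ J)
    (hc : HasDerivAt c c' t) :
    HasDerivAt (fun s => lam f (c s) (u s))
      ((∫ x, (dx b t x * fluxDens f (c t) (u t x) (weakDeriv (u t) x)
        + dx (dx b) t x * (u t x * weakDeriv (u t) x))) + c' * momentum (u t)) t := by
  have d := ((hlaw.hamiltonian_law t ht).fun_sub (hlaw.potential_law t ht)).fun_add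
    (hc.fun_mul (hlaw.momentum_law t ht))
  have hv := hu.mem t ht
  have cdx : Continuous (dx b t) := continuous_of_hasDerivAt (hb.hasDerivAt_dx t)
  have i1 := hv.memLp.integrable_sq
  have i2 := hv.memLp_weakDeriv.integrable_sq
  obtain ⟨i3, i4⟩ := hv.integrable_antideriv hf
  have i5 := integrable_mul_of_memLp hv.memLp hv.memLp_weakDeriv
  have j1 : Integrable (fun x => dt b t x * u t x ^ 2) :=
    i1.bdd_mul (hb.continuous_dt t).aestronglyMeasurable (.of_forall fun x => hb.abs_dt_le t x)
  have j2 : Integrable (fun x => dx b t x * u t x ^ 2) :=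
    i1.bdd_mul cdx.aestronglyMeasurable (.of_forall fun x => hb.abs_dx_le t x)
  have j3 : Integrable (fun x => dx b t x * weakDeriv (u t) x ^ 2) :=
    i2.bdd_mul cdx.aestronglyMeasurable (.of_forall fun x => hb.abs_dx_le t x)
  have j4 : Integrable (fun x => dx b t x * (u t x * f (u t x))) :=
    i4.bdd_mul cdx.aestronglyMeasurable (.of_forall fun x => hb.abs_dx_le t x)
  have j5 : Integrable (fun x => dx b t x * antideriv f (u t x)) :=
    i3.bdd_mul cdx.aestronglyMeasurable (.of_forall fun x => hb.abs_dx_le t x)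
  have j6 : Integrable (fun x => dx (dx b) t x * (u t x * weakDeriv (u t) x)) :=
    i5.bdd_mul (IsPotential.measurable_dx_dx t).aestronglyMeasurable
      (.of_forall fun x => hb.abs_dx_dx_le t x)
  refine (d.congr_of_eventuallyEq ?_).congr_deriv ?_
  · filter_upwards [hJ.mem_nhds ht] with s hs using lam_eq hf hb (hu.mem s hs) s (c s)
  · have e1 : (fun x => (1 / 2) * u t x ^ 2 * dt b t x
        + dx b t x * (u t x * f (u t x) - (3 / 2) * weakDeriv (u t) x ^ 2 - antideriv f (u t x))
        - dx (dx b) t x * u t x * weakDeriv (u t) x)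
        = fun x => (1 / 2) * (dt b t x * u t x ^ 2) + dx b t x * (u t x * f (u t x))
          - (3 / 2) * (dx b t x * weakDeriv (u t) x ^ 2) - dx b t x * antideriv f (u t x)
          - dx (dx b) t x * (u t x * weakDeriv (u t) x) := by funext x; ring
    have e2 : (fun x => dx b t x * fluxDens f (c t) (u t x) (weakDeriv (u t) x)
        + dx (dx b) t x * (u t x * weakDeriv (u t) x))
        = fun x => (1 / 2) * c t * (dx b t x * u t x ^ 2) - dx b t x * (u t x * f (u t x))
          + (3 / 2) * (dx b t x * weakDeriv (u t) x ^ 2) + dx b t x * antideriv f (u t x)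
          + dx (dx b) t x * (u t x * weakDeriv (u t) x) := by
      funext x; simp only [fluxDens]; ring
    rw [e1, e2]
    simp (disch := fun_prop) only [integral_add, integral_sub, integral_const_mul]
    ring

namespace IsWaveData

variable {f : ℝ → ℝ} {Q : ℝ → ℝ → ℝ} {S : Set ℝ} {K ν c : ℝ}
  {Ξ g : ℝ → ℝ} {r M : ℝ}

/-- The Hessian pairs `ξ` with `∂ₓ(x Q)` as the energy flux does to first order, so that only small
terms remain in the rate of change of `⟨x Q, ξ⟩`. -/
lemma exists_abs_dilation_rate_le (h : IsWaveData f Q S K ν) (hM : NonlinBounds f (K + 1) M) :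
    ∃ C, 0 ≤ C ∧ ∀ c ∈ S, ∀ Ξ g r, IsH1Rep Ξ g r → r ≤ 1 → ∀ B B₁ B₂ εa εx,
    IsFrozenPotential B B₁ B₂ εa εx → ∀ l c' : ℝ,
    |(-(∫ x, (g x * (2 * deriv (Q c) x + x * (c * Q c x - f (Q c x)))
        + (c - deriv f (Q c x)) * (Ξ x * (Q c x + x * deriv (Q c) x))))
      + l * (∫ x, (Q c x + Ξ x) * (Q c x + x * deriv (Q c) x))
      - (∫ x, (B x - B 0) * ((Q c x + Ξ x) * (Q c x + x * deriv (Q c) x)))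
      + (∫ x, nlRem f (Q c x) (Ξ x) * (Q c x + x * deriv (Q c) x))
      + c' * (∫ x, Ξ x * (x * zc Q c x)) - c' * ∫ x, zc Q c x * (x * Q c x))
      - ∫ x, Ξ x * (3 * (c * Q c x - f (Q c x)) - (c - deriv f (Q c x)) * Q c x)|
      ≤ C * (|l| + |c'| + εa * εx + r ^ 2) := by
  have hν := h.nu_pos
  have hK := h.bound_nonneg
  have hM0 := hM.nonneg
  have hMK := hM.mono (show K ≤ K + 1 by linarith)
  obtain ⟨L, hΦ⟩ := h.speedFamily_id_mul_q
  have hμ := hΦ.rate_pos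
  have hLK : 0 ≤ K * (2 / ν) := by positivity
  refine ⟨2 * ((K + 1) * |L|) / (ν / 2) + (K + 1) * (|L| * (8 / (ν / 2) ^ 2)) + M * |L|
    + (2 * (K * (2 / ν)) / (ν / 2) + 2 * (K * |L|) / (ν / 2)), by positivity, ?_⟩
  intro c hc Ξ g r hX hr B B₁ B₂ εa εx hB l c'
  have hL : |L| = L := abs_of_nonneg (hΦ.bd c hc).nonneg
  have hL0 : 0 ≤ L := (hΦ.bd c hc).nonneg
  rw [hL]
  have hE : 0 ≤ εa * εx := (abs_nonneg _).trans (hB.abs_le₁ 0)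
  have e := (h.hess_pairing hc hX.prim hX.memLp hX.memLp' (hΦ.hasDerivAt₁ c hc)
    (p₁ := fun x => 2 * deriv (Q c) x + x * (c * Q c x - f (Q c x)))
    (s := fun x => 3 * (c * Q c x - f (Q c x)) - (c - deriv f (Q c x)) * Q c x) (fun x => ?_)
    ?_ (hΦ.memLp₁ hc) (hΦ.memLp₂ hc) ?_).2
  rotate_left
  · exact (((h.q1_hasDerivAt hc x).const_mul 2).fun_add ((hasDerivAt_id' x).fun_mul
      ((h.profile c hc).hasDerivAt_deriv2 h.nonlin x))).congr_deriv (by ring)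
  · exact (continuous_const.mul (h.q2_cont hc)).sub
      ((continuous_const.sub (h.deriv_f_cont hc)).mul (h.q_cont hc))
  · have m1 : MemLp (fun x => c * Q c x - f (Q c x)) 2 volume :=
      (h.q2_bd hMK hc).memLp h.nu_pos (h.q2_cont hc)
    have m2 : MemLp (fun x => deriv f (Q c x) * Q c x) 2 volume :=
      memLp_bdd_mul (h.q_memLp hc) (h.deriv_f_cont hc).aestronglyMeasurable
        ((h.deriv_f_bd hMK hc).le hν.le)
    have m3 := ((m1.const_mul 3).sub ((h.q_memLp hc).const_mul c)).add m2
    convert m3 using 1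
    funext x
    simp only [Pi.add_apply, Pi.sub_apply]
    ring
  have hU : ∀ x, |Q c x + Ξ x| ≤ K + 1 := fun x => (abs_add_le _ _).trans
    (add_le_add ((h.q_bd c hc).le hν.le x) ((hX.abs_le x).trans hr))
  have b1 := ((hΦ.bd₁ c hc).mul_bdd hU).abs_integral_le hμ
  have b2 := hB.abs_integral_sub_mul_le hμ hU (hΦ.bd₁ c hc)
  have b3 := abs_integral_le_of_sq_bound hX hM0 (h.abs_nlRem_le hM hc hX hr)
    ((hΦ.bd₁ c hc).le hμ.le)
  have b4 := (((h.z_bd c hc).id_mul hν).mul_bdd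
    (fun x => (hX.abs_le x).trans hr)).abs_integral_le hμ
  have b5 := ((hΦ.bd c hc).mul_bdd ((h.z_bd c hc).le hν.le)).abs_integral_le hμ
  rw [e]
  rw [one_mul] at b4
  set J1 := ∫ x, (Q c x + Ξ x) * (Q c x + x * deriv (Q c) x)
  set J2 := ∫ x, (B x - B 0) * ((Q c x + Ξ x) * (Q c x + x * deriv (Q c) x))
  set J3 := ∫ x, nlRem f (Q c x) (Ξ x) * (Q c x + x * deriv (Q c) x)
  set J4 := ∫ x, Ξ x * (x * zc Q c x)
  set J5 := ∫ x, zc Q c x * (x * Q c x)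
  set J6 := ∫ x, Ξ x * (3 * (c * Q c x - f (Q c x)) - (c - deriv f (Q c x)) * Q c x)
  have e2 : - -J6 + l * J1 - J2 + J3 + c' * J4 - c' * J5 - J6 = l * J1 - J2 + J3 + c' * (J4 - J5) := by
    ring
  rw [e2]
  have t1 : |l * J1 - J2 + J3 + c' * (J4 - J5)| ≤ |l| * |J1| + |J2| + |J3| + |c'| * (|J4| + |J5|) := by
    refine (abs_add_le _ _).trans (add_le_add ((abs_add_le _ _).trans (add_le_add_left
      ((abs_sub _ _).trans ?_) _)) ?_)
    · rw [abs_mul]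
    · rw [abs_mul]
      exact mul_le_mul_of_nonneg_left (abs_sub _ _) (abs_nonneg _)
  have p1 := abs_nonneg l
  have p2 := abs_nonneg c'
  have p3 := sq_nonneg r
  obtain ⟨Y, hY⟩ : ∃ Y, |l| + |c'| + εa * εx + r ^ 2 = Y := ⟨_, rfl⟩
  rw [hY]
  have q1 : |l| ≤ Y := by linarith
  have q2 : |c'| ≤ Y := by linarith
  have q3 : εa * εx ≤ Y := by linarith
  have q4 : r ^ 2 ≤ Y := by linarith
  have hY0 : 0 ≤ Y := p1.trans q1
  have d1 := mul_le_mul q1 b1 (abs_nonneg _) hY0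
  have d2 := b2.trans (mul_le_mul_of_nonneg_left q3 (by positivity))
  have d3 := b3.trans (mul_le_mul_of_nonneg_left q4 (by positivity))
  have d4 := mul_le_mul q2 (add_le_add b4 b5) (by positivity) hY0
  refine t1.trans ((add_le_add (add_le_add (add_le_add d1 d2) d3) d4).trans (le_of_eq ?_))
  ring

end IsWaveData

/-! ### The Lyapunov functional -/

lemma MemH1.exists_h1Rep {v : ℝ → ℝ} (hv : MemH1 v) (a : ℝ) : ∃ Ξ : ℝ → ℝ,
    IsH1Rep Ξ (fun x => weakDeriv v (x + a)) (h1Norm v) ∧ ∀ᵐ x, Ξ x = v (x + a) := by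
  obtain ⟨p, hp, ep⟩ := hv.exists_primitive
  have mp := hv.memLp.ae_eq ep
  refine ⟨fun x => p (x + a), ⟨hp.comp_add a, memLp_comp_add mp a,
    memLp_comp_add hv.memLp_weakDeriv a, fun x => ?_, ?_, ?_⟩,
    (ae_shift ep a).mono fun x hx => hx.symm⟩
  · apply abs_le_of_sq_le_sq _ (h1Norm_nonneg v)
    refine (hp.sq_le mp hv.memLp_weakDeriv (x + a)).trans ?_
    rw [h1Norm_sq, l2_congr ep, l2_sq, l2_sq,
      integral_add mp.integrable_sq hv.memLp_weakDeriv.integrable_sq]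
  · rw [l2_shift, ← l2_congr ep]
    exact l2_le_h1Norm v
  · rw [l2_shift]
    exact l2_weakDeriv_le_h1Norm v

namespace IsWaveData

variable {f : ℝ → ℝ} {Q : ℝ → ℝ → ℝ} {S : Set ℝ} {K ν : ℝ}

/-- The fluctuation in the moving frame. -/
lemma exists_fluct_rep (h : IsWaveData f Q S K ν) {u : ℝ → ℝ → ℝ} {a c : ℝ → ℝ} {t : ℝ}
    (hc : c t ∈ S) (hu : MemH1 (u t)) : MemH1 (fluct Q u a c t) ∧ ∃ Ξ g,
    IsH1Rep Ξ g (h1Norm (fluct Q u a c t)) ∧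
    (∀ᵐ x, Ξ x = fluct Q u a c t (x + a t)) ∧
    (∀ᵐ x, u t (x + a t) = Q (c t) x + Ξ x) ∧
    ∀ᵐ x, weakDeriv (u t) (x + a t) = deriv (Q (c t)) x + g x := by
  have hw := (h.q_memH1 hc).1.shift (-a t)
  have hξ := hu.sub hw.1
  obtain ⟨Ξ, hX, e⟩ := hξ.1.exists_h1Rep (a t)
  refine ⟨hξ.1, Ξ, _, hX, e, ?_, ?_⟩
  · filter_upwards [e] with x hx
    rw [hx, add_neg_cancel_right]
    ring
  · filter_upwards [ae_shift hξ.2 (a t), ae_shift hw.2 (a t), (h.q_memH1 hc).2] with x h1 h2 h3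
    rw [h1, h2, add_neg_cancel_right, h3]
    ring

/-- The constraints hold throughout a time interval, so their rates of change vanish. -/
lemma orth_pairing_eventually (h : IsWaveData f Q S K ν) {J I₀ : Set ℝ} (hJ : IsOpen J)
    {u : ℝ → ℝ → ℝ} {a c : ℝ → ℝ} {α t c' : ℝ} (hmod : IsModulated Q I₀ α J u a c) (ht : t ∈ J)
    (hc : c t ∈ S) (hcd : HasDerivAt c c' t) :
    (∀ᶠ s in 𝓝 t, ∫ x, fluct Q u a c s x * Q (c s) (x - a s) = 0) ∧
      ∀ᶠ s in 𝓝 t, ∫ x, fluct Q u a c s x * wc Q α (c s) (x - a s) = 0 := by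
  have key : ∀ᶠ s in 𝓝 t, (∫ x, fluct Q u a c s x * Q (c s) (x - a s) = 0) ∧
      ∫ x, fluct Q u a c s x * wc Q α (c s) (x - a s) = 0 := by
    filter_upwards [hJ.mem_nhds ht, hcd.continuousAt.eventually (h.isOpen.mem_nhds hc)] with s hs hcs
    obtain ⟨o1, o2⟩ := (h.isSympOrth_iff hcs α (a s) _).1 (hmod.orth s hs)
    rw [← integral_shift (fun x => fluct Q u a c s x * Q (c s) (x - a s)) (a s),
      ← integral_shift (fun x => fluct Q u a c s x * wc Q α (c s) (x - a s)) (a s)]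
    simp only [add_sub_cancel_right]
    exact ⟨o1, o2⟩
  exact ⟨key.mono fun s hs => hs.1, key.mono fun s hs => hs.2⟩

/-- The derivative of the Lyapunov functional in the moving frame, where the orthogonality to `Q`
has removed the linear part of the change of momentum. -/
lemma hasDerivAt_lyapunov (h : IsWaveData f Q S K ν) {b : ℝ → ℝ → ℝ} {εa εt εx : ℝ}
    (hb : IsPotential b εa εt εx) {J : Set ℝ} (hJ : IsOpen J) {u : ℝ → ℝ → ℝ}
    (hu : IsSolution f b J u) (hlaw : HasBalanceLaws f b J u) {a c : ℝ → ℝ} {c' t D B' r : ℝ}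
    (ht : t ∈ J) (hc : c t ∈ S) (hcd : HasDerivAt c c' t) {Ξ g : ℝ → ℝ} (hX : IsH1Rep Ξ g r)
    (eξ : ∀ᵐ x, Ξ x = fluct Q u a c t (x + a t))
    (eU : ∀ᵐ x, u t (x + a t) = Q (c t) x + Ξ x)
    (eU' : ∀ᵐ x, weakDeriv (u t) (x + a t) = deriv (Q (c t)) x + g x)
    (oQ : ∫ x, Ξ x * Q (c t) x = 0)
    (hB : HasDerivAt (fun s => dx b s (a s)) B' t)
    (hD : HasDerivAt (fun s => ∫ x, fluct Q u a c s x * ((x - a s) * Q (c s) (x - a s))) D t) :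
    HasDerivAt (lyapunov f b Q u a c)
      ((∫ x, (dx b t (x + a t) * fluxDens f (c t) (Q (c t) x + Ξ x) (deriv (Q (c t)) x + g x)
        + dx (dx b) t (x + a t) * ((Q (c t) x + Ξ x) * (deriv (Q (c t)) x + g x))))
      + dx b t (a t) * D + B' * (∫ x, Ξ x * (x * Q (c t) x)) + (1 / 2) * c' * ∫ x, Ξ x ^ 2) t := by
  have d1 := hasDerivAt_lam_solution h.nonlin hb hJ hu hlaw ht hcd
  have d2 := (h.hasDerivAt_lam hc).comp t hcd
  have d := (d1.fun_sub d2).fun_add (hB.fun_mul hD)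
  refine (d.congr_of_eventuallyEq ?_).congr_deriv ?_
  · filter_upwards [hcd.continuousAt.eventually (h.isOpen.mem_nhds hc)] with s hcs
    have e1 : (fun x => wave Q (c s) (a s) x + fluct Q u a c s x) = u s := by
      funext x; simp only [fluct]; ring
    have e2 : ip (fun x => (x - a s) * wave Q (c s) (a s) x) (fluct Q u a c s)
        = ∫ x, fluct Q u a c s x * ((x - a s) * Q (c s) (x - a s)) := by
      simp only [ip, wave, mul_comm]
    rw [lyapunov, e1, e2, h.lam_wave hcs]
    rfl
  · have e1 : (∫ x, (dx b t x * fluxDens f (c t) (u t x) (weakDeriv (u t) x)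
        + dx (dx b) t x * (u t x * weakDeriv (u t) x)))
        = ∫ x, (dx b t (x + a t) * fluxDens f (c t) (Q (c t) x + Ξ x) (deriv (Q (c t)) x + g x)
        + dx (dx b) t (x + a t) * ((Q (c t) x + Ξ x) * (deriv (Q (c t)) x + g x))) := by
      rw [← integral_shift _ (a t)]
      refine integral_congr_ae ?_
      filter_upwards [eU, eU'] with x h1 h2
      rw [h1, h2]
    have e2 : ∫ x, fluct Q u a c t x * ((x - a t) * Q (c t) (x - a t))
        = ∫ x, Ξ x * (x * Q (c t) x) := by
      rw [← integral_shift _ (a t)]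
      refine integral_congr_ae ?_
      filter_upwards [eξ] with x h1
      rw [h1, add_sub_cancel_right]
    have e3 : ∫ x, u t x ^ 2 = (∫ x, Q (c t) x ^ 2) + ∫ x, Ξ x ^ 2 := by
      have i1 := (h.q_memLp hc).integrable_sq
      have i2 := hX.memLp.integrable_sq
      have i3 := integrable_mul_of_memLp hX.memLp (h.q_memLp hc)
      have e : ∫ x, u t x ^ 2
          = ∫ x, (Q (c t) x ^ 2 + 2 * (Ξ x * Q (c t) x) + Ξ x ^ 2) := by
        rw [← integral_shift _ (a t)]
        refine integral_congr_ae ?_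
        filter_upwards [eU] with x h1
        rw [h1]
        ring
      rw [e]
      simp (disch := fun_prop) only [integral_add, integral_const_mul]
      rw [oQ]
      ring
    rw [e1, e2, momentum, e3]
    ring

end IsWaveData

/-- `f`, `Q` and the speeds in `S` satisfy the Lyapunov estimate with the constants `α₀`, `κ`,
`C`. -/
def HasLyapunovBound (f : ℝ → ℝ) (I₀ : Set ℝ) (Q : ℝ → ℝ → ℝ) (S : Set ℝ) (α₀ κ C : ℝ) : Prop :=
  ∀ (εa εt εx : ℝ), 0 < εa → εa ≤ 1 → 0 < εt → 0 < εx → εx ≤ 1 →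
  ∀ b : ℝ → ℝ → ℝ, IsPotential b εa εt εx →
  ∀ α : ℝ, 0 < α → α ≤ α₀ →
  ∀ J : Set ℝ, IsOpen J →
  ∀ u : ℝ → ℝ → ℝ, IsSolution f b J u → HasBalanceLaws f b J u →
  ∀ a c : ℝ → ℝ, IsModulated Q I₀ α J u a c →
  ∀ t ∈ J, c t ∈ S →
  ∀ η : ℝ → ℝ, IsHessMinimizer f Q α (c t) (a t) η →
  h1Norm (fluct Q u a c t) ≤ 1 →
  (√α)⁻¹ * h1Norm (goodPart η (fluct Q u a c t)) + h1Norm (fluct Q u a c t) ≤ κ →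
  ∃ M' : ℝ, HasDerivAt (lyapunov f b Q u a c) M' t ∧
    M' ≤ C * ((εa * εx + h1Norm (fluct Q u a c t) ^ 2) *
      bigXi εa εt εx α (h1Norm (goodPart η (fluct Q u a c t))) (h1Norm (fluct Q u a c t)))

/-- The bookkeeping of the error terms. -/
lemma lyapunov_rate_algebra {G J D B P m l c' a' C₁ Cf Cd L N b₁ εa εt εx α γ r : ℝ}
    (hεa : 0 ≤ εa) (hεa1 : εa ≤ 1) (hεt : 0 ≤ εt) (hεx : 0 ≤ εx) (hεx1 : εx ≤ 1) (hα : 0 ≤ α)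
    (hα1 : α ≤ 1) (hγ : 0 ≤ γ) (hγ1 : γ ≤ 1) (hr : 0 ≤ r) (hr1 : r ≤ 1) (hC₁ : 0 ≤ C₁)
    (hCf : 0 ≤ Cf) (hCd : 0 ≤ Cd) (hL : 0 ≤ L) (hN : 0 ≤ N)
    (hl : |l| ≤ C₁ * (εa * εx + √α * γ + α * r + r ^ 2))
    (hc' : |c'| ≤ C₁ * (εa * εx + √α * γ + α * r + r ^ 2)) (ha' : |a'| ≤ |l| + N)
    (hG : |G + b₁ * J| ≤ Cf * (εa * εx * (εx * r + r ^ 2))) (hb₁ : |b₁| ≤ εa * εx)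
    (hD : |D - J| ≤ Cd * (|l| + |c'| + εa * εx + r ^ 2))
    (hB : |B| ≤ εa * εt * εx + εa * εx ^ 2 * |a'|) (hP : |P| ≤ r * L) (hm0 : 0 ≤ m)
    (hm : m ≤ r ^ 2) :
    G + b₁ * D + B * P + (1 / 2) * c' * m
      ≤ (Cf + Cd * (2 * C₁ + 1) + L * (4 * C₁ + N + 1) + C₁ + 1)
        * ((εa * εx + r ^ 2) * bigXi εa εt εx α γ r) := by
  have hs := Real.sqrt_nonneg α
  have hs1 : √α ≤ 1 := Real.sqrt_le_one.2 hα1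
  have hε : 0 ≤ εa * εx := by positivity
  have hε1 : εa * εx ≤ 1 := mul_le_one₀ hεa1 hεx hεx1
  have p1 : 0 ≤ √α * γ := by positivity
  have p2 : 0 ≤ α * r := by positivity
  have p3 := sq_nonneg r
  have p4 : 0 ≤ εx * r := by positivity
  have p5 : 0 ≤ εt * r := by positivity
  have p6 : 0 ≤ (√α)⁻¹ * (εa * εx) * γ := by positivity
  have p7 : √α * γ ≤ 1 := mul_le_one₀ hs1 hγ hγ1
  have p8 : α * r ≤ 1 := mul_le_one₀ hα1 hr hr1
  have p9 : r ^ 2 ≤ 1 := pow_le_one₀ hr hr1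
  obtain ⟨Y, hY⟩ : ∃ Y, εa * εx + √α * γ + α * r + r ^ 2 = Y := ⟨_, rfl⟩
  obtain ⟨X, hX⟩ : ∃ X, bigXi εa εt εx α γ r = X := ⟨_, rfl⟩
  have hX' : X = εa * εx + √α * γ + (√α)⁻¹ * (εa * εx) * γ + α * r + εx * r + εt * r + r ^ 2 := by
    rw [← hX, bigXi]; ring
  rw [hY] at hl hc'
  rw [hX]
  have hYX : Y ≤ X := by linarith
  have hY0 : 0 ≤ Y := by linarith
  have hX0 : 0 ≤ X := hY0.trans hYX
  have hY4 : Y ≤ 4 := by linarith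
  have ha : |a'| ≤ 4 * C₁ + N := by
    have := mul_le_mul_of_nonneg_left hY4 hC₁
    linarith
  have t1 : |G + b₁ * J| ≤ Cf * (εa * εx * X) := by
    refine hG.trans (mul_le_mul_of_nonneg_left (mul_le_mul_of_nonneg_left ?_ hε) hCf)
    linarith
  have t2 : |b₁ * (D - J)| ≤ Cd * (2 * C₁ + 1) * (εa * εx * X) := by
    have h1 : |l| + |c'| + εa * εx + r ^ 2 ≤ (2 * C₁ + 1) * X := by
      have h2 := mul_le_mul_of_nonneg_left hYX hC₁
      linarith
    rw [abs_mul]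
    calc |b₁| * |D - J| ≤ εa * εx * (Cd * ((2 * C₁ + 1) * X)) :=
          mul_le_mul hb₁ (hD.trans (mul_le_mul_of_nonneg_left h1 hCd)) (abs_nonneg _) hε
      _ = _ := by ring
  have t3 : |B * P| ≤ L * (4 * C₁ + N + 1) * (εa * εx * X) := by
    have h1 : εa * εx ^ 2 * |a'| ≤ εa * εx ^ 2 * (4 * C₁ + N) :=
      mul_le_mul_of_nonneg_left ha (by positivity)
    rw [abs_mul]
    calc |B| * |P| ≤ (εa * εt * εx + εa * εx ^ 2 * (4 * C₁ + N)) * (r * L) :=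
          mul_le_mul (by linarith) hP (abs_nonneg _) (by positivity)
      _ = L * (εa * εx * (εt * r)) + L * (4 * C₁ + N) * (εa * εx * (εx * r)) := by ring
      _ ≤ L * (εa * εx * X) + L * (4 * C₁ + N) * (εa * εx * X) := by
          refine add_le_add (mul_le_mul_of_nonneg_left (mul_le_mul_of_nonneg_left ?_ hε) hL)
            (mul_le_mul_of_nonneg_left (mul_le_mul_of_nonneg_left ?_ hε) (by positivity)) <;>
            linarith
      _ = _ := by ring
  have t4 : (1 / 2) * c' * m ≤ C₁ * (r ^ 2 * X) := by
    have h1 : c' * m ≤ C₁ * X * r ^ 2 :=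
      mul_le_mul ((le_abs_self c').trans (hc'.trans (mul_le_mul_of_nonneg_left hYX hC₁))) hm hm0
        (by positivity)
    have h2 : 0 ≤ C₁ * (r ^ 2 * X) := by positivity
    linarith
  have q1 := (abs_le.1 t1).2
  have q2 := (abs_le.1 t2).2
  have q3 := (abs_le.1 t3).2
  have s1 : 0 ≤ (Cf + Cd * (2 * C₁ + 1) + L * (4 * C₁ + N + 1) + 1) * (r ^ 2 * X) := by positivity
  have s2 : 0 ≤ (C₁ + 1) * (εa * εx * X) := by positivity
  linarith

/-- The Lyapunov estimate near a stable speed. -/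
lemma IsStableData.exists_lyapunovBound {f : ℝ → ℝ} {Q : ℝ → ℝ → ℝ} {S : Set ℝ} {K ν k T : ℝ}
    (h : IsStableData f Q S K ν k T) (I₀ : Set ℝ) : ∃ α₀ κ C : ℝ, 0 < α₀ ∧ α₀ ≤ 1 ∧ 0 < κ ∧ 0 < C ∧
      HasLyapunovBound f I₀ Q S α₀ κ C := by
  have hν := h.nu_pos
  have hK := h.bound_nonneg
  obtain ⟨M, hM⟩ := h.nonlin.exists_bounds (K + 1)
  obtain ⟨α₁, D, hα₁, hα₁1, hD, hmin⟩ := h.exists_minimizer_close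
  obtain ⟨α₂, κ, C₁, hα₂, hα₂1, hκ, hκ1, hC₁, hrates⟩ := h.exists_modulation_rates hM hD
  obtain ⟨Cf, hCf, hflux⟩ := h.exists_abs_flux_le hM
  obtain ⟨Cd, hCd, hdil⟩ := h.exists_abs_dilation_rate_le hM
  obtain ⟨L₁, hΦ₁⟩ := h.speedFamily_q
  obtain ⟨L₂, hΦ₂⟩ := h.speedFamily_id_mul_q
  obtain ⟨L, hL, hLe⟩ : ∃ L, 0 ≤ L ∧ K * (2 / ν) * √(2 / (ν / 2)) = L := ⟨_, by positivity, rfl⟩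
  refine ⟨min α₁ α₂, κ, Cf + Cd * (2 * C₁ + 1) + L * (4 * C₁ + (K + 1) + 1) + C₁ + 1,
    lt_min hα₁ hα₂, (min_le_left _ _).trans hα₁1, hκ, by positivity, ?_⟩
  intro εa εt εx hεa hεa1 hεt hεx hεx1 b hb α hα hαm J hJ u hu hlaw a c hmod t ht hc η hη hr1 hsm
  have ha1 := (hmod.diff_a t ht).hasDerivAt
  have hcd := (hmod.diff_c t ht).hasDerivAt
  obtain ⟨hξ, Ξ, g, hX, eξ, eU, eU'⟩ := h.exists_fluct_rep (a := a) hc (hu.mem t ht)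
  obtain ⟨e, he, hl⟩ := hmin (c t) hc α hα (hαm.trans (min_le_left _ _)) (a t) η hη
  have hB := hb.frozen t (a t)
  obtain ⟨ev1, ev2⟩ := h.orth_pairing_eventually hJ hmod ht hc hcd
  obtain ⟨L₃, hΦ₃⟩ := h.speedFamily_wc hα
  obtain ⟨oQ', oW'⟩ := (h.isSympOrth_iff hc α (a t) _).1 (hmod.orth t ht)
  have oQ : ∫ x, Ξ x * Q (c t) x = 0 := by
    rw [← oQ']
    exact integral_congr_ae (eξ.mono fun x hx => by simp only [hx])
  have oW : ∫ x, Ξ x * wc Q α (c t) x = 0 := by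
    rw [← oW']
    exact integral_congr_ae (eξ.mono fun x hx => by simp only [hx])
  -- the constraints are constant in time: their derivatives give the modulation equations
  have q1 := (h.hasDerivAt_fluct_pairing_frame hM hΦ₁ hu hJ ht hc ha1 hcd hX hr1 hB eU eU').unique
    ((hasDerivAt_const t (0 : ℝ)).congr_of_eventuallyEq ev1)
  have q2 := (h.hasDerivAt_fluct_pairing_frame hM hΦ₃ hu hJ ht hc ha1 hcd hX hr1 hB eU eU').unique
    ((hasDerivAt_const t (0 : ℝ)).congr_of_eventuallyEq ev2)
  -- the pairing in the correction term of the functional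
  have hdp := h.hasDerivAt_fluct_pairing_frame hM hΦ₂ hu hJ ht hc ha1 hcd hX hr1 hB eU eU'
  have hs : IsSplit (deriv (Q (c t))) Ξ α (h1Norm (goodPart η (fluct Q u a c t)))
      (h1Norm (fluct Q u a c t)) D := fun φ hφ =>
    (isSplit_of_minimizer hη.1.1.memLp hη.1.2.2 hξ.memLp (h.q1_memLp hc) eξ (l2_le_h1Norm _) he hl
      φ hφ).trans (add_le_add_left (mul_le_mul_of_nonneg_left (l2_le_h1Norm _) (l2_nonneg _)) _)
  have hγ := h1Norm_nonneg (goodPart η (fluct Q u a c t))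
  have hr := h1Norm_nonneg (fluct Q u a c t)
  generalize h1Norm (goodPart η (fluct Q u a c t)) = γ at *
  generalize h1Norm (fluct Q u a c t) = r at *
  have hα1 : α ≤ 1 := hαm.trans ((min_le_left _ _).trans hα₁1)
  obtain ⟨m1, m2⟩ := hrates (c t) hc α hα (hαm.trans (min_le_right _ _)) Ξ g r γ hX hγ hsm hs oQ oW
    _ _ _ εa εx hB hεa1 (mul_le_one₀ hεa1 hεx.le hεx1) (c t - deriv a t - b t (a t)) (deriv c t)
    (by simpa only [zero_add] using q1) (by simpa only [zero_add] using q2)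
  obtain ⟨B', hB', hBd⟩ := hb.hasDerivAt_dx_moving ha1
  refine ⟨_, h.hasDerivAt_lyapunov hb hJ hu hlaw ht hc hcd hX eξ eU eU' oQ hBd hdp, ?_⟩
  have f1 := hflux (c t) hc Ξ g r hX hr1 _ _ _ εa εx hB hεx.le hεx1
  have f2 := hdil (c t) hc Ξ g r hX hr1 _ _ _ εa εx hB (c t - deriv a t - b t (a t)) (deriv c t)
  simp only [zero_add] at f1 f2
  have hP : |∫ x, Ξ x * (x * Q (c t) x)| ≤ r * L := by
    refine abs_integral_mul_le_rep hX (hΦ₂.memLp hc) ?_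
    rw [← hLe]
    exact ((h.q_bd _ hc).id_mul hν).l2_le (by positivity)
  have hγ1 : γ ≤ 1 := by
    have hi : 1 ≤ (√α)⁻¹ := (one_le_inv₀ (Real.sqrt_pos.2 hα)).2 (Real.sqrt_le_one.2 hα1)
    have := le_mul_of_one_le_left hγ hi
    linarith
  have hm : ∫ x, Ξ x ^ 2 ≤ r ^ 2 := by
    rw [← l2_sq]
    exact pow_le_pow_left₀ (l2_nonneg _) hX.l2_le 2
  have haN : |deriv a t| ≤ |c t - deriv a t - b t (a t)| + (K + 1) := by
    have e1 : deriv a t = -(c t - deriv a t - b t (a t)) + (c t - b t (a t)) := by ring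
    have e2 : |c t - b t (a t)| ≤ K + 1 := by
      refine (abs_sub _ _).trans (add_le_add ?_ ((hb.abs_le t _).trans hεa1))
      rw [abs_of_pos (lt_of_lt_of_le (by positivity) (h.speed_ge _ hc))]
      exact h.speed_le _ hc
    calc |deriv a t| = |-(c t - deriv a t - b t (a t)) + (c t - b t (a t))| := by rw [← e1]
      _ ≤ |-(c t - deriv a t - b t (a t))| + |c t - b t (a t)| := abs_add_le _ _
      _ ≤ _ := by rw [abs_neg]; exact add_le_add_right e2 _
  exact lyapunov_rate_algebra hεa.le hεa1 hεt.le hεx.le hεx1 hα.le hα1 hγ hγ1 hr hr1 hC₁ hCf hCd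
    hL (by positivity) m1 m2 haN f1 (hb.abs_dx_le t _) f2 hB' hP
    (integral_nonneg fun _ => sq_nonneg _) hm

lemma HasLyapunovBound.mono {f : ℝ → ℝ} {I₀ : Set ℝ} {Q : ℝ → ℝ → ℝ} {S S' : Set ℝ}
    {α₀ κ C α₀' κ' C' : ℝ} (h : HasLyapunovBound f I₀ Q S α₀ κ C) (hS : S' ⊆ S) (hα : α₀' ≤ α₀)
    (hκ : κ' ≤ κ) (hC : C ≤ C') : HasLyapunovBound f I₀ Q S' α₀' κ' C' := by
  intro εa εt εx hεa hεa1 hεt hεx hεx1 b hb α hα0 hα1 J hJ u hu hlaw a c hmod t ht hc η hη hr hsm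
  obtain ⟨M', hd, hle⟩ := h εa εt εx hεa hεa1 hεt hεx hεx1 b hb α hα0 (hα1.trans hα) J hJ u hu hlaw
    a c hmod t ht (hS hc) η hη hr (hsm.trans hκ)
  refine ⟨M', hd, hle.trans (mul_le_mul_of_nonneg_right hC ?_)⟩
  have := h1Norm_nonneg (goodPart η (fluct Q u a c t))
  have := h1Norm_nonneg (fluct Q u a c t)
  unfold bigXi
  positivity

/-- The constants can be chosen uniformly over a compact set of stable speeds. -/
lemma IsSolitaryWaveFamily.exists_lyapunovBound {f : ℝ → ℝ} (hf : IsNonlinearity f) {I₀ : Set ℝ}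
    {Q : ℝ → ℝ → ℝ} (hQ : IsSolitaryWaveFamily f I₀ Q) {I : Set ℝ} (hI : IsCompact I)
    (hII₀ : I ⊆ I₀) (hint : ∀ c ∈ I, ∫ x, deriv (fun c' => Q c' x) c ≠ 0)
    (hδ : ∀ c ∈ I, 0 < deriv (delta Q) c) :
    ∃ α₀ κ C : ℝ, 0 < α₀ ∧ α₀ ≤ 1 ∧ 0 < κ ∧ 0 < C ∧ HasLyapunovBound f I₀ Q I α₀ κ C := by
  refine hI.induction_on (p := fun S => ∃ α₀ κ C : ℝ, 0 < α₀ ∧ α₀ ≤ 1 ∧ 0 < κ ∧ 0 < C ∧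
    HasLyapunovBound f I₀ Q S α₀ κ C) ?_ ?_ ?_ ?_
  · exact ⟨1, 1, 1, one_pos, le_rfl, one_pos, one_pos,
      fun _ _ _ _ _ _ _ _ _ _ _ _ _ _ _ _ _ _ _ _ _ _ _ hc => absurd hc (notMem_empty _)⟩
  · rintro S S' hS ⟨α₀, κ, C, h1, h2, h3, h4, h5⟩
    exact ⟨α₀, κ, C, h1, h2, h3, h4, h5.mono hS le_rfl le_rfl le_rfl⟩
  · rintro S S' ⟨α₀, κ, C, h1, h2, h3, h4, h5⟩ ⟨α₁, κ₁, C₁, g1, -, g3, -, g5⟩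
    refine ⟨min α₀ α₁, min κ κ₁, max C C₁, lt_min h1 g1, (min_le_left _ _).trans h2, lt_min h3 g3,
      lt_max_of_lt_left h4, ?_⟩
    intro εa εt εx hεa hεa1 hεt hεx hεx1 b hb α hα0 hα1 J hJ u hu hlaw a c hmod t ht hc
    rcases hc with hc | hc
    · exact h5.mono subset_rfl (min_le_left _ _) (min_le_left _ _) (le_max_left _ _) εa εt εx hεa
        hεa1 hεt hεx hεx1 b hb α hα0 hα1 J hJ u hu hlaw a c hmod t ht hc
    · exact g5.mono subset_rfl (min_le_right _ _) (min_le_right _ _) (le_max_right _ _) εa εt εx hεa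
        hεa1 hεt hεx hεx1 b hb α hα0 hα1 J hJ u hu hlaw a c hmod t ht hc
  · intro c₀ hc₀
    obtain ⟨ρ, K, A, X, ν, hρ, -, hw⟩ := hQ.exists_waveNhd hf (hII₀ hc₀)
    have hmem : c₀ ∈ Metric.ball c₀ ρ := Metric.mem_ball_self hρ
    obtain ⟨K', hw'⟩ := hw.exists_waveData ⟨c₀, hmem⟩
    have hd := hδ c₀ hc₀
    rw [(hw'.hasDerivAt_delta hmem).deriv] at hd
    obtain ⟨S, k, T, hS, -, hst⟩ := hw'.exists_stableData hmem hd (hint c₀ hc₀)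
    exact ⟨S, mem_nhdsWithin_of_mem_nhds (hst.isOpen.mem_nhds hS), hst.exists_lyapunovBound I₀⟩

end BKdV

end

theorem mainTheorem8 (f : ℝ → ℝ) (hf : BKdV.IsNonlinearity f)
    (I₀ : Set ℝ) (Q : ℝ → ℝ → ℝ) (hQ : BKdV.IsSolitaryWaveFamily f I₀ Q)
    (I : Set ℝ) (hI : IsCompact I) (hII₀ : I ⊆ I₀)
    (hint : ∀ c ∈ I, ∫ x, deriv (fun c' => Q c' x) c ≠ 0)
    (hδ : ∀ c ∈ I, 0 < deriv (BKdV.delta Q) c) :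
    ∃ α₀ κ C : ℝ, 0 < α₀ ∧ α₀ ≤ 1 ∧ 0 < κ ∧ 0 < C ∧
      ∀ (εa εt εx : ℝ), 0 < εa → εa ≤ 1 → 0 < εt → 0 < εx → εx ≤ 1 →
      ∀ b : ℝ → ℝ → ℝ, BKdV.IsPotential b εa εt εx →
      ∀ α : ℝ, 0 < α → α ≤ α₀ →
      ∀ J : Set ℝ, IsOpen J →
      ∀ u : ℝ → ℝ → ℝ, BKdV.IsSolution f b J u → BKdV.HasBalanceLaws f b J u →
      ∀ a c : ℝ → ℝ, BKdV.IsModulated Q I₀ α J u a c →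
      ∀ t ∈ J, c t ∈ I →
      ∀ η : ℝ → ℝ, BKdV.IsHessMinimizer f Q α (c t) (a t) η →
      BKdV.h1Norm (BKdV.fluct Q u a c t) ≤ 1 →
      (√α)⁻¹ * BKdV.h1Norm (BKdV.goodPart η (BKdV.fluct Q u a c t))
        + BKdV.h1Norm (BKdV.fluct Q u a c t) ≤ κ →
      ∃ M' : ℝ, HasDerivAt (BKdV.lyapunov f b Q u a c) M' t ∧
        M' ≤ C * ((εa * εx + BKdV.h1Norm (BKdV.fluct Q u a c t) ^ 2) *
          BKdV.bigXi εa εt εx α (BKdV.h1Norm (BKdV.goodPart η (BKdV.fluct Q u a c t)))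
            (BKdV.h1Norm (BKdV.fluct Q u a c t))) := by
  obtain ⟨α₀, κ, C, h1, h2, h3, h4, h5⟩ := hQ.exists_lyapunovBound hf hI hII₀ hint hδ
  exact ⟨α₀, κ, C, h1, h2, h3, h4, h5⟩
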